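/- **Setting.** Let $(p_k)_{k\ge 0}$ be an offspring law with generating function ${\bf f}(z)=\sum_k p_kz^k$, $p_0>0$, mean ${\bf m}={\bf f}'(1)>1$ and $\sum_k k^2p_k<\infty$; let $q\in(0,1)$ be the extinction probability (${\bf f}(q)=q$) and let $\beta>1/{\bf f}'(q)\,(>1)$. Let $T$ be the Galton–Watson tree with this offspring law, conditioned on non-extinction. The $\beta$-biased walk $X$ on $T$ starts at the root; from a vertex with $k$ children it goes to its parent with probability $\frac1{1+\beta k}$ and to each child with probability $\frac{\beta}{1+\beta k}$; from the root all children are equally likely. The *backbone* is the set of vertices with an infinite line of descent. A *trap* consists of a vertex of the backbone (the root of the trap), a child of it outside the backbone (the bud), and all descendants of the bud; its height $H$ is the height of the tree of descendants of the bud. Under ${\bf Q}$ this tree is a Galton–Watson tree with offspring law $q_k=p_kq^{k-1}$; $Z_n$ denotes its $n$-th generation size. Fix $0<\varepsilon<1$ and set $$h_n=\Big\lceil\frac{(1-\varepsilon)\ln n}{-\ln {\bf f}'(q)}\Big\rceil\ (h_0:=0),\qquad h_n^0=\Big\lceil\frac{\ln n}{-\ln{\bf f}'(q)}\Big\rceil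 .$$ *Number of visits.* The steps of $X$ along the backbone form the embedded walk $Y$, generated by i.i.d. uniform variables $U_i$ on $[0,1]$: if $Y_i$ is not the root and has $z$ children on the backbone, then $Y_{i+1}$ is the parent of $Y_i$ if $U_i\le\frac1{z\beta+1}$, and the $j$-th of these children if $U_i\in[1-\frac{j\beta}{z\beta+1},1-\frac{(j-1)\beta}{z\beta+1}]$; at the root, the choice is uniform among the children on the backbone. Let $\widetilde Y$ be the walk on $\mathbb Z$ with $\widetilde Y_0=0$ that makes the step $-1$ if $U_i\le\frac1{\beta+1}$ and $+1$ otherwise, and let $0$-SR be the event that $\widetilde Y_i>0$ for all $i\ge1$. Consider the first vertex visited by $Y$ at which a trap of height at least $h_n$ is rooted; $W_n$ is the number of steps of $X$ from this vertex to the bud of such a trap (the leftmost one if there are several), under the averaged law conditioned on $0$-SR. *Time at the bottom.* For $n+k\ge 1$ let a trap have law ${\bf Q}[\,\cdot\mid H=h^0_{n+k}]$, let $\delta$ be the leftmost vertex of its last generation, and let $W_n$ be independent of the trap and of the walk in the trap. Given these, perform $W_n$ independent excursions of the $\beta$-biased walk, each starting with the step from the root of the trap to the bud and ending at the return to the root of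 the trap. In each excursion count the time between the first and the last visit to $\delta$ (the total length of the excursions from $\delta$ to $\delta$; $0$ if $\delta$ is not visited). Let $\chi_1^*(n)$ be the sum of these times over the $W_n$ excursions, and let $\overline{\mathcal Z}_n^k=\chi_1^*(n)/\beta^{H}$, where $H=h_{n+k}^0$. *The limit.* For $n\ge0$ let $(\phi_{n+1},\psi_{n+1})$ be independent pairs with $${\bf Q}[\phi_{n+1}=j,\psi_{n+1}=k]=c_n\,q_k\,{\bf Q}[Z_n=0]^{j-1}{\bf Q}[Z_{n+1}=0]^{k-j},\quad 1\le j\le k,$$ where $c_n$ is the normalizing constant $\frac{{\bf Q}[H=n]}{{\bf Q}[H=n+1]}$. For a finite tree $t$ with generation sizes $z_l$ put $\Pi(t)=\sum_{l\ge0}z_l\beta^{l+1}$. Let $\Lambda_0=0$, and for $i\ge1$ let $\Lambda_i$ be the sum of $\Pi$ over $\phi_i-1$ trees of law ${\bf Q}[\,\cdot\mid H<i-1]$ and $\psi_i-\phi_i$ trees of law ${\bf Q}[\,\cdot\mid H<i]$, all of them independent. Let $$S_\infty=2\sum_{i\ge0}\beta^{-i}(1+\Lambda_i),\qquad p_\infty=1-\beta^{-1}.$$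 **Proposition.** There is a random variable $W_\infty$ with $W_n\xrightarrow{d}W_\infty$; moreover $S_\infty<\infty$ almost surely, and for every $k\in\mathbb Z$, as $n\to\infty$, $$\overline{\mathcal Z}_n^k\xrightarrow{d}\mathcal Z_\infty:=\frac{S_\infty}{1-\beta^{-1}}\sum_{i=1}^{\mathrm{Bin}(W_\infty,p_\infty)}{\bf e}_i,$$ where the ${\bf e}_i$ are exponential variables of parameter $1$, the variables $S_\infty$, $W_\infty$, $({\bf e}_i)_{i\ge1}$ are independent, and, given $W_\infty$, the variable $\mathrm{Bin}(W_\infty,p_\infty)$ is binomial and independent of $S_\infty$ and of $({\bf e}_i)_{i\ge 1}$. Moreover, there is a non-negative random variable $\mathcal Z_{\sup}$ with $E[\mathcal Z_{\sup}^{1-\delta}]<\infty$ for every $\delta>0$ that stochastically dominates all these variables: $P[\overline{\mathcal Z}_n^k>t]\le P[\mathcal Z_{\sup}>t]$ for all $n\in\mathbb N$, all integers $k>-n$, and all $t\in\mathbb R$. -/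

import Mathlib

open MeasureTheory ProbabilityTheory Filter
open scoped ENNReal unitInterval

/-! ### Plane trees, encoded by offspring numbers

A vertex is a word of natural numbers; the root is `[]` and the `i`-th child of `u` is `i :: u`.
A plane tree is encoded by a field `ξ` of offspring numbers: `ξ u` is the number of children of
`u`, so that the children of `u` are `i :: u` with `i < ξ u`. -/

namespace PlaneTree

/-- `ξ` encodes a plane tree: `ξ u` is the number of children of the vertex `u`. -/
abbrev Field : Type := List ℕ → ℕ

/-- `u` is a vertex of the tree encoded by `ξ`. -/
def Mem (ξ : Field) : List ℕ → Prop
  | [] => True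
  | i :: u => Mem ξ u ∧ i < ξ u

/-- The descendants of `b`, as a tree rooted at `b`. -/
def sub (ξ : Field) (b : List ℕ) : Field := fun v => ξ (v ++ b)

/-- The height of the tree (`⊤` if the tree has vertices in every generation). -/
noncomputable def height (ξ : Field) : ℕ∞ := ⨆ v : List ℕ, ⨆ _ : Mem ξ v, (v.length : ℕ∞)

/-- `v` is a vertex with an infinite line of descent. (The trees are locally finite, so this means
that `v` has descendants in every generation.) -/
def OnBackbone (ξ : Field) (v : List ℕ) : Prop := Mem ξ v ∧ height (sub ξ v) = ⊤

open Classical in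
/-- The labels `i` of the children `i :: v` of `v` on the backbone, in increasing order. -/
noncomputable def backboneChildren (ξ : Field) (v : List ℕ) : List ℕ :=
  (List.range (ξ v)).filter fun i => OnBackbone ξ (i :: v)

open Classical in
/-- The labels `i` of the children `i :: v` of `v` that are not on the backbone. For `v` on the
backbone, these children are the buds adjacent to `v`. -/
noncomputable def otherChildren (ξ : Field) (v : List ℕ) : List ℕ :=
  (List.range (ξ v)).filter fun i => ¬ OnBackbone ξ (i :: v)

/-- A trap of height at least `h` is rooted at the vertex `v` of the backbone, with bud `i :: v`.
The height of a trap is measured from its bud. -/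
def IsBigTrap (ξ : Field) (h : ℕ) (v : List ℕ) (i : ℕ) : Prop :=
  i < ξ v ∧ ¬ OnBackbone ξ (i :: v) ∧ (h : ℕ∞) ≤ height (sub ξ (i :: v))

/-- `v` is the leftmost vertex of the last generation of a finite tree: it is the smallest vertex
of that generation in the lexicographic order of the words read from the root. -/
def IsBottom (ξ : Field) (v : List ℕ) : Prop :=
  Mem ξ v ∧ (v.length : ℕ∞) = height ξ ∧
    ∀ w, Mem ξ w → w.length = v.length → v.reverse ≤ w.reverse

end PlaneTree

/-! ### The biased walk on an infinite tree

`u` and `v` are the sources of randomness: `u j` decides the `j`-th step of the walk along the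
backbone and `v t` decides whether at time `t` the walk steps into, or inside of, a trap. -/

namespace BiasedWalk

open PlaneTree

/-- Weight of the edge from `v` to its parent, edges from `v` to children having weight `β`
(the root has no parent). -/
def parentWeight : List ℕ → ℝ
  | [] => 0
  | _ :: _ => 1

/-- One step of the `β`-biased walk on the backbone, decided by `x ∈ [0,1]`. From a vertex other
than the root with `z` children on the backbone, the step is to the parent if
`x < 1 / (z β + 1)` and to the `j`-th child if
`1 - j β / (z β + 1) < x < 1 - (j - 1) β / (z β + 1)`. -/
noncomputable def backboneStep (β : ℝ) (ξ : Field) (w : List ℕ) (x : I) : List ℕ :=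
  match (backboneChildren ξ w)[⌊(1 - (x : ℝ)) *
      (parentWeight w + β * (backboneChildren ξ w).length) / β⌋₊]? with
  | some i => i :: w
  | none => w.tail

/-- The embedded walk on the backbone. -/
noncomputable def backboneWalk (β : ℝ) (ξ : Field) (u : ℕ → I) : ℕ → List ℕ
  | 0 => []
  | n + 1 => backboneStep β ξ (backboneWalk β ξ u n) (u n)

/-- The `β`-biased walk on the tree, together with the number of steps made so far between two
vertices of the backbone. At a vertex `w` with `k` children, each child outside the backbone is
chosen with probability `β / (a + β k)`, where `a = parentWeight w`; otherwise the walk makes its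
next step on the backbone if `w` is on the backbone, and goes to the parent of `w` if not. -/
noncomputable def walkState (β : ℝ) (ξ : Field) (u v : ℕ → I) : ℕ → List ℕ × ℕ
  | 0 => ([], 0)
  | t + 1 =>
    let w := (walkState β ξ u v t).1
    let j := (walkState β ξ u v t).2
    match (otherChildren ξ w)[⌊(v t : ℝ) * (parentWeight w + β * ξ w) / β⌋₊]? with
    | some i => (i :: w, j)
    | none =>
      open Classical in
      if OnBackbone ξ w then (backboneStep β ξ w (u j), j + 1) else (w.tail, j)

/-- The position at time `t` of the `β`-biased walk on the tree, started at the root. -/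
noncomputable def walk (β : ℝ) (ξ : Field) (u v : ℕ → I) (t : ℕ) : List ℕ :=
  (walkState β ξ u v t).1

/-- The first time (on the clock of the backbone walk) at which the root of a trap of height at
least `h` is met. -/
noncomputable def firstBigTime (β : ℝ) (ξ : Field) (u : ℕ → I) (h : ℕ) : ℕ :=
  sInf {n | ∃ i, IsBigTrap ξ h (backboneWalk β ξ u n) i}

/-- The root of the first trap of height at least `h` that is met. -/
noncomputable def firstBigRoot (β : ℝ) (ξ : Field) (u : ℕ → I) (h : ℕ) : List ℕ :=
  backboneWalk β ξ u (firstBigTime β ξ u h)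

/-- The bud of the first trap of height at least `h` that is met (if there are several such traps
at the same vertex, the leftmost is taken). -/
noncomputable def firstBigBud (β : ℝ) (ξ : Field) (u : ℕ → I) (h : ℕ) : List ℕ :=
  sInf {i | IsBigTrap ξ h (firstBigRoot β ξ u h) i} :: firstBigRoot β ξ u h

/-- The number of visits of the walk to the first trap of height at least `h` that is met. -/
noncomputable def numVisits (β : ℝ) (ξ : Field) (u v : ℕ → I) (h : ℕ) : ℕ :=
  {t | walk β ξ u v t = firstBigRoot β ξ u h ∧
    walk β ξ u v (t + 1) = firstBigBud β ξ u h}.ncard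

/-- The `β`-biased walk on `ℤ` driven by the same variables as the walk on the backbone. -/
noncomputable def intWalk (β : ℝ) (u : ℕ → I) : ℕ → ℤ
  | 0 => 0
  | n + 1 => if (u n : ℝ) ≤ 1 / (β + 1) then intWalk β u n - 1 else intWalk β u n + 1

/-- The time `t` is a super-regeneration time. -/
def IsSuperRegeneration (β : ℝ) (u : ℕ → I) (t : ℕ) : Prop :=
  (∀ s < t, intWalk β u s < intWalk β u t) ∧ ∀ s > t, intWalk β u t < intWalk β u s

/-! ### The biased walk in a trap

The trap consists of a vertex `none` (its root) joined by an edge to the root `some []`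
(the bud) of the tree encoded by `ξ`. -/

/-- An excursion of the `β`-biased walk into the trap: it starts at the bud, at the time after the
walk has stepped from the root of the trap to the bud, and is absorbed when it returns to the root
of the trap. -/
noncomputable def trapWalk (β : ℝ) (ξ : Field) (v : ℕ → I) : ℕ → Option (List ℕ)
  | 0 => some []
  | t + 1 =>
    match trapWalk β ξ v t with
    | none => none
    | some w =>
      if ⌊(v t : ℝ) * (1 + β * ξ w) / β⌋₊ < ξ w then
        some (⌊(v t : ℝ) * (1 + β * ξ w) / β⌋₊ :: w)
      else
        match w with
        | [] => none
        | _ :: w' => some w'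

/-- At time `t` the excursion is at the leftmost bottom point of the trap. -/
def AtBottom (β : ℝ) (ξ : Field) (v : ℕ → I) (t : ℕ) : Prop :=
  ∃ w, trapWalk β ξ v t = some w ∧ IsBottom ξ w

/-- The time which one excursion into the trap spends in excursions from the bottom point to the
bottom point: the number of times between the first and the last visit to the bottom point. -/
noncomputable def bottomTime (β : ℝ) (ξ : Field) (v : ℕ → I) : ℕ :=
  {t | (∃ s ≤ t, AtBottom β ξ v s) ∧ ∃ s > t, AtBottom β ξ v s}.ncard

end BiasedWalk

/-! ### Conditioning -/

/-- The probability measure `μ` conditioned on the event `s`. If `s` is a null event there is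
nothing to condition on, and the value is `μ`. -/
noncomputable def condLaw {Ω : Type*} [MeasurableSpace Ω] (μ : Measure Ω) (s : Set Ω) :
    Measure Ω :=
  open Classical in if μ s = 0 then μ else ProbabilityTheory.cond μ s

instance condLaw.isProbabilityMeasure {Ω : Type*} [MeasurableSpace Ω] (μ : Measure Ω)
    [IsProbabilityMeasure μ] (s : Set Ω) : IsProbabilityMeasure (condLaw μ s) := by
  unfold condLaw
  split_ifs with h
  · infer_instance
  · exact cond_isProbabilityMeasure h

instance expMeasure_one_isProbabilityMeasure : IsProbabilityMeasure (expMeasure 1) :=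
  isProbabilityMeasure_expMeasure one_pos

/-! ### The model -/

/-- The generating function of an offspring law. -/
noncomputable def genFun (p : PMF ℕ) (z : ℝ) : ℝ := ∑' k, (p k).toReal * z ^ k

/-- The data of the model: a supercritical offspring law `p` with leaves and finite second moment,
its extinction probability `q` (the only fixed point in `(0,1)` of the generating function), and a
bias `β` in the sub-ballistic regime. -/
structure BiasedGW where
  p : PMF ℕ
  q : ℝ
  β : ℝ
  p_zero : p 0 ≠ 0
  one_lt_mean : 1 < ∑' k : ℕ, p k * (k : ℝ≥0∞)
  second_moment : ∑' k : ℕ, p k * (k : ℝ≥0∞) ^ 2 ≠ ∞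
  q_pos : 0 < q
  q_lt_one : q < 1
  genFun_q : genFun p q = q
  one_lt_bias : 1 < β
  subballistic : 1 / deriv (genFun p) q < β

/-- The law of a Galton-Watson tree with offspring law `p`: all the words, in particular all the
vertices of the tree, have independent offspring numbers with law `p`. -/
noncomputable def gwMeasure (p : PMF ℕ) : Measure PlaneTree.Field :=
  Measure.infinitePi fun _ => p.toMeasure

instance gwMeasure.isProbabilityMeasure (p : PMF ℕ) : IsProbabilityMeasure (gwMeasure p) := by
  unfold gwMeasure; infer_instance

/-- The law of a sequence of independent uniform variables on `[0,1]`. -/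
noncomputable def uniformSeq : Measure (ℕ → I) := Measure.infinitePi fun _ => volume

instance uniformSeq.isProbabilityMeasure : IsProbabilityMeasure uniformSeq := by
  unfold uniformSeq; infer_instance

namespace BiasedGW

open PlaneTree BiasedWalk

variable (D : BiasedGW)

/-! #### Number of visits to a big trap -/

/-- The tree (conditioned on non-extinction) and the walk on it, conditioned on `0` being a
super-regeneration time. The components are the tree and the two driving sequences. -/
noncomputable def walkMeasure : Measure (Field × (ℕ → I) × (ℕ → I)) :=
  condLaw ((gwMeasure D.p).prod (uniformSeq.prod uniformSeq))
    {ω | height ω.1 = ⊤ ∧ IsSuperRegeneration D.β ω.2.1 0}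

instance : IsProbabilityMeasure D.walkMeasure := by
  unfold walkMeasure; infer_instance

/-- The critical height `⌈(1 - ε) ln n / (- ln f'(q))⌉` of a big trap (it is `0` for `n = 0`). -/
noncomputable def bigHeight (ε : ℝ) (n : ℕ) : ℕ :=
  ⌈(1 - ε) * Real.log n / (- Real.log (deriv (genFun D.p) D.q))⌉₊

/-- The number `W_n` of visits to the first big trap that is met. -/
noncomputable def W (ε : ℝ) (n : ℕ) (ω : Field × (ℕ → I) × (ℕ → I)) : ℕ :=
  numVisits D.β ω.1 ω.2.1 ω.2.2 (D.bigHeight ε n)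

/-! #### The law of a trap -/

/-- The offspring law of the traps, `q_k = p_k q ^ (k - 1)`. -/
noncomputable def trapOffspring : PMF ℕ :=
  ⟨fun k => D.p k * ENNReal.ofReal D.q ^ k / ENNReal.ofReal D.q, by
    have hq0 : ENNReal.ofReal D.q ≠ 0 := by simpa using D.q_pos
    have h1 : ∑' k, D.p k * ENNReal.ofReal D.q ^ k = ENNReal.ofReal D.q := by
      have hle : ∑' k, D.p k * ENNReal.ofReal D.q ^ k ≤ 1 := by
        rw [← D.p.tsum_coe]
        refine ENNReal.tsum_le_tsum fun k => ?_
        refine mul_le_of_le_one_right' (pow_le_one' ?_ k)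
        simpa using D.q_lt_one.le
      have hne : ∑' k, D.p k * ENNReal.ofReal D.q ^ k ≠ ∞ :=
        ne_top_of_le_ne_top ENNReal.one_ne_top hle
      rw [← ENNReal.ofReal_toReal hne, ENNReal.tsum_toReal_eq (ENNReal.ne_top_of_tsum_ne_top hne)]
      congr 1
      refine Eq.trans (tsum_congr fun k => ?_) D.genFun_q
      rw [ENNReal.toReal_mul, ENNReal.toReal_pow, ENNReal.toReal_ofReal D.q_pos.le]
    have h2 : ∑' k, D.p k * ENNReal.ofReal D.q ^ k / ENNReal.ofReal D.q = 1 := by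
      simp_rw [div_eq_mul_inv]
      rw [ENNReal.tsum_mul_right, h1]
      exact ENNReal.mul_inv_cancel hq0 ENNReal.ofReal_ne_top
    exact h2 ▸ ENNReal.summable.hasSum⟩

/-- The law of a trap (seen from its bud): a Galton-Watson tree with offspring law `q_k`. -/
noncomputable def trapMeasure : Measure Field := gwMeasure D.trapOffspring

instance : IsProbabilityMeasure D.trapMeasure := by
  unfold trapMeasure; infer_instance

/-- The height `h_x^0 = ⌈ln x / (- ln f'(q))⌉`. -/
noncomputable def trapHeight (x : ℝ) : ℕ :=
  ⌈Real.log x / (- Real.log (deriv (genFun D.p) D.q))⌉₊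

/-! #### Time spent at the bottom of a trap of given height -/

/-- The probability space of the time spent at the bottom of a trap of height `h_{n+k}^0`. The
components, which are independent, are: the tree and the walk on it (which determine the number
`W_n` of visits), the trap conditioned on having height `h_{n+k}^0`, and the variables that drive
the successive excursions of the walk into the trap. -/
noncomputable def bottomMeasure (n : ℕ) (k : ℤ) :
    Measure ((Field × (ℕ → I) × (ℕ → I)) × Field × (ℕ → ℕ → I)) :=
  D.walkMeasure.prod
    ((condLaw D.trapMeasure {ξ | height ξ = (D.trapHeight ((n : ℝ) + k) : ℕ∞)}).prod
      (Measure.infinitePi fun _ => uniformSeq))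

instance (n : ℕ) (k : ℤ) : IsProbabilityMeasure (D.bottomMeasure n k) := by
  unfold bottomMeasure; infer_instance

/-- The time spent at the bottom of the trap during the `W_n` visits to it, divided by `β ^ H`,
where `H = h_{n+k}^0` is the height of the trap. -/
noncomputable def Zbar (ε : ℝ) (n : ℕ) (k : ℤ)
    (ω : (Field × (ℕ → I) × (ℕ → I)) × Field × (ℕ → ℕ → I)) : ℝ :=
  (∑ i ∈ Finset.range (D.W ε n ω.1), (bottomTime D.β ω.2.1 (ω.2.2 i) : ℝ)) /
    D.β ^ D.trapHeight ((n : ℝ) + k)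

/-! #### The infinite trap grown from its bottom point -/

/-- The unnormalized joint law of `(φ_{n+1}, ψ_{n+1})`: the weight of `(j, k)`, `1 ≤ j ≤ k`, is
`q_k Q[Z_n = 0] ^ (j - 1) Q[Z_{n+1} = 0] ^ (k - j)`. -/
noncomputable def spineWeight (n : ℕ) (x : ℕ × ℕ) : ℝ≥0∞ :=
  if 1 ≤ x.1 ∧ x.1 ≤ x.2 then
    D.trapOffspring x.2 * D.trapMeasure {ξ | height ξ < (n : ℕ∞)} ^ (x.1 - 1) *
      D.trapMeasure {ξ | height ξ < ((n + 1 : ℕ) : ℕ∞)} ^ (x.2 - x.1)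
  else 0

theorem trapMeasure_height_lt_ne_zero (n : ℕ) :
    D.trapMeasure {ξ | height ξ < ((n + 1 : ℕ) : ℕ∞)} ≠ 0 := by
  have hsub : {ξ : Field | ξ [] ∈ ({0} : Set ℕ)} ⊆ {ξ | height ξ < ((n + 1 : ℕ) : ℕ∞)} := by
    intro ξ hξ
    have h0 : ξ [] = 0 := hξ
    have hmem : ∀ v, Mem ξ v → v = [] := by
      intro v
      induction v with
      | nil => intro _; rfl
      | cons i u ih =>
        intro h
        have hu := ih h.1
        subst hu
        exact absurd h.2 (by omega)
    have hh : height ξ ≤ 0 := by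
      refine iSup₂_le fun v hv => ?_
      rw [hmem v hv]
      simp
    refine lt_of_le_of_lt hh ?_
    exact_mod_cast Nat.succ_pos n
  intro h
  have h1 := measure_mono_null hsub h
  have h2 : D.trapMeasure {ξ : Field | ξ [] ∈ ({0} : Set ℕ)} = D.trapOffspring 0 := by
    have h3 := (measurePreserving_eval_infinitePi
      (fun _ : List ℕ => D.trapOffspring.toMeasure) []).measure_preimage
        (s := {0}) (measurableSet_singleton _).nullMeasurableSet
    rw [PMF.toMeasure_apply_singleton _ _ (measurableSet_singleton _)] at h3
    exact h3
  rw [h2] at h1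
  have h4 : D.p 0 * ENNReal.ofReal D.q ^ 0 / ENNReal.ofReal D.q = 0 := h1
  simp [ENNReal.div_eq_zero_iff, D.p_zero] at h4

theorem tsum_spineWeight_ne_zero (n : ℕ) : ∑' x, D.spineWeight n x ≠ 0 := by
  intro h
  rw [ENNReal.tsum_eq_zero] at h
  have hp : ∀ k : ℕ, D.p k * (k : ℝ≥0∞) = 0 := by
    intro k
    rcases Nat.eq_zero_or_pos k with rfl | hk
    · simp
    · have h1 := h (1, k)
      have hk' : 1 ≤ k := hk
      simp only [spineWeight, le_refl, hk', and_self, if_true, Nat.sub_self, pow_zero, mul_one,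
        mul_eq_zero] at h1
      rcases h1 with h1 | h1
      · have h4 : D.p k * ENNReal.ofReal D.q ^ k / ENNReal.ofReal D.q = 0 := h1
        rw [ENNReal.div_eq_zero_iff, mul_eq_zero] at h4
        rcases h4 with (h4 | h4) | h4
        · simp [h4]
        · have := eq_zero_of_pow_eq_zero h4
          exact absurd this (by simpa using D.q_pos)
        · exact absurd h4 ENNReal.ofReal_ne_top
      · exact absurd (eq_zero_of_pow_eq_zero h1) (D.trapMeasure_height_lt_ne_zero n)
  have := D.one_lt_mean
  simp [hp] at this

theorem tsum_spineWeight_ne_top (n : ℕ) : ∑' x, D.spineWeight n x ≠ ∞ := by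
  have hq0 : ENNReal.ofReal D.q ≠ 0 := by simpa using D.q_pos
  have hle : ∑' x, D.spineWeight n x ≤
      (∑' k : ℕ, D.p k * (k : ℝ≥0∞) ^ 2) * (ENNReal.ofReal D.q)⁻¹ := by
    rw [ENNReal.tsum_prod', ENNReal.tsum_comm, ← ENNReal.tsum_mul_right]
    refine ENNReal.tsum_le_tsum fun k => ?_
    have hz : ∀ j ∉ Finset.Icc 1 k, D.spineWeight n (j, k) = 0 := by
      intro j hj
      rw [spineWeight, if_neg]
      simpa [Finset.mem_Icc] using hj
    rw [tsum_eq_sum hz]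
    have hb : ∀ j ∈ Finset.Icc 1 k,
        D.spineWeight n (j, k) ≤ D.p k * (ENNReal.ofReal D.q)⁻¹ := by
      intro j hj
      rw [spineWeight, if_pos (by simpa [Finset.mem_Icc] using hj)]
      refine (mul_le_of_le_one_right' (pow_le_one' prob_le_one _)).trans ?_
      refine (mul_le_of_le_one_right' (pow_le_one' prob_le_one _)).trans ?_
      change D.p k * ENNReal.ofReal D.q ^ k / ENNReal.ofReal D.q ≤ _
      rw [div_eq_mul_inv]
      gcongr
      refine mul_le_of_le_one_right' (pow_le_one' ?_ k)
      simpa using D.q_lt_one.le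
    refine (Finset.sum_le_sum hb).trans ?_
    rw [Finset.sum_const, Nat.card_Icc, nsmul_eq_mul, Nat.add_sub_cancel]
    have hk : (k : ℝ≥0∞) ≤ (k : ℝ≥0∞) ^ 2 := by
      exact_mod_cast Nat.le_self_pow two_ne_zero k
    calc (k : ℝ≥0∞) * (D.p k * (ENNReal.ofReal D.q)⁻¹)
        = D.p k * k * (ENNReal.ofReal D.q)⁻¹ := by ring
      _ ≤ D.p k * (k : ℝ≥0∞) ^ 2 * (ENNReal.ofReal D.q)⁻¹ := by gcongr
  refine ne_top_of_le_ne_top ?_ hle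
  exact ENNReal.mul_ne_top D.second_moment (ENNReal.inv_ne_top.2 hq0)

/-- The joint law of `(φ_{n+1}, ψ_{n+1})`. The normalizing constant is
`c_n = Q[H = n] / Q[H = n + 1]`. -/
noncomputable def spineLaw (n : ℕ) : PMF (ℕ × ℕ) :=
  PMF.normalize (D.spineWeight n) (D.tsum_spineWeight_ne_zero n) (D.tsum_spineWeight_ne_top n)

/-- The random data attached to an ancestor of the bottom point: `(φ, ψ)`, and the trees of the
subtraps on the left and on the right of the spine (without the edge to the spine). -/
abbrev SpineData : Type := (ℕ × ℕ) × (ℕ → Field) × (ℕ → Field)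

/-- The law of the infinite trap. The entry with index `n` describes the ancestor number `n + 1` of
the bottom point; the subtraps on its left are conditioned on having height less than `n`, those on
its right on having height less than `n + 1`. (For `n = 0` there are no subtraps on the left.) -/
noncomputable def spineMeasure : Measure (ℕ → SpineData) :=
  Measure.infinitePi fun n =>
    (D.spineLaw n).toMeasure.prod
      ((Measure.infinitePi fun _ => condLaw D.trapMeasure {ξ | height ξ < (n : ℕ∞)}).prod
        (Measure.infinitePi fun _ =>
          condLaw D.trapMeasure {ξ | height ξ < ((n + 1 : ℕ) : ℕ∞)}))

instance : IsProbabilityMeasure D.spineMeasure := by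
  unfold spineMeasure; infer_instance

/-- The weight of a subtrap: the sum of the conductances of its edges. The edge from the root of
the subtrap to the tree `ξ` has conductance `β`, and the edges between the generations `l - 1` and
`l` of `ξ` have conductance `β ^ (l + 1)`. -/
noncomputable def subtrapWeight (ξ : Field) : ℝ≥0∞ :=
  ∑' v : {v : List ℕ // Mem ξ v}, ENNReal.ofReal D.β ^ (v.1.length + 1)

/-- The total weight `Λ` of the subtraps rooted at an ancestor of the bottom point. -/
noncomputable def ancestorWeight (s : SpineData) : ℝ≥0∞ :=
  ∑ j ∈ Finset.range (s.1.1 - 1), D.subtrapWeight (s.2.1 j) +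
    ∑ j ∈ Finset.range (s.1.2 - s.1.1), D.subtrapWeight (s.2.2 j)

/-- The weight `Λ_i`; there are no subtraps at the bottom point, so that `Λ_0 = 0`. -/
noncomputable def Λ (s : ℕ → SpineData) : ℕ → ℝ≥0∞
  | 0 => 0
  | n + 1 => D.ancestorWeight (s n)

/-- `S_∞ = 2 ∑_i β ^ (-i) (1 + Λ_i)`. -/
noncomputable def Sinf (s : ℕ → SpineData) : ℝ≥0∞ :=
  2 * ∑' i : ℕ, (ENNReal.ofReal D.β)⁻¹ ^ i * (1 + D.Λ s i)

/-! #### The limit variable -/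

/-- The escape probability `p_∞ = 1 - β⁻¹`. -/
noncomputable def escapeProb : I :=
  ⟨1 - D.β⁻¹, by
    have h := D.one_lt_bias
    have h1 : D.β⁻¹ ≤ 1 := inv_le_one_of_one_le₀ h.le
    have h2 : 0 ≤ D.β⁻¹ := by positivity
    constructor <;> linarith⟩

/-- The probability space of `Z_∞`. The components, which are independent, are: a variable
`W_∞` with law `μW`, a sequence of Bernoulli variables with parameter `p_∞`, the infinite trap, and
a sequence of exponential variables with parameter `1`. -/
noncomputable def limitMeasure (μW : Measure ℕ) :
    Measure (ℕ × (ℕ → ℕ) × (ℕ → SpineData) × (ℕ → ℝ)) :=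
  μW.prod ((Measure.infinitePi fun _ => bernoulliMeasure 1 0 D.escapeProb).prod
    (D.spineMeasure.prod (Measure.infinitePi fun _ => expMeasure 1)))

instance (μW : Measure ℕ) [IsProbabilityMeasure μW] :
    IsProbabilityMeasure (D.limitMeasure μW) := by
  unfold limitMeasure; infer_instance

/-- `Z_∞ = S_∞ / (1 - β⁻¹) ∑_{i ≤ N} e_i`, where `N`, the number of successes among the first
`W_∞` Bernoulli variables, has the binomial law `Bin(W_∞, p_∞)`. -/
noncomputable def Zinf (ω : ℕ × (ℕ → ℕ) × (ℕ → SpineData) × (ℕ → ℝ)) : ℝ :=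
  (D.Sinf ω.2.2.1).toReal / (1 - D.β⁻¹) *
    ∑ i ∈ Finset.range (∑ j ∈ Finset.range ω.1, ω.2.1 j), ω.2.2.2 i

end BiasedGW

/-!
The number of visits `W_n` and the trap at which they take place decouple, and each of the two
has its own limit.

*Number of visits.* Given the tree and the backbone walk, a visit to the bud `b` of a backbone
vertex with `z` backbone children is decided anew at each stay of the backbone walk, so that the
number of visits has an explicit generating function (`BiasedWalk.lintegral_pow_totalCrossings`).
The backbone walk is driven by the same uniform variables as a walk on `ℤ` with positive drift,
hence has regeneration times, and at such a time the tree ahead is a fresh Galton-Watson tree. A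
first-passage decomposition at the regeneration times expresses the generating function of `W_n`
as a quotient of two block quantities, both proportional, up to a negligible error, to the
probability that a given bud carries a trap of height at least `h_n`; the quotient converges
(`BiasedGW.tendsto_rootVal`). As the means of `W_n` are bounded (`BiasedGW.lintegral_W_le`), the
laws converge (`BiasedGW.exists_tendsto_law_W`).

*Time at the bottom.* The trap of height `n` has, up to the encoding, the law of the tree
`BiasedGW.treeOf s n` grown from its bottom point along the random spine `s`
(`BiasedGW.lintegral_heightLaw`), so that traps of all heights live on one probability space and
increase with the height. Fix `s`, and let `a(d)` be the generating function, at `z`, of the last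
visit to the bottom point `d` for a walk started there. Reversibility gives
`1 - z a(d) = (1 - z) Σ β ^ |x| ρ(x) g(x) a(x)`, with the Green function `g`, while one excursion
from the bud has the generating function `1 - (1 - a(d)) / g(d)`. For
`z = exp (i l β ^ (-n))` a gradient estimate shows that `a` is nearly constant near the bottom of
the tree, where nearly all of the weight sits, and the time at the bottom divided by `β ^ n` tends
to an exponential variable with mean `S_∞ / (1 - β⁻¹)` with probability `1 - β⁻¹`, and to `0`
otherwise (`BiasedWalk.tendsto_betweenFun`). Finiteness of `E[S_∞]`
(`BiasedGW.lintegral_Sinf_ne_top`) follows from `β f'(q) / β = f'(q) < 1`. Dominated convergence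
and Lévy's theorem give the limit of the time at the bottom.

*Domination.* The duration of an excursion has mean at most the total conductance of the trap, so
that the rescaled times at the bottom have means at most a constant `c`
(`BiasedGW.lintegral_Zbar_le`). By Markov's inequality they are dominated by `c / U` with `U`
uniform on `(0, 1]`, whose moments of order less than `1` are finite.
-/

/-! ### Product measures -/

section ProductMeasure

variable {ι κ₁ κ₂ X : Type*} [MeasurableSpace X]

theorem measurable_sumElim_prod :
    Measurable fun p : (κ₁ → X) × (κ₂ → X) => (Sum.elim p.1 p.2 : κ₁ ⊕ κ₂ → X) :=
  measurable_pi_iff.2 fun i => by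
    rcases i with i | i <;> simp only [Sum.elim_inl, Sum.elim_inr] <;> fun_prop

/-- Two independent families of independent variables form one family of independent variables. -/
theorem map_sumElim_prod_infinitePi (α : κ₁ → Measure X) (γ : κ₂ → Measure X)
    [∀ i, IsProbabilityMeasure (α i)] [∀ i, IsProbabilityMeasure (γ i)]
    [∀ i, IsProbabilityMeasure (Sum.elim α γ i)] :
    ((Measure.infinitePi α).prod (Measure.infinitePi γ)).map
      (fun p => (Sum.elim p.1 p.2 : κ₁ ⊕ κ₂ → X)) = Measure.infinitePi (Sum.elim α γ) := by
  refine Measure.eq_infinitePi _ fun s t ht => ?_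
  rw [Measure.map_apply measurable_sumElim_prod (.pi s.countable_toSet fun i _ => ht i)]
  have : (fun p => (Sum.elim p.1 p.2 : κ₁ ⊕ κ₂ → X)) ⁻¹' Set.pi s t =
      (Set.pi s.toLeft fun i => t (Sum.inl i)) ×ˢ (Set.pi s.toRight fun i => t (Sum.inr i)) := by
    ext p
    simp [Set.mem_pi]
  rw [this, Measure.prod_prod, Measure.infinitePi_pi _ fun i _ => ht _,
    Measure.infinitePi_pi _ fun i _ => ht _]
  conv_rhs => rw [← Finset.toLeft_disjSum_toRight (u := s), Finset.prod_disjSum]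
  rfl

/-- A family assembled from distinct entries of two independent families. -/
theorem map_splice_prod_infinitePi (α : κ₁ → Measure X) (γ : κ₂ → Measure X) (ρ : ι → Measure X)
    [∀ i, IsProbabilityMeasure (α i)] [∀ i, IsProbabilityMeasure (γ i)]
    [∀ i, IsProbabilityMeasure (ρ i)] (e : ι → κ₁ ⊕ κ₂) (he : Function.Injective e)
    (hρ : ∀ i, ρ i = Sum.elim α γ (e i)) :
    ((Measure.infinitePi α).prod (Measure.infinitePi γ)).map
      (fun p i => Sum.elim p.1 p.2 (e i)) = Measure.infinitePi ρ := by
  have : ∀ i, IsProbabilityMeasure (Sum.elim α γ i) := by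
    rintro (i | i) <;> simp only [Sum.elim_inl, Sum.elim_inr] <;> infer_instance
  have h1 := Measure.map_infinitePi_infinitePi_of_inj (P := Sum.elim α γ) he
  rw [← map_sumElim_prod_infinitePi, Measure.map_map (by fun_prop) measurable_sumElim_prod] at h1
  rwa [show ρ = fun i => Sum.elim α γ (e i) from funext hρ]

/-- Resampling one entry of an independent family. -/
theorem map_update_prod_infinitePi [DecidableEq ι] (μ μ' : ι → Measure X)
    [∀ i, IsProbabilityMeasure (μ i)] [∀ i, IsProbabilityMeasure (μ' i)] (j : ι)
    (h : ∀ i, i ≠ j → μ' i = μ i) :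
    ((Measure.infinitePi μ).prod (μ' j)).map (fun p => Function.update p.1 j p.2) =
      Measure.infinitePi μ' := by
  rw [← map_splice_prod_infinitePi μ μ' μ' (fun i => if i = j then .inr i else .inl i)
    (fun i k => by dsimp only; split_ifs <;> simp_all) fun i => by split_ifs <;> simp_all,
    ← (measurePreserving_eval_infinitePi μ' j).map_eq]
  nth_rw 1 [← Measure.map_id (μ := Measure.infinitePi μ)]
  rw [Measure.map_prod_map _ _ measurable_id (measurable_pi_apply j),
    Measure.map_map measurable_update' (by fun_prop)]
  congr 1
  funext p i
  by_cases hi : i = j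
  · subst hi; simp
  · simp [hi]

end ProductMeasure

/-! ### Splitting a driving sequence -/

/-- The sequence which starts with the first `m` terms of `u` and continues with `u'`. -/
def splitSeq {X : Type*} (m : ℕ) (u u' : ℕ → X) : ℕ → X :=
  fun i => if i < m then u i else u' (i - m)

/-- The sequence `u` after time `m`. -/
def shiftSeq {X : Type*} (m : ℕ) (u : ℕ → X) : ℕ → X := fun i => u (m + i)

@[simp] theorem shiftSeq_splitSeq {X : Type*} (m : ℕ) (u u' : ℕ → X) :
    shiftSeq m (splitSeq m u u') = u' := by
  funext i; simp [shiftSeq, splitSeq]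

theorem splitSeq_of_lt {X : Type*} {m i : ℕ} (h : i < m) (u u' : ℕ → X) :
    splitSeq m u u' i = u i := by simp [splitSeq, h]

@[simp] theorem shiftSeq_shiftSeq {X : Type*} (m n : ℕ) (u : ℕ → X) :
    shiftSeq n (shiftSeq m u) = shiftSeq (m + n) u := by
  funext i; simp [shiftSeq, Nat.add_assoc]

@[fun_prop]
theorem measurable_shiftSeq {X : Type*} [MeasurableSpace X] (m : ℕ) :
    Measurable (shiftSeq m : (ℕ → X) → ℕ → X) :=
  measurable_pi_iff.2 fun i => measurable_pi_apply (m + i)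

/-- A function of two variables, one of which takes countably many values. -/
theorem Measurable.discrete_apply {ι Ω X : Type*} [Countable ι] [MeasurableSpace ι]
    [MeasurableSingletonClass ι] [MeasurableSpace Ω] [MeasurableSpace X] {f : ι → Ω → X}
    (hf : ∀ i, Measurable (f i)) {g : Ω → ι} (hg : Measurable g) :
    Measurable fun ω => f (g ω) ω :=
  (measurable_from_prod_countable_right (f := fun p => f p.1 p.2) hf).comp
    (hg.prodMk measurable_id)

theorem measurable_splitSeq {X : Type*} [MeasurableSpace X] (m : ℕ) :
    Measurable (fun p : (ℕ → X) × (ℕ → X) => splitSeq m p.1 p.2) := by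
  refine measurable_pi_iff.2 fun i => ?_
  unfold splitSeq
  split_ifs <;> fun_prop

theorem map_splitSeq (m : ℕ) :
    (uniformSeq.prod uniformSeq).map (fun p => splitSeq m p.1 p.2) = uniformSeq := by
  refine Eq.trans ?_ (map_splice_prod_infinitePi (fun _ : ℕ => (volume : Measure I))
    (fun _ : ℕ => volume) (fun _ => volume)
    (fun i => if i < m then Sum.inl i else Sum.inr (i - m)) (fun i j => ?_) fun i => ?_)
  · congr 1
    funext p i
    simp only [splitSeq]
    split_ifs <;> rfl
  · dsimp only; split_ifs <;> simp; omega
  · split_ifs <;> rfl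

/-- Independence of the past and the future of the driving sequence. -/
theorem lintegral_uniformSeq_split (m : ℕ) {f : (ℕ → I) → ℝ≥0∞} (hf : Measurable f) :
    ∫⁻ u, f u ∂uniformSeq = ∫⁻ u, ∫⁻ u', f (splitSeq m u u') ∂uniformSeq ∂uniformSeq := by
  conv_lhs => rw [← map_splitSeq m]
  rw [lintegral_map hf (measurable_splitSeq m), lintegral_prod]
  exact (hf.comp (measurable_splitSeq m)).aemeasurable

theorem lintegral_uniformSeq_past_mul_future (m : ℕ) {f g : (ℕ → I) → ℝ≥0∞} (hf : Measurable f)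
    (hg : Measurable g) (hfm : ∀ u u', f (splitSeq m u u') = f u) :
    ∫⁻ u, f u * g (shiftSeq m u) ∂uniformSeq =
      (∫⁻ u, f u ∂uniformSeq) * ∫⁻ u, g u ∂uniformSeq := by
  rw [lintegral_uniformSeq_split m (f := fun u => f u * g (shiftSeq m u))
    (hf.mul (hg.comp (measurable_shiftSeq m)))]
  simp only [hfm, shiftSeq_splitSeq]
  simp_rw [lintegral_const_mul _ hg]
  rw [lintegral_mul_const _ hf]

/-- Resampling the term number `t` of the driving sequence. -/
theorem lintegral_uniformSeq_update (t : ℕ) {f : (ℕ → I) → ℝ≥0∞} (hf : Measurable f) :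
    ∫⁻ u, f u ∂uniformSeq =
      ∫⁻ u, ∫⁻ x, f (Function.update u t x) ∂(volume : Measure I) ∂uniformSeq := by
  conv_lhs => rw [uniformSeq, ← map_update_prod_infinitePi (fun _ : ℕ => (volume : Measure I))
    (fun _ => volume) t fun _ _ => rfl]
  rw [lintegral_map hf measurable_update', lintegral_prod _ (by fun_prop)]
  rfl

/-! ### The choice of a child by a uniform variable -/

theorem volume_floor_eq {A β : ℝ} (hβ : 0 < β) {i : ℕ} (hi : (i + 1 : ℝ) * β ≤ A) :
    (volume : Measure I) {x | ⌊(x : ℝ) * A / β⌋₊ = i} = ENNReal.ofReal (β / A) := by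
  have hA : 0 < A := lt_of_lt_of_le (by positivity) hi
  have hset : {x : I | ⌊(x : ℝ) * A / β⌋₊ = i} =
      Subtype.val ⁻¹' (Set.Ico (i * β / A) ((i + 1) * β / A)) := by
    ext x
    have hx : 0 ≤ (x : ℝ) * A / β := by have := x.2.1; positivity
    simp only [Set.mem_ofPred_eq, Set.mem_preimage, Set.mem_Ico]
    rw [Nat.floor_eq_iff hx, le_div_iff₀ hβ, div_lt_iff₀ hβ, div_le_iff₀ hA, lt_div_iff₀ hA]
  have hsub : Set.Ico (i * β / A) ((i + 1) * β / A) ⊆ Set.Icc (0 : ℝ) 1 := by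
    intro y hy
    refine ⟨le_trans (by positivity) hy.1, hy.2.le.trans ?_⟩
    rw [div_le_one hA]; exact hi
  rw [hset]
  rw [Measure.Subtype.volume_def, comap_subtype_coe_apply measurableSet_Icc,
    Subtype.image_preimage_coe, Set.inter_eq_right.2 hsub, Real.volume_Ico]
  ring

theorem measurable_floor_child (A β : ℝ) : Measurable fun x : I => ⌊(x : ℝ) * A / β⌋₊ := by
  fun_prop

section

variable {Ω : Type*} [MeasurableSpace Ω] (μ : Measure Ω) [IsProbabilityMeasure μ]

theorem measure_le_of_forall_eq {N : Ω → ℕ} (hN : Measurable N) {b : ℕ} {p : ℝ} (hp : 0 ≤ p)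
    (h : ∀ i < b, μ {x | N x = i} = ENNReal.ofReal p) :
    μ {x | b ≤ N x} = ENNReal.ofReal (1 - b * p) := by
  have h1 : μ (N ⁻¹' Set.Iio b) = ENNReal.ofReal (b * p) := by
    have : N ⁻¹' Set.Iio b = ⋃ i ∈ Finset.range b, {x | N x = i} := by ext x; simp
    rw [this, measure_biUnion_finset (fun i _ j _ hij => Set.disjoint_left.2 fun x hx hx' =>
      hij (hx.symm.trans hx')) fun i _ => measurableSet_setOfPred.2 (by fun_prop),
      Finset.sum_congr rfl fun i hi => h i (Finset.mem_range.1 hi), Finset.sum_const,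
      Finset.card_range, nsmul_eq_mul, ENNReal.ofReal_mul (by positivity), ENNReal.ofReal_natCast]
  have h2 : {x | b ≤ N x} = (N ⁻¹' Set.Iio b)ᶜ := by ext x; simp
  rw [h2, prob_compl_eq_one_sub (hN measurableSet_Iio), h1, ← ENNReal.ofReal_one,
    ENNReal.ofReal_sub _ (by positivity)]

theorem lintegral_comp_of_forall_eq {N : Ω → ℕ} (hN : Measurable N) {b : ℕ} {p : ℝ} (hp : 0 ≤ p)
    (h : ∀ i < b, μ {x | N x = i} = ENNReal.ofReal p) (F : ℕ → ℝ≥0∞) (c : ℝ≥0∞)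
    (hF : ∀ i, b ≤ i → F i = c) :
    ∫⁻ x, F (N x) ∂μ =
      ENNReal.ofReal p * ∑ i ∈ Finset.range b, F i + ENNReal.ofReal (1 - b * p) * c := by
  have h1 : ∀ x, F (N x) = ∑ i ∈ Finset.range b, {x | N x = i}.indicator (fun _ => F i) x +
      {x | b ≤ N x}.indicator (fun _ => c) x := by
    intro x
    by_cases hx : b ≤ N x <;> simp [Set.indicator_apply, hx, hF, not_lt.2]
  have hms : ∀ i, MeasurableSet {x | N x = i} := fun i => hN (measurableSet_singleton i)
  have hmb : MeasurableSet {x | b ≤ N x} := hN measurableSet_Ici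
  simp_rw [h1]
  rw [lintegral_add_right _ (measurable_const.indicator hmb), lintegral_finsetSum _
    fun i _ => measurable_const.indicator (hms i), lintegral_indicator_const hmb,
    measure_le_of_forall_eq μ hN hp h, Finset.mul_sum, mul_comm c]
  congr 1
  refine Finset.sum_congr rfl fun i hi => ?_
  rw [lintegral_indicator_const (hms i), h i (Finset.mem_range.1 hi), mul_comm]

end

/-- If each of the first `b` children is chosen with probability `β / A`, this is the average of a
function of the choice which does not distinguish the remaining outcomes. -/
theorem lintegral_floor_child {A β : ℝ} (hβ : 0 < β) {b : ℕ} (hA : 0 < A) (hb : b * β ≤ A)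
    (F : ℕ → ℝ≥0∞) (c : ℝ≥0∞) (hF : ∀ i, b ≤ i → F i = c) :
    ∫⁻ x : I, F ⌊(x : ℝ) * A / β⌋₊ =
      ENNReal.ofReal (β / A) * ∑ i ∈ Finset.range b, F i +
        ENNReal.ofReal (1 - b * (β / A)) * c := by
  refine lintegral_comp_of_forall_eq (volume : Measure I) (measurable_floor_child A β)
    (by positivity) (fun i hi => volume_floor_eq hβ ?_) F c hF
  have : ((i + 1 : ℕ) : ℝ) ≤ b := by exact_mod_cast hi
  push_cast at this
  nlinarith

/-! ### Subtrees, heights and the backbone -/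

namespace PlaneTree

@[simp] theorem sub_nil (ξ : Field) : sub ξ [] = ξ := by funext v; simp [sub]

theorem sub_sub (ξ : Field) (b c : List ℕ) : sub (sub ξ b) c = sub ξ (c ++ b) := by
  funext v; simp [sub]

theorem mem_append {ξ : Field} {v w : List ℕ} :
    Mem ξ (v ++ w) ↔ Mem ξ w ∧ Mem (sub ξ w) v := by
  induction v with
  | nil => simp [Mem]
  | cons i v ih => simp only [List.cons_append, Mem, ih, sub, and_assoc]

theorem Mem.of_suffix {ξ : Field} {v w : List ℕ} (h : Mem ξ w) (hv : v <:+ w) : Mem ξ v := by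
  obtain ⟨x, rfl⟩ := hv
  exact (mem_append.1 h).1

theorem le_height_iff {ξ : Field} {n : ℕ} :
    (n : ℕ∞) ≤ height ξ ↔ ∃ v, Mem ξ v ∧ v.length = n := by
  constructor
  · intro h
    by_contra! hn
    have hlt : ∀ v, Mem ξ v → v.length < n := by
      intro v hv
      by_contra! hle
      exact hn (v.drop (v.length - n)) (hv.of_suffix (List.drop_suffix _ _))
        (by rw [List.length_drop]; omega)
    have hpos : 0 < n := lt_of_le_of_lt (Nat.zero_le _) (hlt [] trivial)
    have : height ξ ≤ ((n - 1 : ℕ) : ℕ∞) := iSup₂_le fun v hv => by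
      exact_mod_cast Nat.le_sub_one_of_lt (hlt v hv)
    have := h.trans this
    rw [Nat.cast_le] at this
    omega
  · rintro ⟨v, hv, rfl⟩
    exact le_iSup₂ (f := fun v (_ : Mem ξ v) => (v.length : ℕ∞)) v hv

theorem length_le_height {ξ : Field} {v : List ℕ} (hv : Mem ξ v) : (v.length : ℕ∞) ≤ height ξ :=
  le_height_iff.2 ⟨v, hv, rfl⟩

theorem height_eq_top_iff {ξ : Field} :
    height ξ = ⊤ ↔ ∀ n : ℕ, ∃ v, Mem ξ v ∧ n ≤ v.length := by
  rw [ENat.eq_top_iff_forall_ge]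
  constructor
  · intro h n
    obtain ⟨v, hv, hl⟩ := le_height_iff.1 (h n)
    exact ⟨v, hv, hl.ge⟩
  · intro h n
    obtain ⟨v, hv, hl⟩ := h n
    exact le_trans (by exact_mod_cast hl) (length_le_height hv)

theorem succ_le_height_iff {ξ : Field} {n : ℕ} :
    ((n + 1 : ℕ) : ℕ∞) ≤ height ξ ↔ ∃ i < ξ [], (n : ℕ∞) ≤ height (sub ξ [i]) := by
  simp only [le_height_iff]
  constructor
  · rintro ⟨v, hv, hl⟩
    have hne : v ≠ [] := by rintro rfl; simp at hl
    obtain ⟨x, i, rfl⟩ : ∃ x i, v = x ++ [i] :=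
      ⟨v.dropLast, v.getLast hne, (List.dropLast_append_getLast hne).symm⟩
    obtain ⟨h1, h2⟩ := mem_append.1 hv
    exact ⟨i, h1.2, x, h2, by simpa using hl⟩
  · rintro ⟨i, hi, x, hx, hl⟩
    exact ⟨x ++ [i], mem_append.2 ⟨⟨trivial, hi⟩, hx⟩, by simp [hl]⟩

theorem height_lt_succ_iff {ξ : Field} {n : ℕ} :
    height ξ < ((n + 1 : ℕ) : ℕ∞) ↔ ∀ i < ξ [], height (sub ξ [i]) < (n : ℕ∞) := by
  rw [← not_le, succ_le_height_iff]
  push Not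
  rfl

theorem height_eq_succ_iff {ξ : Field} {n : ℕ} :
    height ξ = ((n + 1 : ℕ) : ℕ∞) ↔ (∀ i < ξ [], height (sub ξ [i]) < ((n + 1 : ℕ) : ℕ∞)) ∧
      ∃ i < ξ [], height (sub ξ [i]) = (n : ℕ∞) := by
  have key : ∀ a : ℕ∞, a < ((n + 1 : ℕ) : ℕ∞) ↔ a ≤ n := by
    intro a
    exact ENat.lt_add_one_iff (ENat.natCast_ne_top n)
  rw [eq_iff_le_not_lt, height_lt_succ_iff]
  have h1 : height ξ ≤ ((n + 1 : ℕ) : ℕ∞) ↔ height ξ < ((n + 1 + 1 : ℕ) : ℕ∞) := by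
    exact (ENat.lt_add_one_iff (ENat.natCast_ne_top _)).symm
  rw [h1, height_lt_succ_iff]
  push Not
  constructor
  · rintro ⟨h, i, hi, hn⟩
    exact ⟨h, i, hi, le_antisymm ((key _).1 (h i hi)) hn⟩
  · rintro ⟨h, i, hi, hn⟩
    exact ⟨h, i, hi, hn.ge⟩

/-- A locally finite infinite tree has an infinite subtree above one of the children of its root. -/
theorem exists_height_sub_eq_top {ξ : Field} (h : height ξ = ⊤) :
    ∃ i < ξ [], height (sub ξ [i]) = ⊤ := by
  by_contra! hn
  choose! f hf using fun (i : ℕ) (hi : i < ξ []) => ENat.ne_top_iff_exists.1 (hn i hi)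
  obtain ⟨M, hM⟩ : ∃ M, ∀ i < ξ [], f i < M :=
    ⟨(Finset.range (ξ [])).sup f + 1, fun i hi =>
      Nat.lt_succ_of_le (Finset.le_sup (f := f) (Finset.mem_range.2 hi))⟩
  have : ((M + 1 : ℕ) : ℕ∞) ≤ height ξ := h ▸ le_top
  obtain ⟨i, hi, hle⟩ := succ_le_height_iff.1 this
  rw [← hf i hi, Nat.cast_le] at hle
  exact absurd (hM i hi) (not_lt.2 hle)

theorem height_le_of_sub {ξ : Field} {w : List ℕ} (hw : Mem ξ w) :
    height (sub ξ w) ≤ height ξ := by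
  refine iSup₂_le fun v hv => le_trans ?_ (length_le_height (mem_append.2 ⟨hw, hv⟩))
  simp

theorem finite_level (ξ : Field) (n : ℕ) : {v | Mem ξ v ∧ v.length = n}.Finite := by
  induction n with
  | zero =>
    refine (Set.finite_singleton []).subset ?_
    simp
  | succ n ih =>
    have : {v | Mem ξ v ∧ v.length = n + 1} ⊆
        ⋃ w ∈ {v | Mem ξ v ∧ v.length = n}, (fun i => i :: w) '' Set.Iio (ξ w) := by
      rintro v ⟨hv, hl⟩
      cases v with
      | nil => simp at hl
      | cons i w =>
        simp only [Set.mem_iUnion]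
        exact ⟨w, ⟨hv.1, by simpa using hl⟩, i, hv.2, rfl⟩
    exact Set.Finite.subset (ih.biUnion fun w _ => (Set.finite_Iio _).image _) this

theorem finite_mem {ξ : Field} (h : height ξ ≠ ⊤) : {v | Mem ξ v}.Finite := by
  obtain ⟨n, hn⟩ := ENat.ne_top_iff_exists.1 h
  have : {v | Mem ξ v} ⊆ ⋃ k ∈ Set.Iic n, {v | Mem ξ v ∧ v.length = k} := by
    intro v hv
    simp only [Set.mem_iUnion]
    refine ⟨v.length, ?_, hv, rfl⟩
    have := length_le_height hv
    rw [← hn] at this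
    exact_mod_cast this
  exact ((Set.finite_Iic n).biUnion fun k _ => finite_level ξ k).subset this

theorem onBackbone_append {ξ : Field} {v w : List ℕ} (hw : Mem ξ w) :
    OnBackbone ξ (v ++ w) ↔ OnBackbone (sub ξ w) v := by
  simp [OnBackbone, mem_append, hw, sub_sub]

theorem onBackbone_nil {ξ : Field} : OnBackbone ξ [] ↔ height ξ = ⊤ := by
  simp [OnBackbone, Mem]

theorem OnBackbone.of_suffix {ξ : Field} {v w : List ℕ} (h : OnBackbone ξ w) (hv : v <:+ w) :
    OnBackbone ξ v := by
  obtain ⟨x, rfl⟩ := hv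
  have h1 := mem_append.1 h.1
  refine ⟨h1.1, ?_⟩
  have h2 := height_le_of_sub h1.2
  rw [sub_sub, h.2] at h2
  exact top_le_iff.1 h2

theorem OnBackbone.height_eq_top {ξ : Field} {w : List ℕ} (h : OnBackbone ξ w) :
    height ξ = ⊤ :=
  onBackbone_nil.1 (h.of_suffix (List.nil_suffix))

theorem mem_backboneChildren {ξ : Field} {v : List ℕ} {i : ℕ} :
    i ∈ backboneChildren ξ v ↔ i < ξ v ∧ OnBackbone ξ (i :: v) := by
  simp [backboneChildren]

theorem mem_otherChildren {ξ : Field} {v : List ℕ} {i : ℕ} :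
    i ∈ otherChildren ξ v ↔ i < ξ v ∧ ¬ OnBackbone ξ (i :: v) := by
  simp [otherChildren]

theorem length_backboneChildren_add (ξ : Field) (v : List ℕ) :
    (backboneChildren ξ v).length + (otherChildren ξ v).length = ξ v := by
  classical
  have := List.length_eq_length_filter_add (l := List.range (ξ v))
    (fun i => decide (OnBackbone ξ (i :: v)))
  simp only [List.length_range] at this
  refine Eq.trans ?_ this.symm
  congr 2
  refine List.filter_congr fun i _ => ?_
  by_cases h : OnBackbone ξ (i :: v) <;> simp [h]

theorem OnBackbone.length_backboneChildren_pos {ξ : Field} {v : List ℕ} (h : OnBackbone ξ v) :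
    0 < (backboneChildren ξ v).length := by
  obtain ⟨i, hi, hh⟩ := exists_height_sub_eq_top h.2
  rw [sub_sub] at hh
  have hi' : i < ξ v := by simpa [sub] using hi
  exact List.length_pos_of_mem (mem_backboneChildren.2 ⟨hi', ⟨h.1, hi'⟩, hh⟩)

theorem backboneChildren_append {ξ : Field} {v w : List ℕ} (hw : Mem ξ w) :
    backboneChildren ξ (v ++ w) = backboneChildren (sub ξ w) v := by
  refine List.filter_congr fun i _ => ?_
  have := onBackbone_append (v := i :: v) hw
  exact decide_eq_decide.2 this

theorem isBigTrap_append {ξ : Field} {h : ℕ} {v w : List ℕ} {i : ℕ} (hw : Mem ξ w) :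
    IsBigTrap ξ h (v ++ w) i ↔ IsBigTrap (sub ξ w) h v i := by
  have := onBackbone_append (v := i :: v) hw
  simp only [List.cons_append] at this
  simp only [IsBigTrap, this, sub_sub]
  rfl

/-! ### Replacing a subtree -/

/-- The tree `ξ` with the descendants of `w` replaced by the tree `η`. -/
def graft (ξ : Field) (w : List ℕ) (η : Field) : Field :=
  fun v => if w <:+ v then η (v.take (v.length - w.length)) else ξ v

theorem graft_append (ξ : Field) (w : List ℕ) (η : Field) (v : List ℕ) :
    graft ξ w η (v ++ w) = η v := by
  simp [graft]

theorem graft_of_not_suffix {ξ : Field} {w : List ℕ} {η : Field} {v : List ℕ} (h : ¬ w <:+ v) :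
    graft ξ w η v = ξ v := by
  simp [graft, h]

@[simp] theorem sub_graft (ξ : Field) (w : List ℕ) (η : Field) : sub (graft ξ w η) w = η := by
  funext v; exact graft_append ξ w η v

@[simp] theorem graft_graft (ξ : Field) (w : List ℕ) (η ζ : Field) :
    graft (graft ξ w η) w ζ = graft ξ w ζ := by
  funext v
  by_cases h : w <:+ v
  · obtain ⟨x, rfl⟩ := h
    rw [graft_append, graft_append]
  · rw [graft_of_not_suffix h, graft_of_not_suffix h, graft_of_not_suffix h]

@[simp] theorem graft_self (ξ : Field) (w : List ℕ) : graft ξ w (sub ξ w) = ξ := by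
  funext v
  by_cases h : w <:+ v
  · obtain ⟨x, rfl⟩ := h
    rw [graft_append]; rfl
  · rw [graft_of_not_suffix h]

theorem mem_congr {ξ η : Field} {v : List ℕ}
    (h : ∀ x, x <:+ v → x ≠ v → ξ x = η x) : Mem ξ v ↔ Mem η v := by
  induction v with
  | nil => simp [Mem]
  | cons i v ih =>
    simp only [Mem, h v (List.suffix_cons i v) (by simp)]
    rw [ih]
    intro x hx _
    refine h x (hx.trans (List.suffix_cons i v)) ?_
    rintro rfl
    have := hx.length_le
    simp at this

theorem not_suffix_of_strict {w v x : List ℕ} (hv : w <:+ v → v = w) (hx : x <:+ v) (hne : x ≠ v) :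
    ¬ w <:+ x := by
  intro hw
  have h1 := hv (hw.trans hx)
  subst h1
  exact hne (hx.eq_of_length_le hw.length_le)

/-- Vertices which are not strictly below `w` are unaffected by the replacement. -/
theorem mem_graft {ξ : Field} {w : List ℕ} {η : Field} {v : List ℕ} (hv : w <:+ v → v = w) :
    Mem (graft ξ w η) v ↔ Mem ξ v :=
  mem_congr fun _ hx hne => graft_of_not_suffix (not_suffix_of_strict hv hx hne)

theorem sub_graft_of_disjoint {ξ : Field} {w : List ℕ} {η : Field} {v : List ℕ}
    (h1 : ¬ w <:+ v) (h2 : ¬ v <:+ w) : sub (graft ξ w η) v = sub ξ v := by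
  funext x
  refine graft_of_not_suffix fun h => ?_
  rcases List.suffix_or_suffix_of_suffix h (List.suffix_append x v) with h | h
  · exact h1 h
  · exact h2 h

theorem height_sub_graft_aux {ξ : Field} {y v : List ℕ} {η : Field} (hw : Mem ξ (y ++ v))
    (hη : height η = ⊤ ↔ height (sub ξ (y ++ v)) = ⊤) (h : height (sub ξ v) = ⊤) :
    height (sub (graft ξ (y ++ v) η) v) = ⊤ := by
  have hw' : Mem (graft ξ (y ++ v) η) (y ++ v) := (mem_graft fun _ => rfl).2 hw
  by_cases hη' : height η = ⊤
  · have h1 := height_le_of_sub (mem_append.1 hw').2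
    rw [sub_sub, sub_graft, hη'] at h1
    exact top_le_iff.1 h1
  · have hf := fun h => hη' (hη.2 h)
    obtain ⟨N, hN⟩ := ENat.ne_top_iff_exists.1 hf
    rw [height_eq_top_iff] at h ⊢
    intro n
    obtain ⟨x, hx, hl⟩ := h (max n (N + y.length + 1))
    refine ⟨x, ?_, (le_max_left _ _).trans hl⟩
    have hxm := mem_append.2 ⟨(mem_append.1 hw).1, hx⟩
    have hns : ¬ (y ++ v) <:+ x ++ v := by
      rintro ⟨x', hx'⟩
      have h4 := length_le_height (mem_append.1 (hx' ▸ hxm)).2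
      rw [← hN, Nat.cast_le] at h4
      have h5 := congrArg List.length hx'
      simp only [List.length_append] at h5
      omega
    exact (mem_append.1 ((mem_graft fun h => absurd h hns).2 hxm)).2

theorem onBackbone_graft {ξ : Field} {w : List ℕ} {η : Field} {v : List ℕ} (hw : Mem ξ w)
    (hη : height η = ⊤ ↔ height (sub ξ w) = ⊤) (hv : w <:+ v → v = w) :
    OnBackbone (graft ξ w η) v ↔ OnBackbone ξ v := by
  unfold OnBackbone
  rw [mem_graft hv]
  refine and_congr_right fun hm => ?_
  by_cases hvw : v <:+ w
  · obtain ⟨y, rfl⟩ := hvw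
    refine ⟨fun h => ?_, height_sub_graft_aux hw hη⟩
    have := height_sub_graft_aux (η := sub ξ (y ++ v))
      ((mem_graft fun _ => rfl).2 hw) (by rw [sub_graft]; exact hη.symm) h
    rwa [graft_graft, graft_self] at this
  · rw [sub_graft_of_disjoint (fun h => hvw (hv h ▸ List.suffix_rfl)) hvw]

theorem not_strict_cons {w v : List ℕ} (hv : ¬ w <:+ v) (i : ℕ) : w <:+ i :: v → i :: v = w := by
  intro h
  rcases List.suffix_cons_iff.1 h with h | h
  · exact h.symm
  · exact absurd h hv

theorem backboneChildren_graft {ξ : Field} {w : List ℕ} {η : Field} {v : List ℕ} (hw : Mem ξ w)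
    (hη : height η = ⊤ ↔ height (sub ξ w) = ⊤) (hv : ¬ w <:+ v) :
    backboneChildren (graft ξ w η) v = backboneChildren ξ v := by
  unfold backboneChildren
  rw [graft_of_not_suffix hv]
  refine List.filter_congr fun i _ => ?_
  exact decide_eq_decide.2 (onBackbone_graft hw hη (not_strict_cons hv i))

theorem isBigTrap_graft {ξ : Field} {w : List ℕ} {η : Field} {v : List ℕ} {h i : ℕ} (hw : Mem ξ w)
    (hη : height η = ⊤ ↔ height (sub ξ w) = ⊤) (hv : ¬ w <:+ v)
    (hb : i :: v <:+ w → OnBackbone ξ (i :: v)) :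
    IsBigTrap (graft ξ w η) h v i ↔ IsBigTrap ξ h v i := by
  unfold IsBigTrap
  rw [graft_of_not_suffix hv, onBackbone_graft hw hη (not_strict_cons hv i)]
  by_cases hc : i :: v <:+ w
  · simp [hb hc]
  · rw [sub_graft_of_disjoint (fun h => hc (not_strict_cons hv i h ▸ List.suffix_rfl)) hc]

/-! ### Measurability of functionals of the tree -/

instance : MeasurableSpace (List ℕ) := ⊤

instance : DiscreteMeasurableSpace (List ℕ) := ⟨fun _ => trivial⟩

@[fun_prop]
theorem measurable_sub (w : List ℕ) : Measurable fun ξ : Field => sub ξ w :=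
  measurable_pi_iff.2 fun v => measurable_pi_apply (v ++ w)

@[fun_prop]
theorem _root_.Measurable.treeSub {Ω : Type*} [MeasurableSpace Ω] {f : Ω → Field} {g : Ω → List ℕ}
    (hf : Measurable f) (hg : Measurable g) : Measurable fun ω => sub (f ω) (g ω) :=
  .discrete_apply (fun w => (measurable_sub w).comp hf) hg

theorem measurable_graft (w : List ℕ) :
    Measurable fun p : Field × Field => graft p.1 w p.2 := by
  refine measurable_pi_iff.2 fun v => ?_
  unfold graft
  split_ifs <;> fun_prop

@[fun_prop]
theorem measurable_mem (v : List ℕ) : Measurable fun ξ => Mem ξ v := by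
  induction v with
  | nil => exact measurable_const
  | cons i v ih => exact ih.and (by fun_prop)

@[fun_prop]
theorem measurable_height : Measurable height := by
  have h : ∀ n : ℕ, Measurable fun ξ => (n : ℕ∞) ≤ height ξ := fun n => by
    simp only [le_height_iff]; fun_prop
  refine measurable_to_countable' fun x => measurableSet_setOfPred.2 ?_
  induction x with
  | top =>
    simp only [Set.mem_singleton_iff, ENat.eq_top_iff_forall_ge]
    fun_prop
  | coe n =>
    have h1 : ∀ ξ, height ξ = n ↔ (n : ℕ∞) ≤ height ξ ∧ ¬ ((n + 1 : ℕ) : ℕ∞) ≤ height ξ := by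
      intro ξ
      rw [not_le, Nat.cast_succ, ENat.lt_add_one_iff (ENat.natCast_ne_top n), and_comm,
        le_antisymm_iff]
    simp only [Set.mem_singleton_iff, h1]
    fun_prop

theorem measurableSet_le_height (n : ℕ) : MeasurableSet {ξ : Field | (n : ℕ∞) ≤ height ξ} :=
  measurable_height (.of_discrete (s := Set.Ici (n : ℕ∞)))

theorem measurableSet_height_lt (n : ℕ) : MeasurableSet {ξ : Field | height ξ < (n : ℕ∞)} :=
  measurable_height .of_discrete

theorem measurableSet_height_eq_top : MeasurableSet {ξ : Field | height ξ = ⊤} :=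
  measurable_height (measurableSet_singleton ⊤)

theorem measurableSet_height_eq (n : ℕ) : MeasurableSet {ξ : Field | height ξ = (n : ℕ∞)} :=
  measurable_height (measurableSet_singleton _)

@[fun_prop]
theorem measurable_onBackbone (v : List ℕ) : Measurable fun ξ => OnBackbone ξ v := by
  unfold OnBackbone; fun_prop

theorem measurableSet_onBackbone (v : List ℕ) : MeasurableSet {ξ : Field | OnBackbone ξ v} :=
  measurableSet_setOfPred.2 (by fun_prop)

theorem measurable_filter {Ω : Type*} [MeasurableSpace Ω] (l : List ℕ) (P : Ω → ℕ → Prop)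
    [∀ ω i, Decidable (P ω i)] (hP : ∀ i, MeasurableSet {ω | P ω i}) :
    Measurable fun ω => l.filter fun i => decide (P ω i) := by
  induction l with
  | nil => simp
  | cons a l ih =>
    simp only [List.filter_cons, decide_eq_true_eq]
    exact .ite (hP a) (measurable_from_top.comp ih) ih

@[fun_prop]
theorem measurable_backboneChildren (v : List ℕ) :
    Measurable fun ξ : Field => backboneChildren ξ v := by
  classical
  exact .discrete_apply (fun k => measurable_filter (List.range k)
    (fun ξ i => OnBackbone ξ (i :: v)) fun i => measurableSet_onBackbone (i :: v))
      (measurable_pi_apply v)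

@[fun_prop]
theorem measurable_otherChildren (v : List ℕ) :
    Measurable fun ξ : Field => otherChildren ξ v := by
  classical
  exact .discrete_apply (fun k => measurable_filter (List.range k)
    (fun ξ i => ¬ OnBackbone ξ (i :: v)) fun i => (measurableSet_onBackbone (i :: v)).compl)
      (measurable_pi_apply v)

@[fun_prop]
theorem measurable_isBigTrap (h : ℕ) (v : List ℕ) (i : ℕ) :
    Measurable fun ξ : Field => IsBigTrap ξ h v i := by
  unfold IsBigTrap; fun_prop

end PlaneTree

/-! ### The branching property and the extinction probability -/

section Branching

open PlaneTree

theorem measurable_node :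
    Measurable fun ξ : Field => (ξ [], fun i : ℕ => sub ξ [i]) :=
  (measurable_pi_apply []).prodMk (measurable_pi_iff.2 fun i => measurable_sub [i])

/-- The branching property: the offspring number of the root and the trees above the potential
children of the root are independent, and these trees are again Galton-Watson trees. -/
theorem map_node_gwMeasure (p : PMF ℕ) :
    (gwMeasure p).map (fun ξ => (ξ [], fun i : ℕ => sub ξ [i])) =
      p.toMeasure.prod (Measure.infinitePi fun _ : ℕ => gwMeasure p) := by
  let f : Unit ⊕ (ℕ × List ℕ) → List ℕ := Sum.elim (fun _ => []) fun x => x.2 ++ [x.1]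
  have hf : Function.Injective f := by
    rintro (⟨⟩ | ⟨i, v⟩) (⟨⟩ | ⟨j, w⟩) h
    all_goals simp_all [f]
  have : ∀ i, IsProbabilityMeasure ((Sum.elim (fun _ : Unit => p.toMeasure)
      (fun _ : ℕ × List ℕ => p.toMeasure)) i) := by
    rintro (i | i) <;> simp only [Sum.elim_inl, Sum.elim_inr] <;> infer_instance
  have h2 := map_sumElim_prod_infinitePi (fun _ : Unit => p.toMeasure)
    (fun _ : ℕ × List ℕ => p.toMeasure)
  have h3 : (Sum.elim (fun _ : Unit => p.toMeasure) fun _ : ℕ × List ℕ => p.toMeasure) =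
      fun _ => p.toMeasure := by
    funext i; cases i <;> rfl
  let Ψ : (Unit ⊕ (ℕ × List ℕ) → ℕ) → ℕ × (ℕ → Field) :=
    fun g => (g (Sum.inl ()), fun i v => g (Sum.inr (i, v)))
  have hΨ : Measurable Ψ := (measurable_pi_apply _).prodMk
    (measurable_pi_iff.2 fun i => measurable_pi_iff.2 fun v => measurable_pi_apply _)
  have h4 : (gwMeasure p).map (fun ξ => (ξ [], fun i : ℕ => sub ξ [i])) =
      (Measure.infinitePi fun _ => p.toMeasure).map Ψ := by
    rw [← Measure.map_infinitePi_infinitePi_of_inj (P := fun _ => p.toMeasure) hf,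
      Measure.map_map hΨ (by fun_prop)]
    rfl
  simp only [h3] at h2
  rw [h4, ← h2, Measure.map_map hΨ measurable_sumElim_prod]
  have h6 : Ψ ∘ (fun q => (Sum.elim q.1 q.2 : Unit ⊕ (ℕ × List ℕ) → ℕ)) =
      Prod.map (fun g => g ()) (MeasurableEquiv.curry ℕ (List ℕ) ℕ) := by
    funext q; rfl
  rw [h6, ← Measure.map_prod_map _ _ (measurable_pi_apply ()) (MeasurableEquiv.measurable _)]
  congr 1
  · exact Measure.infinitePi_map_eval (fun _ : Unit => p.toMeasure) ()
  · exact Measure.infinitePi_map_curry (fun (_ : ℕ) (_ : List ℕ) => p.toMeasure)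

theorem lintegral_toMeasure (p : PMF ℕ) (f : ℕ → ℝ≥0∞) :
    ∫⁻ k, f k ∂p.toMeasure = ∑' k, p k * f k := by
  simp [lintegral_countable', PMF.toMeasure_apply_singleton, mul_comm]

theorem lintegral_gwMeasure_node (p : PMF ℕ) {F : ℕ × (ℕ → Field) → ℝ≥0∞} (hF : Measurable F) :
    ∫⁻ ξ, F (ξ [], fun i => sub ξ [i]) ∂gwMeasure p =
      ∑' k, p k * ∫⁻ t, F (k, t) ∂(Measure.infinitePi fun _ : ℕ => gwMeasure p) := by
  rw [← lintegral_toMeasure, ← lintegral_prod _ hF.aemeasurable, ← map_node_gwMeasure,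
    lintegral_map hF measurable_node]

theorem measure_height_lt_zero (p : PMF ℕ) : gwMeasure p {ξ | height ξ < ((0 : ℕ) : ℕ∞)} = 0 := by
  simp

theorem measure_height_lt_succ (p : PMF ℕ) (n : ℕ) :
    gwMeasure p {ξ | height ξ < ((n + 1 : ℕ) : ℕ∞)} =
      ∑' k, p k * gwMeasure p {ξ | height ξ < (n : ℕ∞)} ^ k := by
  have h1 := lintegral_gwMeasure_node p (F := Set.indicator
    {x : ℕ × (ℕ → Field) | ∀ i < x.1, height (x.2 i) < (n : ℕ∞)} fun _ => 1)
    (measurable_const.indicator (measurableSet_setOfPred.2 (by fun_prop)))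
  have h2 : ∀ ξ : Field, Set.indicator
      {x : ℕ × (ℕ → Field) | ∀ i < x.1, height (x.2 i) < (n : ℕ∞)} (fun _ => (1 : ℝ≥0∞))
        (ξ [], fun i => sub ξ [i]) =
      Set.indicator {ξ | height ξ < ((n + 1 : ℕ) : ℕ∞)} (fun _ => 1) ξ := fun ξ =>
    Set.indicator_const_eq_indicator_const height_lt_succ_iff.symm
  simp_rw [h2] at h1
  rw [lintegral_indicator_const (measurableSet_height_lt _), one_mul] at h1
  rw [h1]
  refine tsum_congr fun k => ?_
  have h3 : ∀ t : ℕ → Field, Set.indicator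
      {x : ℕ × (ℕ → Field) | ∀ i < x.1, height (x.2 i) < (n : ℕ∞)} (fun _ => (1 : ℝ≥0∞)) (k, t) =
      Set.indicator (Set.pi (Finset.range k) fun _ => {ξ | height ξ < (n : ℕ∞)}) (fun _ => 1) t :=
    fun t => Set.indicator_const_eq_indicator_const (by simp [Set.mem_pi])
  simp_rw [h3]
  rw [lintegral_indicator_const, one_mul, Measure.infinitePi_pi _ fun _ _ =>
    measurableSet_height_lt n]
  · simp
  · exact MeasurableSet.pi (Finset.countable_toSet _) fun _ _ => measurableSet_height_lt n

/-- The subtree at `w` is independent of the rest of the tree. Here `f` is a functional of the rest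
of the tree and of the information that the subtree belongs to a class `A`. -/
theorem lintegral_mul_sub (p : PMF ℕ) (w : List ℕ) {A : Set Field} (hA : MeasurableSet A)
    {f J : Field → ℝ≥0∞} (hf : Measurable f) (hJ : Measurable J)
    (hf0 : ∀ ξ, sub ξ w ∉ A → f ξ = 0)
    (hfA : ∀ ξ η, sub ξ w ∈ A → η ∈ A → f (graft ξ w η) = f ξ) :
    gwMeasure p A * ∫⁻ ξ, f ξ * J (sub ξ w) ∂gwMeasure p =
      (∫⁻ ξ, f ξ ∂gwMeasure p) * ∫⁻ ξ in A, J ξ ∂gwMeasure p := by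
  have hgraft : ((gwMeasure p).prod (gwMeasure p)).map (fun q => graft q.1 w q.2) =
      gwMeasure p := by
    have := map_splice_prod_infinitePi (fun _ => p.toMeasure)
      (fun _ => p.toMeasure) (fun _ => p.toMeasure)
      (fun v => if w <:+ v then Sum.inr (v.take (v.length - w.length)) else Sum.inl v) ?_ ?_
    · refine Eq.trans ?_ this
      congr 1
      funext q v
      simp only [graft]
      split_ifs <;> rfl
    · intro u v huv
      simp only at huv
      split_ifs at huv with h1 h2 h2
      · obtain ⟨x, rfl⟩ := h1
        obtain ⟨y, rfl⟩ := h2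
        simpa using huv
      · exact Sum.inl_injective huv
    · intro i; split_ifs <;> rfl
  have hsplit : ∀ g : Field → ℝ≥0∞, Measurable g → ∫⁻ ξ, g ξ ∂gwMeasure p =
      ∫⁻ ξ, ∫⁻ η, g (graft ξ w η) ∂gwMeasure p ∂gwMeasure p := by
    intro g hg
    conv_lhs => rw [← hgraft]
    rw [lintegral_map hg (measurable_graft w), lintegral_prod]
    exact (hg.comp (measurable_graft w)).aemeasurable
  rcases A.eq_empty_or_nonempty with rfl | ⟨η₀, hη₀⟩
  · have := fun ξ => hf0 ξ (Set.notMem_empty _)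
    simp [this]
  have hfg : ∀ ξ η, f (graft ξ w η) = A.indicator (fun _ => f (graft ξ w η₀)) η := by
    intro ξ η
    by_cases hη : η ∈ A
    · rw [Set.indicator_of_mem hη]
      have := hfA (graft ξ w η) η₀ (by rwa [sub_graft]) hη₀
      rw [graft_graft] at this
      exact this.symm
    · rw [Set.indicator_of_notMem hη]
      exact hf0 _ (by rwa [sub_graft])
  have key : ∀ g : Field → ℝ≥0∞, Measurable g → ∫⁻ ξ, f ξ * g (sub ξ w) ∂gwMeasure p =
      (∫⁻ ξ, f (graft ξ w η₀) ∂gwMeasure p) * ∫⁻ ξ in A, g ξ ∂gwMeasure p := by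
    intro g hg
    rw [hsplit (fun ξ => f ξ * g (sub ξ w)) (hf.mul (hg.comp (measurable_sub w)))]
    have h1 : Measurable fun ξ : Field => f (graft ξ w η₀) :=
      hf.comp ((measurable_graft w).comp (measurable_id.prodMk measurable_const))
    rw [← lintegral_mul_const _ h1]
    refine lintegral_congr fun ξ => ?_
    rw [← lintegral_indicator hA, ← lintegral_const_mul _ (hg.indicator hA)]
    refine lintegral_congr fun η => ?_
    rw [hfg]
    by_cases hη : η ∈ A <;> simp [hη]
  have h1 := key (fun _ => 1) measurable_const
  simp only [mul_one, lintegral_const, Measure.restrict_apply MeasurableSet.univ, Set.univ_inter,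
    one_mul] at h1
  rw [key J hJ, h1]
  ring

end Branching

namespace BiasedGW

open PlaneTree

variable (D : BiasedGW)

/-- The probabilities of the offspring law, as real numbers. -/
noncomputable def coef (k : ℕ) : ℝ := (D.p k).toReal

theorem coef_nonneg (k : ℕ) : 0 ≤ D.coef k := ENNReal.toReal_nonneg

theorem ofReal_coef (k : ℕ) : ENNReal.ofReal (D.coef k) = D.p k :=
  ENNReal.ofReal_toReal (D.p.apply_ne_top k)

theorem mean_ne_top : ∑' k : ℕ, D.p k * (k : ℝ≥0∞) ≠ ∞ := by
  refine ne_top_of_le_ne_top D.second_moment (ENNReal.tsum_le_tsum fun k => ?_)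
  gcongr
  exact_mod_cast Nat.le_self_pow two_ne_zero k

theorem summable_coef_mul : Summable fun k : ℕ => D.coef k * k := by
  have := ENNReal.summable_toReal D.mean_ne_top
  simpa [coef] using this

theorem hasSum_coef : HasSum D.coef 1 := by
  have h := D.p.tsum_coe
  have h1 := ENNReal.summable_toReal (by rw [h]; exact ENNReal.one_ne_top)
  have h2 := ENNReal.tsum_toReal_eq D.p.apply_ne_top
  rw [h, ENNReal.toReal_one] at h2
  exact h2 ▸ h1.hasSum

theorem exists_two_le : ∃ k, 2 ≤ k ∧ 0 < D.coef k := by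
  by_contra! h
  have h0 : ∀ k, 2 ≤ k → D.p k = 0 := by
    intro k hk
    have := le_antisymm (h k hk) (D.coef_nonneg k)
    rw [← D.ofReal_coef, this, ENNReal.ofReal_zero]
  have h1 : ∑' k : ℕ, D.p k * (k : ℝ≥0∞) ≤ ∑' k, D.p k := by
    refine ENNReal.tsum_le_tsum fun k => ?_
    rcases Nat.lt_or_ge k 2 with hk | hk
    · refine mul_le_of_le_one_right' ?_
      exact_mod_cast Nat.le_of_lt_succ hk
    · simp [h0 k hk]
  rw [D.p.tsum_coe] at h1
  exact absurd D.one_lt_mean (not_lt.2 h1)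

theorem summable_coef_mul_pow {x : ℝ} (h0 : 0 ≤ x) (h1 : x ≤ 1) :
    Summable fun k => D.coef k * x ^ k :=
  D.hasSum_coef.summable.of_nonneg_of_le (fun k => mul_nonneg (D.coef_nonneg k) (by positivity))
    fun k => mul_le_of_le_one_right (D.coef_nonneg k) (pow_le_one₀ h0 h1)

/-- The derivative `f'(q)`, which is the mean of the offspring law of the traps. -/
noncomputable def r : ℝ := deriv (genFun D.p) D.q

theorem r_eq : D.r = ∑' k : ℕ, D.coef k * (k * D.q ^ (k - 1)) := by
  have h : HasDerivAt (fun z : ℝ => ∑' k, D.coef k * z ^ k)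
      (∑' k : ℕ, D.coef k * (k * D.q ^ (k - 1))) D.q := by
    refine hasDerivAt_tsum_of_isPreconnected
      (g' := fun k z => D.coef k * (k * z ^ (k - 1))) (y₀ := D.q)
      D.summable_coef_mul Metric.isOpen_ball
      (convex_ball (0 : ℝ) 1).isPreconnected (fun k y _ => ?_) (fun k y hy => ?_) ?_ ?_ ?_
    · exact (hasDerivAt_pow k y).const_mul (D.coef k)
    · rw [norm_mul, norm_mul, norm_pow, Real.norm_of_nonneg (D.coef_nonneg k), Real.norm_natCast]
      exact mul_le_mul_of_nonneg_left (mul_le_of_le_one_right (Nat.cast_nonneg k)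
        (pow_le_one₀ (norm_nonneg y) (mem_ball_zero_iff.1 hy).le)) (D.coef_nonneg k)
    · simp [abs_of_pos D.q_pos, D.q_lt_one]
    · exact D.summable_coef_mul_pow D.q_pos.le D.q_lt_one.le
    · simp [abs_of_pos D.q_pos, D.q_lt_one]
  exact h.deriv

theorem summable_r : Summable fun k : ℕ => D.coef k * (k * D.q ^ (k - 1)) :=
  D.summable_coef_mul.of_nonneg_of_le
    (fun k => mul_nonneg (D.coef_nonneg k) (mul_nonneg (Nat.cast_nonneg k)
      (pow_nonneg D.q_pos.le _)))
    fun k => mul_le_mul_of_nonneg_left (mul_le_of_le_one_right (Nat.cast_nonneg k)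
      (pow_le_one₀ D.q_pos.le D.q_lt_one.le)) (D.coef_nonneg k)

theorem hasSum_genFun_q : HasSum (fun k => D.coef k * D.q ^ k) D.q := by
  have := (D.summable_coef_mul_pow D.q_pos.le D.q_lt_one.le).hasSum
  rwa [show ∑' k, D.coef k * D.q ^ k = D.q from D.genFun_q] at this

theorem r_pos : 0 < D.r := by
  obtain ⟨k, hk, hc⟩ := D.exists_two_le
  rw [D.r_eq]
  refine D.summable_r.tsum_pos (fun k => mul_nonneg (D.coef_nonneg k)
    (mul_nonneg (Nat.cast_nonneg k) (pow_nonneg D.q_pos.le _))) k ?_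
  have := D.q_pos
  positivity

theorem pow_sub_pow_le_mul {x y : ℝ} (hx : 0 ≤ x) (hxy : x ≤ y) (k : ℕ) :
    y ^ k - x ^ k ≤ k * y ^ (k - 1) * (y - x) := by
  rw [← geom_sum₂_mul]
  refine mul_le_mul_of_nonneg_right ?_ (sub_nonneg.2 hxy)
  refine (Finset.sum_le_card_nsmul _ _ (y ^ (k - 1)) fun i hi => ?_).trans_eq (by simp)
  have hi' := Finset.mem_range.1 hi
  calc y ^ i * x ^ (k - 1 - i) ≤ y ^ i * y ^ (k - 1 - i) := by
        exact mul_le_mul_of_nonneg_left (pow_le_pow_left₀ hx hxy _)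
          (pow_nonneg (hx.trans hxy) _)
    _ = y ^ (k - 1) := by rw [← pow_add]; congr 1; omega

theorem mul_pow_mul_le_one_sub_pow {y : ℝ} (hy : 0 ≤ y) (hy1 : y ≤ 1) (k : ℕ) :
    k * y ^ (k - 1) * (1 - y) ≤ 1 - y ^ k := by
  have h := geom_sum₂_mul (1 : ℝ) y k
  rw [one_pow] at h
  rw [← h]
  refine mul_le_mul_of_nonneg_right ?_ (sub_nonneg.2 hy1)
  have := Finset.card_nsmul_le_sum (Finset.range k) (fun i => (1 : ℝ) ^ i * y ^ (k - 1 - i))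
    (y ^ (k - 1)) fun i hi => by
      rw [one_pow, one_mul]
      exact pow_le_pow_of_le_one hy hy1 (by omega)
  simpa using this

theorem r_lt_one : D.r < 1 := by
  have hq := D.q_pos
  have hq1 := D.q_lt_one
  have h1 : HasSum (fun k => D.coef k * (1 - D.q ^ k)) (1 - D.q) := by
    have := D.hasSum_coef.sub D.hasSum_genFun_q
    simpa [mul_sub] using this
  have h2 : HasSum (fun k : ℕ => D.coef k * (k * D.q ^ (k - 1) * (1 - D.q))) (D.r * (1 - D.q)) := by
    have := (D.summable_r.hasSum).mul_right (1 - D.q)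
    rw [← D.r_eq] at this
    simpa [mul_assoc] using this
  obtain ⟨k, hk, hc⟩ := D.exists_two_le
  have h3 : D.r * (1 - D.q) < 1 - D.q := by
    refine hasSum_lt (i := k) (fun j => mul_le_mul_of_nonneg_left (mul_pow_mul_le_one_sub_pow hq.le
      hq1.le j) (D.coef_nonneg j)) (mul_lt_mul_of_pos_left ?_ hc) h2 h1
    obtain ⟨m, rfl⟩ : ∃ m, k = m + 2 := ⟨k - 2, by omega⟩
    -- one more factor: `(m + 1) q ^ m (1 - q) ≤ 1 - q ^ (m + 1)`
    have h4 := mul_pow_mul_le_one_sub_pow hq.le hq1.le (m + 1)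
    have h5 : D.q ^ (m + 1) < 1 := pow_lt_one₀ hq.le hq1 (by omega)
    rw [pow_succ D.q (m + 1)]
    push_cast at h4 ⊢
    have h7 : ((m : ℝ) + 1) * D.q ^ (m + 1) * (1 - D.q) ≤ D.q * (1 - D.q ^ (m + 1)) := by
      rw [pow_succ _ _] at h4 ⊢
      nlinarith
    nlinarith
  nlinarith

/-- The probability that the height of the tree is less than `n`. -/
noncomputable def extBy (n : ℕ) : ℝ := (gwMeasure D.p {ξ | height ξ < (n : ℕ∞)}).toReal

theorem extBy_nonneg (n : ℕ) : 0 ≤ D.extBy n := ENNReal.toReal_nonneg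

theorem extBy_le_one (n : ℕ) : D.extBy n ≤ 1 :=
  ENNReal.toReal_le_of_le_ofReal zero_le_one (by simpa using prob_le_one)

theorem extBy_zero : D.extBy 0 = 0 := by
  rw [extBy, measure_height_lt_zero, ENNReal.toReal_zero]

theorem extBy_succ (n : ℕ) : D.extBy (n + 1) = ∑' k, D.coef k * D.extBy n ^ k := by
  rw [extBy, measure_height_lt_succ, ENNReal.tsum_toReal_eq]
  · simp only [ENNReal.toReal_mul, ENNReal.toReal_pow]; rfl
  · intro k
    exact ENNReal.mul_ne_top (D.p.apply_ne_top k) (ENNReal.pow_ne_top (measure_ne_top _ _))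

theorem extBy_lt (n : ℕ) : D.extBy n < D.q := by
  induction n with
  | zero => rw [extBy_zero]; exact D.q_pos
  | succ n ih =>
    rw [extBy_succ]
    obtain ⟨k, hk, hc⟩ := D.exists_two_le
    refine hasSum_lt (i := k) (fun j => ?_) ?_
      (D.summable_coef_mul_pow (D.extBy_nonneg n) (D.extBy_le_one n)).hasSum D.hasSum_genFun_q
    · exact mul_le_mul_of_nonneg_left (pow_le_pow_left₀ (D.extBy_nonneg n) ih.le j)
        (D.coef_nonneg j)
    · exact mul_lt_mul_of_pos_left (pow_lt_pow_left₀ ih (D.extBy_nonneg n) (by omega)) hc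

theorem q_sub_extBy_le (n : ℕ) : D.q - D.extBy n ≤ D.r ^ n * D.q := by
  induction n with
  | zero => simp [extBy_zero]
  | succ n ih =>
    have h1 := D.hasSum_genFun_q.sub
      (D.summable_coef_mul_pow (D.extBy_nonneg n) (D.extBy_le_one n)).hasSum
    rw [← D.extBy_succ] at h1
    have h2 : HasSum (fun k : ℕ => D.coef k * (k * D.q ^ (k - 1)) * (D.q - D.extBy n))
        (D.r * (D.q - D.extBy n)) := by
      rw [D.r_eq]; exact D.summable_r.hasSum.mul_right _
    have h3 : D.q - D.extBy (n + 1) ≤ D.r * (D.q - D.extBy n) := by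
      refine hasSum_le (fun k => ?_) h1 h2
      have := pow_sub_pow_le_mul (D.extBy_nonneg n) (D.extBy_lt n).le k
      have := mul_le_mul_of_nonneg_left this (D.coef_nonneg k)
      linarith
    refine h3.trans ?_
    rw [pow_succ', mul_assoc]
    exact mul_le_mul_of_nonneg_left ih D.r_pos.le

theorem tendsto_extBy : Tendsto D.extBy atTop (nhds D.q) := by
  have h : Tendsto (fun n => D.q - D.r ^ n * D.q) atTop (nhds (D.q - 0 * D.q)) :=
    tendsto_const_nhds.sub ((tendsto_pow_atTop_nhds_zero_of_lt_one D.r_pos.le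
      D.r_lt_one).mul_const _)
  rw [zero_mul, sub_zero] at h
  exact tendsto_of_tendsto_of_tendsto_of_le_of_le h tendsto_const_nhds
    (fun n => by have := D.q_sub_extBy_le n; linarith) fun n => (D.extBy_lt n).le

/-- The event of survival. -/
def survival : Set Field := {ξ | height ξ = ⊤}

theorem measurableSet_survival : MeasurableSet survival := measurableSet_height_eq_top

theorem measure_height_ne_top : gwMeasure D.p survivalᶜ = ENNReal.ofReal D.q := by
  have h1 : survivalᶜ = ⋃ n : ℕ, {ξ : Field | height ξ < (n : ℕ∞)} := by
    ext ξ
    simp only [Set.mem_ofPred_eq, Set.mem_iUnion]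
    constructor
    · intro h
      obtain ⟨n, hn⟩ := ENat.ne_top_iff_exists.1 h
      exact ⟨n + 1, by rw [← hn]; exact_mod_cast Nat.lt_succ_self n⟩
    · exact fun ⟨n, hn⟩ => (lt_top_of_lt hn).ne
  have hmono : Monotone fun n : ℕ => {ξ : Field | height ξ < (n : ℕ∞)} := fun m n hmn ξ hξ =>
    lt_of_lt_of_le (show height ξ < (m : ℕ∞) from hξ) (by exact_mod_cast hmn)
  have h2 := tendsto_measure_iUnion_atTop (μ := gwMeasure D.p) hmono
  rw [← h1] at h2
  exact tendsto_nhds_unique h2 ((ENNReal.tendsto_ofReal D.tendsto_extBy).congr fun n =>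
    ENNReal.ofReal_toReal (measure_ne_top _ _))

theorem measure_survival : gwMeasure D.p survival = ENNReal.ofReal (1 - D.q) := by
  have h := prob_compl_eq_one_sub (μ := gwMeasure D.p) measurableSet_survival.compl
  rw [compl_compl, D.measure_height_ne_top] at h
  rw [h, ENNReal.ofReal_sub _ D.q_pos.le, ENNReal.ofReal_one]

theorem measure_survival_ne_zero : gwMeasure D.p survival ≠ 0 := by
  rw [D.measure_survival]
  simpa using D.q_lt_one

/-- The trees of finite height at least `h`. -/
def tallFinite (h : ℕ) : Set Field := {ξ | (h : ℕ∞) ≤ height ξ ∧ height ξ ≠ ⊤}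

theorem measure_tallFinite (h : ℕ) :
    gwMeasure D.p (tallFinite h) = ENNReal.ofReal (D.q - D.extBy h) := by
  have h1 : tallFinite h = survivalᶜ \ {ξ | height ξ < (h : ℕ∞)} := by
    ext ξ; simp [tallFinite, survival, and_comm]
  rw [h1, measure_sdiff _ (measurableSet_height_lt h).nullMeasurableSet (measure_ne_top _ _),
    D.measure_height_ne_top, ENNReal.ofReal_sub _ (D.extBy_nonneg h)]
  · rw [extBy, ENNReal.ofReal_toReal (measure_ne_top _ _)]
  · exact fun ξ hξ => (lt_top_of_lt hξ).ne

theorem measure_tallFinite_ne_zero (h : ℕ) : gwMeasure D.p (tallFinite h) ≠ 0 := by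
  rw [measure_tallFinite]
  simpa using D.extBy_lt h

theorem lintegral_root_offspring :
    ∫⁻ ξ, (ξ [] : ℝ≥0∞) ∂gwMeasure D.p = ∑' k : ℕ, D.p k * (k : ℝ≥0∞) := by
  rw [← lintegral_toMeasure, ← Measure.infinitePi_map_eval (fun _ => D.p.toMeasure) [],
    lintegral_map (by fun_prop) (by fun_prop)]
  rfl

end BiasedGW

/-! ### Super-regeneration times of the biased walk on the integers -/

namespace BiasedWalk

theorem intWalk_congr {β : ℝ} {u u' : ℕ → I} {n : ℕ} (h : ∀ i < n, u i = u' i) :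
    intWalk β u n = intWalk β u' n := by
  induction n with
  | zero => rfl
  | succ n ih => simp only [intWalk, h n (Nat.lt_succ_self n), ih fun i hi => h i (by omega)]

theorem intWalk_splitSeq {β : ℝ} {m n : ℕ} (h : n ≤ m) (u u' : ℕ → I) :
    intWalk β (splitSeq m u u') n = intWalk β u n :=
  intWalk_congr fun _ hi => splitSeq_of_lt (by omega) u u'

theorem intWalk_add (β : ℝ) (u : ℕ → I) (m j : ℕ) :
    intWalk β u (m + j) = intWalk β u m + intWalk β (shiftSeq m u) j := by
  induction j with
  | zero => simp [intWalk]
  | succ j ih => 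
    rw [← Nat.add_assoc]
    simp only [intWalk, ih, shiftSeq]
    split_ifs <;> simp only [*, if_true, if_false] <;> ring

theorem intWalk_sub_one_le (β : ℝ) (u : ℕ → I) (n : ℕ) :
    intWalk β u n - 1 ≤ intWalk β u (n + 1) := by
  simp only [intWalk]; split_ifs <;> omega

theorem neg_le_intWalk (β : ℝ) (u : ℕ → I) (n : ℕ) : -(n : ℤ) ≤ intWalk β u n := by
  induction n with
  | zero => simp [intWalk]
  | succ n ih => have := intWalk_sub_one_le β u n; push_cast; omega

@[fun_prop]
theorem measurable_intWalk (β : ℝ) (n : ℕ) : Measurable fun u => intWalk β u n := by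
  induction n with
  | zero => exact measurable_const
  | succ n ih =>
    exact .ite (measurableSet_setOfPred.2 (by fun_prop)) (ih.sub_const 1) (ih.add_const 1)

section

variable {β : ℝ}

/-- The event that the first `L` steps go up. -/
def upSteps (β : ℝ) (L : ℕ) : Set (ℕ → I) := {u | ∀ i < L, 1 / (β + 1) < (u i : ℝ)}

theorem intWalk_of_up {L : ℕ} {u : ℕ → I} (h : u ∈ upSteps β L) {n : ℕ} (hn : n ≤ L) :
    intWalk β u n = n := by
  induction n with
  | zero => rfl
  | succ n ih =>
    simp only [intWalk, not_le.2 (h n (by omega)), ih (by omega)]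
    push_cast; ring

theorem measurableSet_upSteps (β : ℝ) (L : ℕ) : MeasurableSet (upSteps β L) :=
  measurableSet_setOfPred.2 (by fun_prop)

theorem volume_up (hβ : 1 < β) : (volume : Measure I) {x | 1 / (β + 1) < (x : ℝ)} =
    ENNReal.ofReal (β / (β + 1)) := by
  refine (unitInterval.volume_Ioi ⟨1 / (β + 1), by positivity,
    by rw [div_le_one (by positivity)]; linarith⟩).trans (congr_arg _ ?_)
  field_simp
  ring

theorem volume_down (hβ : 1 < β) : (volume : Measure I) {x | (x : ℝ) ≤ 1 / (β + 1)} =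
    ENNReal.ofReal (1 / (β + 1)) :=
  unitInterval.volume_Iic ⟨1 / (β + 1), by positivity,
    by rw [div_le_one (by positivity)]; linarith⟩

theorem measure_upSteps (hβ : 1 < β) (L : ℕ) :
    uniformSeq (upSteps β L) = ENNReal.ofReal (β / (β + 1)) ^ L := by
  have h1 : upSteps β L = Set.pi (Finset.range L) fun _ => {x : I | 1 / (β + 1) < (x : ℝ)} := by
    ext u; simp [upSteps]
  rw [h1, uniformSeq, Measure.infinitePi_pi _ fun _ _ => measurableSet_setOfPred.2 (by fun_prop)]
  simp only [volume_up hβ, Finset.prod_const, Finset.card_range]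

theorem measure_inter_shift (m : ℕ) {A B : Set (ℕ → I)} (hA : MeasurableSet A)
    (hB : MeasurableSet B) (h : ∀ u u', splitSeq m u u' ∈ A ↔ u ∈ A) :
    uniformSeq (A ∩ shiftSeq m ⁻¹' B) = uniformSeq A * uniformSeq B := by
  have := lintegral_uniformSeq_past_mul_future m (f := A.indicator fun _ => 1)
    (g := B.indicator fun _ => 1) (measurable_const.indicator hA) (measurable_const.indicator hB)
    fun u u' => Set.indicator_const_eq_indicator_const (h u u')
  rw [lintegral_indicator_const hA, lintegral_indicator_const hB, one_mul, one_mul] at this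
  rw [← this, ← lintegral_indicator_one (hA.inter (measurable_shiftSeq m hB))]
  refine lintegral_congr fun u => ?_
  by_cases h1 : u ∈ A <;> by_cases h2 : shiftSeq m u ∈ B <;> simp [h1, h2]

theorem measure_shift (m : ℕ) {B : Set (ℕ → I)} (hB : MeasurableSet B) :
    uniformSeq (shiftSeq m ⁻¹' B) = uniformSeq B := by
  simpa using measure_inter_shift m .univ hB fun _ _ => by simp

/-! #### The drift of the walk -/

/-- The exponential moment `E[β ^ (-X_1 / 2)]`. -/
noncomputable def kap (β : ℝ) : ℝ := 2 * √β / (β + 1)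

theorem kap_nonneg (hβ : 1 < β) : 0 ≤ kap β := by unfold kap; positivity

theorem kap_lt_one (hβ : 1 < β) : kap β < 1 := by
  unfold kap
  rw [div_lt_one (by positivity)]
  have h1 : 1 < √β := by rw [Real.lt_sqrt (by norm_num)]; simpa using hβ
  have h2 : √β * √β = β := Real.mul_self_sqrt (by linarith)
  nlinarith [mul_pos (sub_pos.2 h1) (sub_pos.2 h1)]

theorem lintegral_zpow_intWalk (hβ : 1 < β) (n : ℕ) :
    ∫⁻ u, ENNReal.ofReal ((√β)⁻¹ ^ intWalk β u n) ∂uniformSeq = ENNReal.ofReal (kap β) ^ n := by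
  have hm : ∀ k, Measurable fun u => ENNReal.ofReal ((√β)⁻¹ ^ intWalk β u k) := fun k =>
    (measurable_from_top (f := fun z : ℤ => ENNReal.ofReal ((√β)⁻¹ ^ z))).comp
      (measurable_intWalk β k)
  induction n with
  | zero => simp [intWalk]
  | succ n ih =>
    rw [lintegral_uniformSeq_update n (hm _), pow_succ, ← ih, ← lintegral_mul_const _ (hm n)]
    refine lintegral_congr fun u => ?_
    have h1 : ∀ x : I, intWalk β (Function.update u n x) n = intWalk β u n := fun x =>
      intWalk_congr fun i hi => Function.update_of_ne (by omega) _ _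
    have h2 : ∀ x : I, ENNReal.ofReal ((√β)⁻¹ ^ intWalk β (Function.update u n x) (n + 1)) =
        ENNReal.ofReal ((√β)⁻¹ ^ intWalk β u n) *
          ({x : I | (x : ℝ) ≤ 1 / (β + 1)}.indicator (fun _ => ENNReal.ofReal √β) x +
           {x : I | 1 / (β + 1) < (x : ℝ)}.indicator (fun _ => ENNReal.ofReal (√β)⁻¹) x) := by
      intro x
      by_cases hx : (x : ℝ) ≤ 1 / (β + 1)
      · simp only [intWalk, Function.update_self, h1, hx, hx.not_gt, if_true, Set.indicator_apply,
          Set.mem_ofPred_eq, if_false, add_zero]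
        rw [← ENNReal.ofReal_mul (by positivity), zpow_sub₀ (by positivity)]
        simp
      · simp only [intWalk, Function.update_self, h1, hx, not_le.1 hx, if_true, Set.indicator_apply,
          Set.mem_ofPred_eq, if_false, zero_add]
        rw [← ENNReal.ofReal_mul (by positivity), zpow_add₀ (by positivity), zpow_one]
    have hd : MeasurableSet {x : I | (x : ℝ) ≤ 1 / (β + 1)} :=
      measurableSet_setOfPred.2 (by fun_prop)
    simp_rw [h2]
    rw [lintegral_const_mul' _ _ ENNReal.ofReal_ne_top,
      lintegral_add_left (measurable_const.indicator hd), lintegral_indicator_const hd,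
      lintegral_indicator_const (measurableSet_setOfPred.2 (by fun_prop)), volume_down hβ,
      volume_up hβ, ← ENNReal.ofReal_mul (by positivity), ← ENNReal.ofReal_mul (by positivity),
      ← ENNReal.ofReal_add (by positivity) (by positivity)]
    congr 2
    unfold kap
    field_simp
    rw [Real.sq_sqrt (by linarith)]
    ring

theorem measure_intWalk_le (hβ : 1 < β) (n : ℕ) (l : ℤ) :
    uniformSeq {u | intWalk β u n ≤ l} ≤ ENNReal.ofReal (√β ^ l) * ENNReal.ofReal (kap β) ^ n := by
  have hs : 1 < √β := by rw [Real.lt_sqrt (by norm_num)]; simpa using hβ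
  rw [← lintegral_zpow_intWalk hβ n, ← lintegral_indicator_one
    (measurableSet_setOfPred.2 (by fun_prop)), ← lintegral_const_mul' _ _ ENNReal.ofReal_ne_top]
  refine lintegral_mono (Set.indicator_le fun u (hu : intWalk β u n ≤ l) => ?_)
  rw [← ENNReal.ofReal_mul (by positivity), Pi.one_apply, ← ENNReal.ofReal_one, inv_zpow',
    ← zpow_add₀ (by positivity)]
  exact ENNReal.ofReal_le_ofReal (one_le_zpow₀ hs.le (by omega))

theorem tsum_measure_intWalk_le_ne_top (hβ : 1 < β) (l : ℤ) :
    ∑' n, uniformSeq {u | intWalk β u n ≤ l} ≠ ∞ := by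
  refine ne_top_of_le_ne_top ?_ (ENNReal.tsum_le_tsum fun n => measure_intWalk_le hβ n l)
  rw [ENNReal.tsum_mul_left, ENNReal.tsum_geometric]
  refine ENNReal.mul_ne_top ENNReal.ofReal_ne_top (ENNReal.inv_ne_top.2 ?_)
  rw [← ENNReal.ofReal_one, ← ENNReal.ofReal_sub _ (kap_nonneg hβ)]
  simpa using kap_lt_one hβ

/-- The walk tends to infinity. -/
theorem ae_finite_intWalk_le (hβ : 1 < β) :
    ∀ᵐ u ∂uniformSeq, ∀ l : ℤ, {n | intWalk β u n ≤ l}.Finite :=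
  ae_all_iff.2 fun l => measure_mono_null (fun _ hu => Nat.frequently_atTop_iff_infinite.2 hu)
    (measure_setOfPred_frequently_eq_zero (tsum_measure_intWalk_le_ne_top hβ l))

/-- For large `L`, the walk is unlikely to go down to `-L`. -/
theorem exists_tsum_measure_le (hβ : 1 < β) : ∃ L : ℕ, 0 < L ∧
    ∑' n, uniformSeq {u | intWalk β u (n + L) ≤ -(L : ℤ)} ≤ 1 / 2 / 2 := by
  obtain ⟨L, hL, hpos⟩ := (((ENNReal.tendsto_sum_nat_add
    (fun n => uniformSeq {u | intWalk β u n ≤ 0}) (tsum_measure_intWalk_le_ne_top hβ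
      0)).eventually_le_const (show (0 : ℝ≥0∞) < 1 / 2 / 2 by simp)).and
      (eventually_gt_atTop 0)).exists
  refine ⟨L, hpos, le_trans (ENNReal.tsum_le_tsum fun n => measure_mono fun u hu => ?_) hL⟩
  have : intWalk β u (n + L) ≤ -(L : ℤ) := hu
  show intWalk β u (n + L) ≤ 0
  omega

/-! #### Super-regeneration -/

/-- The event that `0` is a super-regeneration time. -/
def superReg (β : ℝ) : Set (ℕ → I) := {u | IsSuperRegeneration β u 0}

theorem mem_superReg {u : ℕ → I} : u ∈ superReg β ↔ ∀ s, 0 < s → 0 < intWalk β u s := by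
  simp [superReg, IsSuperRegeneration, intWalk]

@[fun_prop]
theorem measurable_isSuperRegeneration (β : ℝ) (t : ℕ) :
    Measurable fun u => IsSuperRegeneration β u t := by
  unfold IsSuperRegeneration; fun_prop

theorem measurableSet_superReg (β : ℝ) : MeasurableSet (superReg β) :=
  measurableSet_setOfPred.2 (by fun_prop)

/-- The event that the first `m` steps make `m` a super-regeneration time, and `0` as well, as far
as can be seen at time `m`. -/
def pastReg (β : ℝ) (m : ℕ) : Set (ℕ → I) :=
  {u | (∀ j, 0 < j → j ≤ m → 0 < intWalk β u j) ∧ ∀ j < m, intWalk β u j < intWalk β u m}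

theorem measurableSet_pastReg (β : ℝ) (m : ℕ) : MeasurableSet (pastReg β m) :=
  measurableSet_setOfPred.2 (by fun_prop)

theorem splitSeq_mem_pastReg (m : ℕ) (u u' : ℕ → I) :
    splitSeq m u u' ∈ pastReg β m ↔ u ∈ pastReg β m := by
  refine and_congr (forall₃_congr fun j _ hj => ?_) (forall₂_congr fun j hj => ?_)
  · rw [intWalk_splitSeq hj]
  · rw [intWalk_splitSeq hj.le, intWalk_splitSeq le_rfl]

theorem measure_compl_aboveNeg_le {L : ℕ}
    (hL : ∑' n, uniformSeq {u | intWalk β u (n + L) ≤ -(L : ℤ)} ≤ 1 / 2 / 2) (n : ℕ) :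
    uniformSeq {u | ∀ j ≤ n, -(L : ℤ) < intWalk β u j}ᶜ ≤ 1 / 2 / 2 := by
  refine le_trans (le_trans (measure_mono fun u hu => ?_) (measure_iUnion_le _)) hL
  obtain ⟨n, -, hn⟩ : ∃ j ≤ n, intWalk β u j ≤ -(L : ℤ) := by simpa using hu
  have := neg_le_intWalk β u n
  refine Set.mem_iUnion.2 ⟨n - L, ?_⟩
  rwa [Set.mem_ofPred_eq, Nat.sub_add_cancel (by omega)]

/-- The event that the last of `n` steps end at most `L - 1` below the previous maximum. -/
def endHigh (β : ℝ) (L n : ℕ) : Set (ℕ → I) :=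
  {u | ∀ j ≤ n, -(L : ℤ) < intWalk β u n - intWalk β u j}

theorem measurableSet_endHigh (β : ℝ) (L n : ℕ) : MeasurableSet (endHigh β L n) :=
  measurableSet_setOfPred.2 (by fun_prop)

theorem measure_compl_endHigh_le {L : ℕ}
    (hL : ∑' n, uniformSeq {u | intWalk β u (n + L) ≤ -(L : ℤ)} ≤ 1 / 2 / 2) (n : ℕ) :
    uniformSeq (endHigh β L n)ᶜ ≤ 1 / 2 / 2 := by
  have hsub : (endHigh β L n)ᶜ ⊆ ⋃ k ∈ Finset.range (n + 1),
      shiftSeq (n - (k + L)) ⁻¹' {u | intWalk β u (k + L) ≤ -(L : ℤ)} := by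
    intro u hu
    obtain ⟨j, hj, hle⟩ : ∃ j ≤ n, intWalk β u n - intWalk β u j ≤ -(L : ℤ) := by
      simpa [endHigh] using hu
    have h1 := intWalk_add β u j (n - j)
    rw [Nat.add_sub_cancel' hj] at h1
    have h2 := neg_le_intWalk β (shiftSeq j u) (n - j)
    refine Set.mem_biUnion (x := n - j - L) (by simp; omega) ?_
    show intWalk β (shiftSeq _ u) _ ≤ _
    rw [show n - j - L + L = n - j by omega, show n - (n - j) = j by omega]
    omega
  exact ((measure_mono hsub).trans (measure_biUnion_finset_le _ _)).trans ((Finset.sum_le_sum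
    fun k _ => (measure_shift _ (measurableSet_setOfPred.2 (by fun_prop))).le).trans
      ((ENNReal.sum_le_tsum _).trans hL))

theorem half_le_measure_inter {A B : Set (ℕ → I)} (h1 : uniformSeq Aᶜ ≤ 1 / 2 / 2)
    (h2 : uniformSeq Bᶜ ≤ 1 / 2 / 2) : 1 / 2 ≤ uniformSeq (A ∩ B) := by
  rw [← ENNReal.add_le_add_iff_right (by simp : (1 / 2 : ℝ≥0∞) ≠ ∞), ENNReal.add_halves,
    ← measure_univ (μ := uniformSeq)]
  refine (measure_univ_le_add_compl (A ∩ B)).trans (add_le_add_right ?_ _)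
  rw [Set.compl_inter, measure_univ, ← ENNReal.add_halves (1 / 2)]
  exact (measure_union_le _ _).trans (add_le_add h1 h2)

/-- A lower bound, uniform in `m`, for the probability that `m` looks like a super-regeneration
time. The first and the last `L` steps are prescribed to go up, which leaves only events of small
probability to be avoided in between. -/
theorem exists_le_measure_pastReg (hβ : 1 < β) :
    ∃ c : ℝ≥0∞, c ≠ 0 ∧ ∀ m, c ≤ uniformSeq (pastReg β m) := by
  obtain ⟨L, hLpos, hL⟩ := exists_tsum_measure_le hβ
  set p := ENNReal.ofReal (β / (β + 1)) with hp
  have hp0 : p ≠ 0 := by simpa [hp] using (by positivity : 0 < β / (β + 1))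
  have hp1 : p ≤ 1 := ENNReal.ofReal_le_one.2 (by rw [div_le_one (by positivity)]; linarith)
  refine ⟨p ^ (2 * L) * (1 / 2), by simp [hp0], fun m => ?_⟩
  rcases lt_or_ge m (2 * L) with hm | hm
  · calc p ^ (2 * L) * (1 / 2) ≤ p ^ (2 * L) * 1 := by gcongr; simp
      _ ≤ p ^ m := by rw [mul_one]; exact pow_le_pow_right_of_le_one' hp1 hm.le
      _ = uniformSeq (upSteps β m) := (measure_upSteps hβ m).symm
      _ ≤ _ := measure_mono fun u hu => ?_
    refine ⟨fun j hj hjm => ?_, fun j hj => ?_⟩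
    · rw [intWalk_of_up hu hjm]; exact_mod_cast hj
    · rw [intWalk_of_up hu hj.le, intWalk_of_up hu le_rfl]; exact_mod_cast hj
  · obtain ⟨n, rfl⟩ : ∃ n, m = L + (n + L) := ⟨m - 2 * L, by omega⟩
    set B : Set (ℕ → I) := {u | ∀ j ≤ n, -(L : ℤ) < intWalk β u j} ∩ endHigh β L n
    have hBm : MeasurableSet B :=
      (measurableSet_setOfPred.2 (by fun_prop)).inter (measurableSet_endHigh β L n)
    calc p ^ (2 * L) * (1 / 2) ≤ p ^ L * (uniformSeq B * p ^ L) := by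
          rw [two_mul, pow_add, mul_assoc, mul_comm (p ^ L) (1 / 2)]
          gcongr
          exact half_le_measure_inter (measure_compl_aboveNeg_le hL n)
            (measure_compl_endHigh_le hL n)
      _ = uniformSeq (upSteps β L ∩ shiftSeq L ⁻¹' (B ∩ shiftSeq n ⁻¹' upSteps β L)) := by
        rw [measure_inter_shift L (measurableSet_upSteps β L)
          (hBm.inter (measurable_shiftSeq n (measurableSet_upSteps β L))),
          measure_inter_shift n hBm (measurableSet_upSteps β L), measure_upSteps hβ]
        · refine fun u u' => and_congr (forall₂_congr fun j hj => ?_) (forall₂_congr fun j hj => ?_)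
          · rw [intWalk_splitSeq hj]
          · rw [intWalk_splitSeq hj, intWalk_splitSeq le_rfl]
        · exact fun u u' => forall₂_congr fun j hj => by rw [splitSeq_of_lt hj]
      _ ≤ _ := measure_mono ?_
    -- The walk goes up to `L`, stays in between `0` and its final height for `n` steps, and goes up
    -- by `L` again.
    rintro u ⟨hu1, ⟨hu2, hu3⟩, hu4⟩
    have hu4' : shiftSeq (L + n) u ∈ upSteps β L := by
      rwa [Set.mem_preimage, shiftSeq_shiftSeq] at hu4
    have key : ∀ j ≤ L + (n + L), (0 < j → 0 < intWalk β u j) ∧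
        (j < L + (n + L) → intWalk β u j < intWalk β (shiftSeq L u) n + L + L) ∧
        (j = L + (n + L) → intWalk β u j = intWalk β (shiftSeq L u) n + L + L) := by
      intro j hj
      have hn := hu2 n le_rfl
      rcases le_or_gt j L with h | h
      · rw [intWalk_of_up hu1 h]; omega
      · obtain ⟨i, rfl⟩ := Nat.exists_eq_add_of_lt h
        rcases le_or_gt (i + 1) n with h' | h'
        · rw [add_assoc, intWalk_add, intWalk_of_up hu1 le_rfl]
          have h1 := hu2 _ h'
          have h2 := hu3 _ h'
          omega
        · obtain ⟨l, rfl⟩ := Nat.exists_eq_add_of_le (Nat.lt_succ_iff.1 h')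
          rw [show L + (n + l) + 1 = L + n + (l + 1) by omega, intWalk_add, intWalk_add,
            intWalk_of_up hu1 le_rfl, intWalk_of_up hu4' (by omega)]
          omega
    exact ⟨fun j hj hjm => (key j hjm).1 hj, fun j hj => by
      rw [(key _ le_rfl).2.2 rfl]; exact (key j hj.le).2.1 hj⟩

theorem measure_superReg_ne_zero (hβ : 1 < β) : uniformSeq (superReg β) ≠ 0 := by
  obtain ⟨c, hc0, hc⟩ := exists_le_measure_pastReg hβ
  have h : superReg β = ⋂ m, {u | ∀ j, 0 < j → j ≤ m → 0 < intWalk β u j} := by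
    ext u
    simp only [mem_superReg, Set.mem_iInter]
    exact ⟨fun h _ j hj _ => h j hj, fun h j hj => h j j hj le_rfl⟩
  rw [h]
  exact ne_bot_of_le_ne_bot hc0 (ge_of_tendsto' (tendsto_measure_iInter_atTop
    (fun m => (measurableSet_setOfPred.2 (by fun_prop)).nullMeasurableSet)
    (fun m n h u hu j h1 h2 => hu j h1 (h2.trans h)) ⟨0, measure_ne_top _ _⟩)
    fun m => (hc m).trans (measure_mono fun u hu => hu.1))

/-- The event that `0` is a super-regeneration time, and that there are no others until time `j`:
on the event that `0` is a super-regeneration time, the time `j` belongs to the first block. -/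
def inBlock (β : ℝ) (j : ℕ) : Set (ℕ → I) :=
  superReg β ∩ {u | ∀ t, 0 < t → t ≤ j → ¬ IsSuperRegeneration β u t}

theorem measurableSet_inBlock (β : ℝ) (j : ℕ) : MeasurableSet (inBlock β j) :=
  (measurableSet_superReg β).inter (measurableSet_setOfPred.2 (by fun_prop))

@[fun_prop]
theorem measurable_mem_inBlock (β : ℝ) (j : ℕ) : Measurable fun u => u ∈ inBlock β j :=
  measurableSet_setOfPred.1 (measurableSet_inBlock β j)

theorem inBlock_zero : inBlock β 0 = superReg β :=
  Set.inter_eq_left.2 fun _ _ _ _ _ => by omega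

theorem inBlock_subset (j : ℕ) : inBlock β j ⊆ superReg β := Set.inter_subset_left

theorem isSuperRegeneration_of_past {u : ℕ → I} {m : ℕ} (h1 : u ∈ pastReg β m)
    (h2 : shiftSeq m u ∈ superReg β) : IsSuperRegeneration β u m := by
  refine ⟨h1.2, fun s hs => ?_⟩
  obtain ⟨i, rfl⟩ : ∃ i, s = m + i := ⟨s - m, by omega⟩
  have := mem_superReg.1 h2 i (by omega)
  rw [intWalk_add]; omega

theorem superReg_of_past {u : ℕ → I} {m : ℕ} (h1 : u ∈ pastReg β m)
    (h2 : shiftSeq m u ∈ superReg β) : u ∈ superReg β := by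
  rw [mem_superReg]
  intro s hs
  rcases le_or_gt s m with h | h
  · exact h1.1 s hs h
  · have h3 := (isSuperRegeneration_of_past h1 h2).2 s h
    rcases Nat.eq_zero_or_pos m with rfl | hm
    · simpa [intWalk] using h3
    · exact (h1.1 m hm le_rfl).trans h3

theorem IsSuperRegeneration.shift {u : ℕ → I} {m j : ℕ} (h : IsSuperRegeneration β u (m + j)) :
    IsSuperRegeneration β (shiftSeq m u) j := by
  refine ⟨fun s hs => ?_, fun s hs => ?_⟩
  · have := h.1 (m + s) (by omega)
    rw [intWalk_add, intWalk_add] at this; omega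
  · have := h.2 (m + s) (by omega)
    rw [intWalk_add, intWalk_add] at this; omega

/-- The expected length of a block is finite. This is the renewal equation obtained by splitting
at the last super-regeneration time before `t`. -/
theorem tsum_measure_inBlock_ne_top (hβ : 1 < β) : ∑' j, uniformSeq (inBlock β j) ≠ ∞ := by
  obtain ⟨c, hc0, hc⟩ := exists_le_measure_pastReg hβ
  refine ne_top_of_le_ne_top (ENNReal.inv_ne_top.2 hc0) ?_
  rw [ENNReal.tsum_eq_iSup_nat' (tendsto_add_atTop_nat 1)]
  refine iSup_le fun t => ?_
  rw [← one_div, ENNReal.le_div_iff_mul_le (Or.inl hc0) (Or.inr (by norm_num)), mul_comm]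
  let B : ℕ → Set (ℕ → I) := fun s => pastReg β s ∩ shiftSeq s ⁻¹' inBlock β (t - s)
  have hlt : ∀ s s', s < s' → s' ≤ t → Disjoint (B s) (B s') := by
    intro s s' hs hs'
    rw [Set.disjoint_left]
    rintro u ⟨_, h2⟩ ⟨h3, h4⟩
    obtain ⟨i, rfl⟩ := Nat.exists_eq_add_of_lt hs
    exact h2.2 (i + 1) (by omega) (by omega)
      (IsSuperRegeneration.shift (isSuperRegeneration_of_past h3 (inBlock_subset _ h4)))
  calc c * ∑ j ∈ Finset.range (t + 1), uniformSeq (inBlock β j)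
      = ∑ s ∈ Finset.range (t + 1), c * uniformSeq (inBlock β (t - s)) := by
        rw [Finset.mul_sum, ← Finset.sum_range_reflect]
        rfl
    _ ≤ ∑ s ∈ Finset.range (t + 1), uniformSeq (B s) := by
        refine Finset.sum_le_sum fun s _ => ?_
        rw [measure_inter_shift s (measurableSet_pastReg β s) (measurableSet_inBlock β _)
          (splitSeq_mem_pastReg s)]
        gcongr
        exact hc s
    _ = uniformSeq (⋃ s ∈ Finset.range (t + 1), B s) := by
        refine (measure_biUnion_finset (fun s hs s' hs' hne => ?_) fun s _ =>
          (measurableSet_pastReg β s).inter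
            (measurable_shiftSeq s (measurableSet_inBlock β _))).symm
        simp only [Finset.coe_range, Set.mem_Iio] at hs hs'
        rcases lt_or_gt_of_ne hne with h | h
        · exact hlt s s' h (by omega)
        · exact (hlt s' s h (by omega)).symm
    _ ≤ 1 := prob_le_one

/-- The event that `m > 0` is the first super-regeneration time after `0`, as far as can be seen at
time `m`. -/
def pastFirst (β : ℝ) (m : ℕ) : Set (ℕ → I) :=
  {u | 0 < m ∧ u ∈ pastReg β m ∧ ∀ t, 0 < t → t < m →
    ¬ ((∀ s < t, intWalk β u s < intWalk β u t) ∧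
      ∀ s, t < s → s ≤ m → intWalk β u t < intWalk β u s)}

theorem measurableSet_pastFirst (β : ℝ) (m : ℕ) : MeasurableSet (pastFirst β m) := by
  unfold pastFirst pastReg
  exact measurableSet_setOfPred.2 (by simp only [Set.mem_ofPred_eq]; fun_prop)

theorem splitSeq_mem_pastFirst (m : ℕ) (u u' : ℕ → I) :
    splitSeq m u u' ∈ pastFirst β m ↔ u ∈ pastFirst β m := by
  refine and_congr_right fun _ => and_congr (splitSeq_mem_pastReg m u u')
    (forall₃_congr fun t _ ht => not_congr (and_congr (forall₂_congr fun s hs => ?_)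
      (forall₃_congr fun s _ hs => ?_)))
  · rw [intWalk_splitSeq (by omega), intWalk_splitSeq (by omega)]
  · rw [intWalk_splitSeq (by omega), intWalk_splitSeq (by omega)]

/-- The event that `m` is the end of the first block. -/
def blockEnd (β : ℝ) (m : ℕ) : Set (ℕ → I) := pastFirst β m ∩ shiftSeq m ⁻¹' superReg β

theorem measurableSet_blockEnd (β : ℝ) (m : ℕ) : MeasurableSet (blockEnd β m) :=
  (measurableSet_pastFirst β m).inter (measurable_shiftSeq m (measurableSet_superReg β))

theorem blockEnd_subset (m : ℕ) : blockEnd β m ⊆ superReg β :=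
  fun _ hu => superReg_of_past hu.1.2.1 hu.2

theorem isSuperRegeneration_of_blockEnd {u : ℕ → I} {m : ℕ} (hu : u ∈ blockEnd β m) :
    IsSuperRegeneration β u m := isSuperRegeneration_of_past hu.1.2.1 hu.2

theorem not_isSuperRegeneration_of_blockEnd {u : ℕ → I} {m t : ℕ} (hu : u ∈ blockEnd β m)
    (ht : 0 < t) (htm : t < m) : ¬ IsSuperRegeneration β u t := fun h =>
  hu.1.2.2 t ht htm ⟨h.1, fun s hs _ => h.2 s hs⟩

theorem mem_inBlock_iff_of_blockEnd {u : ℕ → I} {m j : ℕ} (hu : u ∈ blockEnd β m) :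
    u ∈ inBlock β j ↔ j < m := by
  constructor
  · intro h
    by_contra! hle
    exact h.2 m hu.1.1 hle (isSuperRegeneration_of_blockEnd hu)
  · intro h
    exact ⟨blockEnd_subset m hu, fun t h1 h2 =>
      not_isSuperRegeneration_of_blockEnd hu h1 (by omega)⟩

theorem mem_blockEnd_of {u : ℕ → I} {m : ℕ} (hu : u ∈ superReg β) (hm : 0 < m)
    (h1 : IsSuperRegeneration β u m) (h2 : ∀ t, 0 < t → t < m → ¬ IsSuperRegeneration β u t) :
    u ∈ blockEnd β m := by
  refine ⟨⟨hm, ⟨fun j hj _ => mem_superReg.1 hu j hj, h1.1⟩, fun t ht htm h => ?_⟩, ?_⟩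
  · refine h2 t ht htm ⟨h.1, fun s hs => ?_⟩
    rcases le_or_gt s m with hsm | hsm
    · exact h.2 s hs hsm
    · exact (h.2 m htm le_rfl).trans (h1.2 s hsm)
  · refine mem_superReg.2 fun s hs => ?_
    have := h1.2 (m + s) (by omega)
    rw [intWalk_add] at this; omega

theorem ae_exists_blockEnd (hβ : 1 < β) :
    ∀ᵐ u ∂uniformSeq, u ∈ superReg β → ∃ m, u ∈ blockEnd β m := by
  refine measure_mono_null (fun u (hu : ¬ (u ∈ superReg β → ∃ m, u ∈ blockEnd β m)) => ?_)
    (measure_setOfPred_frequently_eq_zero (tsum_measure_inBlock_ne_top hβ))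
  push Not at hu
  refine Frequently.of_forall fun j => ⟨hu.1, fun t ht htj hsr => ?_⟩
  classical
  have hex : ∃ m, 0 < m ∧ IsSuperRegeneration β u m := ⟨t, ht, hsr⟩
  have hs := Nat.find_spec hex
  exact hu.2 _ (mem_blockEnd_of hu.1 hs.1 hs.2 fun s h1 h2 h3 => Nat.find_min hex h2 ⟨h1, h3⟩)

theorem disjoint_blockEnd {m n : ℕ} (h : m ≠ n) : Disjoint (blockEnd β m) (blockEnd β n) := by
  rw [Set.disjoint_left]
  intro u h1 h2
  have h3 := fun j => (mem_inBlock_iff_of_blockEnd (j := j) h1).symm.trans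
    (mem_inBlock_iff_of_blockEnd h2)
  rcases lt_or_gt_of_ne h with h | h
  · exact absurd ((h3 m).2 h) (lt_irrefl _)
  · exact absurd ((h3 n).1 h) (lt_irrefl _)

end

end BiasedWalk

/-! ### The walk on the backbone -/

namespace BiasedWalk

open PlaneTree

/-- Weight of the edge to the parent, when the root is given the weight `a`. The value `a = 0` is
the case of a tree, and `a = 1` that of a subtree whose root has a parent outside of it. -/
def rootedWeight (a : ℝ) : List ℕ → ℝ
  | [] => a
  | _ :: _ => 1

/-- The step of the walk on the backbone when the root has the weight `a`. -/
noncomputable def bstep (a β : ℝ) (ξ : Field) (w : List ℕ) (x : I) : List ℕ :=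
  match (backboneChildren ξ w)[⌊(1 - (x : ℝ)) *
      (rootedWeight a w + β * (backboneChildren ξ w).length) / β⌋₊]? with
  | some i => i :: w
  | none => w.tail

/-- The walk on the backbone when the root has the weight `a`. -/
noncomputable def bw (a β : ℝ) (ξ : Field) (u : ℕ → I) : ℕ → List ℕ
  | 0 => []
  | n + 1 => bstep a β ξ (bw a β ξ u n) (u n)

theorem rootedWeight_zero (w : List ℕ) : rootedWeight 0 w = parentWeight w := by
  cases w <;> rfl

theorem bw_zero_eq (β : ℝ) (ξ : Field) (u : ℕ → I) (n : ℕ) :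
    bw 0 β ξ u n = backboneWalk β ξ u n := by
  induction n with
  | zero => rfl
  | succ n ih =>
    simp only [bw, backboneWalk, bstep, backboneStep, ih, rootedWeight_zero]

section

variable {a β : ℝ}

theorem rootedWeight_nonneg (ha : 0 ≤ a) (w : List ℕ) : 0 ≤ rootedWeight a w := by
  cases w <;> simp [rootedWeight, ha]

theorem rootedWeight_le_one (ha : a ≤ 1) (w : List ℕ) : rootedWeight a w ≤ 1 := by
  cases w <;> simp [rootedWeight, ha]

theorem rootedWeight_append {w : List ℕ} (hw : w ≠ []) (x : List ℕ) :
    rootedWeight a (x ++ w) = rootedWeight 1 x := by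
  obtain ⟨y, w, rfl⟩ := List.exists_cons_of_ne_nil hw
  cases x <;> rfl

theorem bw_congr {ξ : Field} {u u' : ℕ → I} {n : ℕ} (h : ∀ i < n, u i = u' i) :
    bw a β ξ u n = bw a β ξ u' n := by
  induction n with
  | zero => rfl
  | succ n ih => simp only [bw, h n (Nat.lt_succ_self n), ih fun i hi => h i (by omega)]

theorem bw_splitSeq {ξ : Field} {m n : ℕ} (h : n ≤ m) (u u' : ℕ → I) :
    bw a β ξ (splitSeq m u u') n = bw a β ξ u n :=
  bw_congr fun _ hi => splitSeq_of_lt (by omega) u u'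

theorem bstep_cases (a β : ℝ) (ξ : Field) (w : List ℕ) (x : I) :
    (∃ i ∈ backboneChildren ξ w, bstep a β ξ w x = i :: w) ∨ bstep a β ξ w x = w.tail := by
  unfold bstep
  split
  · next i hi => exact Or.inl ⟨i, List.mem_of_getElem? hi, rfl⟩
  · exact Or.inr rfl

theorem onBackbone_bw {ξ : Field} (h : height ξ = ⊤) (u : ℕ → I) (n : ℕ) :
    OnBackbone ξ (bw a β ξ u n) := by
  induction n with
  | zero => exact onBackbone_nil.2 h
  | succ n ih =>
    simp only [bw]
    rcases bstep_cases a β ξ (bw a β ξ u n) (u n) with ⟨i, hi, he⟩ | he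
    · rw [he]; exact (mem_backboneChildren.1 hi).2
    · rw [he]; exact ih.of_suffix (List.tail_suffix _)

theorem length_bstep (a β : ℝ) (ξ : Field) (w : List ℕ) (x : I) :
    (w.length : ℤ) - 1 ≤ (bstep a β ξ w x).length := by
  rcases bstep_cases a β ξ w x with ⟨i, _, he⟩ | he
  · rw [he, List.length_cons]; push_cast; omega
  · rw [he, List.length_tail]; omega

theorem exists_bstep_eq_cons (hβ : 1 < β) (ha0 : 0 ≤ a) (ha1 : a ≤ 1) {ξ : Field} {w : List ℕ}
    (hw : OnBackbone ξ w) {x : I} (hx : 1 / (β + 1) < (x : ℝ)) :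
    ∃ i, (backboneChildren ξ w)[⌊(1 - (x : ℝ)) *
      (rootedWeight a w + β * (backboneChildren ξ w).length) / β⌋₊]? = some i ∧
        bstep a β ξ w x = i :: w := by
  have hz' : (1 : ℝ) ≤ (backboneChildren ξ w).length := by exact_mod_cast
    hw.length_backboneChildren_pos
  have hr := rootedWeight_le_one ha1 w
  have hr0 := rootedWeight_nonneg ha0 w
  have hx1 := x.2.2
  have hlt : ⌊(1 - (x : ℝ)) * (rootedWeight a w + β * (backboneChildren ξ w).length) / β⌋₊ <
      (backboneChildren ξ w).length := by
    rw [Nat.floor_lt (by have : 0 ≤ 1 - (x : ℝ) := by linarith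
                         positivity), div_lt_iff₀ (by linarith)]
    have h1 : rootedWeight a w + β * (backboneChildren ξ w).length ≤
        (β + 1) * (backboneChildren ξ w).length := by linarith
    have h2 : (1 - (x : ℝ)) * (β + 1) < β := by
      rw [div_lt_iff₀ (by linarith)] at hx
      linarith
    calc (1 - (x : ℝ)) * (rootedWeight a w + β * (backboneChildren ξ w).length)
        ≤ (1 - (x : ℝ)) * ((β + 1) * (backboneChildren ξ w).length) := by
          exact mul_le_mul_of_nonneg_left h1 (by linarith)
      _ = (1 - (x : ℝ)) * (β + 1) * (backboneChildren ξ w).length := by ring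
      _ < β * (backboneChildren ξ w).length := mul_lt_mul_of_pos_right h2 (by linarith)
      _ = _ := mul_comm _ _
  refine ⟨(backboneChildren ξ w)[_]'hlt, List.getElem?_eq_getElem hlt, ?_⟩
  unfold bstep
  rw [List.getElem?_eq_getElem hlt]

theorem intWalk_sub_le_length (hβ : 1 < β) (ha0 : 0 ≤ a) (ha1 : a ≤ 1) {ξ : Field}
    (h : height ξ = ⊤) (u : ℕ → I) (m j : ℕ) :
    intWalk β u (m + j) - intWalk β u m ≤
      ((bw a β ξ u (m + j)).length : ℤ) - (bw a β ξ u m).length := by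
  induction j with
  | zero => simp
  | succ j ih =>
    rw [← Nat.add_assoc]
    simp only [bw, intWalk]
    split_ifs with hx
    · have := length_bstep a β ξ (bw a β ξ u (m + j)) (u (m + j))
      omega
    · obtain ⟨i, _, he⟩ := exists_bstep_eq_cons hβ ha0 ha1 (onBackbone_bw h u (m + j)) (not_le.1 hx)
      rw [he, List.length_cons]; push_cast; omega

theorem intWalk_le_length (hβ : 1 < β) (ha0 : 0 ≤ a) (ha1 : a ≤ 1) {ξ : Field}
    (h : height ξ = ⊤) (u : ℕ → I) (j : ℕ) :
    intWalk β u j ≤ (bw a β ξ u j).length := by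
  have := intWalk_sub_le_length hβ ha0 ha1 h u 0 j
  simpa [intWalk, bw] using this

theorem length_lt_of_isSuperRegeneration (hβ : 1 < β) (ha0 : 0 ≤ a) (ha1 : a ≤ 1) {ξ : Field}
    (h : height ξ = ⊤) {u : ℕ → I} {m s : ℕ} (hm : IsSuperRegeneration β u m) (hs : s < m) :
    (bw a β ξ u s).length < (bw a β ξ u m).length := by
  have h1 := intWalk_sub_le_length hβ ha0 ha1 h u s (m - s)
  rw [Nat.add_sub_cancel' hs.le] at h1
  have := hm.1 s hs
  omega

theorem lt_of_mem_superReg {u : ℕ → I} (hu : u ∈ superReg β) : 1 / (β + 1) < (u 0 : ℝ) := by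
  have h := mem_superReg.1 hu 1 one_pos
  by_contra hn
  simp [intWalk] at h
  rw [if_pos (by simpa using hn)] at h
  omega

theorem bstep_append {ξ : Field} {w x : List ℕ} (hw : Mem ξ w) (hne : w ≠ []) (t : I)
    (hx : x ≠ [] ∨ ∃ i, bstep 1 β (sub ξ w) x t = i :: x) :
    bstep a β ξ (x ++ w) t = bstep 1 β (sub ξ w) x t ++ w := by
  unfold bstep at hx ⊢
  rw [backboneChildren_append hw, rootedWeight_append hne]
  split
  · rfl
  · next hn =>
    rcases hx with hx | ⟨i, hi⟩
    · obtain ⟨y, x', rfl⟩ := List.exists_cons_of_ne_nil hx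
      rfl
    · simp only [hn] at hi
      have := congrArg List.length hi
      simp at this

/-- After a super-regeneration time the walk lives in the subtree which it has just entered. -/
theorem bw_add (hβ : 1 < β) {ξ : Field} (h : height ξ = ⊤) {u : ℕ → I} {m : ℕ}
    (hu : shiftSeq m u ∈ superReg β) (hne : bw a β ξ u m ≠ []) (j : ℕ) :
    bw a β ξ u (m + j) =
      bw 1 β (sub ξ (bw a β ξ u m)) (shiftSeq m u) j ++ bw a β ξ u m := by
  set w := bw a β ξ u m with hw
  have hbw : OnBackbone ξ w := onBackbone_bw h u m
  have hh := hbw.2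
  induction j with
  | zero => simp [bw, hw]
  | succ j ih =>
    rw [← Nat.add_assoc]
    simp only [bw]
    rw [ih, bstep_append hbw.1 hne]
    · rfl
    · rcases Nat.eq_zero_or_pos j with rfl | hj
      · right
        obtain ⟨i, _, hi⟩ := exists_bstep_eq_cons hβ zero_le_one le_rfl
          (onBackbone_bw (a := 1) hh (shiftSeq m u) 0) (lt_of_mem_superReg hu)
        exact ⟨i, hi⟩
      · left
        intro h0
        have h1 := intWalk_le_length hβ zero_le_one le_rfl hh (shiftSeq m u) j
        rw [h0] at h1
        have := mem_superReg.1 hu j hj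
        simp at h1
        omega

theorem bstep_graft {ξ : Field} {w : List ℕ} {η : Field} {v : List ℕ} (hw : Mem ξ w)
    (hη : height η = ⊤ ↔ height (sub ξ w) = ⊤) (hv : ¬ w <:+ v) (x : I) :
    bstep a β (graft ξ w η) v x = bstep a β ξ v x := by
  unfold bstep
  rw [backboneChildren_graft hw hη hv]

theorem bw_graft {ξ : Field} {w : List ℕ} {η : Field} {u : ℕ → I} (hw : Mem ξ w)
    (hη : height η = ⊤ ↔ height (sub ξ w) = ⊤) {n : ℕ} (h : ∀ j < n, ¬ w <:+ bw a β ξ u j) :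
    bw a β (graft ξ w η) u n = bw a β ξ u n := by
  induction n with
  | zero => rfl
  | succ n ih =>
    simp only [bw]
    rw [ih fun j hj => h j (by omega), bstep_graft hw hη (h n (Nat.lt_succ_self n))]

/-! #### Measurability -/

@[fun_prop]
theorem measurable_bstep (a β : ℝ) :
    Measurable fun p : List ℕ × Field × I => bstep a β p.2.1 p.1 p.2.2 :=
  measurable_from_prod_countable_right fun w =>
    .discrete_apply (g := fun p : Field × I => backboneChildren p.1 w) (f := fun l p =>
      match l[⌊(1 - (p.2 : ℝ)) * (rootedWeight a w + β * l.length) / β⌋₊]? with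
        | some i => i :: w
        | none => w.tail) (fun l => (measurable_from_top (f := fun n : ℕ => match l[n]? with
        | some i => i :: w
        | none => w.tail)).comp (by fun_prop)) (by fun_prop)

@[fun_prop]
theorem measurable_bw (a β : ℝ) (n : ℕ) :
    Measurable fun p : Field × (ℕ → I) => bw a β p.1 p.2 n := by
  induction n with
  | zero => exact measurable_const
  | succ n ih =>
    exact (measurable_bstep a β).comp (f := fun p : Field × (ℕ → I) =>
      (bw a β p.1 p.2 n, p.1, p.2 n)) (by fun_prop)

/-! #### The first big trap -/

/-- A trap of height at least `h` is rooted at `v`. -/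
def BigAt (ξ : Field) (h : ℕ) (v : List ℕ) : Prop := ∃ i, IsBigTrap ξ h v i

/-- The first time at which the walk on the backbone is at the root of a big trap. -/
noncomputable def firstTime (a β : ℝ) (h : ℕ) (ξ : Field) (u : ℕ → I) : ℕ :=
  sInf {n | BigAt ξ h (bw a β ξ u n)}

/-- The root of the first big trap that is met. -/
noncomputable def firstRoot (a β : ℝ) (h : ℕ) (ξ : Field) (u : ℕ → I) : List ℕ :=
  bw a β ξ u (firstTime a β h ξ u)

/-- A big trap is met. -/
def Found (a β : ℝ) (h : ℕ) (ξ : Field) (u : ℕ → I) : Prop := ∃ n, BigAt ξ h (bw a β ξ u n)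

/-- A big trap is met before the first super-regeneration time. -/
def BlockFound (a β : ℝ) (h : ℕ) (ξ : Field) (u : ℕ → I) : Prop :=
  ∃ n, u ∈ inBlock β n ∧ BigAt ξ h (bw a β ξ u n)

/-- The number of visits of the walk on the backbone to `w`. -/
noncomputable def visits (a β : ℝ) (ξ : Field) (u : ℕ → I) (w : List ℕ) : ℕ :=
  {n | bw a β ξ u n = w}.ncard

/-- A function `Γ` of the weight of the parent edge of `w`, of the number of children of `w` on the
backbone, and of the number of visits to `w`. -/
noncomputable def localVal (Γ : ℝ → ℕ → ℕ → ℝ≥0∞) (a β : ℝ) (ξ : Field) (u : ℕ → I)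
    (w : List ℕ) : ℝ≥0∞ :=
  Γ (rootedWeight a w) (backboneChildren ξ w).length (visits a β ξ u w)

@[fun_prop]
theorem measurable_bigAt (h : ℕ) (v : List ℕ) : Measurable fun ξ => BigAt ξ h v := by
  unfold BigAt; fun_prop

@[fun_prop]
theorem measurable_bigAt_bw (a β : ℝ) (h n : ℕ) :
    Measurable fun p : Field × (ℕ → I) => BigAt p.1 h (bw a β p.1 p.2 n) :=
  .discrete_apply (f := fun w (p : Field × (ℕ → I)) => BigAt p.1 h w) (fun w => by fun_prop)
    (measurable_bw a β n)

theorem measurableSet_found (a β : ℝ) (h : ℕ) :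
    MeasurableSet {p : Field × (ℕ → I) | Found a β h p.1 p.2} :=
  measurableSet_setOfPred.2 (by unfold Found; fun_prop)

theorem measurableSet_blockFound (a β : ℝ) (h : ℕ) :
    MeasurableSet {p : Field × (ℕ → I) | BlockFound a β h p.1 p.2} :=
  measurableSet_setOfPred.2 (by unfold BlockFound; fun_prop)

theorem measurable_sInf_nat {Ω : Type*} [MeasurableSpace Ω] {P : Ω → ℕ → Prop}
    (hP : ∀ n, Measurable fun ω => P ω n) : Measurable fun ω => sInf {n | P ω n} := by
  have h : ∀ ω k, sInf {n | P ω n} ≤ k ↔ ((∃ n, P ω n) → ∃ n ≤ k, P ω n) := fun ω k =>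
    ⟨fun hk hne => ⟨_, hk, Nat.sInf_mem hne⟩, fun h =>
      (Set.eq_empty_or_nonempty {n | P ω n}).elim (fun he => by simp [he]) fun hne =>
        let ⟨_, hn, hp⟩ := h hne
        (Nat.sInf_le hp).trans hn⟩
  exact measurable_of_Iic fun k =>
    measurableSet_setOfPred.2 (by simp only [Set.mem_Iic, h]; fun_prop)

theorem measurable_ncard_nat {Ω : Type*} [MeasurableSpace Ω] {P : Ω → ℕ → Prop}
    (hP : ∀ n, Measurable fun ω => P ω n) : Measurable fun ω => {n | P ω n}.ncard :=
  measurable_ncard.comp (measurable_set_iff.2 hP)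

@[fun_prop]
theorem measurable_firstTime (a β : ℝ) (h : ℕ) :
    Measurable fun p : Field × (ℕ → I) => firstTime a β h p.1 p.2 :=
  measurable_sInf_nat (measurable_bigAt_bw a β h)

@[fun_prop]
theorem measurable_firstRoot (a β : ℝ) (h : ℕ) :
    Measurable fun p : Field × (ℕ → I) => firstRoot a β h p.1 p.2 :=
  .discrete_apply (measurable_bw a β) (measurable_firstTime a β h)

@[fun_prop]
theorem measurable_visits (a β : ℝ) (w : List ℕ) :
    Measurable fun p : Field × (ℕ → I) => visits a β p.1 p.2 w :=
  measurable_ncard_nat fun n => by fun_prop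

theorem measurable_localVal (Γ : ℝ → ℕ → ℕ → ℝ≥0∞) (a β : ℝ) (w : List ℕ) :
    Measurable fun p : Field × (ℕ → I) => localVal Γ a β p.1 p.2 w :=
  (measurable_of_countable fun x : List ℕ × ℕ => Γ (rootedWeight a w) x.1.length x.2).comp
    (f := fun p : Field × (ℕ → I) => (backboneChildren p.1 w, visits a β p.1 p.2 w)) (by fun_prop)

theorem measurable_localVal_firstRoot (Γ : ℝ → ℕ → ℕ → ℝ≥0∞) (a β : ℝ) (h : ℕ) :
    Measurable fun p : Field × (ℕ → I) => localVal Γ a β p.1 p.2 (firstRoot a β h p.1 p.2) :=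
  .discrete_apply (measurable_localVal Γ a β) (measurable_firstRoot a β h)

/-! #### Restarting at a super-regeneration time -/

section Restart

variable (hβ : 1 < β) (ha0 : 0 ≤ a) (ha1 : a ≤ 1) {ξ : Field} (hξ : height ξ = ⊤) {u : ℕ → I}
  {m : ℕ} (hu : u ∈ blockEnd β m)

include hβ ha0 ha1 hξ hu

theorem bw_blockEnd_ne_nil : bw a β ξ u m ≠ [] := by
  intro h0
  have := length_lt_of_isSuperRegeneration hβ ha0 ha1 hξ (isSuperRegeneration_of_blockEnd hu)
    hu.1.1
  rw [h0] at this
  simp at this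

theorem bw_add_of_blockEnd (j : ℕ) : bw a β ξ u (m + j) =
    bw 1 β (sub ξ (bw a β ξ u m)) (shiftSeq m u) j ++ bw a β ξ u m :=
  bw_add hβ hξ hu.2 (bw_blockEnd_ne_nil hβ ha0 ha1 hξ hu) j

theorem bigAt_restart (h j : ℕ) : BigAt ξ h (bw a β ξ u (m + j)) ↔
    BigAt (sub ξ (bw a β ξ u m)) h
      (bw 1 β (sub ξ (bw a β ξ u m)) (shiftSeq m u) j) := by
  rw [bw_add_of_blockEnd hβ ha0 ha1 hξ hu]
  exact exists_congr fun i => isBigTrap_append (onBackbone_bw hξ u m).1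

variable {h : ℕ} (hn : ¬ BlockFound a β h ξ u)

omit hβ ha0 ha1 hξ in
include hn in
theorem not_bigAt_of_lt {j : ℕ} (hj : j < m) : ¬ BigAt ξ h (bw a β ξ u j) := fun hb =>
  hn ⟨j, (mem_inBlock_iff_of_blockEnd hu).2 hj, hb⟩

include hn

theorem found_restart : Found a β h ξ u ↔
    Found 1 β h (sub ξ (bw a β ξ u m)) (shiftSeq m u) := by
  constructor
  · rintro ⟨n, hb⟩
    have hmn : m ≤ n := by
      by_contra! hlt
      exact not_bigAt_of_lt hu hn hlt hb
    obtain ⟨j, rfl⟩ := Nat.exists_eq_add_of_le hmn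
    exact ⟨j, (bigAt_restart hβ ha0 ha1 hξ hu h j).1 hb⟩
  · rintro ⟨j, hb⟩
    exact ⟨m + j, (bigAt_restart hβ ha0 ha1 hξ hu h j).2 hb⟩

theorem firstRoot_restart (hf : Found a β h ξ u) : firstRoot a β h ξ u =
    firstRoot 1 β h (sub ξ (bw a β ξ u m)) (shiftSeq m u) ++ bw a β ξ u m := by
  have h1 : BigAt ξ h (bw a β ξ u (firstTime a β h ξ u)) :=
    Nat.sInf_mem hf
  have h2 := Nat.sInf_mem ((found_restart hβ ha0 ha1 hξ hu hn).1 hf)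
  have h3 : firstTime a β h ξ u =
      m + firstTime 1 β h (sub ξ (bw a β ξ u m)) (shiftSeq m u) := by
    refine le_antisymm ?_ ?_
    · exact Nat.sInf_le
        ((bigAt_restart hβ ha0 ha1 hξ hu h _).2 h2)
    · have hmn : m ≤ firstTime a β h ξ u := by
        by_contra! hlt
        exact not_bigAt_of_lt hu hn hlt h1
      obtain ⟨j, hj⟩ := Nat.exists_eq_add_of_le hmn
      rw [hj] at h1 ⊢
      have := Nat.sInf_le (s := {n | BigAt (sub ξ (bw a β ξ u m)) h
        (bw 1 β (sub ξ (bw a β ξ u m)) (shiftSeq m u) n)})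
        ((bigAt_restart hβ ha0 ha1 hξ hu h j).1 h1)
      exact Nat.add_le_add_left this m
  rw [firstRoot, h3, bw_add_of_blockEnd hβ ha0 ha1 hξ hu]
  rfl

omit hn in
theorem visits_restart (v : List ℕ) : visits a β ξ u (v ++ bw a β ξ u m) =
    visits 1 β (sub ξ (bw a β ξ u m)) (shiftSeq m u) v := by
  have : {n | bw a β ξ u n = v ++ bw a β ξ u m} =
      (fun j => m + j) '' {j | bw 1 β (sub ξ (bw a β ξ u m)) (shiftSeq m u) j = v} := by
    ext n
    simp only [Set.mem_ofPred_eq]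
    constructor
    · intro hv
      have hmn : m ≤ n := by
        by_contra! hlt
        have := length_lt_of_isSuperRegeneration hβ ha0 ha1 hξ
          (isSuperRegeneration_of_blockEnd hu) hlt
        rw [hv, List.length_append] at this
        omega
      obtain ⟨j, rfl⟩ := Nat.exists_eq_add_of_le hmn
      rw [bw_add_of_blockEnd hβ ha0 ha1 hξ hu] at hv
      exact ⟨j, List.append_cancel_right hv, rfl⟩
    · rintro ⟨j, hj, rfl⟩
      rw [bw_add_of_blockEnd hβ ha0 ha1 hξ hu, hj]
  rw [visits, this, Set.ncard_image_of_injective _ (add_right_injective m)]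
  rfl

theorem localVal_restart (Γ : ℝ → ℕ → ℕ → ℝ≥0∞) (hf : Found a β h ξ u) :
    localVal Γ a β ξ u (firstRoot a β h ξ u) =
      localVal Γ 1 β (sub ξ (bw a β ξ u m)) (shiftSeq m u)
        (firstRoot 1 β h (sub ξ (bw a β ξ u m)) (shiftSeq m u)) := by
  rw [firstRoot_restart hβ ha0 ha1 hξ hu hn hf]
  unfold localVal
  rw [rootedWeight_append (bw_blockEnd_ne_nil hβ ha0 ha1 hξ hu),
    backboneChildren_append (onBackbone_bw hξ u m).1, visits_restart hβ ha0 ha1 hξ hu]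

end Restart

end

end BiasedWalk

/-! ### Regeneration: blocks of the walk on the backbone -/

namespace BiasedGW

open PlaneTree BiasedWalk

variable (D : BiasedGW)

/-- The joint law of the tree and of the variables driving the walk on the backbone. -/
noncomputable def treeWalk : Measure (Field × (ℕ → I)) := (gwMeasure D.p).prod uniformSeq

instance : IsProbabilityMeasure D.treeWalk := by unfold treeWalk; infer_instance

/-- The event that the tree is infinite and that `0` is a super-regeneration time. -/
def good : Set (Field × (ℕ → I)) := survival ×ˢ superReg D.β

theorem measurableSet_good : MeasurableSet D.good :=
  measurableSet_survival.prod (measurableSet_superReg D.β)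

theorem measure_good : D.treeWalk D.good = gwMeasure D.p survival * uniformSeq (superReg D.β) :=
  Measure.prod_prod _ _

theorem measure_good_ne_zero : D.treeWalk D.good ≠ 0 := by
  rw [measure_good]
  exact mul_ne_zero D.measure_survival_ne_zero (measure_superReg_ne_zero D.one_lt_bias)

variable {D} {a : ℝ}

/-- The event that the tree is infinite, that `m` is the end of the first block, and that no big
trap is met before `m`. -/
def endWithoutBig (D : BiasedGW) (a : ℝ) (h m : ℕ) : Set (Field × (ℕ → I)) :=
  (survival ×ˢ blockEnd D.β m) ∩ {p | ¬ BlockFound a D.β h p.1 p.2}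

theorem measurableSet_endWithoutBig (h m : ℕ) : MeasurableSet (D.endWithoutBig a h m) :=
  (measurableSet_survival.prod (measurableSet_blockEnd D.β m)).inter
    (measurableSet_blockFound a D.β h).compl

theorem blockFound_iff_of_blockEnd {ξ : Field} {u : ℕ → I} {h m : ℕ} (hu : u ∈ blockEnd D.β m) :
    BlockFound a D.β h ξ u ↔ ∃ j < m, BigAt ξ h (bw a D.β ξ u j) :=
  exists_congr fun j => by rw [mem_inBlock_iff_of_blockEnd hu]

/-- The event that the tree is infinite, and that the walk is at `w` at time `m`, having met no big
trap. -/
def atWithoutBig (D : BiasedGW) (a : ℝ) (h m : ℕ) (u : ℕ → I) (w : List ℕ) : Set Field :=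
  {ξ | ξ ∈ survival ∧ bw a D.β ξ u m = w ∧ ∀ j < m, ¬ BigAt ξ h (bw a D.β ξ u j)}

theorem measurableSet_atWithoutBig_prod (h m : ℕ) (w : List ℕ) :
    MeasurableSet {p : Field × (ℕ → I) | p.1 ∈ D.atWithoutBig a h m p.2 w} :=
  measurableSet_setOfPred.2 (by simp only [atWithoutBig, survival, Set.mem_ofPred_eq]; fun_prop)

theorem measurableSet_atWithoutBig (h m : ℕ) (u : ℕ → I) (w : List ℕ) :
    MeasurableSet (D.atWithoutBig a h m u w) :=
  (measurableSet_atWithoutBig_prod (D := D) (a := a) h m w).preimage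
    (measurable_id.prodMk measurable_const)

theorem graft_mem_survival {ξ : Field} {w : List ℕ} {η : Field} (hw : Mem ξ w)
    (hη : height η = ⊤ ↔ height (sub ξ w) = ⊤) (hξ : ξ ∈ survival) :
    graft ξ w η ∈ survival := by
  have h1 := onBackbone_graft hw hη fun h => (List.suffix_nil.1 h).symm
  rw [onBackbone_nil, onBackbone_nil] at h1
  exact h1.2 hξ

theorem graft_mem_atWithoutBig {h m : ℕ} {u : ℕ → I} {w : List ℕ} {ξ η : Field}
    (hlt : ∀ ζ, ζ ∈ D.atWithoutBig a h m u w → ∀ j < m, ¬ w <:+ bw a D.β ζ u j)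
    (hη : η ∈ survival) (hξ : ξ ∈ D.atWithoutBig a h m u w) :
    graft ξ w η ∈ D.atWithoutBig a h m u w := by
  have hw := hξ.2.1 ▸ onBackbone_bw hξ.1 u m
  have hη' : height η = ⊤ ↔ height (sub ξ w) = ⊤ := by
    simp only [hw.2, iff_true]; exact hη
  have hns := hlt ξ hξ
  have hbw : ∀ j ≤ m, bw a D.β (graft ξ w η) u j = bw a D.β ξ u j := fun j hj =>
    bw_graft hw.1 hη' fun i hi => hns i (by omega)
  refine ⟨graft_mem_survival hw.1 hη' hξ.1, by rw [hbw m le_rfl]; exact hξ.2.1, fun j hj => ?_⟩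
  rw [hbw j hj.le]
  rintro ⟨i, hi⟩
  exact hξ.2.2 j hj ⟨i, (isBigTrap_graft hw.1 hη' (hns j hj) fun hs => hw.of_suffix hs).1 hi⟩

theorem lintegral_atWithoutBig_sub {h m : ℕ} {u : ℕ → I} (w : List ℕ)
    (hlt : ∀ ζ, ζ ∈ D.atWithoutBig a h m u w → ∀ j < m, ¬ w <:+ bw a D.β ζ u j)
    {J : Field → ℝ≥0∞} (hJ : Measurable J) :
    gwMeasure D.p survival * ∫⁻ ξ in D.atWithoutBig a h m u w, J (sub ξ w) ∂gwMeasure D.p =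
      gwMeasure D.p (D.atWithoutBig a h m u w) * ∫⁻ ξ in survival, J ξ ∂gwMeasure D.p := by
  have hms := measurableSet_atWithoutBig (D := D) (a := a) h m u w
  have key := lintegral_mul_sub D.p w measurableSet_survival
    (f := (D.atWithoutBig a h m u w).indicator fun _ => 1) (measurable_const.indicator hms) hJ
    (fun ξ hξ => Set.indicator_of_notMem (fun h1 : ξ ∈ D.atWithoutBig a h m u w => hξ
      (h1.2.1 ▸ onBackbone_bw h1.1 u m : OnBackbone ξ w).2) _) (fun ξ η hξ hη => ?_)
  · rw [lintegral_indicator_const hms, one_mul] at key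
    simp_rw [← key, ← lintegral_indicator hms, Set.indicator, ite_mul, one_mul, zero_mul]
  · refine Set.indicator_const_eq_indicator_const ⟨fun h1 => ?_, graft_mem_atWithoutBig hlt hη⟩
    have := graft_mem_atWithoutBig hlt hξ h1
    rwa [graft_graft, graft_self] at this

variable (ha0 : 0 ≤ a) (ha1 : a ≤ 1)

include ha0 ha1 in
theorem not_suffix_of_pastReg {h m : ℕ} {u : ℕ → I} (hu : u ∈ pastReg D.β m) {w : List ℕ}
    {ζ : Field} (hζ : ζ ∈ D.atWithoutBig a h m u w) {j : ℕ} (hj : j < m) :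
    ¬ w <:+ bw a D.β ζ u j := by
  intro hs
  have h1 := intWalk_sub_le_length D.one_lt_bias ha0 ha1 hζ.1 u j (m - j)
  rw [Nat.add_sub_cancel' hj.le, hζ.2.1] at h1
  have := hu.2 j hj
  have := hs.length_le
  omega

/-- The event that no big trap is met before time `m`. -/
noncomputable def probWithoutBig (D : BiasedGW) (a : ℝ) (h m : ℕ) (u : ℕ → I) : ℝ≥0∞ :=
  ∑' w, gwMeasure D.p (D.atWithoutBig a h m u w)

theorem measurable_probWithoutBig (h m : ℕ) : Measurable (D.probWithoutBig a h m) :=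
  .tsum fun w =>
    measurable_measure_prodMk_right (measurableSet_atWithoutBig_prod (D := D) (a := a) h m w)

theorem probWithoutBig_splitSeq (h m : ℕ) (u u' : ℕ → I) :
    D.probWithoutBig a h m (splitSeq m u u') = D.probWithoutBig a h m u :=
  tsum_congr fun w => congrArg _ (Set.ext fun ξ => and_congr_right fun _ => and_congr
    (by rw [bw_splitSeq le_rfl]) (forall₂_congr fun j hj => by rw [bw_splitSeq hj.le]))

include ha0 ha1 in
/-- The branching property at the end of a block: the tree and the driving variables ahead are
independent of the block and have the law `treeWalk` restricted to `good`. -/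
theorem lintegral_endWithoutBig_aux (h m : ℕ) {J : Field × (ℕ → I) → ℝ≥0∞} (hJ : Measurable J) :
    gwMeasure D.p survival * ∫⁻ p in D.endWithoutBig a h m,
      J (sub p.1 (bw a D.β p.1 p.2 m), shiftSeq m p.2) ∂D.treeWalk =
    (∫⁻ u in pastFirst D.β m, D.probWithoutBig a h m u ∂uniformSeq) *
      ∫⁻ p in D.good, J p ∂D.treeWalk := by
  have hE := measurableSet_endWithoutBig (D := D) (a := a) h m
  -- For fixed `u`, the tree is split at the position of the walk at time `m`.
  have hu : ∀ u, gwMeasure D.p survival * ∫⁻ ξ, (D.endWithoutBig a h m).indicator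
      (fun p => J (sub p.1 (bw a D.β p.1 p.2 m), shiftSeq m p.2)) (ξ, u) ∂gwMeasure D.p =
      (pastFirst D.β m).indicator (D.probWithoutBig a h m) u *
        (superReg D.β).indicator (fun u' => ∫⁻ ξ in survival, J (ξ, u') ∂gwMeasure D.p)
          (shiftSeq m u) := by
    intro u
    by_cases hu1 : u ∈ pastFirst D.β m
    swap
    · simp [endWithoutBig, blockEnd, hu1]
    by_cases hu2 : shiftSeq m u ∈ superReg D.β
    swap
    · simp [endWithoutBig, blockEnd, hu2]
    rw [Set.indicator_of_mem hu1, Set.indicator_of_mem hu2]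
    have hb : u ∈ blockEnd D.β m := ⟨hu1, hu2⟩
    have h1 : ∀ ξ, (D.endWithoutBig a h m).indicator
        (fun p => J (sub p.1 (bw a D.β p.1 p.2 m), shiftSeq m p.2)) (ξ, u) =
        ∑' w, (D.atWithoutBig a h m u w).indicator (fun ξ => J (sub ξ w, shiftSeq m u)) ξ := by
      intro ξ
      rw [tsum_eq_single (bw a D.β ξ u m) fun w hw =>
        Set.indicator_of_notMem (fun h2 => hw h2.2.1.symm) _]
      exact Set.indicator_eq_indicator
        (by simp [endWithoutBig, atWithoutBig, hb, blockFound_iff_of_blockEnd hb]) rfl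
    simp_rw [h1]
    rw [lintegral_tsum fun w => (Measurable.indicator
      (by fun_prop)
      (measurableSet_atWithoutBig h m u w)).aemeasurable, ← ENNReal.tsum_mul_left,
      probWithoutBig, ← ENNReal.tsum_mul_right]
    refine tsum_congr fun w => ?_
    rw [lintegral_indicator (measurableSet_atWithoutBig h m u w)]
    exact lintegral_atWithoutBig_sub w (J := fun ξ => J (ξ, shiftSeq m u))
      (fun ζ hζ j hj => not_suffix_of_pastReg ha0 ha1 hu1.2.1 hζ hj) (by fun_prop)
  rw [← lintegral_indicator hE, treeWalk, lintegral_prod_symm _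
    (Measurable.indicator (by fun_prop) hE).aemeasurable,
    ← lintegral_const_mul' _ _ (measure_ne_top _ _)]
  simp_rw [hu]
  rw [lintegral_uniformSeq_past_mul_future m
    ((measurable_probWithoutBig h m).indicator (measurableSet_pastFirst D.β m))
    (.indicator (Measurable.lintegral_prod_left' hJ)
      (measurableSet_superReg D.β)) fun u u' => Set.indicator_eq_indicator
        (splitSeq_mem_pastFirst m u u') (probWithoutBig_splitSeq h m u u'),
    lintegral_indicator (measurableSet_pastFirst D.β m),
    lintegral_indicator (measurableSet_superReg D.β), good, ← Measure.prod_restrict,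
    lintegral_prod_symm _ hJ.aemeasurable]

include ha0 ha1 in
/-- At the end of the first block the walk starts afresh in the subtree which it enters. -/
theorem lintegral_endWithoutBig (h m : ℕ) {J : Field × (ℕ → I) → ℝ≥0∞} (hJ : Measurable J) :
    D.treeWalk D.good * ∫⁻ p in D.endWithoutBig a h m,
      J (sub p.1 (bw a D.β p.1 p.2 m), shiftSeq m p.2) ∂D.treeWalk =
    D.treeWalk (D.endWithoutBig a h m) * ∫⁻ p in D.good, J p ∂D.treeWalk := by
  have h1 := lintegral_endWithoutBig_aux (D := D) ha0 ha1 h m hJ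
  have h2 := lintegral_endWithoutBig_aux (D := D) ha0 ha1 h m (J := fun _ => 1) measurable_const
  simp only [lintegral_const, Measure.restrict_apply MeasurableSet.univ, Set.univ_inter,
    one_mul] at h2
  refine (ENNReal.mul_right_inj D.measure_survival_ne_zero (measure_ne_top _ _)).1 ?_
  calc gwMeasure D.p survival * (D.treeWalk D.good * ∫⁻ p in D.endWithoutBig a h m,
        J (sub p.1 (bw a D.β p.1 p.2 m), shiftSeq m p.2) ∂D.treeWalk)
      = D.treeWalk D.good * (gwMeasure D.p survival * ∫⁻ p in D.endWithoutBig a h m,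
        J (sub p.1 (bw a D.β p.1 p.2 m), shiftSeq m p.2) ∂D.treeWalk) := by ring
    _ = ((∫⁻ u in pastFirst D.β m, D.probWithoutBig a h m u ∂uniformSeq) *
          D.treeWalk D.good) * ∫⁻ p in D.good, J p ∂D.treeWalk := by rw [h1]; ring
    _ = _ := by rw [← h2]; ring

theorem ae_good_exists_blockEnd :
    ∀ᵐ p ∂D.treeWalk, p.2 ∈ superReg D.β → ∃ m, p.2 ∈ blockEnd D.β m :=
  Measure.quasiMeasurePreserving_snd.ae (ae_exists_blockEnd D.one_lt_bias)

theorem good_sdiff_blockFound (h : ℕ) :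
    (D.good ∩ {p | ¬ BlockFound a D.β h p.1 p.2} : Set _) =ᵐ[D.treeWalk]
      ⋃ m, D.endWithoutBig a h m := by
  filter_upwards [ae_good_exists_blockEnd (D := D)] with p hp
  refine propext ⟨fun ⟨⟨h1, h2⟩, h3⟩ => ?_, fun h1 => ?_⟩
  · obtain ⟨m, hm⟩ := hp h2
    exact Set.mem_iUnion.2 ⟨m, ⟨h1, hm⟩, h3⟩
  · obtain ⟨m, ⟨h2, h3⟩, h4⟩ := Set.mem_iUnion.1 h1
    exact ⟨⟨h2, blockEnd_subset m h3⟩, h4⟩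

include ha0 ha1 in
/-- The renewal equation for a functional `F` which restarts at the end of the first block, as
`J`, unless a big trap is met in this block. -/
theorem lintegral_good_renewal (h : ℕ) {F J : Field × (ℕ → I) → ℝ≥0∞} (hJ : Measurable J)
    (hFJ : ∀ m, ∀ p ∈ D.endWithoutBig a h m,
      F p = J (sub p.1 (bw a D.β p.1 p.2 m), shiftSeq m p.2)) :
    D.treeWalk D.good * ∫⁻ p in D.good, F p ∂D.treeWalk =
      D.treeWalk D.good *
        (∫⁻ p in D.good ∩ {p | BlockFound a D.β h p.1 p.2}, F p ∂D.treeWalk) +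
      D.treeWalk (D.good ∩ {p | ¬ BlockFound a D.β h p.1 p.2}) *
        ∫⁻ p in D.good, J p ∂D.treeWalk := by
  have hdisj : Pairwise (Function.onFun Disjoint (D.endWithoutBig a h)) := fun m n hmn =>
    Set.disjoint_left.2 fun p h1 h2 => Set.disjoint_left.1 (disjoint_blockEnd hmn) h1.1.2 h2.1.2
  have hmE := fun m => measurableSet_endWithoutBig (D := D) (a := a) h m
  have h2 : D.good \ {p | BlockFound a D.β h p.1 p.2} =
      D.good ∩ {p | ¬ BlockFound a D.β h p.1 p.2} := rfl
  rw [← lintegral_inter_add_sdiff F D.good (measurableSet_blockFound a D.β h), h2, mul_add]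
  congr 1
  rw [setLIntegral_congr (good_sdiff_blockFound h), measure_congr (good_sdiff_blockFound h),
    lintegral_iUnion hmE hdisj, measure_iUnion hdisj hmE, ← ENNReal.tsum_mul_left,
    ← ENNReal.tsum_mul_right]
  refine tsum_congr fun m => ?_
  rw [← lintegral_endWithoutBig ha0 ha1 h m hJ, setLIntegral_congr_fun (hmE m) (hFJ m)]

end BiasedGW

/-! ### The traps met in a block -/

namespace BiasedWalk

open PlaneTree

/-- The child of `x.2` with label `x.1` is the bud of a trap whose root is visited before the first
super-regeneration time. -/
def VisitedBud (a β : ℝ) (ξ : Field) (u : ℕ → I) (x : ℕ × List ℕ) : Prop :=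
  x.1 < ξ x.2 ∧ ¬ OnBackbone ξ (x.1 :: x.2) ∧ ∃ j, u ∈ inBlock β j ∧ bw a β ξ u j = x.2

theorem VisitedBud.mem {a β : ℝ} {ξ : Field} {u : ℕ → I} {x : ℕ × List ℕ}
    (hx : VisitedBud a β ξ u x) (hξ : height ξ = ⊤) : Mem ξ (x.1 :: x.2) := by
  obtain ⟨h1, -, j, -, hj⟩ := hx
  exact ⟨hj ▸ (onBackbone_bw hξ u j).1, h1⟩

theorem VisitedBud.height_ne_top {a β : ℝ} {ξ : Field} {u : ℕ → I} {x : ℕ × List ℕ}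
    (hx : VisitedBud a β ξ u x) (hξ : height ξ = ⊤) : height (sub ξ (x.1 :: x.2)) ≠ ⊤ :=
  fun h => hx.2.1 ⟨hx.mem hξ, h⟩

theorem blockFound_iff_visitedBud {a β : ℝ} {h : ℕ} {ξ : Field} {u : ℕ → I} :
    BlockFound a β h ξ u ↔
      ∃ x, VisitedBud a β ξ u x ∧ (h : ℕ∞) ≤ height (sub ξ (x.1 :: x.2)) := by
  constructor
  · rintro ⟨j, hj, i, h1, h2, h3⟩
    exact ⟨(i, bw a β ξ u j), ⟨h1, h2, j, hj, rfl⟩, h3⟩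
  · rintro ⟨⟨i, w⟩, ⟨h1, h2, j, hj, rfl⟩, h3⟩
    exact ⟨j, hj, i, h1, h2, h3⟩

theorem inBlock_of_le {β : ℝ} {i j : ℕ} (h : i ≤ j) {u : ℕ → I} (hu : u ∈ inBlock β j) :
    u ∈ inBlock β i :=
  ⟨hu.1, fun t ht hti => hu.2 t ht (hti.trans h)⟩

/-- If a big trap is met in the first block, then one of the buds visited there is the bud of a big
trap rooted at the first root. -/
theorem BlockFound.exists_visitedBud {a β : ℝ} {h : ℕ} {ξ : Field} {u : ℕ → I}
    (hb : BlockFound a β h ξ u) : ∃ x, x.2 = firstRoot a β h ξ u ∧ VisitedBud a β ξ u x ∧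
      (h : ℕ∞) ≤ height (sub ξ (x.1 :: x.2)) := by
  obtain ⟨j, hj, hbig⟩ := hb
  obtain ⟨i, h3, h4, h5⟩ := (Nat.sInf_mem (s := {n | BigAt ξ h (bw a β ξ u n)}) ⟨j, hbig⟩)
  exact ⟨(i, firstRoot a β h ξ u), rfl, ⟨h3, h4, _, inBlock_of_le (Nat.sInf_le hbig) hj, rfl⟩, h5⟩

theorem not_suffix_of_not_onBackbone {a β : ℝ} {ξ : Field} {u : ℕ → I} {v : List ℕ}
    (hξ : height ξ = ⊤) (hv : ¬ OnBackbone ξ v) (j : ℕ) : ¬ v <:+ bw a β ξ u j := fun hs =>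
  hv ((onBackbone_bw hξ u j).of_suffix hs)

section Graft

variable {a β : ℝ} {ξ η : Field} {u : ℕ → I} {v : List ℕ} (hξ : height ξ = ⊤) (hm : Mem ξ v)
  (hv : ¬ OnBackbone ξ v) (hη : height η ≠ ⊤)

include hm hv hη in
theorem height_eq_top_graft_iff : height η = ⊤ ↔ height (sub ξ v) = ⊤ :=
  iff_of_false hη fun h => hv ⟨hm, h⟩

include hξ hm hv hη

theorem bw_graft_bud (n : ℕ) : bw a β (graft ξ v η) u n = bw a β ξ u n :=
  bw_graft hm (height_eq_top_graft_iff hm hv hη)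
    fun j _ => not_suffix_of_not_onBackbone hξ hv j

theorem localVal_graft_bud (Γ : ℝ → ℕ → ℕ → ℝ≥0∞) {w : List ℕ} (hw : ¬ v <:+ w) :
    localVal Γ a β (graft ξ v η) u w = localVal Γ a β ξ u w := by
  unfold localVal visits
  simp only [bw_graft_bud hξ hm hv hη, backboneChildren_graft hm
    (height_eq_top_graft_iff hm hv hη) hw]

theorem height_graft_bud : height (graft ξ v η) = ⊤ :=
  BiasedGW.graft_mem_survival hm (height_eq_top_graft_iff hm hv hη) hξ

theorem visitedBud_graft {x : ℕ × List ℕ} :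
    VisitedBud a β (graft ξ v η) u x ↔ VisitedBud a β ξ u x := by
  by_cases h1 : ∃ j, u ∈ inBlock β j ∧ bw a β ξ u j = x.2
  · have hns : ¬ v <:+ x.2 := by
      obtain ⟨j, -, hj⟩ := h1
      exact hj ▸ not_suffix_of_not_onBackbone hξ hv j
    unfold VisitedBud
    simp only [bw_graft_bud hξ hm hv hη]
    rw [graft_of_not_suffix hns, onBackbone_graft hm (height_eq_top_graft_iff hm hv hη)
      (not_strict_cons hns x.1)]
  · refine iff_of_false (fun h2 => h1 ?_) fun h2 => h1 h2.2.2
    have := h2.2.2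
    simpa only [bw_graft_bud hξ hm hv hη] using this

end Graft

/-- Different buds have disjoint traps. -/
theorem VisitedBud.not_suffix {a β : ℝ} {ξ : Field} {u : ℕ → I} {x y : ℕ × List ℕ}
    (hξ : height ξ = ⊤) (hx : VisitedBud a β ξ u x) (hy : VisitedBud a β ξ u y) (hxy : x ≠ y) :
    ¬ (x.1 :: x.2) <:+ (y.1 :: y.2) := by
  intro h
  rcases List.suffix_cons_iff.1 h with h | h
  · simp only [List.cons.injEq] at h
    exact hxy (Prod.ext h.1 h.2)
  · obtain ⟨j, -, hj⟩ := hy.2.2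
    rw [← hj] at h
    exact not_suffix_of_not_onBackbone hξ hx.2.1 j h

theorem measurableSet_visitedBud (a β : ℝ) (x : ℕ × List ℕ) :
    MeasurableSet {p : Field × (ℕ → I) | VisitedBud a β p.1 p.2 x} :=
  measurableSet_setOfPred.2 (by unfold VisitedBud; fun_prop)

end BiasedWalk

namespace BiasedGW

open PlaneTree BiasedWalk

variable {D : BiasedGW} {a : ℝ}

/-- The event that the bud `x` is visited in the first block. -/
def budEvent (D : BiasedGW) (a : ℝ) (x : ℕ × List ℕ) : Set (Field × (ℕ → I)) :=
  D.good ∩ {p | VisitedBud a D.β p.1 p.2 x}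

/-- The event that the bud `x` is visited in the first block and belongs to a big trap. -/
def bigBudEvent (D : BiasedGW) (a : ℝ) (h : ℕ) (x : ℕ × List ℕ) : Set (Field × (ℕ → I)) :=
  D.budEvent a x ∩ {p | (h : ℕ∞) ≤ height (sub p.1 (x.1 :: x.2))}

theorem measurableSet_budEvent (x : ℕ × List ℕ) : MeasurableSet (D.budEvent a x) :=
  D.measurableSet_good.inter (measurableSet_visitedBud a D.β x)

theorem measurableSet_bigBudEvent (h : ℕ) (x : ℕ × List ℕ) :
    MeasurableSet (D.bigBudEvent a h x) :=
  (measurableSet_budEvent x).inter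
    (measurableSet_setOfPred.2 (by fun_prop))

theorem graft_mem_budEvent {x y : ℕ × List ℕ} {ξ η : Field} {u : ℕ → I}
    (hp : (ξ, u) ∈ D.budEvent a x) (hη : η ∉ survival) :
    (graft ξ (x.1 :: x.2) η, u) ∈ D.budEvent a y ↔ (ξ, u) ∈ D.budEvent a y := by
  have hξ := hp.1.1
  have hm := hp.2.mem hξ
  have hv := hp.2.2.1
  refine and_congr (iff_of_true ⟨height_graft_bud hξ hm hv hη, hp.1.2⟩ hp.1) ?_
  exact visitedBud_graft hξ hm hv hη

theorem graft_mem_bigBudEvent {h : ℕ} {x y : ℕ × List ℕ} {ξ η : Field} {u : ℕ → I}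
    (hp : (ξ, u) ∈ D.budEvent a x) (hη : η ∉ survival) (hxy : y ≠ x) :
    (graft ξ (x.1 :: x.2) η, u) ∈ D.bigBudEvent a h y ↔ (ξ, u) ∈ D.bigBudEvent a h y := by
  have h1 := graft_mem_budEvent (y := y) hp hη
  have h2 : (ξ, u) ∈ D.budEvent a y → ((h : ℕ∞) ≤ height (sub (graft ξ (x.1 :: x.2) η)
      (y.1 :: y.2)) ↔ (h : ℕ∞) ≤ height (sub ξ (y.1 :: y.2))) := by
    intro hy
    rw [sub_graft_of_disjoint (hp.2.not_suffix hp.1.1 hy.2 hxy.symm)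
      (hy.2.not_suffix hp.1.1 hp.2 hxy)]
  exact ⟨fun h3 => ⟨h1.1 h3.1, (h2 (h1.1 h3.1)).1 h3.2⟩,
    fun h3 => ⟨h1.2 h3.1, (h2 h3.1).2 h3.2⟩⟩

/-- A visited bud carries an independent finite tree, so that it belongs to a big trap with the
same probability as any finite tree has a large height. -/
theorem lintegral_bigBudEvent (h : ℕ) (x : ℕ × List ℕ) {G : Field × (ℕ → I) → ℝ≥0∞}
    (hG : Measurable G) (hGx : ∀ ξ u, (ξ, u) ∈ D.budEvent a x → ∀ η, η ∉ survival →
      G (graft ξ (x.1 :: x.2) η, u) = G (ξ, u)) :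
    ENNReal.ofReal D.q * ∫⁻ p in D.bigBudEvent a h x, G p ∂D.treeWalk =
      gwMeasure D.p (tallFinite h) * ∫⁻ p in D.budEvent a x, G p ∂D.treeWalk := by
  set v := x.1 :: x.2 with hv
  have hmV := measurableSet_budEvent (D := D) (a := a) x
  have hmT := measurableSet_bigBudEvent (D := D) (a := a) h x
  rw [← lintegral_indicator hmV, ← lintegral_indicator hmT, treeWalk,
    lintegral_prod_symm _ (hG.indicator hmV).aemeasurable,
    lintegral_prod_symm _ (hG.indicator hmT).aemeasurable,
    ← lintegral_const_mul' _ _ ENNReal.ofReal_ne_top,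
    ← lintegral_const_mul' _ _ (measure_ne_top _ _)]
  refine lintegral_congr fun u => ?_
  have hf : Measurable fun ξ : Field => (D.budEvent a x).indicator G (ξ, u) :=
    (hG.indicator hmV).comp (measurable_id.prodMk measurable_const)
  have hJ : Measurable ({ξ : Field | (h : ℕ∞) ≤ height ξ}.indicator fun _ => (1 : ℝ≥0∞)) :=
    measurable_const.indicator (measurableSet_le_height h)
  have key := lintegral_mul_sub D.p v measurableSet_survival.compl hf hJ (fun ξ hξ => ?_)
    (fun ξ η hξ hη => ?_)
  · rw [D.measure_height_ne_top, lintegral_indicator_const (measurableSet_le_height h), one_mul,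
      Measure.restrict_apply (measurableSet_le_height h)] at key
    have h2 : {ξ : Field | (h : ℕ∞) ≤ height ξ} ∩ survivalᶜ = tallFinite h := rfl
    rw [h2, mul_comm (∫⁻ _, _ ∂_)] at key
    rw [← key]
    congr 1
    refine lintegral_congr fun ξ => ?_
    by_cases h1 : (ξ, u) ∈ D.budEvent a x <;> by_cases h3 : (h : ℕ∞) ≤ height (sub ξ v) <;>
      simp [bigBudEvent, h1, h3, ← hv]
  · refine Set.indicator_of_notMem (fun h1 => hξ ?_) _
    exact h1.2.height_ne_top h1.1.1
  · by_cases h1 : (ξ, u) ∈ D.budEvent a x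
    · exact Set.indicator_eq_indicator (graft_mem_budEvent h1 hη) (hGx ξ u h1 η hη)
    · refine (Set.indicator_of_notMem (fun h2 => h1 ?_) _).trans (Set.indicator_of_notMem h1 _).symm
      have := (graft_mem_budEvent (y := x) h2 hξ).2 h2
      rwa [graft_graft, graft_self] at this

/-- The expected sum of the values of a local functional over the buds visited in a block. -/
noncomputable def budVal (D : BiasedGW) (a : ℝ) (Γ : ℝ → ℕ → ℕ → ℝ≥0∞) : ℝ≥0∞ :=
  ∑' x : ℕ × List ℕ, ∫⁻ p in D.budEvent a x, localVal Γ a D.β p.1 p.2 x.2 ∂D.treeWalk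

/-- The expected number of visited buds other than which there is the bud of a big trap. -/
noncomputable def budErr (D : BiasedGW) (a : ℝ) (h : ℕ) : ℝ≥0∞ :=
  ∑' x : ℕ × List ℕ, D.treeWalk (D.budEvent a x ∩ ⋃ y ≠ x, D.bigBudEvent a h y)

/-- The expectation of a local functional at the first root, on the event that a big trap is met in
the first block. -/
noncomputable def blockVal (D : BiasedGW) (a : ℝ) (h : ℕ) (Γ : ℝ → ℕ → ℕ → ℝ≥0∞) : ℝ≥0∞ :=
  ∫⁻ p in D.good ∩ {p | BlockFound a D.β h p.1 p.2},
    localVal Γ a D.β p.1 p.2 (firstRoot a D.β h p.1 p.2) ∂D.treeWalk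

theorem mul_tsum_lintegral_bigBudEvent (h : ℕ) (Γ : ℝ → ℕ → ℕ → ℝ≥0∞) :
    ENNReal.ofReal D.q * ∑' x : ℕ × List ℕ, ∫⁻ p in D.bigBudEvent a h x,
      localVal Γ a D.β p.1 p.2 x.2 ∂D.treeWalk =
        gwMeasure D.p (tallFinite h) * D.budVal a Γ := by
  rw [budVal, ← ENNReal.tsum_mul_left, ← ENNReal.tsum_mul_left]
  refine tsum_congr fun x => lintegral_bigBudEvent h x (measurable_localVal Γ a D.β x.2) ?_
  intro ξ u hp η hη
  refine localVal_graft_bud hp.1.1 (hp.2.mem hp.1.1) hp.2.2.1 hη Γ fun hs => ?_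
  have := hs.length_le
  simp at this

theorem mul_tsum_measure_pair (h : ℕ) :
    ENNReal.ofReal D.q * ∑' x : ℕ × List ℕ,
      D.treeWalk (D.bigBudEvent a h x ∩ ⋃ y ≠ x, D.bigBudEvent a h y) =
        gwMeasure D.p (tallFinite h) * D.budErr a h := by
  rw [budErr, ← ENNReal.tsum_mul_left, ← ENNReal.tsum_mul_left]
  refine tsum_congr fun x => ?_
  have hm : MeasurableSet (⋃ y ≠ x, D.bigBudEvent a h y) :=
    .iUnion fun y => .iUnion fun _ => measurableSet_bigBudEvent h y
  have key := lintegral_bigBudEvent (D := D) (a := a) h x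
    (G := (⋃ y ≠ x, D.bigBudEvent a h y).indicator fun _ => 1) (measurable_const.indicator hm) ?_
  · rw [lintegral_indicator_const hm, lintegral_indicator_const hm, Measure.restrict_apply hm,
      Measure.restrict_apply hm, one_mul, one_mul] at key
    rwa [Set.inter_comm, Set.inter_comm (D.budEvent a x)]
  · intro ξ u hp η hη
    refine Set.indicator_const_eq_indicator_const ?_
    simp only [Set.mem_iUnion]
    exact exists_congr fun y => exists_congr fun hy => graft_mem_bigBudEvent hp hη hy

theorem tsum_lintegral_bigBudEvent (h : ℕ) {Φ : ℕ × List ℕ → Field × (ℕ → I) → ℝ≥0∞}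
    (hΦ : ∀ x, Measurable (Φ x)) :
    ∑' x, ∫⁻ p in D.bigBudEvent a h x, Φ x p ∂D.treeWalk =
      ∫⁻ p, ∑' x, (D.bigBudEvent a h x).indicator (Φ x) p ∂D.treeWalk := by
  have hm : ∀ x, AEMeasurable ((D.bigBudEvent a h x).indicator (Φ x)) D.treeWalk := fun x =>
    ((hΦ x).indicator (measurableSet_bigBudEvent h x)).aemeasurable
  rw [lintegral_tsum hm]
  exact tsum_congr fun x => (lintegral_indicator (measurableSet_bigBudEvent h x) _).symm

theorem measurableSet_good_blockFound (h : ℕ) :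
    MeasurableSet (D.good ∩ {p | BlockFound a D.β h p.1 p.2}) :=
  D.measurableSet_good.inter (measurableSet_blockFound a D.β h)

theorem blockVal_le (h : ℕ) (Γ : ℝ → ℕ → ℕ → ℝ≥0∞) :
    ENNReal.ofReal D.q * D.blockVal a h Γ ≤ gwMeasure D.p (tallFinite h) * D.budVal a Γ := by
  rw [← mul_tsum_lintegral_bigBudEvent, tsum_lintegral_bigBudEvent h
    fun x => measurable_localVal Γ a D.β x.2, blockVal,
    ← lintegral_indicator (measurableSet_good_blockFound h)]
  refine mul_le_mul_right (lintegral_mono fun p => ?_) _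
  by_cases hp : p ∈ D.good ∩ {p | BlockFound a D.β h p.1 p.2}
  swap
  · rw [Set.indicator_of_notMem hp]; exact zero_le
  rw [Set.indicator_of_mem hp]
  obtain ⟨x, hx1, hx2, hx3⟩ := hp.2.exists_visitedBud
  refine le_trans ?_ (ENNReal.le_tsum x)
  rw [Set.indicator_of_mem (show p ∈ D.bigBudEvent a h x from ⟨⟨hp.1, hx2⟩, hx3⟩), hx1]

theorem le_blockVal (h : ℕ) {Γ : ℝ → ℕ → ℕ → ℝ≥0∞} (hΓ : ∀ b k n, Γ b k n ≤ 1) :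
    gwMeasure D.p (tallFinite h) * D.budVal a Γ ≤
      ENNReal.ofReal D.q * D.blockVal a h Γ +
        gwMeasure D.p (tallFinite h) * D.budErr a h := by
  have hm : ∀ x, MeasurableSet (⋃ y ≠ x, D.bigBudEvent a h y) := fun x =>
    .iUnion fun y => .iUnion fun _ => measurableSet_bigBudEvent h y
  have h1 : ∑' x : ℕ × List ℕ, D.treeWalk (D.bigBudEvent a h x ∩ ⋃ y ≠ x, D.bigBudEvent a h y) =
      ∫⁻ p, ∑' x, (D.bigBudEvent a h x).indicator
        ((⋃ y ≠ x, D.bigBudEvent a h y).indicator fun _ => 1) p ∂D.treeWalk := by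
    rw [← tsum_lintegral_bigBudEvent h fun x => measurable_const.indicator (hm x)]
    refine tsum_congr fun x => ?_
    rw [lintegral_indicator_const (hm x), Measure.restrict_apply (hm x), one_mul, Set.inter_comm]
  rw [← mul_tsum_lintegral_bigBudEvent, ← mul_tsum_measure_pair, ← mul_add,
    tsum_lintegral_bigBudEvent h fun x => measurable_localVal Γ a D.β x.2, h1, blockVal,
    ← lintegral_indicator (measurableSet_good_blockFound h), ← lintegral_add_left]
  swap
  · exact (measurable_localVal_firstRoot Γ a D.β h).indicator (measurableSet_good_blockFound h)
  refine mul_le_mul_right (lintegral_mono fun p => ?_) _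
  -- Either a single visited bud belongs to a big trap, or all of them are counted in the error.
  by_cases hp : ∃ x, p ∈ D.bigBudEvent a h x ∧ ∀ y ≠ x, p ∉ D.bigBudEvent a h y
  · obtain ⟨x, hx, hy⟩ := hp
    refine le_trans ?_ le_self_add
    have hb : p ∈ D.good ∩ {p | BlockFound a D.β h p.1 p.2} :=
      ⟨hx.1.1, blockFound_iff_visitedBud.2 ⟨x, hx.1.2, hx.2⟩⟩
    obtain ⟨y, hy1, hy2, hy3⟩ := hb.2.exists_visitedBud
    have hyx : y = x := by
      by_contra hne
      exact hy y hne ⟨⟨hb.1, hy2⟩, hy3⟩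
    rw [tsum_eq_single x fun y hne => Set.indicator_of_notMem (hy y hne) _,
      Set.indicator_of_mem hx, Set.indicator_of_mem hb, ← hy1, hyx]
  · push Not at hp
    refine le_trans (ENNReal.tsum_le_tsum fun x => ?_) le_add_self
    by_cases hx : p ∈ D.bigBudEvent a h x
    · obtain ⟨y, hyx, hy⟩ := hp x hx
      rw [Set.indicator_of_mem hx, Set.indicator_of_mem hx, Set.indicator_of_mem]
      · exact hΓ _ _ _
      · simp only [Set.mem_iUnion]; exact ⟨y, hyx, hy⟩
    · rw [Set.indicator_of_notMem hx]; exact zero_le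

end BiasedGW

/-! ### The expected number of buds met in a block -/

namespace BiasedGW

open PlaneTree BiasedWalk

variable {D : BiasedGW} {a : ℝ}

theorem exists_bw_eq_of_suffix {β : ℝ} {ξ : Field} {u : ℕ → I} {w : List ℕ} {n : ℕ}
    (h : w <:+ bw a β ξ u n) : ∃ k ≤ n, bw a β ξ u k = w := by
  induction n with
  | zero => exact ⟨0, le_rfl, (List.suffix_nil.1 h).symm⟩
  | succ n ih =>
    have hstep : w = bw a β ξ u (n + 1) ∨ w <:+ bw a β ξ u n := by
      simp only [bw] at h ⊢
      rcases bstep_cases a β ξ (bw a β ξ u n) (u n) with ⟨i, _, he⟩ | he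
      · rw [he] at h ⊢
        exact List.suffix_cons_iff.1 h
      · rw [he] at h
        exact Or.inr (h.trans (List.tail_suffix _))
    rcases hstep with hw | hw
    · exact ⟨n + 1, le_rfl, hw.symm⟩
    · obtain ⟨k, hk, he⟩ := ih hw
      exact ⟨k, by omega, he⟩

/-- The event that the tree is infinite and that the walk is at `w` at time `j` for the first
time. -/
def newAt (D : BiasedGW) (a : ℝ) (u : ℕ → I) (j : ℕ) (w : List ℕ) : Set Field :=
  {ξ | ξ ∈ survival ∧ bw a D.β ξ u j = w ∧ ∀ i < j, bw a D.β ξ u i ≠ w}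

theorem measurableSet_newAt (u : ℕ → I) (j : ℕ) (w : List ℕ) :
    MeasurableSet (D.newAt a u j w) :=
  measurableSet_survival.inter (measurableSet_setOfPred.2 (by fun_prop))

theorem graft_mem_newAt {u : ℕ → I} {j : ℕ} {w : List ℕ} {ξ η : Field}
    (hη : η ∈ survival) (hξ : ξ ∈ D.newAt a u j w) : graft ξ w η ∈ D.newAt a u j w := by
  have hw := hξ.2.1 ▸ onBackbone_bw hξ.1 u j
  have hη' : height η = ⊤ ↔ height (sub ξ w) = ⊤ := by
    simp only [hw.2, iff_true]; exact hη
  have hns : ∀ i < j, ¬ w <:+ bw a D.β ξ u i := by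
    intro i hi hs
    obtain ⟨k, hk, he⟩ := exists_bw_eq_of_suffix hs
    exact hξ.2.2 k (by omega) he
  have hbw : ∀ i ≤ j, bw a D.β (graft ξ w η) u i = bw a D.β ξ u i := fun i hi =>
    bw_graft hw.1 hη' fun k hk => hns k (by omega)
  refine ⟨graft_mem_survival hw.1 hη' hξ.1, by rw [hbw j le_rfl]; exact hξ.2.1, fun i hi => ?_⟩
  rw [hbw i hi.le]
  exact hξ.2.2 i hi

theorem lintegral_newAt_offspring_le (u : ℕ → I) (j : ℕ) (w : List ℕ) :
    gwMeasure D.p survival * ∫⁻ ξ in D.newAt a u j w, (ξ w : ℝ≥0∞) ∂gwMeasure D.p ≤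
      gwMeasure D.p (D.newAt a u j w) * ∑' k : ℕ, D.p k * (k : ℝ≥0∞) := by
  have hms := measurableSet_newAt (D := D) (a := a) u j w
  have key := lintegral_mul_sub D.p w measurableSet_survival
    (f := (D.newAt a u j w).indicator fun _ => 1) (measurable_const.indicator hms)
    (J := fun η => (η [] : ℝ≥0∞)) (by fun_prop)
    (fun ξ hξ => ?_) (fun ξ η hξ hη => ?_)
  · rw [lintegral_indicator_const hms, one_mul] at key
    have h1 : ∫⁻ ξ in D.newAt a u j w, (ξ w : ℝ≥0∞) ∂gwMeasure D.p =
        ∫⁻ ξ, (D.newAt a u j w).indicator (fun _ => 1) ξ * ((sub ξ w) [] : ℝ≥0∞)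
          ∂gwMeasure D.p := by
      rw [← lintegral_indicator hms]
      refine lintegral_congr fun ξ => ?_
      by_cases h1 : ξ ∈ D.newAt a u j w <;> simp [h1, sub]
    rw [h1, key, ← lintegral_root_offspring]
    exact mul_le_mul_right (setLIntegral_le_lintegral _ _) _
  · refine Set.indicator_of_notMem (fun h1 => hξ ?_) _
    exact (h1.2.1 ▸ onBackbone_bw h1.1 u j : OnBackbone ξ w).2
  · refine Set.indicator_const_eq_indicator_const ⟨fun h1 => ?_, fun h1 => graft_mem_newAt hη h1⟩
    have := graft_mem_newAt hξ h1
    rwa [graft_graft, graft_self] at this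

theorem tsum_indicator_budEvent_le (ξ : Field) (u : ℕ → I) :
    ∑' x, (D.budEvent a x).indicator (fun _ => (1 : ℝ≥0∞)) (ξ, u) ≤
      ∑' j, (inBlock D.β j).indicator (fun _ => 1) u *
        ∑' w, (D.newAt a u j w).indicator (fun ξ => (ξ w : ℝ≥0∞)) ξ := by
  classical
  rw [ENNReal.tsum_prod', ENNReal.tsum_comm]
  simp_rw [← ENNReal.tsum_mul_left]
  refine le_of_le_of_eq (ENNReal.tsum_le_tsum fun w => ?_) ENNReal.tsum_comm
  by_cases hw : ∃ i, (ξ, u) ∈ D.budEvent a (i, w)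
  · obtain ⟨i, hg, -, -, hw⟩ := hw
    have hmin := Nat.find_spec hw
    set j := Nat.find hw with hj
    have hnew : ξ ∈ D.newAt a u j w := ⟨hg.1, hmin.2, fun k hk he =>
      Nat.find_min hw hk ⟨inBlock_of_le hk.le hmin.1, he⟩⟩
    refine le_trans ?_ (ENNReal.le_tsum j)
    rw [Set.indicator_of_mem hmin.1, Set.indicator_of_mem hnew, one_mul]
    refine (tsum_eq_sum (s := Finset.range (ξ w)) fun k hk => Set.indicator_of_notMem (fun h2 =>
      hk (Finset.mem_range.2 h2.2.1)) _).trans_le ((Finset.sum_le_sum fun k _ =>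
      Set.indicator_le_self' (fun _ _ => zero_le) _).trans_eq ?_)
    simp
  · push Not at hw
    rw [ENNReal.tsum_eq_zero.2 fun i => Set.indicator_of_notMem (hw i) _]
    exact zero_le

theorem tsum_measure_newAt_le (u : ℕ → I) (j : ℕ) :
    ∑' w, gwMeasure D.p (D.newAt a u j w) ≤ 1 := by
  rw [← measure_iUnion (fun w w' hne => Set.disjoint_left.2 fun ξ h1 h2 =>
    hne (h1.2.1.symm.trans h2.2.1)) fun w => measurableSet_newAt u j w]
  exact prob_le_one

theorem budVal_one (D : BiasedGW) (a : ℝ) :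
    D.budVal a (fun _ _ _ => 1) = ∑' x, D.treeWalk (D.budEvent a x) := by
  simp [budVal, localVal]

theorem budVal_one_eq_lintegral : D.budVal a (fun _ _ _ => 1) =
    ∫⁻ p, ∑' x, (D.budEvent a x).indicator (fun _ => (1 : ℝ≥0∞)) p ∂D.treeWalk := by
  rw [lintegral_tsum fun x => (measurable_const.indicator (measurableSet_budEvent x)).aemeasurable,
    budVal_one]
  exact tsum_congr fun x => by
    rw [lintegral_indicator_const (measurableSet_budEvent x), one_mul]

theorem budVal_one_ne_top (D : BiasedGW) (a : ℝ) : D.budVal a (fun _ _ _ => 1) ≠ ∞ := by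
  set m := ∑' k : ℕ, D.p k * (k : ℝ≥0∞) with hmdef
  have hu : ∀ u, gwMeasure D.p survival * ∫⁻ ξ, ∑' x, (D.budEvent a x).indicator
      (fun _ => (1 : ℝ≥0∞)) (ξ, u) ∂gwMeasure D.p ≤
      ∑' j, (inBlock D.β j).indicator (fun _ => 1) u * m := by
    intro u
    have h1 : ∀ w j, Measurable ((D.newAt a u j w).indicator fun ξ => (ξ w : ℝ≥0∞)) :=
      fun w j => Measurable.indicator (by fun_prop) (measurableSet_newAt u j w)
    calc _ ≤ gwMeasure D.p survival * ∫⁻ ξ, ∑' j, (inBlock D.β j).indicator (fun _ => 1) u *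
        ∑' w, (D.newAt a u j w).indicator (fun ξ => (ξ w : ℝ≥0∞)) ξ ∂gwMeasure D.p :=
          mul_le_mul_right (lintegral_mono fun ξ => tsum_indicator_budEvent_le ξ u) _
      _ = ∑' j, (inBlock D.β j).indicator (fun _ => 1) u * ∑' w, (gwMeasure D.p survival *
            ∫⁻ ξ in D.newAt a u j w, (ξ w : ℝ≥0∞) ∂gwMeasure D.p) := by
          have h2 : ∀ j, AEMeasurable (fun ξ => (inBlock D.β j).indicator (fun _ => (1 : ℝ≥0∞)) u *
              ∑' w, (D.newAt a u j w).indicator (fun ξ => (ξ w : ℝ≥0∞)) ξ) (gwMeasure D.p) :=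
            fun j => ((Measurable.tsum fun w => h1 w j).const_mul _).aemeasurable
          rw [lintegral_tsum h2, ← ENNReal.tsum_mul_left]
          refine tsum_congr fun j => ?_
          rw [lintegral_const_mul _ (Measurable.tsum fun w => h1 w j),
            lintegral_tsum fun w => (h1 w j).aemeasurable, ENNReal.tsum_mul_left, mul_left_comm]
          exact congr_arg _ (congr_arg _ (tsum_congr fun w =>
            lintegral_indicator (measurableSet_newAt u j w) _))
      _ ≤ ∑' j, (inBlock D.β j).indicator (fun _ => 1) u * m := by
          refine ENNReal.tsum_le_tsum fun j => mul_le_mul_right ?_ _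
          calc _ ≤ ∑' w, gwMeasure D.p (D.newAt a u j w) * m :=
                ENNReal.tsum_le_tsum fun w => lintegral_newAt_offspring_le u j w
            _ ≤ 1 * m := by
                rw [ENNReal.tsum_mul_right]
                exact mul_le_mul_left (tsum_measure_newAt_le u j) _
            _ = m := one_mul m
  have hle : gwMeasure D.p survival * D.budVal a (fun _ _ _ => 1) ≤
      (∑' j, uniformSeq (inBlock D.β j)) * m := by
    rw [budVal_one_eq_lintegral, treeWalk, lintegral_prod_symm _ (Measurable.tsum fun x =>
      measurable_const.indicator (measurableSet_budEvent x)).aemeasurable,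
      ← lintegral_const_mul' _ _ (measure_ne_top _ _)]
    refine (lintegral_mono hu).trans_eq ?_
    have h2 : ∀ j, Measurable ((inBlock D.β j).indicator fun _ => (1 : ℝ≥0∞)) := fun j =>
      measurable_const.indicator (measurableSet_inBlock D.β j)
    rw [lintegral_tsum fun j => ((h2 j).mul_const _).aemeasurable, ← ENNReal.tsum_mul_right]
    refine tsum_congr fun j => ?_
    rw [lintegral_mul_const _ (h2 j), lintegral_indicator_const (measurableSet_inBlock D.β j),
      one_mul]
  intro htop
  rw [htop, ENNReal.mul_top D.measure_survival_ne_zero, top_le_iff] at hle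
  exact ENNReal.mul_ne_top (tsum_measure_inBlock_ne_top D.one_lt_bias) D.mean_ne_top hle

theorem tendsto_budErr (D : BiasedGW) (a : ℝ) :
    Tendsto (fun h => D.budErr a h) atTop (nhds 0) := by
  have hm : ∀ h x, MeasurableSet (D.budEvent a x ∩ ⋃ y ≠ x, D.bigBudEvent a h y) := fun h x =>
    (measurableSet_budEvent x).inter
      (.iUnion fun y => .iUnion fun _ => measurableSet_bigBudEvent h y)
  have h1 : ∀ h, D.budErr a h = ∫⁻ p, ∑' x, (D.budEvent a x ∩
      ⋃ y ≠ x, D.bigBudEvent a h y).indicator (fun _ => (1 : ℝ≥0∞)) p ∂D.treeWalk := by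
    intro h
    rw [lintegral_tsum fun x => (measurable_const.indicator (hm h x)).aemeasurable, budErr]
    exact tsum_congr fun x => by rw [lintegral_indicator_const (hm h x), one_mul]
  simp_rw [h1]
  have hfin := budVal_one_eq_lintegral (D := D) (a := a) ▸ budVal_one_ne_top D a
  rw [← lintegral_zero]
  refine tendsto_lintegral_of_dominated_convergence _
    (fun h => Measurable.tsum fun x => measurable_const.indicator (hm h x))
    (fun h => Eventually.of_forall fun p => ENNReal.tsum_le_tsum fun x => ?_) hfin ?_
  · exact Set.indicator_le_indicator_of_subset Set.inter_subset_left (fun _ => zero_le) p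
  · filter_upwards [ae_lt_top (Measurable.tsum fun x => measurable_const.indicator
    (measurableSet_budEvent x)) hfin] with p hp
    -- Almost surely only finitely many buds are visited, and their trees have bounded heights.
    have hfinite : {x | p ∈ D.budEvent a x}.Finite := by
      by_contra hinf
      have := Set.infinite_coe_iff.2 hinf
      have h4 := tsum_subtype {x | p ∈ D.budEvent a x} (fun _ => (1 : ℝ≥0∞))
      rw [ENNReal.tsum_const_eq_top_of_ne_zero (c := 1)
        one_ne_zero] at h4
      refine hp.ne (Eq.trans (tsum_congr fun x => ?_) h4.symm)
      exact Set.indicator_const_eq_indicator_const Iff.rfl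
    obtain ⟨M, hM⟩ : ∃ M : ℕ, ∀ x, p ∈ D.budEvent a x →
        height (sub p.1 (x.1 :: x.2)) < (M : ℕ∞) := by
      choose! f hf using fun x (hx : p ∈ D.budEvent a x) =>
        ENat.ne_top_iff_exists.1 (hx.2.height_ne_top hx.1.1)
      refine ⟨hfinite.toFinset.sup f + 1, fun x hx => ?_⟩
      rw [← hf x hx]
      exact_mod_cast Nat.lt_succ_of_le (Finset.le_sup (f := f) (hfinite.mem_toFinset.2 hx))
    refine tendsto_const_nhds.congr' ?_
    filter_upwards [eventually_ge_atTop M] with h hh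
    refine (ENNReal.tsum_eq_zero.2 fun x => Set.indicator_of_notMem ?_ _).symm
    rintro ⟨-, h5⟩
    simp only [Set.mem_iUnion] at h5
    obtain ⟨y, -, hy1, hy2⟩ := h5
    exact absurd (hy2.trans_lt (hM y hy1)) (by simpa using hh)

theorem budVal_one_ne_zero (D : BiasedGW) (a : ℝ) : D.budVal a (fun _ _ _ => 1) ≠ 0 := by
  obtain ⟨k, hk, hpk⟩ := D.exists_two_le
  rw [budVal_one]
  intro h0
  -- The root has two children, the first with finitely many and the second with infinitely many
  -- descendants.
  set A : Set (ℕ × (ℕ → Field)) := {k} ×ˢ ({t | t 0 ∈ survivalᶜ} ∩ {t | t 1 ∈ survival}) with hA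
  have hAm : MeasurableSet A :=
    (measurableSet_singleton k).prod (((measurable_pi_apply 0) measurableSet_survival.compl).inter
      ((measurable_pi_apply 1) measurableSet_survival))
  have hsub : {ξ : Field | (ξ [], fun i => sub ξ [i]) ∈ A} ×ˢ superReg D.β ⊆
      D.budEvent a (0, []) := by
    rintro ⟨ξ, u⟩ ⟨⟨hξ0, hξ1, hξ2⟩, hu⟩
    have hξ0' : ξ [] = k := hξ0
    have htop : height ξ = ⊤ := by
      have : OnBackbone ξ [1] := ⟨⟨trivial, by omega⟩, hξ2⟩
      exact this.height_eq_top
    refine ⟨⟨htop, hu⟩, by change 0 < ξ []; omega, fun hb => hξ1 hb.2, 0, ?_, rfl⟩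
    rw [inBlock_zero]; exact hu
  have h2 := measure_mono_null hsub (ENNReal.tsum_eq_zero.1 h0 (0, []))
  rw [treeWalk, Measure.prod_prod, mul_eq_zero] at h2
  rcases h2 with h2 | h2
  · have h3 := lintegral_gwMeasure_node D.p (F := A.indicator fun _ => 1)
      (measurable_const.indicator hAm)
    have h5 := ENNReal.tsum_eq_zero.1 (h3.symm.trans ((lintegral_indicator_const (μ := gwMeasure
      D.p) (measurable_node hAm) (1 : ℝ≥0∞)).trans (by rw [one_mul]; exact h2))) k
    rw [mul_eq_zero, or_iff_right (fun h0 => by simp [coef, h0] at hpk)] at h5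
    have h6 : ∀ t : ℕ → Field, A.indicator (fun _ => (1 : ℝ≥0∞)) (k, t) =
        (Set.pi ({0, 1} : Finset ℕ) fun i => if i = 0 then survivalᶜ else survival).indicator
          (fun _ => 1) t := fun t => Set.indicator_const_eq_indicator_const (by simp [hA])
    have hmi : ∀ i : ℕ, MeasurableSet (if i = 0 then survivalᶜ else survival) := fun i => by
      split_ifs <;> simp [measurableSet_survival]
    simp_rw [h6] at h5
    rw [lintegral_indicator_const (MeasurableSet.pi (Finset.countable_toSet _) fun i _ => hmi i),
      one_mul, Measure.infinitePi_pi _ fun i _ => hmi i] at h5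
    simp only [Finset.prod_eq_zero_iff, Finset.mem_insert, Finset.mem_singleton] at h5
    obtain ⟨i, rfl | rfl, h7⟩ := h5
    · rw [if_pos rfl, D.measure_height_ne_top] at h7
      exact absurd h7 (by simpa using D.q_pos)
    · rw [if_neg one_ne_zero] at h7
      exact D.measure_survival_ne_zero h7
  · exact measure_superReg_ne_zero D.one_lt_bias h2

end BiasedGW

/-! ### The law of the first big trap -/

namespace BiasedGW

open PlaneTree BiasedWalk

variable {D : BiasedGW} {a : ℝ}

/-- The event that a big trap is met. -/
def foundEvent (D : BiasedGW) (a : ℝ) (h : ℕ) : Set (Field × (ℕ → I)) :=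
  {p | Found a D.β h p.1 p.2}

/-- The expectation of a local functional at the first root, on the event that the tree is infinite
and that `0` is a super-regeneration time. -/
noncomputable def rootVal (D : BiasedGW) (a : ℝ) (h : ℕ) (Γ : ℝ → ℕ → ℕ → ℝ≥0∞) : ℝ≥0∞ :=
  ∫⁻ p in D.good, (D.foundEvent a h).indicator
    (fun p => localVal Γ a D.β p.1 p.2 (firstRoot a D.β h p.1 p.2)) p ∂D.treeWalk

/-- The probability of meeting a big trap in the first block. -/
noncomputable def probBlock (D : BiasedGW) (a : ℝ) (h : ℕ) : ℝ≥0∞ :=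
  D.treeWalk (D.good ∩ {p | BlockFound a D.β h p.1 p.2})

theorem blockVal_one (D : BiasedGW) (a : ℝ) (h : ℕ) :
    D.blockVal a h (fun _ _ _ => 1) = D.probBlock a h := by
  simp [blockVal, localVal, probBlock]

theorem probBlock_add (D : BiasedGW) (a : ℝ) (h : ℕ) :
    D.probBlock a h + D.treeWalk (D.good ∩ {p | ¬ BlockFound a D.β h p.1 p.2}) =
      D.treeWalk D.good :=
  measure_inter_add_sdiff D.good (measurableSet_blockFound a D.β h)

theorem blockVal_le_probBlock (D : BiasedGW) (a : ℝ) (h : ℕ) {Γ : ℝ → ℕ → ℕ → ℝ≥0∞}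
    (hΓ : ∀ b k n, Γ b k n ≤ 1) : D.blockVal a h Γ ≤ D.probBlock a h := by
  rw [← blockVal_one]
  exact lintegral_mono fun _ => hΓ _ _ _

theorem rootVal_le (D : BiasedGW) (a : ℝ) (h : ℕ) {Γ : ℝ → ℕ → ℕ → ℝ≥0∞}
    (hΓ : ∀ b k n, Γ b k n ≤ 1) : D.rootVal a h Γ ≤ D.treeWalk D.good := by
  rw [← setLIntegral_one]
  exact lintegral_mono fun p => Set.indicator_le' (fun _ _ => hΓ _ _ _) (fun _ _ => zero_le) p

section

variable (ha0 : 0 ≤ a) (ha1 : a ≤ 1)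

include ha0 ha1 in
theorem rootVal_renewal (h : ℕ) (Γ : ℝ → ℕ → ℕ → ℝ≥0∞) :
    D.treeWalk D.good * D.rootVal a h Γ = D.treeWalk D.good * D.blockVal a h Γ +
      D.treeWalk (D.good ∩ {p | ¬ BlockFound a D.β h p.1 p.2}) * D.rootVal 1 h Γ := by
  have key := lintegral_good_renewal (D := D) ha0 ha1 h
    (F := (D.foundEvent a h).indicator
      fun p => localVal Γ a D.β p.1 p.2 (firstRoot a D.β h p.1 p.2))
    (J := (D.foundEvent 1 h).indicator
      fun p => localVal Γ 1 D.β p.1 p.2 (firstRoot 1 D.β h p.1 p.2))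
    ((measurable_localVal_firstRoot Γ 1 D.β h).indicator (measurableSet_found 1 D.β h)) ?_
  · rw [rootVal, key, rootVal]
    congr 2
    refine setLIntegral_congr_fun (measurableSet_good_blockFound h) fun p hp => ?_
    obtain ⟨n, -, hn⟩ := hp.2
    exact Set.indicator_of_mem (s := D.foundEvent a h) ⟨n, hn⟩ _
  · intro m p hp
    have hr := found_restart D.one_lt_bias ha0 ha1 hp.1.1 hp.1.2 hp.2
    by_cases hf : Found a D.β h p.1 p.2
    · exact Set.indicator_eq_indicator (iff_of_true hf (hr.1 hf))
        (localVal_restart D.one_lt_bias ha0 ha1 hp.1.1 hp.1.2 hp.2 Γ hf)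
    · rw [Set.indicator_of_notMem (s := D.foundEvent a h) hf,
        Set.indicator_of_notMem (s := D.foundEvent 1 h) fun h1 => hf (hr.2 h1)]

end

theorem probBlock_mul_rootVal (D : BiasedGW) (h : ℕ) {Γ : ℝ → ℕ → ℕ → ℝ≥0∞}
    (hΓ : ∀ b k n, Γ b k n ≤ 1) :
    D.probBlock 1 h * D.rootVal 1 h Γ = D.treeWalk D.good * D.blockVal 1 h Γ := by
  have h1 := rootVal_renewal (D := D) zero_le_one le_rfl h Γ
  rw [← probBlock_add D 1 h, add_mul, probBlock_add] at h1
  exact (ENNReal.add_left_inj (ENNReal.mul_ne_top (measure_ne_top _ _)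
    (ne_top_of_le_ne_top (measure_ne_top _ _) (rootVal_le D 1 h hΓ)))).1 h1

theorem tendsto_measure_tallFinite (D : BiasedGW) :
    Tendsto (fun h => gwMeasure D.p (tallFinite h)) atTop (nhds 0) := by
  simp_rw [measure_tallFinite]
  simpa using ENNReal.tendsto_ofReal (D.tendsto_extBy.const_sub D.q)

theorem ofReal_q_ne_zero (D : BiasedGW) : ENNReal.ofReal D.q ≠ 0 := by simpa using D.q_pos

theorem tendsto_probBlock (D : BiasedGW) (a : ℝ) :
    Tendsto (fun h => D.probBlock a h) atTop (nhds 0) := by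
  have h1 : ∀ h, D.probBlock a h ≤ (ENNReal.ofReal D.q)⁻¹ *
      (gwMeasure D.p (tallFinite h) * D.budVal a fun _ _ _ => 1) := by
    intro h
    rw [mul_comm, ← div_eq_mul_inv, ENNReal.le_div_iff_mul_le (Or.inl D.ofReal_q_ne_zero)
      (Or.inl ENNReal.ofReal_ne_top), ← blockVal_one, mul_comm]
    exact blockVal_le h _
  have h2 := ENNReal.Tendsto.const_mul (ENNReal.Tendsto.mul_const D.tendsto_measure_tallFinite
    (Or.inr (budVal_one_ne_top D a))) (Or.inr (ENNReal.inv_ne_top.2 D.ofReal_q_ne_zero))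
  rw [zero_mul, mul_zero] at h2
  exact tendsto_of_tendsto_of_tendsto_of_le_of_le tendsto_const_nhds h2 (fun _ => zero_le) h1

theorem rootVal_one_mul_le (D : BiasedGW) (h : ℕ) {Γ : ℝ → ℕ → ℕ → ℝ≥0∞}
    (hΓ : ∀ b k n, Γ b k n ≤ 1) :
    D.rootVal 1 h Γ * D.budVal 1 (fun _ _ _ => 1) ≤
      D.treeWalk D.good * D.budVal 1 Γ + D.treeWalk D.good * D.budErr 1 h := by
  rw [← ENNReal.mul_le_mul_iff_right (D.measure_tallFinite_ne_zero h) (measure_ne_top _ _)]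
  have h1 := le_blockVal (D := D) (a := 1) h fun _ _ _ => le_rfl
  have h2 := blockVal_le (D := D) (a := 1) h Γ
  have h3 := probBlock_mul_rootVal D h hΓ
  have h4 := rootVal_le D 1 h hΓ
  rw [blockVal_one] at h1
  generalize gwMeasure D.p (tallFinite h) = η, ENNReal.ofReal D.q = q, D.treeWalk D.good = C,
    D.rootVal 1 h Γ = R, D.budErr 1 h = e, D.probBlock 1 h = P at *
  calc _ = R * (η * D.budVal 1 fun _ _ _ => 1) := by ring
    _ ≤ R * (q * P + η * e) := mul_le_mul_right h1 _
    _ = C * (q * D.blockVal 1 h Γ) + η * (R * e) := by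
      rw [mul_add, mul_left_comm, mul_comm R P, h3]; ring
    _ ≤ C * (η * D.budVal 1 Γ) + η * (C * e) := by gcongr
    _ = _ := by ring

theorem le_rootVal_one_mul (D : BiasedGW) (h : ℕ) {Γ : ℝ → ℕ → ℕ → ℝ≥0∞}
    (hΓ : ∀ b k n, Γ b k n ≤ 1) :
    D.treeWalk D.good * D.budVal 1 Γ ≤ D.rootVal 1 h Γ * D.budVal 1 (fun _ _ _ => 1) +
      D.treeWalk D.good * D.budErr 1 h := by
  rw [← ENNReal.mul_le_mul_iff_right (D.measure_tallFinite_ne_zero h) (measure_ne_top _ _)]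
  have h1 := le_blockVal (D := D) (a := 1) h hΓ
  have h2 := blockVal_le (D := D) (a := 1) h fun _ _ _ => 1
  have h3 := probBlock_mul_rootVal D h hΓ
  rw [blockVal_one] at h2
  generalize gwMeasure D.p (tallFinite h) = η, ENNReal.ofReal D.q = q, D.treeWalk D.good = C,
    D.rootVal 1 h Γ = R, D.budErr 1 h = e, D.probBlock 1 h = P at *
  calc _ = C * (η * D.budVal 1 Γ) := by ring
    _ ≤ C * (q * D.blockVal 1 h Γ + η * e) := mul_le_mul_right h1 _
    _ = R * (q * P) + η * (C * e) := by rw [mul_add, mul_left_comm C, ← h3]; ring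
    _ ≤ R * (η * D.budVal 1 fun _ _ _ => 1) + η * (C * e) := by gcongr
    _ = _ := by ring

theorem tendsto_of_le_add {f g e : ℕ → ℝ≥0∞} {c : ℝ≥0∞} (hg : Tendsto g atTop (nhds c))
    (he : Tendsto e atTop (nhds 0)) (h1 : ∀ h, f h ≤ g h + e h) (h2 : ∀ h, g h ≤ f h + e h) :
    Tendsto f atTop (nhds c) := by
  have h3 := hg.add he
  have h4 := ENNReal.Tendsto.sub hg he (Or.inr ENNReal.zero_ne_top)
  rw [add_zero] at h3
  rw [tsub_zero] at h4
  exact tendsto_of_tendsto_of_tendsto_of_le_of_le h4 h3 (fun h => tsub_le_iff_right.2 (h2 h)) h1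

/-- The limit of the law of a local functional at the first root of a big trap: it is read off from
the first moment of the visited buds. -/
theorem tendsto_rootVal (D : BiasedGW) {Γ : ℝ → ℕ → ℕ → ℝ≥0∞} (hΓ : ∀ b k n, Γ b k n ≤ 1) :
    Tendsto (fun h => D.rootVal 0 h Γ) atTop (nhds (D.treeWalk D.good * D.budVal 1 Γ /
      D.budVal 1 fun _ _ _ => 1)) := by
  have hb0 := budVal_one_ne_zero D 1
  have hC : D.treeWalk D.good ≠ ∞ := measure_ne_top _ _
  have he : Tendsto (fun h => D.treeWalk D.good * D.budErr 1 h) atTop (nhds 0) := by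
    have := ENNReal.Tendsto.const_mul (tendsto_budErr D 1) (Or.inr hC)
    rwa [mul_zero] at this
  refine tendsto_of_le_add ((ENNReal.Tendsto.div_const (tendsto_of_le_add tendsto_const_nhds he
    (fun h => rootVal_one_mul_le D h hΓ) fun h => le_rootVal_one_mul D h hΓ) (Or.inr hb0)).congr
    fun h => ENNReal.mul_div_cancel_right hb0 (budVal_one_ne_top D 1)) (tendsto_probBlock D 0) (fun
      h => ?_) fun h => ?_
  all_goals
    have h3 := rootVal_renewal (D := D) (a := 0) le_rfl zero_le_one h Γ
    have h4 := rootVal_le D 1 h hΓ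
    rw [← ENNReal.mul_le_mul_iff_right D.measure_good_ne_zero hC]
  · rw [h3, mul_add, add_comm]
    exact add_le_add (mul_le_mul_left (measure_mono Set.inter_subset_left) _)
      (mul_le_mul_right (blockVal_le_probBlock D 0 h hΓ) _)
  · calc D.treeWalk D.good * D.rootVal 1 h Γ
        = D.treeWalk (D.good ∩ {p | ¬ BlockFound 0 D.β h p.1 p.2}) * D.rootVal 1 h Γ +
          D.probBlock 0 h * D.rootVal 1 h Γ := by rw [← probBlock_add D 0 h, add_mul, add_comm]
      _ ≤ D.treeWalk D.good * D.rootVal 0 h Γ + D.probBlock 0 h * D.treeWalk D.good := by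
          rw [h3]
          gcongr
          exact le_add_self
      _ = _ := by ring

theorem Found.of_le {β : ℝ} {h h' : ℕ} (hh : h ≤ h') {ξ : Field} {u : ℕ → I}
    (hf : Found a β h' ξ u) : Found a β h ξ u := by
  obtain ⟨n, i, h1, h2, h3⟩ := hf
  exact ⟨n, i, h1, h2, le_trans (by exact_mod_cast hh) h3⟩

theorem rootVal_one (D : BiasedGW) (a : ℝ) (h : ℕ) :
    D.rootVal a h (fun _ _ _ => 1) = D.treeWalk (D.good ∩ D.foundEvent a h) := by
  have h1 := lintegral_indicator_const (μ := D.treeWalk.restrict D.good)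
    (measurableSet_found a D.β h) (1 : ℝ≥0∞)
  rw [one_mul, Measure.restrict_apply (measurableSet_found a D.β h), Set.inter_comm] at h1
  exact h1

/-- Big traps of all heights are met almost surely. -/
theorem ae_found (D : BiasedGW) (h : ℕ) :
    ∀ᵐ p ∂D.treeWalk, p ∈ D.good → Found 0 D.β h p.1 p.2 := by
  have hC : D.treeWalk D.good ≠ ∞ := measure_ne_top _ _
  -- For a large height the probability of meeting a big trap in a block is positive, ...
  obtain ⟨h', hh', hlt⟩ : ∃ h' ≥ h, D.budErr 1 h' < D.budVal 1 fun _ _ _ => 1 := by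
    have h1 := (tendsto_budErr D 1).eventually
      (gt_mem_nhds (pos_iff_ne_zero.2 (budVal_one_ne_zero D 1)))
    exact ((eventually_ge_atTop h).and h1).exists
  have hP : D.probBlock 1 h' ≠ 0 := by
    intro h0
    have h1 := le_blockVal (D := D) (a := 1) h' fun _ _ _ => le_rfl
    rw [blockVal_one, h0, mul_zero, zero_add, ENNReal.mul_le_mul_iff_right
      (D.measure_tallFinite_ne_zero h') (measure_ne_top _ _)] at h1
    exact absurd hlt (not_lt.2 h1)
  have h1 : D.rootVal 1 h' (fun _ _ _ => 1) = D.treeWalk D.good := by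
    have h2 := probBlock_mul_rootVal D h' fun _ _ _ => le_rfl
    rw [blockVal_one, mul_comm (D.treeWalk D.good)] at h2
    exact (ENNReal.mul_right_inj hP (ne_top_of_le_ne_top hC
      (measure_mono Set.inter_subset_left))).1 h2
  have h2 : D.rootVal 0 h' (fun _ _ _ => 1) = D.treeWalk D.good := by
    have h3 := rootVal_renewal (D := D) (a := 0) le_rfl zero_le_one h' fun _ _ _ => 1
    rw [h1, blockVal_one, mul_comm (D.treeWalk _) (D.treeWalk D.good), ← mul_add,
      probBlock_add] at h3
    exact (ENNReal.mul_right_inj D.measure_good_ne_zero hC).1 h3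
  rw [rootVal_one] at h2
  have h3 : D.treeWalk (D.good \ D.foundEvent 0 h') = 0 := by
    have h4 := measure_inter_add_sdiff (μ := D.treeWalk) D.good (measurableSet_found 0 D.β h')
    change D.treeWalk (D.good ∩ D.foundEvent 0 h') +
      D.treeWalk (D.good \ D.foundEvent 0 h') = _ at h4
    rw [h2] at h4
    nth_rewrite 2 [← add_zero (D.treeWalk D.good)] at h4
    exact (ENNReal.add_right_inj hC).1 h4
  filter_upwards [measure_eq_zero_iff_ae_notMem.1 h3] with p hp hg
  refine Found.of_le hh' ?_
  by_contra hn
  exact hp ⟨hg, hn⟩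

/-! #### The number of visits to the first root -/

/-- The event that the first big trap is met at time `k`. -/
def firstAt (D : BiasedGW) (a : ℝ) (h : ℕ) (ξ : Field) (k : ℕ) : Set (ℕ → I) :=
  {u | BigAt ξ h (bw a D.β ξ u k) ∧ ∀ j < k, ¬ BigAt ξ h (bw a D.β ξ u j)}

theorem measurableSet_firstAt (h : ℕ) (ξ : Field) (k : ℕ) :
    MeasurableSet (D.firstAt a h ξ k) :=
  measurableSet_setOfPred.2 (by fun_prop)

theorem splitSeq_mem_firstAt (h : ℕ) (ξ : Field) (k : ℕ) (u u' : ℕ → I) :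
    splitSeq k u u' ∈ D.firstAt a h ξ k ↔ u ∈ D.firstAt a h ξ k := by
  refine and_congr ?_ (forall₂_congr fun j hj => ?_)
  · rw [bw_splitSeq le_rfl]
  · rw [bw_splitSeq hj.le]

theorem visits_firstRoot_le (ha0 : 0 ≤ a) (ha1 : a ≤ 1) {h : ℕ} {ξ : Field} (hξ : height ξ = ⊤)
    {u : ℕ → I} (hf : Found a D.β h ξ u) :
    (visits a D.β ξ u (firstRoot a D.β h ξ u) : ℝ≥0∞) ≤ ∑' k, (D.firstAt a h ξ k).indicator
      (fun _ => 1) u * ∑' i, {u | intWalk D.β u i ≤ 0}.indicator (fun _ => 1) (shiftSeq k u) := by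
  set K := firstTime a D.β h ξ u with hK
  have hbig := Nat.sInf_mem hf
  have hmin : ∀ j < K, ¬ BigAt ξ h (bw a D.β ξ u j) := fun j hj hb =>
    absurd (Nat.sInf_le hb) (not_le.2 hj)
  have hmem : u ∈ D.firstAt a h ξ K := ⟨hbig, hmin⟩
  refine le_trans ?_ (ENNReal.le_tsum K)
  rw [Set.indicator_of_mem hmem, one_mul]
  -- The integer walk never exceeds the displacement of the walk on the backbone.
  have hsub : {n | bw a D.β ξ u n = firstRoot a D.β h ξ u} ⊆
      (fun i => K + i) '' {i | intWalk D.β (shiftSeq K u) i ≤ 0} := by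
    intro n hn
    have hn' : bw a D.β ξ u n = bw a D.β ξ u K := hn
    have hle : K ≤ n := by
      by_contra! hlt
      exact hmin n hlt (hn' ▸ hbig)
    obtain ⟨i, rfl⟩ := Nat.exists_eq_add_of_le hle
    refine ⟨i, ?_, rfl⟩
    have h1 := intWalk_sub_le_length D.one_lt_bias ha0 ha1 hξ u K i
    rw [hn', intWalk_add] at h1
    change intWalk D.β (shiftSeq K u) i ≤ 0
    omega
  have h1 : {i | intWalk D.β (shiftSeq K u) i ≤ 0}.encard =
      ∑' i, {u | intWalk D.β u i ≤ 0}.indicator (fun _ => (1 : ℝ≥0∞)) (shiftSeq K u) := by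
    rw [← ENNReal.tsum_set_one]
    exact tsum_subtype {i | intWalk D.β (shiftSeq K u) i ≤ 0} (fun _ => (1 : ℝ≥0∞))
  rw [← h1]
  exact_mod_cast ENat.toENNReal_le.2 ((Set.ncard_le_encard _).trans ((Set.encard_le_encard
    hsub).trans (Set.encard_image_le _ _)))

/-- The expected number of visits to the first root is bounded uniformly in the height. -/
theorem lintegral_visits_firstRoot_le (ha0 : 0 ≤ a) (ha1 : a ≤ 1) (h : ℕ) :
    ∫⁻ p in D.good, (D.foundEvent a h).indicator
      (fun p => (visits a D.β p.1 p.2 (firstRoot a D.β h p.1 p.2) : ℝ≥0∞)) p ∂D.treeWalk ≤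
      ∑' i, uniformSeq {u | intWalk D.β u i ≤ 0} := by
  have hm : Measurable fun p : Field × (ℕ → I) =>
      (visits a D.β p.1 p.2 (firstRoot a D.β h p.1 p.2) : ℝ≥0∞) :=
    measurable_localVal_firstRoot (fun _ _ n => (n : ℝ≥0∞)) a D.β h
  have hF : MeasurableSet (D.foundEvent a h) := measurableSet_found a D.β h
  rw [← lintegral_indicator D.measurableSet_good]
  rw [treeWalk, lintegral_prod _ ((hm.indicator hF).indicator D.measurableSet_good).aemeasurable]
  have hi : ∀ i, MeasurableSet {u | intWalk D.β u i ≤ 0} := fun i =>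
    (measurable_intWalk D.β i) measurableSet_Iic
  have hw : Measurable fun u => ∑' i, {u | intWalk D.β u i ≤ 0}.indicator
      (fun _ => (1 : ℝ≥0∞)) u := Measurable.tsum fun i => measurable_const.indicator (hi i)
  have hξ : ∀ ξ, ∫⁻ u, D.good.indicator ((D.foundEvent a h).indicator
      fun p => (visits a D.β p.1 p.2 (firstRoot a D.β h p.1 p.2) : ℝ≥0∞)) (ξ, u) ∂uniformSeq ≤
      ∑' i, uniformSeq {u | intWalk D.β u i ≤ 0} := by
    intro ξ
    have hk : ∀ k, Measurable ((D.firstAt a h ξ k).indicator fun _ => (1 : ℝ≥0∞)) := fun k =>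
      measurable_const.indicator (measurableSet_firstAt h ξ k)
    calc _ ≤ ∫⁻ u, ∑' k, (D.firstAt a h ξ k).indicator (fun _ => 1) u *
          ∑' i, {u | intWalk D.β u i ≤ 0}.indicator (fun _ => 1) (shiftSeq k u) ∂uniformSeq := by
          refine lintegral_mono fun u => ?_
          by_cases h1 : (ξ, u) ∈ D.good <;> by_cases h2 : (ξ, u) ∈ D.foundEvent a h <;>
            simp only [h1, h2, Set.indicator_of_mem, Set.indicator_of_notMem, zero_le,
              not_false_eq_true]
          exact visits_firstRoot_le ha0 ha1 h1.1 h2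
      _ = ∑' k, uniformSeq (D.firstAt a h ξ k) * ∑' i, uniformSeq {u | intWalk D.β u i ≤ 0} := by
          refine (lintegral_tsum fun k =>
            ((hk k).mul (hw.comp (measurable_shiftSeq k))).aemeasurable).trans ?_
          refine tsum_congr fun k => (lintegral_uniformSeq_past_mul_future k (hk k) hw fun u u' =>
            Set.indicator_const_eq_indicator_const (splitSeq_mem_firstAt h ξ k u u')).trans ?_
          rw [lintegral_indicator_const (measurableSet_firstAt h ξ k), one_mul,
            lintegral_tsum fun i => (measurable_const.indicator (hi i)).aemeasurable]
          congr 1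
          exact tsum_congr fun i => by rw [lintegral_indicator_const (hi i), one_mul]
      _ ≤ 1 * ∑' i, uniformSeq {u | intWalk D.β u i ≤ 0} := by
          rw [ENNReal.tsum_mul_right]
          gcongr
          rw [← measure_iUnion (fun k l hkl => Set.disjoint_left.2 fun u h1 h2 =>
            (lt_or_gt_of_ne hkl).elim (fun hlt => h2.2 k hlt h1.1) fun hlt => h1.2 l hlt h2.1)
            fun k => measurableSet_firstAt h ξ k]
          exact prob_le_one
      _ = _ := one_mul _
  refine (lintegral_mono hξ).trans ?_
  simp

end BiasedGW

/-! ### The number of visits to a trap, given the walk on the backbone -/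

namespace BiasedWalk

open PlaneTree

open Classical in
/-- The state of the walk after a step which does not lead to a child outside of the backbone. -/
noncomputable def leave (β : ℝ) (ξ : Field) (u : ℕ → I) (S : List ℕ × ℕ) : List ℕ × ℕ :=
  if OnBackbone ξ S.1 then (backboneStep β ξ S.1 (u S.2), S.2 + 1) else (S.1.tail, S.2)

/-- One step of the walk on the tree. -/
noncomputable def wstep (β : ℝ) (ξ : Field) (u : ℕ → I) (S : List ℕ × ℕ) (x : I) : List ℕ × ℕ :=
  match (otherChildren ξ S.1)[⌊(x : ℝ) * (parentWeight S.1 + β * ξ S.1) / β⌋₊]? with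
  | some i => (i :: S.1, S.2)
  | none => leave β ξ u S

theorem walkState_succ (β : ℝ) (ξ : Field) (u v : ℕ → I) (t : ℕ) :
    walkState β ξ u v (t + 1) = wstep β ξ u (walkState β ξ u v t) (v t) := rfl

theorem walkState_congr {β : ℝ} {ξ : Field} {u v v' : ℕ → I} {t : ℕ} (h : ∀ i < t, v i = v' i) :
    walkState β ξ u v t = walkState β ξ u v' t := by
  induction t with
  | zero => rfl
  | succ t ih => rw [walkState_succ, walkState_succ, h t (Nat.lt_succ_self t),
      ih fun i hi => h i (by omega)]

/-- The states which the walk can reach: the vertex belongs to a trap rooted at the current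
position of the walk on the backbone, or is this position. -/
def Reachable (β : ℝ) (ξ : Field) (u : ℕ → I) (S : List ℕ × ℕ) : Prop :=
  Mem ξ S.1 ∧ backboneWalk β ξ u S.2 <:+ S.1 ∧
    ∀ y, y <:+ S.1 → backboneWalk β ξ u S.2 <:+ y → y ≠ backboneWalk β ξ u S.2 →
      ¬ OnBackbone ξ y

section

variable {β : ℝ} {ξ : Field} {u : ℕ → I} (hξ : height ξ = ⊤)

include hξ in
theorem onBackbone_backboneWalk (n : ℕ) : OnBackbone ξ (backboneWalk β ξ u n) := by
  rw [← bw_zero_eq]; exact onBackbone_bw hξ u n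

include hξ in
theorem Reachable.onBackbone_iff {S : List ℕ × ℕ} (hS : Reachable β ξ u S) :
    OnBackbone ξ S.1 ↔ S.1 = backboneWalk β ξ u S.2 := by
  constructor
  · intro h
    by_contra hne
    exact hS.2.2 S.1 List.suffix_rfl hS.2.1 hne h
  · intro h
    rw [h]; exact onBackbone_backboneWalk hξ S.2

include hξ in
theorem reachable_leave {S : List ℕ × ℕ} (hS : Reachable β ξ u S) :
    Reachable β ξ u (leave β ξ u S) := by
  unfold leave
  split_ifs with h
  · have h1 := (hS.onBackbone_iff hξ).1 h
    have h2 : backboneStep β ξ S.1 (u S.2) = backboneWalk β ξ u (S.2 + 1) := by rw [h1]; rfl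
    rw [h2]
    refine ⟨(onBackbone_backboneWalk hξ _).1, List.suffix_rfl, fun y h3 h4 h5 => absurd ?_ h5⟩
    exact h3.eq_of_length_le h4.length_le
  · have h1 := fun h2 => h ((hS.onBackbone_iff hξ).2 h2)
    refine ⟨hS.1.of_suffix (List.tail_suffix _), ?_,
      fun y h3 h4 h5 => hS.2.2 y (h3.trans (List.tail_suffix _)) h4 h5⟩
    obtain ⟨w, j⟩ := S
    cases w with
    | nil => exact hS.2.1
    | cons c w =>
      rcases List.suffix_cons_iff.1 hS.2.1 with h2 | h2
      · exact absurd h2.symm h1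
      · exact h2

theorem reachable_child {S : List ℕ × ℕ} (hS : Reachable β ξ u S) {i : ℕ}
    (hi : i ∈ otherChildren ξ S.1) : Reachable β ξ u (i :: S.1, S.2) := by
  rw [mem_otherChildren] at hi
  refine ⟨⟨hS.1, hi.1⟩, hS.2.1.trans (List.suffix_cons _ _), fun y h1 h2 h3 => ?_⟩
  rcases List.suffix_cons_iff.1 h1 with h4 | h4
  · rw [h4]; exact hi.2
  · exact hS.2.2 y h4 h2 h3

include hξ in
theorem reachable_wstep {S : List ℕ × ℕ} (hS : Reachable β ξ u S) (x : I) :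
    Reachable β ξ u (wstep β ξ u S x) := by
  unfold wstep
  split
  · next i hi => exact reachable_child hS (List.mem_of_getElem? hi)
  · exact reachable_leave hξ hS

include hξ in
theorem reachable_walkState (v : ℕ → I) (t : ℕ) : Reachable β ξ u (walkState β ξ u v t) := by
  induction t with
  | zero =>
    refine ⟨trivial, List.suffix_rfl, fun y h1 _ h2 => absurd (List.suffix_nil.1 h1) h2⟩
  | succ t ih => rw [walkState_succ]; exact reachable_wstep hξ ih _

include hξ in
theorem finite_reachable (j : ℕ) : {w | Reachable β ξ u (w, j)}.Finite := by
  set y := backboneWalk β ξ u j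
  have hsub : {w | Reachable β ξ u (w, j)} ⊆ {y} ∪ ⋃ c ∈ {c | c ∈ otherChildren ξ y},
      (fun x => x ++ (c :: y)) '' {x | Mem (sub ξ (c :: y)) x} := by
    rintro w ⟨h1, ⟨x, hx⟩, h3⟩
    have hx' : x ++ y = w := hx
    rcases List.eq_nil_or_concat x with rfl | ⟨x', c, rfl⟩
    · left; exact hx'.symm
    · right
      have hw : w = x' ++ (c :: y) := by rw [← hx']; simp
      have hsuf := hw ▸ List.suffix_append _ _
      simp only [Set.mem_iUnion]
      refine ⟨c, mem_otherChildren.2 ⟨(h1.of_suffix hsuf).2, h3 _ hsuf (List.suffix_cons _ _) (by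
        simp [y])⟩,
        x', ?_, hw.symm⟩
      rw [hw] at h1
      exact (mem_append.1 h1).2
  refine Set.Finite.subset ((Set.finite_singleton _).union (Set.Finite.biUnion
    (List.finite_toSet _) fun c hc => Set.Finite.image _ (finite_mem fun htop => ?_))) hsub
  have hc' := mem_otherChildren.1 hc
  exact hc'.2 ⟨⟨(onBackbone_backboneWalk hξ j).1, hc'.1⟩, htop⟩

theorem parentWeight_nonneg (w : List ℕ) : 0 ≤ parentWeight w := by
  cases w <;> simp [parentWeight]

theorem parentWeight_le_one (w : List ℕ) : parentWeight w ≤ 1 := by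
  cases w <;> simp [parentWeight]

include hξ in
theorem total_weight_pos (hβ : 1 < β) (w : List ℕ) : 0 < parentWeight w + β * ξ w := by
  cases w with
  | nil =>
    obtain ⟨i, hi, -⟩ := exists_height_sub_eq_top hξ
    have : (0 : ℝ) < ξ [] := by exact_mod_cast Nat.zero_lt_of_lt hi
    simp only [parentWeight]
    positivity
  | cons c w => simp only [parentWeight]; positivity

/-- The probability of a step which does not lead to a child outside of the backbone. -/
noncomputable def leaveProb (β : ℝ) (ξ : Field) (w : List ℕ) : ℝ :=
  (parentWeight w + β * (backboneChildren ξ w).length) / (parentWeight w + β * ξ w)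

include hξ in
theorem leaveProb_eq (hβ : 1 < β) (w : List ℕ) : leaveProb β ξ w =
    1 - (otherChildren ξ w).length * (β / (parentWeight w + β * ξ w)) := by
  have h1 : ((backboneChildren ξ w).length : ℝ) + (otherChildren ξ w).length = ξ w := by
    exact_mod_cast length_backboneChildren_add ξ w
  rw [leaveProb, eq_sub_iff_add_eq, mul_div_assoc', ← add_div, div_eq_one_iff_eq (total_weight_pos
    hξ hβ w).ne', ← h1]
  ring

theorem leaveProb_nonneg (hβ : 1 < β) (w : List ℕ) : 0 ≤ leaveProb β ξ w := by
  have := parentWeight_nonneg w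
  unfold leaveProb
  positivity

theorem sum_range_getElem? (l : List ℕ) (f : Option ℕ → ℝ≥0∞) :
    ∑ i ∈ Finset.range l.length, f l[i]? = (l.map fun i => f (some i)).sum := by
  induction l with
  | nil => simp
  | cons c l ih =>
    rw [List.length_cons, Finset.sum_range_succ', List.map_cons, List.sum_cons, add_comm, ← ih]
    simp

include hξ in
theorem lintegral_wstep (hβ : 1 < β) (S : List ℕ × ℕ) (G : List ℕ × ℕ → ℝ≥0∞) :
    ∫⁻ x, G (wstep β ξ u S x) ∂(volume : Measure I) =
      ENNReal.ofReal (β / (parentWeight S.1 + β * ξ S.1)) *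
        ∑ i ∈ (otherChildren ξ S.1).toFinset, G (i :: S.1, S.2) +
      ENNReal.ofReal (leaveProb β ξ S.1) * G (leave β ξ u S) := by
  have hle : (otherChildren ξ S.1).length ≤ ξ S.1 := by
    have := length_backboneChildren_add ξ S.1; omega
  have hle' : ((otherChildren ξ S.1).length : ℝ) ≤ ξ S.1 := by exact_mod_cast hle
  have hb : ((otherChildren ξ S.1).length : ℝ) * β ≤ parentWeight S.1 + β * ξ S.1 := by
    have := parentWeight_nonneg S.1
    nlinarith
  have key := lintegral_floor_child (by linarith : (0 : ℝ) < β) (total_weight_pos hξ hβ S.1) hb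
    (fun n => G (match (otherChildren ξ S.1)[n]? with
      | some i => (i :: S.1, S.2)
      | none => leave β ξ u S)) (G (leave β ξ u S)) fun n hn => by
        simp only [List.getElem?_eq_none hn]
  refine key.trans ?_
  rw [leaveProb_eq hξ hβ]
  congr 2
  have hnd : (otherChildren ξ S.1).Nodup := List.Nodup.filter _ List.nodup_range
  rw [List.sum_toFinset _ hnd]
  exact sum_range_getElem? (otherChildren ξ S.1) fun o => G (match o with
    | some i => (i :: S.1, S.2)
    | none => leave β ξ u S)

end

/-! #### Measurability -/

theorem measurable_wstep (β : ℝ) :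
    Measurable fun p : (List ℕ × ℕ) × Field × (ℕ → I) × I =>
      wstep β p.2.1 p.2.2.1 p.1 p.2.2.2 := by
  refine measurable_from_prod_countable_right fun S => ?_
  have h1 : Measurable fun p : Field × (ℕ → I) × I => leave β p.1 p.2.1 S := by
    have hb := (measurable_bstep 0 β).comp (f := fun p : Field × (ℕ → I) × I =>
      (S.1, p.1, p.2.1 S.2)) (by fun_prop)
    exact Measurable.ite (measurableSet_setOfPred.2 (by fun_prop)) (hb.prodMk measurable_const)
      measurable_const
  -- The step is a function of three discrete quantities.
  have h2 : Measurable fun p : Field × (ℕ → I) × I => (otherChildren p.1 S.1,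
      ⌊(p.2.2 : ℝ) * (parentWeight S.1 + β * p.1 S.1) / β⌋₊, leave β p.1 p.2.1 S) := by
    fun_prop
  exact (measurable_of_countable fun y =>
    (match y.1[y.2.1]? with
      | some i => (i :: S.1, S.2)
      | none => y.2.2 : List ℕ × ℕ)).comp h2

theorem measurable_walkState (β : ℝ) (t : ℕ) :
    Measurable fun p : Field × (ℕ → I) × (ℕ → I) => walkState β p.1 p.2.1 p.2.2 t := by
  induction t with
  | zero => exact measurable_const
  | succ t ih =>
    exact (measurable_wstep β).comp (f := fun p : Field × (ℕ → I) × (ℕ → I) =>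
      (walkState β p.1 p.2.1 p.2.2 t, p.1, p.2.1, p.2.2 t)) (ih.prodMk (by fun_prop))

theorem measurable_walkState_right (β : ℝ) (ξ : Field) (u : ℕ → I) (t : ℕ) :
    Measurable fun v : ℕ → I => walkState β ξ u v t :=
  (measurable_walkState β t).comp (measurable_const.prodMk (measurable_const.prodMk measurable_id))

end BiasedWalk

namespace BiasedWalk

open PlaneTree

section

variable {β : ℝ} {ξ : Field} {u : ℕ → I}

/-! #### The walk leaves every trap -/

/-- The Lyapunov function by which the time spent in the traps rooted at the position number `j` of
the walk on the backbone is controlled. -/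
noncomputable def trapLyapunov (β : ℝ) (ξ : Field) (u : ℕ → I) (ρ : ℝ) (j : ℕ)
    (S : List ℕ × ℕ) : ℝ :=
  if S.2 < j then 1
  else if S.2 = j then
    ∑ i ∈ Finset.range (S.1.length - (backboneWalk β ξ u j).length + 1), ρ ^ i
  else 0

/-- The number of steps up to time `t` which lead from `w` to its child with label `i`. -/
noncomputable def crossings (β : ℝ) (ξ : Field) (u : ℕ → I) (w : List ℕ) (i : ℕ) (v : ℕ → I)
    (t : ℕ) : ℕ :=
  ∑ m ∈ Finset.range t, if walk β ξ u v m = w ∧ walk β ξ u v (m + 1) = i :: w then 1 else 0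

theorem crossings_congr {w : List ℕ} {i : ℕ} {v v' : ℕ → I} {t : ℕ} (h : ∀ m < t, v m = v' m) :
    crossings β ξ u w i v t = crossings β ξ u w i v' t := by
  refine Finset.sum_congr rfl fun m hm => ?_
  have hm' := Finset.mem_range.1 hm
  unfold walk
  rw [walkState_congr (v := v) (v' := v') fun k hk => h k (by omega),
    walkState_congr (v := v) (v' := v') fun k hk => h k (by omega)]

theorem measurable_crossings (w : List ℕ) (i t : ℕ) :
    Measurable fun v : ℕ → I => crossings β ξ u w i v t := by
  refine Finset.measurable_sum _ fun m _ => ?_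
  have h1 : ∀ m, Measurable fun v => walk β ξ u v m := fun m =>
    measurable_fst.comp (measurable_walkState_right β ξ u m)
  exact Measurable.ite (measurableSet_setOfPred.2 (by fun_prop)) measurable_const measurable_const

/-- The Markov property of the walk, together with the counter of the steps from `w` to its child
with label `i`. -/
theorem lintegral_walkState_succ (w : List ℕ) (i t : ℕ) (H : ℕ → List ℕ × ℕ → ℝ≥0∞) :
    ∫⁻ v, H (crossings β ξ u w i v (t + 1)) (walkState β ξ u v (t + 1)) ∂uniformSeq =
      ∫⁻ v, ∫⁻ x, H (crossings β ξ u w i v t +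
        if (walkState β ξ u v t).1 = w ∧ (wstep β ξ u (walkState β ξ u v t) x).1 = i :: w
          then 1 else 0) (wstep β ξ u (walkState β ξ u v t) x) ∂(volume : Measure I)
            ∂uniformSeq := by
  have hH : Measurable fun y : ℕ × (List ℕ × ℕ) => H y.1 y.2 := measurable_of_countable _
  rw [lintegral_uniformSeq_update t]
  · refine lintegral_congr fun v => lintegral_congr fun x => ?_
    have h1 : ∀ m < t, Function.update v t x m = v m := fun m hm =>
      Function.update_of_ne hm.ne _ _
    simp only [crossings, Finset.sum_range_succ, walk, walkState_succ, walkState_congr h1,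
      Function.update_self]
    congr 2
    exact crossings_congr h1
  · exact hH.comp ((measurable_crossings w i (t + 1)).prodMk
      (measurable_walkState_right β ξ u (t + 1)))

variable (hβ : 1 < β) (hξ : height ξ = ⊤)

include hβ hξ

theorem le_leaveProb {w : List ℕ} {K : ℕ} (hK : ξ w ≤ K)
    (hw : w ≠ [] ∨ OnBackbone ξ w) : 1 / (1 + β * K) ≤ leaveProb β ξ w := by
  have hK' : (ξ w : ℝ) ≤ K := by exact_mod_cast hK
  have hp := parentWeight_le_one w
  have h1 : 1 ≤ parentWeight w + β * (backboneChildren ξ w).length := by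
    rcases hw with hw | hw
    · obtain ⟨c, w, rfl⟩ := List.exists_cons_of_ne_nil hw
      simp only [parentWeight]
      have : 0 ≤ β * ((backboneChildren ξ (c :: w)).length : ℝ) := by positivity
      linarith
    · have h2 : (1 : ℝ) ≤ (backboneChildren ξ w).length := by
        exact_mod_cast hw.length_backboneChildren_pos
      have := parentWeight_nonneg w
      nlinarith
  refine div_le_div₀ (by linarith) h1 (total_weight_pos hξ hβ w) ?_
  have := mul_le_mul_of_nonneg_left hK' (by linarith : (0 : ℝ) ≤ β)
  linarith

/-- The Lyapunov function decreases on average at each step taken while the walk on the backbone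
stays at its `j`-th vertex, provided that the vertices within reach have at most `K` children and
length at most `h`: the walk goes towards the backbone with probability at least `1 / (1 + β K)`,
twice the ratio of the increments of the function along a path away from the backbone. -/
theorem lintegral_trapLyapunov_add_le {j K h : ℕ}
    (hK : ∀ w, Reachable β ξ u (w, j) → ξ w ≤ K ∧ w.length ≤ h) {S : List ℕ × ℕ}
    (hS : Reachable β ξ u S) (hSj : S.2 = j) :
    (∫⁻ x, ENNReal.ofReal (trapLyapunov β ξ u (1 / (1 + β * K) / 2) j (wstep β ξ u S x))) +
      ENNReal.ofReal ((1 / (1 + β * K) / 2) ^ (h + 1)) ≤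
        ENNReal.ofReal (trapLyapunov β ξ u (1 / (1 + β * K) / 2) j S) := by
  obtain ⟨w, j'⟩ := S
  simp only at hSj
  subst hSj
  obtain ⟨hKw, hhw⟩ := hK w hS
  set p := 1 / (1 + β * K) with hp
  have hp0 : 0 < p := by positivity
  have hp1 : p ≤ 1 := by
    rw [hp, div_le_one (by positivity)]
    have : 0 ≤ β * K := by positivity
    linarith
  set ρ := p / 2 with hρ
  have hρ0 : 0 < ρ := by positivity
  have hρ1 : ρ ≤ 1 := by linarith
  set y := backboneWalk β ξ u j' with hy
  obtain ⟨d, hd⟩ : ∃ d, w.length = y.length + d := Nat.exists_eq_add_of_le hS.2.1.length_le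
  -- The value at a vertex at distance `d` from the backbone.
  set φ : ℕ → ℝ := fun d => ∑ i ∈ Finset.range (d + 1), ρ ^ i with hφ
  have hφ0 : ∀ d, 0 ≤ φ d := fun d => by positivity
  have hV : trapLyapunov β ξ u ρ j' (w, j') = φ d := by
    simp only [trapLyapunov, lt_irrefl, if_false, if_true, hφ, ← hy, hd]
    congr 3
    omega
  have hchild : ∀ i, trapLyapunov β ξ u ρ j' (i :: w, j') = φ (d + 1) := by
    intro i
    simp only [trapLyapunov, lt_irrefl, if_false, if_true, hφ, ← hy, List.length_cons, hd]
    congr 2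
    omega
  have hleave : trapLyapunov β ξ u ρ j' (leave β ξ u (w, j')) = φ d - ρ ^ d := by
    unfold leave
    split_ifs with hb
    · have h1 := (hS.onBackbone_iff hξ).1 hb
      have h2 : d = 0 := by
        have := congrArg List.length h1
        simp only [← hy] at this; omega
      simp [trapLyapunov, h2, hφ]
    · have h1 := fun h2 => hb ((hS.onBackbone_iff hξ).2 h2)
      have h2 : 1 ≤ d := by
        by_contra h0
        exact h1 (hS.2.1.eq_of_length_le (by simp only [← hy]; omega)).symm
      obtain ⟨e, rfl⟩ := Nat.exists_eq_add_of_le' h2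
      have h3 : φ (e + 1) - ρ ^ (e + 1) = φ e := by
        simp only [hφ]; rw [Finset.sum_range_succ]; ring
      rw [h3]
      simp only [trapLyapunov, lt_irrefl, if_false, if_true, hφ, ← hy, List.length_tail, hd]
      congr 2
      omega
  have hw : w ≠ [] ∨ OnBackbone ξ w := by
    by_cases h0 : w = []
    · right
      rw [hS.onBackbone_iff hξ]
      have := hS.2.1
      simp only [h0, List.suffix_nil] at this
      simp only [h0, this]
    · exact Or.inl h0
  have hlp := le_leaveProb hβ hξ hKw hw
  rw [lintegral_wstep hξ hβ (w, j') fun S => ENNReal.ofReal (trapLyapunov β ξ u ρ j' S)]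
  simp only [hchild, hleave, hV]
  set ℓ := leaveProb β ξ w with hℓ
  have hcard : (otherChildren ξ w).toFinset.card = (otherChildren ξ w).length :=
    List.toFinset_card_of_nodup (List.Nodup.filter _ List.nodup_range)
  have hA := total_weight_pos hξ hβ w
  have hφd : 0 ≤ φ d - ρ ^ d := by
    have : φ d - ρ ^ d = ∑ i ∈ Finset.range d, ρ ^ i := by
      simp only [hφ]; rw [Finset.sum_range_succ]; ring
    rw [this]; positivity
  rw [Finset.sum_const, hcard, nsmul_eq_mul, ← ENNReal.ofReal_natCast,
    ← ENNReal.ofReal_mul (by positivity), ← ENNReal.ofReal_mul (by positivity),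
    ← ENNReal.ofReal_mul (leaveProb_nonneg hβ w), ← ENNReal.ofReal_add (by positivity)
      (mul_nonneg (leaveProb_nonneg hβ w) hφd),
    ← ENNReal.ofReal_add (add_nonneg (by positivity)
      (mul_nonneg (leaveProb_nonneg hβ w) hφd)) (by positivity)]
  refine ENNReal.ofReal_le_ofReal ?_
  have h1 : β / (parentWeight w + β * ξ w) * ((otherChildren ξ w).length * φ (d + 1)) =
      (1 - ℓ) * φ (d + 1) := by rw [hℓ, leaveProb_eq hξ hβ w]; ring
  have h2 : φ (d + 1) = φ d + ρ ^ (d + 1) := by simp only [hφ]; rw [Finset.sum_range_succ]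
  have h3 : ρ ^ (h + 1) ≤ ρ ^ (d + 1) := pow_le_pow_of_le_one hρ0.le hρ1 (by omega)
  rw [h1, h2]
  have h4 : 0 < ρ ^ d := by positivity
  have h6 : p = 2 * ρ := by rw [hρ]; ring
  have h7 : 0 ≤ ℓ := leaveProb_nonneg hβ w
  rw [pow_succ' ρ d] at h3 ⊢
  have h8 : (p - ℓ) * ρ ^ d ≤ 0 := mul_nonpos_of_nonpos_of_nonneg (by linarith) h4.le
  have h9 : 0 ≤ ℓ * (ρ * ρ ^ d) := by positivity
  nlinarith

omit hβ in
theorem trapLyapunov_wstep_le {ρ : ℝ} {j : ℕ} {S : List ℕ × ℕ}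
    (hS : Reachable β ξ u S) (hSj : S.2 ≠ j) (x : I) :
    trapLyapunov β ξ u ρ j (wstep β ξ u S x) ≤ trapLyapunov β ξ u ρ j S := by
  have h2 : (wstep β ξ u S x).2 = S.2 ∨ ((wstep β ξ u S x).2 = S.2 + 1 ∧
      (wstep β ξ u S x).1 = backboneWalk β ξ u (S.2 + 1)) := by
    unfold wstep
    split
    · exact Or.inl rfl
    · unfold leave
      split_ifs with hb
      · right
        refine ⟨rfl, ?_⟩
        rw [(hS.onBackbone_iff hξ).1 hb]; rfl
      · exact Or.inl rfl
  rcases h2 with h2 | ⟨h2, h3⟩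
  · simp [trapLyapunov, h2, hSj]
  · unfold trapLyapunov
    split_ifs <;> first | omega | simp_all

/-- Almost surely, the walk makes infinitely many steps on the backbone. -/
theorem ae_tendsto_walkState_snd :
    ∀ᵐ v ∂uniformSeq, ∀ J, ∀ᶠ t in atTop, J ≤ (walkState β ξ u v t).2 := by
  have hj : ∀ j, ∀ᵐ v ∂uniformSeq, ∀ᶠ t in atTop, (walkState β ξ u v t).2 ≠ j := by
    intro j
    have hfin := finite_reachable (β := β) (u := u) hξ j
    obtain ⟨K, hK⟩ := (hfin.image ξ).bddAbove
    obtain ⟨h, hh⟩ := (hfin.image List.length).bddAbove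
    have hKh : ∀ w, Reachable β ξ u (w, j) → ξ w ≤ K ∧ w.length ≤ h := fun w hw =>
      ⟨hK ⟨w, hw, rfl⟩, hh ⟨w, hw, rfl⟩⟩
    set ρ := 1 / (1 + β * K) / 2 with hρ
    have hρ0 : 0 < ρ := by positivity
    set c := ENNReal.ofReal (ρ ^ (h + 1)) with hc
    have hc0 : c ≠ 0 := by rw [hc]; simpa using pow_pos hρ0 (h + 1)
    have hms : ∀ t, MeasurableSet {v : ℕ → I | (walkState β ξ u v t).2 = j} := fun t =>
      (measurable_snd.comp (measurable_walkState_right β ξ u t)) (measurableSet_singleton j)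
    have hstep : ∀ t, ∫⁻ v, ENNReal.ofReal (trapLyapunov β ξ u ρ j (walkState β ξ u v (t + 1)))
        ∂uniformSeq + c * uniformSeq {v | (walkState β ξ u v t).2 = j} ≤
        ∫⁻ v, ENNReal.ofReal (trapLyapunov β ξ u ρ j (walkState β ξ u v t)) ∂uniformSeq := by
      intro t
      rw [lintegral_walkState_succ [] 0 t fun _ S => ENNReal.ofReal (trapLyapunov β ξ u ρ j S),
        ← lintegral_indicator_const (hms t), ← lintegral_add_right _
          (measurable_const.indicator (hms t))]
      refine lintegral_mono fun v => ?_
      have hr := reachable_walkState (β := β) (u := u) hξ v t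
      by_cases h1 : (walkState β ξ u v t).2 = j
      · rw [Set.indicator_of_mem (s := {v : ℕ → I | (walkState β ξ u v t).2 = j}) h1]
        exact lintegral_trapLyapunov_add_le hβ hξ hKh hr h1
      · rw [Set.indicator_of_notMem (s := {v : ℕ → I | (walkState β ξ u v t).2 = j}) h1, add_zero]
        refine (lintegral_mono fun x => ENNReal.ofReal_le_ofReal
          (trapLyapunov_wstep_le hξ hr h1 x)).trans_eq ?_
        simp
    have hsum : ∀ T, ∫⁻ v, ENNReal.ofReal (trapLyapunov β ξ u ρ j (walkState β ξ u v T))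
        ∂uniformSeq + c * ∑ t ∈ Finset.range T, uniformSeq {v | (walkState β ξ u v t).2 = j} ≤
        1 := by
      intro T
      induction T with
      | zero =>
        simp only [walkState]
        unfold trapLyapunov
        split_ifs <;> simp
      | succ T ih =>
        refine le_trans ?_ ih
        rw [Finset.sum_range_succ, mul_add, add_comm (c * _), ← add_assoc]
        exact add_le_add (hstep T) le_rfl
    refine (ae_iff.2 ?_)
    have h3 : ∑' t, uniformSeq {v | (walkState β ξ u v t).2 = j} ≠ ∞ := by
      have h4 : c * ∑' t, uniformSeq {v | (walkState β ξ u v t).2 = j} ≤ 1 := by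
        rw [← ENNReal.tsum_mul_left]
        refine ENNReal.tsum_le_of_sum_range_le fun T => ?_
        rw [← Finset.mul_sum]
        exact le_add_self.trans (hsum T)
      intro htop
      rw [htop, ENNReal.mul_top hc0] at h4
      exact absurd h4 (by simp)
    simpa only [Filter.not_eventually, not_not, ne_eq] using (measure_setOfPred_frequently_eq_zero
      h3)
  filter_upwards [ae_all_iff.2 hj] with v hv J
  filter_upwards [(Finset.eventually_all _).2 fun j _ => hv j] with t ht
  by_contra! hlt
  exact ht _ (Finset.mem_range.2 hlt) rfl

end

end BiasedWalk

namespace BiasedWalk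

open PlaneTree

/-! #### The generating function of the number of visits -/

/-- The number of visits of the walk on the backbone to `w` from time `j` on. -/
noncomputable def visitsFrom (β : ℝ) (ξ : Field) (u : ℕ → I) (w : List ℕ) (j : ℕ) : ℕ :=
  {n | j ≤ n ∧ backboneWalk β ξ u n = w}.ncard

/-- The number of steps of the walk from `w` to its child with label `i`. -/
noncomputable def totalCrossings (β : ℝ) (ξ : Field) (u v : ℕ → I) (w : List ℕ) (i : ℕ) : ℕ :=
  {t | walk β ξ u v t = w ∧ walk β ξ u v (t + 1) = i :: w}.ncard

/-- The generating function at `s` of the number of steps into a given trap during a stay at its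
root, where `b` is the weight of the edge from the root to its parent and `k` the number of the
children of the root on the backbone. -/
noncomputable def stayFactor (β s b : ℝ) (k : ℕ) : ℝ := (b + β * k) / (b + β * k + β * (1 - s))

section

variable {β : ℝ} {ξ : Field} {u : ℕ → I} {w : List ℕ}

theorem visitsFrom_eq_of_ne {j : ℕ} (h : backboneWalk β ξ u j ≠ w) :
    visitsFrom β ξ u w j = visitsFrom β ξ u w (j + 1) := by
  unfold visitsFrom
  congr 1
  ext n
  refine and_congr_left fun hn => ⟨fun h1 => ?_, fun h1 => by omega⟩
  rcases eq_or_lt_of_le h1 with rfl | h2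
  · exact absurd hn h
  · exact h2

variable (hfin : {n | backboneWalk β ξ u n = w}.Finite)

include hfin in
theorem visitsFrom_eq_of_eq {j : ℕ} (h : backboneWalk β ξ u j = w) :
    visitsFrom β ξ u w j = visitsFrom β ξ u w (j + 1) + 1 := by
  unfold visitsFrom
  have h1 : {n | j ≤ n ∧ backboneWalk β ξ u n = w} =
      insert j {n | j + 1 ≤ n ∧ backboneWalk β ξ u n = w} := by
    ext n
    constructor
    · rintro ⟨h1, h2⟩
      rcases eq_or_lt_of_le h1 with rfl | h3
      · exact Or.inl rfl
      · exact Or.inr ⟨h3, h2⟩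
    · rintro (rfl | ⟨h1, h2⟩)
      · exact ⟨le_rfl, h⟩
      · exact ⟨by omega, h2⟩
  rw [h1, Set.ncard_insert_of_notMem (by simp) (hfin.subset fun n hn => hn.2)]

include hfin in
theorem exists_visitsFrom_eq_zero : ∃ J, ∀ j, J ≤ j → visitsFrom β ξ u w j = 0 := by
  obtain ⟨J, hJ⟩ := hfin.bddAbove
  refine ⟨J + 1, fun j hj => ?_⟩
  have : {n | j ≤ n ∧ backboneWalk β ξ u n = w} = ∅ := by
    ext n
    simp only [Set.mem_empty_iff_false, iff_false]
    rintro ⟨h1, h2⟩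
    have := hJ h2
    omega
  rw [visitsFrom, this, Set.ncard_empty]

variable (hβ : 1 < β) (hξ : height ξ = ⊤) {i : ℕ} (hi : i ∈ otherChildren ξ w)

include hξ in
theorem lintegral_wstep_of_ne (f : ℕ → ℕ → ℝ≥0∞) {S : List ℕ × ℕ} (hS : Reachable β ξ u S)
    (hSw : S.1 ≠ w) (C : ℕ) :
    ∫⁻ x, f (C + if S.1 = w ∧ (wstep β ξ u S x).1 = i :: w then 1 else 0)
      (visitsFrom β ξ u w (wstep β ξ u S x).2) = f C (visitsFrom β ξ u w S.2) := by
  have h1 : ∀ x, visitsFrom β ξ u w (wstep β ξ u S x).2 = visitsFrom β ξ u w S.2 := by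
    intro x
    unfold wstep
    split
    · rfl
    · unfold leave
      split_ifs with hb
      · rw [hS.onBackbone_iff hξ] at hb
        exact (visitsFrom_eq_of_ne (hb ▸ hSw)).symm
      · rfl
  simp [h1, hSw]

include hfin hi hβ hξ in
/-- The one-step expectation of a function of the number of steps into the trap and of the number
of remaining visits of the walk on the backbone, at the root of the trap. -/
theorem lintegral_wstep_of_eq (f : ℕ → ℕ → ℝ≥0∞) {S : List ℕ × ℕ} (hS : Reachable β ξ u S)
    (hSw : S.1 = w) (hw : OnBackbone ξ w) (C : ℕ) :
    ∃ n, visitsFrom β ξ u w S.2 = n + 1 ∧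
    ∫⁻ x, f (C + if S.1 = w ∧ (wstep β ξ u S x).1 = i :: w then 1 else 0)
      (visitsFrom β ξ u w (wstep β ξ u S x).2) =
      ENNReal.ofReal (β / (parentWeight w + β * ξ w)) * (f (C + 1) (n + 1) +
        ((otherChildren ξ w).length - 1 : ℕ) * f C (n + 1)) +
      ENNReal.ofReal (leaveProb β ξ w) * f C n := by
  obtain ⟨w', j⟩ := S
  subst hSw
  have hY : backboneWalk β ξ u j = w' := ((hS.onBackbone_iff hξ).1 hw).symm
  have hR := visitsFrom_eq_of_eq hfin hY
  refine ⟨_, hR, ?_⟩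
  rw [lintegral_wstep hξ hβ (w', j) fun S' => f (C + if w' = w' ∧ S'.1 = i :: w' then 1 else 0)
    (visitsFrom β ξ u w' S'.2)]
  have hi' := List.mem_toFinset.2 hi
  have hlv : leave β ξ u (w', j) = (backboneStep β ξ w' (u j), j + 1) := if_pos hw
  have hne : backboneStep β ξ w' (u j) ≠ i :: w' := by
    intro h0
    have h1 := onBackbone_backboneWalk (β := β) (u := u) hξ (j + 1)
    have h2 : backboneWalk β ξ u (j + 1) = backboneStep β ξ w' (u j) := by rw [← hY]; rfl
    rw [h2, h0] at h1
    exact (mem_otherChildren.1 hi).2 h1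
  rw [← Finset.add_sum_erase _ _ hi', hlv]
  have hcard : ((otherChildren ξ w').toFinset.erase i).card = (otherChildren ξ w').length - 1 := by
    have hnd : (otherChildren ξ w').Nodup := List.Nodup.filter _ List.nodup_range
    rw [Finset.card_erase_of_mem hi', List.toFinset_card_of_nodup hnd]
  have hsum : ∑ x ∈ (otherChildren ξ w').toFinset.erase i,
      f (C + if w' = w' ∧ x :: w' = i :: w' then 1 else 0) (visitsFrom β ξ u w' j) =
      ((otherChildren ξ w').length - 1 : ℕ) * f C (visitsFrom β ξ u w' (j + 1) + 1) := by
    rw [← hcard, ← nsmul_eq_mul, ← Finset.sum_const]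
    refine Finset.sum_congr rfl fun x hx => ?_
    have := (Finset.mem_erase.1 hx).1
    simp [this, hR]
  refine congrArg₂ (· + ·) (congrArg _ (congrArg₂ (· + ·) ?_ hsum)) ?_
  · simp [hR]
  · simp [hne]

theorem stayFactor_denom_pos {s b : ℝ} (hβ : 1 < β) (hs : s ≤ 1) (hb : 0 ≤ b) {k : ℕ}
    (hk : 0 < k) : 0 < b + β * k + β * (1 - s) := by
  positivity

theorem stayFactor_nonneg {s b : ℝ} (hβ : 1 < β) (hs : s ≤ 1) (hb : 0 ≤ b) (k : ℕ) :
    0 ≤ stayFactor β s b k := by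
  unfold stayFactor
  positivity

theorem stayFactor_le_one {s b : ℝ} (hβ : 1 < β) (hs : s ≤ 1) (hb : 0 ≤ b) (k : ℕ) :
    stayFactor β s b k ≤ 1 := by
  have h2 : 0 ≤ β * (1 - s) := mul_nonneg (by linarith) (by linarith)
  exact div_le_one_of_le₀ (by linarith) (by positivity)

theorem length_backboneChildren_pos_of_onBackbone (hw : OnBackbone ξ w) :
    (1 : ℝ) ≤ (backboneChildren ξ w).length := by
  exact_mod_cast hw.length_backboneChildren_pos

theorem total_weight_eq (β : ℝ) (ξ : Field) (w : List ℕ) : parentWeight w + β * ξ w =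
    parentWeight w + β * (backboneChildren ξ w).length + β * (otherChildren ξ w).length := by
  have h1 : ((backboneChildren ξ w).length : ℝ) + (otherChildren ξ w).length = ξ w := by
    exact_mod_cast length_backboneChildren_add ξ w
  rw [← h1]; ring

include hfin hi hβ hξ in
/-- A martingale: `stayFactor` is the generating function of the number of crossings made during
one stay of the walk on the backbone at `w`, and `visitsFrom` counts the stays that are not
over. -/
theorem lintegral_pow_crossings (hw : OnBackbone ξ w) {s : ℝ} (hs0 : 0 ≤ s) (hs1 : s ≤ 1)
    (t : ℕ) :
    ∫⁻ v, ENNReal.ofReal (s ^ crossings β ξ u w i v t *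
      stayFactor β s (parentWeight w) (backboneChildren ξ w).length ^
        visitsFrom β ξ u w (walkState β ξ u v t).2) ∂uniformSeq =
      ENNReal.ofReal (stayFactor β s (parentWeight w) (backboneChildren ξ w).length ^
        visitsFrom β ξ u w 0) := by
  set g := stayFactor β s (parentWeight w) (backboneChildren ξ w).length with hg
  have hg0 : 0 ≤ g := stayFactor_nonneg hβ hs1 (parentWeight_nonneg w) _
  induction t with
  | zero =>
    simp [crossings, walkState]
  | succ t ih =>
    rw [← ih, lintegral_walkState_succ w i t fun C S =>
      ENNReal.ofReal (s ^ C * g ^ visitsFrom β ξ u w S.2)]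
    refine lintegral_congr fun v => ?_
    have hr := reachable_walkState (β := β) (u := u) hξ v t
    by_cases hSw : (walkState β ξ u v t).1 = w
    · obtain ⟨n, hn, h1⟩ := lintegral_wstep_of_eq hfin hβ hξ hi
        (fun C n => ENNReal.ofReal (s ^ C * g ^ n)) hr hSw hw (crossings β ξ u w i v t)
      rw [h1, hn]
      have hlen := List.length_pos_of_mem hi
      have hA := total_weight_pos hξ hβ w
      rw [← ENNReal.ofReal_natCast, ← ENNReal.ofReal_mul (by positivity),
        ← ENNReal.ofReal_add (by positivity) (by positivity),
        ← ENNReal.ofReal_mul (by positivity), ← ENNReal.ofReal_mul (leaveProb_nonneg hβ w),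
        ← ENNReal.ofReal_add (by positivity)
          (mul_nonneg (leaveProb_nonneg hβ w) (by positivity))]
      congr 1
      set m := (otherChildren ξ w).length with hm
      have hm' : ((m - 1 : ℕ) : ℝ) = m - 1 := by rw [Nat.cast_sub hlen]; simp
      have hA' := total_weight_eq β ξ w
      set B := parentWeight w + β * (backboneChildren ξ w).length with hB
      have hgB : g * (B + β * (1 - s)) = B := by
        rw [hg, stayFactor, ← hB, div_mul_cancel₀ _ (stayFactor_denom_pos hβ
          hs1 (parentWeight_nonneg w) hw.length_backboneChildren_pos).ne']
      rw [leaveProb, ← hB, hm', hA', ← hm]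
      rw [hA', ← hm] at hA
      have key : β / (B + β * m) * (s * g + (m - 1) * g) + B / (B + β * m) = g := by
        rw [div_mul_eq_mul_div, ← add_div, div_eq_iff hA.ne']
        linear_combination (-1 : ℝ) * hgB
      calc β / (B + β * m) * (s ^ (crossings β ξ u w i v t + 1) * g ^ (n + 1) +
            (m - 1) * (s ^ crossings β ξ u w i v t * g ^ (n + 1))) +
            B / (B + β * m) * (s ^ crossings β ξ u w i v t * g ^ n)
          = s ^ crossings β ξ u w i v t * g ^ n *
            (β / (B + β * m) * (s * g + (m - 1) * g) + B / (B + β * m)) := by ring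
        _ = _ := by rw [key]; ring
    · exact lintegral_wstep_of_ne hξ (fun C n => ENNReal.ofReal (s ^ C * g ^ n)) hr hSw _

include hfin hi hβ hξ in
theorem lintegral_crossings_le (hw : OnBackbone ξ w) (t : ℕ) :
    ∫⁻ v, (crossings β ξ u w i v t : ℝ≥0∞) ∂uniformSeq ≤ visitsFrom β ξ u w 0 := by
  have key : ∫⁻ v, ENNReal.ofReal ((crossings β ξ u w i v t : ℝ) +
      visitsFrom β ξ u w (walkState β ξ u v t).2) ∂uniformSeq ≤
      ENNReal.ofReal (visitsFrom β ξ u w 0) := by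
    induction t with
    | zero => simp [crossings, walkState]
    | succ t ih =>
      refine le_trans ?_ ih
      rw [lintegral_walkState_succ w i t fun C S =>
        ENNReal.ofReal ((C : ℝ) + visitsFrom β ξ u w S.2)]
      refine lintegral_mono fun v => ?_
      have hr := reachable_walkState (β := β) (u := u) hξ v t
      by_cases hSw : (walkState β ξ u v t).1 = w
      · obtain ⟨n, hn, h1⟩ := lintegral_wstep_of_eq hfin hβ hξ hi
          (fun C n => ENNReal.ofReal ((C : ℝ) + n)) hr hSw hw (crossings β ξ u w i v t)
        rw [h1, hn]
        have hlen := List.length_pos_of_mem hi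
        have hA := total_weight_pos hξ hβ w
        rw [← ENNReal.ofReal_natCast ((otherChildren ξ w).length - 1),
          ← ENNReal.ofReal_mul (by positivity),
          ← ENNReal.ofReal_add (by positivity) (by positivity),
          ← ENNReal.ofReal_mul (by positivity), ← ENNReal.ofReal_mul (leaveProb_nonneg hβ w),
          ← ENNReal.ofReal_add (by positivity)
            (mul_nonneg (leaveProb_nonneg hβ w) (by positivity))]
        refine ENNReal.ofReal_le_ofReal ?_
        set m := (otherChildren ξ w).length with hm
        have hm' : ((m - 1 : ℕ) : ℝ) = m - 1 := by rw [Nat.cast_sub hlen]; simp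
        have hA' := total_weight_eq β ξ w
        have hz := length_backboneChildren_pos_of_onBackbone hw
        have hB1 : β ≤ parentWeight w + β * (backboneChildren ξ w).length := by
          have := parentWeight_nonneg w
          nlinarith
        set B := parentWeight w + β * (backboneChildren ξ w).length with hB
        rw [leaveProb, ← hB, hm', hA', ← hm]
        rw [hA', ← hm] at hA
        push_cast
        rw [div_mul_eq_mul_div, div_mul_eq_mul_div, ← add_div, div_le_iff₀ hA]
        nlinarith
      · exact (lintegral_wstep_of_ne hξ (fun C n => ENNReal.ofReal ((C : ℝ) + n)) hr hSw _).le
  rw [ENNReal.ofReal_natCast] at key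
  refine le_trans (lintegral_mono fun v => ?_) key
  rw [← ENNReal.ofReal_natCast]
  exact ENNReal.ofReal_le_ofReal (by simp)

theorem tsum_crossings (v : ℕ → I) : (⨆ t, (crossings β ξ u w i v t : ℝ≥0∞)) =
    {t | walk β ξ u v t = w ∧ walk β ξ u v (t + 1) = i :: w}.encard := by
  rw [← ENNReal.tsum_set_one,
    tsum_subtype {t | walk β ξ u v t = w ∧ walk β ξ u v (t + 1) = i :: w} (fun _ => (1 : ℝ≥0∞)),
    ENNReal.tsum_eq_iSup_nat]
  refine iSup_congr fun t => ?_
  rw [crossings]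
  push_cast
  refine Finset.sum_congr rfl fun m _ => ?_
  rw [Set.indicator_apply]
  simp only [Set.mem_ofPred_eq]

include hfin hi hβ hξ in
theorem lintegral_encard_crossings_le (hw : OnBackbone ξ w) :
    ∫⁻ v, ({t | walk β ξ u v t = w ∧ walk β ξ u v (t + 1) = i :: w}.encard : ℝ≥0∞) ∂uniformSeq ≤
      visitsFrom β ξ u w 0 := by
  simp_rw [← tsum_crossings]
  rw [lintegral_iSup]
  · exact iSup_le fun t => lintegral_crossings_le hfin hβ hξ hi hw t
  · exact fun t => (measurable_of_countable fun n : ℕ => (n : ℝ≥0∞)).comp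
      (measurable_crossings w i t)
  · intro t t' htt' v
    simp only [Nat.cast_le]
    exact Finset.sum_le_sum_of_subset (Finset.range_mono htt')

include hfin hi hβ hξ in
theorem lintegral_totalCrossings_le (hw : OnBackbone ξ w) :
    ∫⁻ v, (totalCrossings β ξ u v w i : ℝ≥0∞) ∂uniformSeq ≤ visitsFrom β ξ u w 0 := by
  refine (lintegral_mono fun v => ?_).trans (lintegral_encard_crossings_le hfin hβ hξ hi hw)
  have h2 : (totalCrossings β ξ u v w i : ℕ∞) ≤
      {t | walk β ξ u v t = w ∧ walk β ξ u v (t + 1) = i :: w}.encard := Set.ncard_le_encard _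
  simpa using ENat.toENNReal_le.2 h2

include hfin hi hβ hξ in
theorem lintegral_pow_totalCrossings (hw : OnBackbone ξ w) {s : ℝ} (hs0 : 0 ≤ s) (hs1 : s ≤ 1) :
    ∫⁻ v, ENNReal.ofReal (s ^ totalCrossings β ξ u v w i) ∂uniformSeq =
      ENNReal.ofReal (stayFactor β s (parentWeight w) (backboneChildren ξ w).length ^
        visitsFrom β ξ u w 0) := by
  set g := stayFactor β s (parentWeight w) (backboneChildren ξ w).length with hg
  have hg0 : 0 ≤ g := stayFactor_nonneg hβ hs1 (parentWeight_nonneg w) _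
  have hmeas : Measurable fun v : ℕ → I =>
      ({t | walk β ξ u v t = w ∧ walk β ξ u v (t + 1) = i :: w}.encard : ℝ≥0∞) := by
    simp_rw [← tsum_crossings]
    exact Measurable.iSup fun t => (measurable_of_countable fun n : ℕ => (n : ℝ≥0∞)).comp
      (measurable_crossings w i t)
  have hfinite := ae_lt_top hmeas (ne_top_of_le_ne_top (ENNReal.natCast_ne_top _)
    (lintegral_encard_crossings_le hfin hβ hξ hi hw))
  obtain ⟨J, hJ⟩ := exists_visitsFrom_eq_zero hfin
  have hlim : Tendsto (fun t => ∫⁻ v, ENNReal.ofReal (s ^ crossings β ξ u w i v t *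
      g ^ visitsFrom β ξ u w (walkState β ξ u v t).2) ∂uniformSeq) atTop
      (nhds (∫⁻ v, ENNReal.ofReal (s ^ totalCrossings β ξ u v w i) ∂uniformSeq)) := by
    refine tendsto_lintegral_of_dominated_convergence (fun _ => 1) (fun t => ?_)
      (fun t => Eventually.of_forall fun v => ?_) (by simp) ?_
    · exact (measurable_of_countable fun y : ℕ × (List ℕ × ℕ) =>
        ENNReal.ofReal (s ^ y.1 * g ^ visitsFrom β ξ u w y.2.2)).comp
          ((measurable_crossings w i t).prodMk (measurable_walkState_right β ξ u t))
    · rw [← ENNReal.ofReal_one]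
      exact ENNReal.ofReal_le_ofReal (mul_le_one₀ (pow_le_one₀ hs0 hs1) (by positivity)
        (pow_le_one₀ hg0 (stayFactor_le_one hβ hs1 (parentWeight_nonneg w) _)))
    · filter_upwards [hfinite, ae_tendsto_walkState_snd hβ hξ] with v hv hv'
      have hset : {t | walk β ξ u v t = w ∧ walk β ξ u v (t + 1) = i :: w}.Finite := by
        rw [← Set.encard_lt_top_iff]
        exact_mod_cast hv
      refine tendsto_const_nhds.congr' ?_
      obtain ⟨T, hT⟩ := hset.bddAbove
      filter_upwards [hv' J, eventually_gt_atTop T] with t ht hTt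
      rw [hJ _ ht, pow_zero, mul_one]
      congr 2
      rw [crossings, totalCrossings, Finset.sum_ite, Finset.sum_const_zero, add_zero,
        Finset.sum_const, smul_eq_mul, mul_one, ← Set.ncard_coe_finset]
      congr 1
      ext m
      simp only [Set.mem_ofPred_eq, Finset.coe_filter, Finset.mem_range]
      exact ⟨fun hm => ⟨(hT hm).trans_lt hTt, hm⟩, fun hm => hm.2⟩
  exact tendsto_nhds_unique hlim (tendsto_const_nhds.congr fun t =>
    (lintegral_pow_crossings hfin hβ hξ hi hw hs0 hs1 t).symm)

end

end BiasedWalk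

/-! ### Weak convergence of laws on the natural numbers -/

/-- A law on `ℕ` is determined by its generating function: the functions `k ↦ 2 ^ (-j * k)` span a
subalgebra of the bounded functions which separates points. -/
theorem ext_of_lintegral_pow {μ ν : Measure ℕ} [IsProbabilityMeasure μ] [IsProbabilityMeasure ν]
    (h : ∀ s : ℝ, 0 ≤ s → s < 1 →
      ∫⁻ k, ENNReal.ofReal (s ^ k) ∂μ = ∫⁻ k, ENNReal.ofReal (s ^ k) ∂ν) : μ = ν := by
  let f : BoundedContinuousFunction ℕ ℝ := .ofNormedAddCommGroup (fun k => (1 / 2) ^ k)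
    continuous_of_discreteTopology 1 fun k => by simp [inv_le_one_of_one_le₀, one_le_pow₀]
  refine ext_of_forall_mem_subalgebra_integral_eq_of_pseudoEMetric_complete_countable
    (A := ⟨Algebra.adjoin ℝ {f}, fun h => h⟩) (fun x y hxy => ⟨f,
      ⟨f, ⟨f, Algebra.subset_adjoin rfl, rfl⟩, rfl⟩, fun h => hxy (by simpa [f] using h)⟩)
      fun g hg => ?_
  rw [Algebra.adjoin_singleton_eq_range_aeval] at hg
  obtain ⟨p, rfl⟩ := hg
  simp only [Polynomial.aeval_eq_sum_range, AlgHom.toRingHom_eq_coe, RingHom.coe_coe,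
    BoundedContinuousFunction.coe_sum, Finset.sum_apply]
  rw [integral_finsetSum _ fun i _ => BoundedContinuousFunction.integrable _ _,
    integral_finsetSum _ fun i _ => BoundedContinuousFunction.integrable _ _]
  refine Finset.sum_congr rfl fun j _ => ?_
  simp only [BoundedContinuousFunction.coe_smul, integral_const_mul, smul_eq_mul]
  rcases eq_or_ne j 0 with rfl | hj
  · simp
  rw [integral_eq_lintegral_of_nonneg_ae (.of_forall fun k => by simp [f]) (by fun_prop),
    integral_eq_lintegral_of_nonneg_ae (.of_forall fun k => by simp [f]) (by fun_prop)]
  have := h ((1 / 2) ^ j) (by positivity) (pow_lt_one₀ (by simp) (by norm_num) hj)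
  simp_rw [← pow_mul, mul_comm j, pow_mul] at this
  exact congr_arg _ (congr_arg _ this)

theorem tendsto_lintegral_pow_nhds (ν : ProbabilityMeasure ℕ) {s : ℝ} (h0 : 0 ≤ s) (h1 : s ≤ 1) :
    Tendsto (fun μ : ProbabilityMeasure ℕ => ∫⁻ k, ENNReal.ofReal (s ^ k) ∂(μ : Measure ℕ))
      (nhds ν) (nhds (∫⁻ k, ENNReal.ofReal (s ^ k) ∂(ν : Measure ℕ))) :=
  (ProbabilityMeasure.tendsto_iff_forall_lintegral_tendsto
   ).1 tendsto_id (BoundedContinuousFunction.nnrealPart (.ofNormedAddCommGroup (s ^ ·)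
      continuous_of_discreteTopology 1 fun k => by simp [abs_of_nonneg, h0, pow_le_one₀, h1]))

/-- Tight laws on `ℕ` whose generating functions converge have a limit. -/
theorem exists_tendsto_of_tendsto_lintegral_pow {μ : ℕ → ProbabilityMeasure ℕ} {c : ℝ≥0∞}
    (hc : c ≠ ∞) (hμ : ∀ n, ∫⁻ k, (k : ℝ≥0∞) ∂(μ n : Measure ℕ) ≤ c)
    (hφ : ∀ s : ℝ, 0 ≤ s → s < 1 → ∃ φ, Tendsto
      (fun n => ∫⁻ k, ENNReal.ofReal (s ^ k) ∂(μ n : Measure ℕ)) atTop (nhds φ)) :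
    ∃ ν : ProbabilityMeasure ℕ, Tendsto μ atTop (nhds ν) := by
  have htight : IsTightMeasureSet
      {((m : ProbabilityMeasure ℕ) : Measure ℕ) | m ∈ Set.range μ} := by
    rw [isTightMeasureSet_iff_exists_isCompact_measure_compl_le]
    intro ε hε
    obtain ⟨N, hN⟩ := ENNReal.exists_nat_mul_gt hε.ne' hc
    refine ⟨Set.Iio N, (Set.finite_Iio N).isCompact, ?_⟩
    rintro _ ⟨_, ⟨n, rfl⟩, rfl⟩
    have h2 : (Set.Iio N)ᶜ = {k : ℕ | (N : ℝ≥0∞) ≤ k} := by ext; simp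
    by_contra! h
    exact hN.not_ge (((mul_le_mul_right h.le _).trans (h2 ▸ mul_meas_ge_le_lintegral
      (measurable_of_countable fun k : ℕ => (k : ℝ≥0∞)) N)).trans (hμ n))
  have hcomp := isCompact_closure_of_isTightMeasureSet htight
  have hmem : ∀ᶠ n in atTop, μ n ∈ closure (Set.range μ) :=
    .of_forall fun n => subset_closure ⟨n, rfl⟩
  obtain ⟨ν, hν, hcl⟩ := hcomp.exists_mapClusterPt (tendsto_principal.2 hmem)
  refine ⟨ν, hcomp.tendsto_nhds_of_unique_mapClusterPt hmem
    fun ν' _ hcl' => Subtype.ext (ext_of_lintegral_pow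
      (μ := (ν' : Measure ℕ)) (ν := (ν : Measure ℕ)) fun s h0 h1 => ?_)⟩
  obtain ⟨φ, hφ⟩ := hφ s h0 h1
  have : ∀ ν, MapClusterPt ν atTop μ → ∫⁻ k, ENNReal.ofReal (s ^ k) ∂(ν : Measure ℕ) = φ :=
    fun ν hν => eq_of_nhds_neBot <|
      ClusterPt.mono (hν.tendsto_comp (tendsto_lintegral_pow_nhds ν h0 h1.le)) hφ
  exact (this ν' hcl').trans (this ν hcl).symm

/-! ### The law of the number of visits -/

namespace BiasedGW

open PlaneTree BiasedWalk

variable {D : BiasedGW}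

theorem firstBigTime_eq (β : ℝ) (ξ : Field) (u : ℕ → I) (h : ℕ) :
    firstBigTime β ξ u h = firstTime 0 β h ξ u := by
  simp only [firstBigTime, firstTime, BigAt, bw_zero_eq]

theorem firstBigRoot_eq (β : ℝ) (ξ : Field) (u : ℕ → I) (h : ℕ) :
    firstBigRoot β ξ u h = firstRoot 0 β h ξ u := by
  rw [firstBigRoot, firstRoot, firstBigTime_eq, bw_zero_eq]

theorem measurable_firstBigBud (β : ℝ) (h : ℕ) :
    Measurable fun p : Field × (ℕ → I) => firstBigBud β p.1 p.2 h := by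
  simp only [firstBigBud, firstBigRoot_eq]
  exact .discrete_apply (f := fun w (p : Field × (ℕ → I)) => sInf {i | IsBigTrap p.1 h w i} :: w)
    (fun w => (measurable_of_countable (· :: w)).comp (measurable_sInf_nat fun i => by fun_prop))
    (measurable_firstRoot 0 β h)

theorem measurable_numVisits (β : ℝ) (h : ℕ) :
    Measurable fun ω : Field × (ℕ → I) × (ℕ → I) => numVisits β ω.1 ω.2.1 ω.2.2 h := by
  refine measurable_ncard_nat fun t => ?_
  have hw t : Measurable fun ω : Field × (ℕ → I) × (ℕ → I) => walk β ω.1 ω.2.1 ω.2.2 t :=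
    measurable_fst.comp (measurable_walkState β t)
  have hp : Measurable fun ω : Field × (ℕ → I) × (ℕ → I) => (ω.1, ω.2.1) := by fun_prop
  have hb := (measurable_firstBigBud β h).comp hp
  simp_rw [firstBigRoot_eq]
  fun_prop

theorem measurable_W (D : BiasedGW) (ε : ℝ) (n : ℕ) : Measurable (D.W ε n) :=
  measurable_numVisits D.β _

theorem lintegral_walkMeasure (D : BiasedGW) {F : Field × (ℕ → I) × (ℕ → I) → ℝ≥0∞}
    (hF : Measurable F) : ∫⁻ ω, F ω ∂D.walkMeasure = (D.treeWalk D.good)⁻¹ *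
      ∫⁻ p in D.good, ∫⁻ v, F (p.1, p.2, v) ∂uniformSeq ∂D.treeWalk := by
  set A : Set (Field × (ℕ → I) × (ℕ → I)) :=
    {ω | height ω.1 = ⊤ ∧ IsSuperRegeneration D.β ω.2.1 0} with hA
  have hassoc : (D.treeWalk.prod uniformSeq).map MeasurableEquiv.prodAssoc =
      (gwMeasure D.p).prod (uniformSeq.prod uniformSeq) := Measure.prodAssoc_prod
  have hpre : MeasurableEquiv.prodAssoc ⁻¹' A = D.good ×ˢ (Set.univ : Set (ℕ → I)) :=
    Set.ext fun ω => (and_iff_left trivial).symm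
  have hAm := (MeasurableEquiv.measurableSet_preimage MeasurableEquiv.prodAssoc).1
    (hpre ▸ D.measurableSet_good.prod .univ)
  have hμA : ((gwMeasure D.p).prod (uniformSeq.prod uniformSeq)) A = D.treeWalk D.good := by
    rw [← hassoc, Measure.map_apply (MeasurableEquiv.measurable _) hAm, hpre, Measure.prod_prod,
      measure_univ, mul_one]
  rw [walkMeasure, condLaw, if_neg (hμA ▸ D.measure_good_ne_zero), ProbabilityTheory.cond, hμA,
    lintegral_smul_measure, ← hassoc,
    Measure.restrict_map (MeasurableEquiv.measurable _) hAm, hpre,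
    lintegral_map hF (MeasurableEquiv.measurable _), ← Measure.prod_restrict,
    Measure.restrict_univ, lintegral_prod]
  · rfl
  · exact (hF.comp (MeasurableEquiv.measurable _)).aemeasurable

/-- The generating function at `s` of the number of visits to a trap, as a local functional. -/
noncomputable def visitsGen (β s b : ℝ) (k n : ℕ) : ℝ≥0∞ :=
  min 1 (ENNReal.ofReal (stayFactor β s b k ^ n))

theorem visitsGen_le_one (β s b : ℝ) (k n : ℕ) : visitsGen β s b k n ≤ 1 := min_le_left _ _

theorem visitsFrom_zero (β : ℝ) (ξ : Field) (u : ℕ → I) (w : List ℕ) :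
    visitsFrom β ξ u w 0 = visits 0 β ξ u w := by
  simp [visitsFrom, visits, bw_zero_eq]

theorem numVisits_eq (β : ℝ) (ξ : Field) (u v : ℕ → I) (h : ℕ) : numVisits β ξ u v h =
    totalCrossings β ξ u v (firstRoot 0 β h ξ u) (sInf {i | IsBigTrap ξ h (firstRoot 0 β h ξ u) i})
    := by
  rw [numVisits, totalCrossings, firstBigBud, firstBigRoot_eq]

section

variable {h : ℕ} {ξ : Field} {u : ℕ → I} (hξ : height ξ = ⊤)
  (hf : Found 0 D.β h ξ u) (hfin : ∀ l : ℤ, {n | intWalk D.β u n ≤ l}.Finite)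

include hf in
theorem sInf_mem_otherChildren : sInf {i | IsBigTrap ξ h (firstRoot 0 D.β h ξ u) i} ∈
    otherChildren ξ (firstRoot 0 D.β h ξ u) := by
  have h2 := Nat.sInf_mem (Nat.sInf_mem (s :=
    {n | BigAt ξ h (bw 0 D.β ξ u n)}) hf)
  exact mem_otherChildren.2 ⟨h2.1, h2.2.1⟩

include hξ hfin in
theorem finite_visits (w : List ℕ) : {n | backboneWalk D.β ξ u n = w}.Finite := by
  refine (hfin w.length).subset fun n hn => ?_
  have := intWalk_le_length D.one_lt_bias le_rfl zero_le_one hξ u n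
  rwa [bw_zero_eq, hn] at this

include hξ hf hfin in
theorem lintegral_pow_numVisits {s : ℝ} (h0 : 0 ≤ s) (h1 : s ≤ 1) :
    ∫⁻ v, ENNReal.ofReal (s ^ numVisits D.β ξ u v h) ∂uniformSeq =
      localVal (visitsGen D.β s) 0 D.β ξ u (firstRoot 0 D.β h ξ u) := by
  simp_rw [numVisits_eq]
  have hw := onBackbone_bw (a := 0) (β := D.β) hξ u (firstTime 0 D.β h ξ u)
  rw [lintegral_pow_totalCrossings (finite_visits hξ hfin _) D.one_lt_bias hξ
    (sInf_mem_otherChildren hf) hw h0 h1, localVal, visitsGen, rootedWeight_zero, visitsFrom_zero,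
    min_eq_right]
  rw [← ENNReal.ofReal_one]
  exact ENNReal.ofReal_le_ofReal (pow_le_one₀
    (stayFactor_nonneg D.one_lt_bias h1 (parentWeight_nonneg _) _)
    (stayFactor_le_one D.one_lt_bias h1 (parentWeight_nonneg _) _))

include hξ hf hfin in
theorem lintegral_numVisits_le : ∫⁻ v, (numVisits D.β ξ u v h : ℝ≥0∞) ∂uniformSeq ≤
    visits 0 D.β ξ u (firstRoot 0 D.β h ξ u) := by
  simp_rw [numVisits_eq]
  rw [← visitsFrom_zero]
  exact lintegral_totalCrossings_le (finite_visits hξ hfin _) D.one_lt_bias hξ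
    (sInf_mem_otherChildren hf) (onBackbone_bw (a := 0) hξ u (firstTime 0 D.β h ξ u))

end

theorem ae_good_found_finite (D : BiasedGW) (h : ℕ) :
    ∀ᵐ p ∂D.treeWalk.restrict D.good, height p.1 = ⊤ ∧ Found 0 D.β h p.1 p.2 ∧
      ∀ l : ℤ, {n | intWalk D.β p.2 n ≤ l}.Finite := by
  rw [ae_restrict_iff' D.measurableSet_good]
  filter_upwards [ae_found D h, Measure.quasiMeasurePreserving_snd.ae (ae_finite_intWalk_le
    D.one_lt_bias)] with p hp1 hp2 hp3
  exact ⟨hp3.1, hp1 hp3, hp2⟩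

theorem lintegral_pow_W (D : BiasedGW) (ε : ℝ) (n : ℕ) {s : ℝ} (h0 : 0 ≤ s) (h1 : s ≤ 1) :
    ∫⁻ ω, ENNReal.ofReal (s ^ D.W ε n ω) ∂D.walkMeasure =
      (D.treeWalk D.good)⁻¹ * D.rootVal 0 (D.bigHeight ε n) (visitsGen D.β s) := by
  rw [lintegral_walkMeasure D (F := fun ω => ENNReal.ofReal (s ^ D.W ε n ω))
    ((measurable_of_countable fun k : ℕ => ENNReal.ofReal (s ^ k)).comp (measurable_W D ε n)),
    rootVal]
  congr 1
  refine lintegral_congr_ae ?_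
  filter_upwards [ae_good_found_finite D (D.bigHeight ε n)] with p hp
  have h2 : p ∈ D.foundEvent 0 (D.bigHeight ε n) := hp.2.1
  rw [Set.indicator_of_mem h2]
  exact lintegral_pow_numVisits hp.1 hp.2.1 hp.2.2 h0 h1

/-- A bound for the expected number of visits, uniformly in the height of the trap. -/
noncomputable def visitsBound (D : BiasedGW) : ℝ≥0∞ :=
  (D.treeWalk D.good)⁻¹ * ∑' i, uniformSeq {u | intWalk D.β u i ≤ 0}

theorem visitsBound_ne_top (D : BiasedGW) : D.visitsBound ≠ ∞ :=
  ENNReal.mul_ne_top (ENNReal.inv_ne_top.2 D.measure_good_ne_zero)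
    (tsum_measure_intWalk_le_ne_top D.one_lt_bias 0)

theorem lintegral_W_le (D : BiasedGW) (ε : ℝ) (n : ℕ) :
    ∫⁻ ω, (D.W ε n ω : ℝ≥0∞) ∂D.walkMeasure ≤ D.visitsBound := by
  rw [lintegral_walkMeasure D (F := fun ω => (D.W ε n ω : ℝ≥0∞))
    ((measurable_of_countable fun k : ℕ => (k : ℝ≥0∞)).comp (measurable_W D ε n))]
  refine mul_le_mul_right ((lintegral_mono_ae ?_).trans
    (lintegral_visits_firstRoot_le (D := D) (a := 0) le_rfl zero_le_one (D.bigHeight ε n))) _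
  filter_upwards [ae_good_found_finite D (D.bigHeight ε n)] with p hp
  have h2 : p ∈ D.foundEvent 0 (D.bigHeight ε n) := hp.2.1
  rw [Set.indicator_of_mem h2]
  exact lintegral_numVisits_le hp.1 hp.2.1 hp.2.2

theorem tendsto_bigHeight (D : BiasedGW) {ε : ℝ} (hε : ε < 1) :
    Tendsto (fun n => D.bigHeight ε n) atTop atTop := by
  exact tendsto_nat_ceil_atTop.comp (Tendsto.atTop_div_const (neg_pos.2 (Real.log_neg D.r_pos
    D.r_lt_one)) (Tendsto.const_mul_atTop (by
    linarith) (Real.tendsto_log_atTop.comp tendsto_natCast_atTop_atTop)))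

/-- The number of visits converges in law. -/
theorem exists_tendsto_law_W (D : BiasedGW) {ε : ℝ} (hε : ε < 1) : ∃ μW : ProbabilityMeasure ℕ,
    Tendsto (β := ProbabilityMeasure ℕ) (fun n => ⟨D.walkMeasure.map (D.W ε n),
      Measure.isProbabilityMeasure_map (measurable_W D ε n).aemeasurable⟩) atTop (nhds μW) := by
  refine exists_tendsto_of_tendsto_lintegral_pow (visitsBound_ne_top D) (fun n => ?_)
    fun s h0 h1 => ?_
  · refine Eq.trans_le ?_ (lintegral_W_le D ε n)
    exact lintegral_map (measurable_of_countable _) (measurable_W D ε n)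
  · have h2 := (tendsto_rootVal D (visitsGen_le_one D.β s)).comp (tendsto_bigHeight D hε)
    refine ⟨_, (ENNReal.Tendsto.const_mul h2 (Or.inr (ENNReal.inv_ne_top.2
      D.measure_good_ne_zero))).congr fun n => ?_⟩
    exact Eq.trans (lintegral_pow_W D ε n h0 h1.le).symm ((lintegral_map (f := fun k : ℕ =>
      ENNReal.ofReal (s ^ k))
      (measurable_of_countable _) (measurable_W D ε n)).symm)

end BiasedGW

/-! ### Harmonic analysis on a finite trap -/

namespace PlaneTree

open Classical in
/-- The vertices of a finite tree (the empty set if the tree is infinite). -/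
noncomputable def vertices (ξ : Field) : Finset (List ℕ) :=
  if h : height ξ ≠ ⊤ then (finite_mem h).toFinset else ∅

variable {ξ : Field}

theorem mem_nil (ξ : Field) : Mem ξ [] := trivial

theorem mem_vertices (h : height ξ ≠ ⊤) {v : List ℕ} : v ∈ vertices ξ ↔ Mem ξ v := by
  simp [vertices, h]

theorem height_sub_ne_top (h : height ξ ≠ ⊤) {w : List ℕ} (hw : Mem ξ w) :
    height (sub ξ w) ≠ ⊤ :=
  ne_top_of_le_ne_top h (height_le_of_sub hw)

/-- Every vertex other than the root is a child of exactly one vertex. -/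
theorem sum_vertices_children {M : Type*} [AddCommMonoid M] (h : height ξ ≠ ⊤)
    (A : List ℕ → M) :
    A [] + ∑ x ∈ vertices ξ, ∑ i ∈ Finset.range (ξ x), A (i :: x) = ∑ x ∈ vertices ξ, A x := by
  rw [← Finset.add_sum_erase _ A ((mem_vertices h).2 (mem_nil ξ)), Finset.sum_sigma']
  congr 1
  refine Finset.sum_bij (fun (y : (_ : List ℕ) × ℕ) _ => y.2 :: y.1) (fun y hy => ?_)
    (fun y _ y' _ he => ?_) (fun x hx => ?_) fun y _ => rfl
  · simp only [Finset.mem_sigma, Finset.mem_range, mem_vertices h] at hy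
    simp only [Finset.mem_erase, mem_vertices h, ne_eq, reduceCtorEq, not_false_eq_true, true_and]
    exact hy
  · obtain ⟨y1, y2⟩ := y
    obtain ⟨rfl, rfl⟩ := he
    rfl
  · simp only [Finset.mem_erase, mem_vertices h] at hx
    obtain _ | ⟨i, x⟩ := x
    · exact absurd rfl hx.1
    · refine ⟨⟨x, i⟩, ?_, rfl⟩
      simp only [Finset.mem_sigma, Finset.mem_range, mem_vertices h]
      exact hx.2

theorem sum_vertices_sub_le {w : List ℕ} (h : height ξ ≠ ⊤) (hw : Mem ξ w) {F : List ℕ → ℝ}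
    (hF : ∀ v, 0 ≤ F v) : ∑ v ∈ vertices (sub ξ w), F (v ++ w) ≤ ∑ v ∈ vertices ξ, F v := by
  rw [← Finset.sum_image (f := F) fun v _ v' _ he =>
    List.append_cancel_right he]
  refine Finset.sum_le_sum_of_subset_of_nonneg (fun v hv => ?_) fun v _ _ => hF v
  obtain ⟨x, hx, rfl⟩ := Finset.mem_image.1 hv
  exact (mem_vertices h).2 (mem_append.2 ⟨hw, (mem_vertices (height_sub_ne_top h hw)).1 hx⟩)

theorem sum_vertices_node {M : Type*} [AddCommMonoid M] (h : height ξ ≠ ⊤) (F : List ℕ → M) :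
    ∑ v ∈ vertices ξ, F v =
      F [] + ∑ i ∈ Finset.range (ξ []), ∑ v ∈ vertices (sub ξ [i]), F (v ++ [i]) := by
  have hm : ∀ {i}, i < ξ [] → Mem ξ [i] := fun hi => ⟨trivial, hi⟩
  rw [← Finset.add_sum_erase _ F ((mem_vertices h).2 (mem_nil ξ)), Finset.sum_sigma']
  congr 1
  refine (Finset.sum_bij (fun y _ => y.2 ++ [y.1]) (fun y hy => ?_) (fun y _ y' _ he => ?_)
    (fun x hx => ?_) fun y _ => rfl).symm
  · simp only [Finset.mem_sigma, Finset.mem_range] at hy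
    rw [mem_vertices (height_sub_ne_top h (hm hy.1))] at hy
    simp only [Finset.mem_erase, mem_vertices h, ne_eq, List.append_eq_nil_iff, reduceCtorEq,
      and_false, not_false_eq_true, true_and]
    exact mem_append.2 ⟨hm hy.1, hy.2⟩
  · obtain ⟨y1, y2⟩ := y
    have he' := List.append_inj' he rfl
    simp only [List.cons.injEq, and_true] at he'
    obtain ⟨rfl, rfl⟩ := he'
    rfl
  · simp only [Finset.mem_erase, mem_vertices h] at hx
    obtain ⟨y, i, rfl⟩ := List.eq_nil_or_concat'  x |>.resolve_left hx.1
    have hx' := mem_append.1 hx.2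
    refine ⟨⟨i, y⟩, ?_, rfl⟩
    simp only [Finset.mem_sigma, Finset.mem_range]
    exact ⟨hx'.1.2, (mem_vertices (height_sub_ne_top h hx'.1)).2 hx'.2⟩

end PlaneTree

namespace BiasedWalk

open PlaneTree

/-- The parent of a vertex of a trap; the parent of the bud is the root `none` of the trap. -/
def parent : List ℕ → Option (List ℕ)
  | [] => none
  | _ :: w => some w

/-- The Laplace operator of a trap at the vertex `w`, for the conductances `1` of the edge to the
parent and `β` of the edges to the children. -/
noncomputable def lap {E : Type*} [AddCommGroup E] [Module ℝ E] (β : ℝ) (ξ : Field)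
    (f : Option (List ℕ) → E) (w : List ℕ) : E :=
  (1 + β * ξ w) • f (some w) - β • ∑ i ∈ Finset.range (ξ w), f (some (i :: w)) - f (parent w)

variable {β : ℝ} {ξ : Field}

/-- Green's identity. -/
theorem sum_mul_lap_sub (h : height ξ ≠ ⊤) (f g : Option (List ℕ) → ℂ) :
    ∑ x ∈ vertices ξ, (β : ℂ) ^ x.length *
        (g (some x) * lap β ξ f x - f (some x) * lap β ξ g x) =
      f (some []) * g none - g (some []) * f none := by
  have key := sum_vertices_children h fun x => (β : ℂ) ^ x.length *
    (f (some x) * g (parent x) - g (some x) * f (parent x))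
  simp only [List.length_nil, pow_zero, one_mul] at key
  rw [← eq_sub_iff_add_eq, ← Finset.sum_sub_distrib] at key
  refine Eq.trans (Finset.sum_congr rfl fun x _ => ?_) key.symm
  simp only [lap, parent, List.length_cons, Complex.real_smul]
  rw [← Finset.mul_sum, Finset.sum_sub_distrib, ← Finset.sum_mul, ← Finset.sum_mul]
  ring

/-- The gradient of a function is the sum of its Laplacian over the vertices below. -/
theorem sum_lap_eq (h : height ξ ≠ ⊤) (f : Option (List ℕ) → ℂ) {w : List ℕ} (hw : Mem ξ w) :
    ∑ x ∈ vertices (sub ξ w), (β : ℂ) ^ x.length * lap β ξ f (x ++ w) =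
      f (some w) - f (parent w) := by
  have key := sum_mul_lap_sub (β := β) (height_sub_ne_top h hw)
    (fun o => o.elim (f (parent w)) fun y => f (some (y ++ w))) fun _ => 1
  simp only [Option.elim_some, List.nil_append, Option.elim_none, one_mul, mul_one] at key
  rw [← key]
  refine Finset.sum_congr rfl fun x _ => ?_
  have h1 : lap β (sub ξ w) (fun _ => (1 : ℂ)) x = 0 := by
    simp only [lap, Finset.sum_const, Finset.card_range, Complex.real_smul, sub]
    push_cast
    ring
  rw [h1, mul_zero, sub_zero]
  cases x <;> rfl

/-- The sum of the conductances at the vertices of a trap, a vertex of the generation `l` having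
the weight `β ^ l`. -/
noncomputable def totalWeight (β : ℝ) (ξ : Field) : ℝ :=
  ∑ x ∈ vertices ξ, β ^ x.length * (1 + β * ξ x)

theorem totalWeight_nonneg (hβ : 0 < β) (ξ : Field) : 0 ≤ totalWeight β ξ :=
  Finset.sum_nonneg fun x _ => by positivity

theorem totalWeight_add_one (h : height ξ ≠ ⊤) :
    totalWeight β ξ + 1 = 2 * ∑ x ∈ vertices ξ, β ^ x.length := by
  have key := sum_vertices_children h fun x => β ^ x.length
  simp only [List.length_cons, Finset.sum_const, Finset.card_range] at key
  rw [two_mul]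
  nth_rewrite 1 [← key]
  rw [add_comm, add_assoc, ← Finset.sum_add_distrib]
  congr 1
  refine Finset.sum_congr rfl fun x _ => by ring

theorem totalWeight_node (h : height ξ ≠ ⊤) : totalWeight β ξ =
    1 + β * ξ [] + β * ∑ i ∈ Finset.range (ξ []), totalWeight β (sub ξ [i]) := by
  rw [totalWeight, sum_vertices_node h]
  simp only [List.length_nil, pow_zero, one_mul, List.length_append, List.length_singleton,
    totalWeight, Finset.mul_sum, sub]
  congr 1
  refine Finset.sum_congr rfl fun i _ => Finset.sum_congr rfl fun x _ => by ring

theorem totalWeight_sub_le (hβ : 0 < β) (h : height ξ ≠ ⊤) {w : List ℕ} (hw : Mem ξ w) :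
    β ^ w.length * totalWeight β (sub ξ w) ≤ totalWeight β ξ := by
  refine Eq.trans_le ?_ (sum_vertices_sub_le h hw
    fun v => by positivity)
  rw [totalWeight, Finset.mul_sum]
  simp only [List.length_append, sub]
  ring

/-- The Green function of a trap with pole `d`, up to a constant factor. -/
noncomputable def green (β : ℝ) (d : List ℕ) : List ℕ → ℝ
  | [] => 1
  | i :: w => green β d w + if i :: w <:+ d then (β⁻¹) ^ (w.length + 1) else 0

/-- The Green function, with the value `0` at the root of the trap. -/
noncomputable def greenExt (β : ℝ) (d : List ℕ) (o : Option (List ℕ)) : ℝ := o.elim 0 (green β d)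

theorem greenExt_sub_parent (β : ℝ) (d w : List ℕ) : greenExt β d (some w) -
    greenExt β d (parent w) = if w <:+ d then (β⁻¹) ^ w.length else 0 := by
  cases w <;> simp [greenExt, parent, green]

theorem lap_eq_sub {E : Type*} [AddCommGroup E] [Module ℝ E] (f : Option (List ℕ) → E)
    (w : List ℕ) : lap β ξ f w = f (some w) - f (parent w) -
      β • ∑ i ∈ Finset.range (ξ w), (f (some (i :: w)) - f (parent (i :: w))) := by
  simp only [lap, parent, Finset.sum_sub_distrib, Finset.sum_const, Finset.card_range, smul_sub,
    add_smul, one_smul, mul_smul, Nat.cast_smul_eq_nsmul]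
  abel

theorem lap_greenExt (hβ : 0 < β) {d : List ℕ} (hd : Mem ξ d) (hd0 : ξ d = 0) (w : List ℕ) :
    lap β ξ (greenExt β d) w = if w = d then (β⁻¹) ^ d.length else 0 := by
  rw [lap_eq_sub]
  simp only [greenExt_sub_parent, List.length_cons, smul_eq_mul]
  split_ifs with h1 h2 h2
  · subst h2; simp [hd0]
  · obtain ⟨x, rfl⟩ := h1
    obtain ⟨y, i, rfl⟩ := (List.eq_nil_or_concat' x).resolve_left fun hx => h2 (by simp [hx])
    have hi : i < ξ w := by
      have : Mem ξ (i :: w) := hd.of_suffix ⟨y, by simp⟩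
      exact this.2
    have hiff : ∀ j, (j :: w <:+ y ++ [i] ++ w) ↔ j = i := fun j => by
      refine ⟨fun ⟨z, hz⟩ => ?_, fun hj => ⟨y, by simp [hj]⟩⟩
      have h3 := List.append_cancel_right (bs := w) (by simpa using hz)
      simpa using (List.append_inj' h3 rfl).2
    simp only [hiff, Finset.sum_ite_eq', Finset.mem_range, hi, if_true]
    rw [pow_succ', mul_inv_cancel_left₀ hβ.ne', sub_self]
  · exact absurd (h2 ▸ List.suffix_refl _) h1
  · have hn : ∀ i, ¬ (i :: w <:+ d) := fun i hi => h1 ((List.suffix_cons i w).trans hi)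
    simp [hn]

theorem green_of_suffix {d w : List ℕ} (h : w <:+ d) :
    green β d w = ∑ j ∈ Finset.range (w.length + 1), (β⁻¹) ^ j := by
  induction w with
  | nil => simp [green]
  | cons i w ih =>
    rw [green, if_pos h, ih ((List.suffix_cons i w).trans h), List.length_cons,
      Finset.sum_range_succ _ (w.length + 1)]

theorem green_le (hβ : 0 < β) (d w : List ℕ) :
    green β d w ≤ ∑ j ∈ Finset.range (w.length + 1), (β⁻¹) ^ j := by
  induction w with
  | nil => simp [green]
  | cons i w ih =>
    rw [green, List.length_cons, Finset.sum_range_succ _ (w.length + 1)]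
    refine add_le_add ih ?_
    split_ifs
    · exact le_rfl
    · positivity

theorem green_mono (hβ : 0 < β) (d x w : List ℕ) : green β d w ≤ green β d (x ++ w) := by
  induction x with
  | nil => simp
  | cons i x ih =>
    refine ih.trans (le_add_of_nonneg_right ?_)
    split_ifs <;> positivity

theorem green_pos (hβ : 0 < β) (d w : List ℕ) : 0 < green β d w := by
  have := green_mono hβ d w []
  rw [List.append_nil] at this
  exact lt_of_lt_of_le one_pos this

theorem green_le_inv (hβ : 1 < β) (d w : List ℕ) : green β d w ≤ (1 - β⁻¹)⁻¹ := by
  have h1 := inv_lt_one_of_one_lt₀ hβ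
  have h0 : 0 ≤ β⁻¹ := by positivity
  refine (green_le (by linarith) d w).trans ?_
  rw [← tsum_geometric_of_lt_one h0 h1]
  exact (summable_geometric_of_lt_one h0 h1).sum_le_tsum _ fun _ _ => by positivity

/-- Pairing with the Green function. -/
theorem sum_mul_green_mul_lap (hβ : 0 < β) (h : height ξ ≠ ⊤) {d : List ℕ} (hd : Mem ξ d)
    (hd0 : ξ d = 0) {f : Option (List ℕ) → ℂ} (hf : f none = 0) :
    ∑ x ∈ vertices ξ, (β : ℂ) ^ x.length * (green β d x * lap β ξ f x) = f (some d) := by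
  have key := sum_mul_lap_sub (β := β) h f fun o => (greenExt β d o : ℂ)
  have hl : ∀ x, lap β ξ (fun o => (greenExt β d o : ℂ)) x =
      ((if x = d then (β⁻¹) ^ d.length else 0 : ℝ) : ℂ) := fun x => by
    rw [← lap_greenExt hβ hd hd0]
    simp [lap]
  simp only [hf, hl] at key
  simp only [mul_sub, Finset.sum_sub_distrib] at key
  rw [sub_eq_iff_eq_add] at key
  refine Eq.trans (by rfl) (key.trans ?_)
  rw [Finset.sum_eq_single d (fun x _ hx => by simp [hx]) fun hx =>
    absurd ((mem_vertices h).2 hd) hx]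
  have : (β : ℂ) ≠ 0 := by exact_mod_cast hβ.ne'
  simp [greenExt]
  field_simp

/-- A function that vanishes at the root of the trap and is harmonic off `d` is determined at the
bud by its value at `d`. -/
theorem apply_bud_mul_green (hβ : 0 < β) (h : height ξ ≠ ⊤) {d : List ℕ} (hd : Mem ξ d)
    (hd0 : ξ d = 0) {f : Option (List ℕ) → ℂ} (hf : f none = 0)
    (hl : ∀ w, Mem ξ w → w ≠ d → lap β ξ f w = 0) : f (some []) * green β d d = f (some d) := by
  have h1 := sum_mul_green_mul_lap hβ h hd hd0 hf
  have h2 := sum_lap_eq (β := β) h f (w := []) trivial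
  simp only [sub_nil, List.append_nil, parent, hf, sub_zero] at h2
  have hdv := (mem_vertices h).2 hd
  rw [Finset.sum_eq_single d (fun x hm hx => by
    rw [hl x ((mem_vertices h).1 hm) hx, mul_zero]) fun hx =>
    absurd hdv hx] at h2
  rw [Finset.sum_eq_single d (fun x hm hx => by
    rw [hl x ((mem_vertices h).1 hm) hx, mul_zero, mul_zero]) fun hx =>
    absurd hdv hx] at h1
  rw [← h1, ← h2]
  ring

end BiasedWalk

/-! ### One excursion into a trap -/

namespace BiasedWalk

open PlaneTree

instance : MeasurableSpace (Option (List ℕ)) := ⊤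

instance : DiscreteMeasurableSpace (Option (List ℕ)) := ⟨fun _ => trivial⟩

/-- One step of the walk in a trap. -/
noncomputable def trapStep (β : ℝ) (ξ : Field) (w : List ℕ) (x : I) : Option (List ℕ) :=
  if ⌊(x : ℝ) * (1 + β * ξ w) / β⌋₊ < ξ w then
    some (⌊(x : ℝ) * (1 + β * ξ w) / β⌋₊ :: w)
  else parent w

/-- The walk in a trap, started at `o` and absorbed at the root `none` of the trap. -/
noncomputable def trapFrom (β : ℝ) (ξ : Field) (o : Option (List ℕ)) (v : ℕ → I) :
    ℕ → Option (List ℕ)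
  | 0 => o
  | t + 1 => (trapFrom β ξ o v t).bind fun w => trapStep β ξ w (v t)

theorem trapWalk_eq (β : ℝ) (ξ : Field) (v : ℕ → I) (t : ℕ) :
    trapWalk β ξ v t = trapFrom β ξ (some []) v t := by
  induction t with
  | zero => rfl
  | succ t ih =>
    rw [trapWalk, trapFrom, ih]
    rcases trapFrom β ξ (some []) v t with _ | w
    · rfl
    · simp only [trapStep]
      cases w <;> rfl

theorem trapFrom_none (β : ℝ) (ξ : Field) (v : ℕ → I) (t : ℕ) : trapFrom β ξ none v t = none := by
  induction t with
  | zero => rfl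
  | succ t ih => rw [trapFrom, ih]; rfl

theorem trapFrom_succ (β : ℝ) (ξ : Field) (w : List ℕ) (v : ℕ → I) (t : ℕ) :
    trapFrom β ξ (some w) v (t + 1) =
      trapFrom β ξ (trapStep β ξ w (v 0)) (shiftSeq 1 v) t := by
  induction t with
  | zero => simp [trapFrom]
  | succ t ih =>
    rw [trapFrom, ih, trapFrom]
    simp only [shiftSeq, add_comm]

theorem trapFrom_ne_none {β : ℝ} {ξ : Field} {o : Option (List ℕ)} {v : ℕ → I} {s t : ℕ}
    (hst : s ≤ t) (h : trapFrom β ξ o v t ≠ none) : trapFrom β ξ o v s ≠ none := by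
  induction t, hst using Nat.le_induction with
  | base => exact h
  | succ t _ ih => exact ih fun hn => h (by rw [trapFrom, hn]; rfl)

theorem measurable_trapStep (β : ℝ) (w : List ℕ) :
    Measurable fun p : Field × I => trapStep β p.1 w p.2 := by
  have h1 : Measurable fun p : Field × I => (p.1 w, ⌊(p.2 : ℝ) * (1 + β * p.1 w) / β⌋₊) := by
    fun_prop
  exact (measurable_of_countable fun q =>
    if q.2 < q.1 then some (q.2 :: w) else parent w).comp h1

theorem measurable_trapFrom (β : ℝ) (o : Option (List ℕ)) (t : ℕ) :
    Measurable fun p : Field × (ℕ → I) => trapFrom β p.1 o p.2 t := by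
  induction t with
  | zero => exact measurable_const
  | succ t ih =>
    refine .discrete_apply (f := fun q (p : Field × (ℕ → I)) =>
      q.bind fun w => trapStep β p.1 w (p.2 t)) (fun q => ?_) ih
    cases q
    · exact measurable_const
    · exact (measurable_trapStep β _).comp (f := fun p : Field × (ℕ → I) => (p.1, p.2 t))
        (by fun_prop)

theorem measurable_trapFrom_right (β : ℝ) (ξ : Field) (o : Option (List ℕ)) (t : ℕ) :
    Measurable fun v : ℕ → I => trapFrom β ξ o v t :=
  (measurable_trapFrom β o t).comp (f := fun v => (ξ, v)) (by fun_prop)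

/-- The law of the first step from `w`. -/
theorem map_trapStep {β : ℝ} (hβ : 0 < β) (ξ : Field) (w : List ℕ) :
    uniformSeq.map (fun v => trapStep β ξ w (v 0)) =
      ∑ i ∈ Finset.range (ξ w), ENNReal.ofReal (β / (1 + β * ξ w)) •
        Measure.dirac (some (i :: w)) +
      ENNReal.ofReal (1 / (1 + β * ξ w)) • Measure.dirac (parent w) := by
  have hA : 0 < 1 + β * ξ w := by positivity
  have hm := (measurable_trapStep β w).comp (f := fun x : I => (ξ, x)) (by fun_prop)
  refine Measure.ext_of_lintegral _ fun f hf => ?_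
  have he : ∫⁻ v, f (trapStep β ξ w (v 0)) ∂uniformSeq = _ :=
    (measurePreserving_eval_infinitePi (fun _ : ℕ => (volume : Measure I)) 0).lintegral_comp
      (hf.comp hm)
  have hm0 : Measurable fun v : ℕ → I => trapStep β ξ w (v 0) := hm.comp (measurable_pi_apply 0)
  rw [lintegral_map hf hm0, he]
  have key := lintegral_floor_child hβ hA (by linarith)
    (fun i => f (if i < ξ w then some (i :: w) else parent w)) (f (parent w)) fun i hi => by
      rw [if_neg (by omega)]
  refine key.trans ?_
  rw [lintegral_add_measure, lintegral_finsetSum_measure]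
  simp only [lintegral_smul_measure, lintegral_dirac, smul_eq_mul, ← Finset.mul_sum]
  congr 2
  · exact Finset.sum_congr rfl fun i hi => by rw [if_pos (Finset.mem_range.1 hi)]
  · field_simp
    ring_nf

section

variable {E : Type*} [NormedAddCommGroup E] [NormedSpace ℝ E] [MeasurableSpace E] [BorelSpace E]
  [SecondCountableTopology E] [CompleteSpace E]

/-- The Markov property at the time `1`. -/
theorem integral_trapStep {β : ℝ} (hβ : 0 < β) (ξ : Field) (w : List ℕ)
    {J : Option (List ℕ) → (ℕ → I) → E} (hJm : ∀ o, Measurable (J o)) {C : ℝ}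
    (hJ : ∀ o v, ‖J o v‖ ≤ C) :
    (1 + β * ξ w) • ∫ v, J (trapStep β ξ w (v 0)) (shiftSeq 1 v) ∂uniformSeq =
      β • ∑ i ∈ Finset.range (ξ w), ∫ v, J (some (i :: w)) v ∂uniformSeq +
        ∫ v, J (parent w) v ∂uniformSeq := by
  have hA : 0 < 1 + β * ξ w := by positivity
  have hm : Measurable fun v : ℕ → I => trapStep β ξ w (v 0) :=
    (measurable_trapStep β w).comp (f := fun v : ℕ → I => (ξ, v 0)) (by fun_prop)
  have hJu : Measurable fun q : Option (List ℕ) × (ℕ → I) => J q.1 q.2 :=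
    measurable_from_prod_countable_right hJm
  set Φ : Option (List ℕ) → E := fun o => ∫ v, J o v ∂uniformSeq with hΦ
  have h1 : ∫ v, J (trapStep β ξ w (v 0)) (shiftSeq 1 v) ∂uniformSeq =
      ∫ v, Φ (trapStep β ξ w (v 0)) ∂uniformSeq := by
    have hmeas : Measurable fun v => J (trapStep β ξ w (v 0)) (shiftSeq 1 v) :=
      hJu.comp
        (hm.prodMk (measurable_shiftSeq 1))
    conv_lhs => rw [← map_splitSeq 1]
    rw [integral_map (measurable_splitSeq 1).aemeasurable hmeas.aestronglyMeasurable,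
      integral_prod]
    · simp only [shiftSeq_splitSeq, splitSeq_of_lt one_pos, hΦ]
    · exact Integrable.of_bound (hmeas.comp (measurable_splitSeq 1)).aestronglyMeasurable C
        (ae_of_all _ fun _ => hJ _ _)
  have hint : ∀ o : Option (List ℕ), ∀ c : ℝ≥0∞, c ≠ ∞ →
      Integrable Φ (c • Measure.dirac o) := fun o c hc =>
    (integrable_dirac (by simp)).smul_measure hc
  rw [h1, ← integral_map hm.aemeasurable measurable_from_top.aestronglyMeasurable,
    map_trapStep hβ,
    integral_add_measure, integral_finsetSum_measure]
  · simp only [integral_smul_measure, integral_dirac]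
    rw [ENNReal.toReal_ofReal (by positivity), ENNReal.toReal_ofReal (by positivity), smul_add,
      ← Finset.smul_sum, smul_smul, smul_smul, mul_div_cancel₀ _ hA.ne', mul_div_cancel₀ _ hA.ne',
      one_smul]
  · exact fun i _ => hint _ _ ENNReal.ofReal_ne_top
  · exact integrable_finsetSum_measure.2 fun i _ => hint _ _ ENNReal.ofReal_ne_top
  · exact hint _ _ ENNReal.ofReal_ne_top

end

/-! #### The duration of an excursion -/

/-- The expected duration of the excursion that remains, started from `w`. -/
noncomputable def durationFrom (β : ℝ) (ξ : Field) : List ℕ → ℝ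
  | [] => totalWeight β ξ
  | i :: w => durationFrom β ξ w + totalWeight β (sub ξ (i :: w))

section

variable {β : ℝ} {ξ : Field}

theorem durationFrom_nonneg (hβ : 0 < β) (w : List ℕ) : 0 ≤ durationFrom β ξ w := by
  induction w with
  | nil => exact totalWeight_nonneg hβ _
  | cons i w ih => exact add_nonneg ih (totalWeight_nonneg hβ _)

theorem lap_durationFrom (h : height ξ ≠ ⊤) {w : List ℕ} (hw : Mem ξ w) :
    lap β ξ (fun o => o.elim 0 (durationFrom β ξ)) w = 1 + β * ξ w := by
  have hd : ∀ x, (fun o => o.elim 0 (durationFrom β ξ)) (some x) -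
      (fun o => o.elim 0 (durationFrom β ξ)) (parent x) =
        totalWeight β (sub ξ x) := fun x => by
    cases x <;> simp [parent, durationFrom]
  rw [lap_eq_sub]
  simp only [hd]
  rw [totalWeight_node (height_sub_ne_top h hw)]
  simp only [sub]
  have : ∀ i, sub (sub ξ w) [i] = sub ξ (i :: w) := fun i => sub_sub ξ w [i]
  simp [← this]

/-- The expected duration of an excursion is at most the total weight of the trap. -/
theorem tsum_measure_ne_none_le (hβ : 0 < β) (h : height ξ ≠ ⊤) {o : Option (List ℕ)}
    (ho : ∀ w, o = some w → Mem ξ w) :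
    ∑' t, uniformSeq {v | trapFrom β ξ o v t ≠ none} ≤
      ENNReal.ofReal (o.elim 0 (durationFrom β ξ)) := by
  set ind : Option (List ℕ) → ℝ := fun o => if o ≠ none then 1 else 0 with hind
  -- `J N` is the duration, cut off at time `N`, so that it is integrable.
  set J : ℕ → Option (List ℕ) → (ℕ → I) → ℝ := fun N o v =>
    ∑ t ∈ Finset.range N, ind (trapFrom β ξ o v t) with hJd
  have hmi := fun o t =>
    (measurable_from_top (f := ind)).comp (measurable_trapFrom_right β ξ o t)
  have hi0 : ∀ o, 0 ≤ ind o := fun o => by simp only [hind]; split_ifs <;> norm_num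
  have hi1 : ∀ o, ind o ≤ 1 := fun o => by simp only [hind]; split_ifs <;> norm_num
  have hJm : ∀ N o, Measurable (J N o) := fun N o =>
    Finset.measurable_sum _ fun t _ => hmi o t
  have hJ : ∀ N o v, ‖J N o v‖ ≤ N := fun N o v => by
    rw [Real.norm_of_nonneg (Finset.sum_nonneg fun t _ => hi0 _)]
    refine (Finset.sum_le_sum fun t _ => hi1 _).trans ?_
    simp
  have key : ∀ N (o : Option (List ℕ)), (∀ w, o = some w → Mem ξ w) →
      ∫ v, J N o v ∂uniformSeq ≤ o.elim 0 (durationFrom β ξ) := by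
    intro N
    induction N with
    | zero =>
      intro o _
      cases o <;> simp [hJd, durationFrom_nonneg hβ]
    | succ N ih =>
      intro o ho
      rcases o with _ | w
      · simp [hJd, trapFrom_none, hind]
      · have hw := ho w rfl
        have hA : 0 < 1 + β * ξ w := by positivity
        have hs : ∀ v, J (N + 1) (some w) v =
            1 + J N (trapStep β ξ w (v 0)) (shiftSeq 1 v) := fun v => by
          simp only [hJd, Finset.sum_range_succ', trapFrom_succ]
          rw [add_comm]
          simp [trapFrom, hind]
        have hstep := integral_trapStep hβ ξ w (hJm N) (hJ N)
        have hint : Integrable (fun v => J N (trapStep β ξ w (v 0)) (shiftSeq 1 v))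
            uniformSeq := by
          refine Integrable.of_bound (Measurable.aestronglyMeasurable ?_) N
            (ae_of_all _ fun v => hJ N _ _)
          have : Measurable fun v => J (N + 1) (some w) v := hJm (N + 1) (some w)
          simp only [hs] at this
          simpa using this.sub_const 1
        simp only [hs]
        rw [integral_add (integrable_const _) hint]
        simp only [integral_const, probReal_univ, smul_eq_mul, one_mul] at hstep ⊢
        have hl := lap_durationFrom (β := β) h hw
        simp only [lap, smul_eq_mul, Option.elim_some] at hl ⊢
        have h1 : ∑ i ∈ Finset.range (ξ w), ∫ v, J N (some (i :: w)) v ∂uniformSeq ≤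
            ∑ i ∈ Finset.range (ξ w), durationFrom β ξ (i :: w) :=
          Finset.sum_le_sum fun i hi => ih (some (i :: w)) fun x hx => by
            obtain rfl := Option.some_injective _ hx
            exact ⟨hw, Finset.mem_range.1 hi⟩
        have h2 := ih (parent w) fun x hx => by
          cases w with
          | nil => simp [parent] at hx
          | cons i y => obtain rfl := Option.some_injective _ hx; exact hw.1
        have h3 := mul_le_mul_of_nonneg_left h1 hβ.le
        refine le_of_mul_le_mul_left ?_ hA
        linarith
  have hle : ∀ N, ∑ t ∈ Finset.range N, uniformSeq {v | trapFrom β ξ o v t ≠ none} ≤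
      ENNReal.ofReal (o.elim 0 (durationFrom β ξ)) := fun N => by
    refine le_trans (le_of_eq ?_) (ENNReal.ofReal_le_ofReal (key N o ho))
    have hint : ∀ t, Integrable (fun v => ind (trapFrom β ξ o v t)) uniformSeq := fun t =>
      Integrable.of_bound (hmi o t).aestronglyMeasurable 1 (ae_of_all _ fun v => by
        rw [Real.norm_of_nonneg (hi0 _)]; exact hi1 _)
    rw [integral_finsetSum _ fun t _ => hint t,
      ENNReal.ofReal_sum_of_nonneg fun t _ => integral_nonneg fun v => hi0 _]
    refine Finset.sum_congr rfl fun t _ => ?_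
    have : (fun v => ind (trapFrom β ξ o v t)) =
        {v | trapFrom β ξ o v t ≠ none}.indicator fun _ => 1 := by
      funext v
      simp only [hind, Set.indicator_apply, Set.mem_ofPred_eq]
    rw [this, integral_indicator_const _ (s := {v | trapFrom β ξ o v t ≠ none})
      (measurable_trapFrom_right β ξ o t (.of_discrete (s := {none}ᶜ))), smul_eq_mul, mul_one,
      ofReal_measureReal]
  exact ENNReal.tsum_le_of_sum_range_le hle

theorem ae_finite_ne_none (hβ : 0 < β) (h : height ξ ≠ ⊤) {o : Option (List ℕ)}
    (ho : ∀ w, o = some w → Mem ξ w) :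
    ∀ᵐ v ∂uniformSeq, {t | trapFrom β ξ o v t ≠ none}.Finite :=
  ae_finite_setOfPred_mem (ne_top_of_le_ne_top ENNReal.ofReal_ne_top
    (tsum_measure_ne_none_le hβ h ho))

end

end BiasedWalk

/-! ### The time between the first and the last visit -/

namespace BiasedWalk

open PlaneTree

section Sets

/-- The last element of a finite set of times (`0` for the empty set). -/
noncomputable def lastTime (A : Set ℕ) : ℕ := {t | ∃ s > t, s ∈ A}.ncard

/-- The time between the first and the last element of a finite set of times. -/
noncomputable def timeBetween (A : Set ℕ) : ℕ := {t | (∃ s ≤ t, s ∈ A) ∧ ∃ s > t, s ∈ A}.ncard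

open Classical in
/-- `z` to the power of the last element of a set of times, and `0` for the empty set. -/
noncomputable def lastGen (z : ℂ) (A : Set ℕ) : ℂ := if A.Nonempty then z ^ lastTime A else 0

variable {A B : Set ℕ} (hAB : ∀ t, t + 1 ∈ A ↔ t ∈ B)

include hAB

theorem lastTime_of_nonempty (hB : B.Finite) (hne : B.Nonempty) :
    lastTime A = lastTime B + 1 := by
  have h1 : {t | ∃ s > t, s ∈ A} = insert 0 (Nat.succ '' {t | ∃ s > t, s ∈ B}) := by
    ext t
    constructor
    · rintro ⟨s, hs, hsA⟩
      rcases t with _ | t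
      · exact Or.inl rfl
      · refine Or.inr ⟨t, ⟨s - 1, by omega, ?_⟩, rfl⟩
        rw [← hAB, Nat.sub_add_cancel (by omega)]
        exact hsA
    · rintro (rfl | ⟨t, ⟨s, hs, hsB⟩, rfl⟩)
      · obtain ⟨s, hs⟩ := hne
        exact ⟨s + 1, Nat.succ_pos s, (hAB s).2 hs⟩
      · exact ⟨s + 1, Nat.succ_lt_succ hs, (hAB s).2 hsB⟩
  have h2 : {t | ∃ s > t, s ∈ B}.Finite := by
    obtain ⟨M, hM⟩ := hB.bddAbove
    refine (Set.finite_Iio M).subset fun t ht => ?_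
    obtain ⟨s, hs, hsB⟩ := ht
    exact lt_of_lt_of_le hs (hM hsB)
  rw [lastTime, h1, Set.ncard_insert_of_notMem (by simp) (h2.image _),
    Set.ncard_image_of_injective _ Nat.succ_injective, lastTime]

theorem lastTime_of_empty (hB : ¬ B.Nonempty) : lastTime A = 0 := by
  have h1 : {t | ∃ s > t, s ∈ A} = ∅ := by
    refine Set.eq_empty_iff_forall_notMem.2 ?_
    rintro t ⟨_ | s, hs, hsA⟩
    exacts [absurd hs (by omega), hB ⟨s, (hAB s).1 hsA⟩]
  rw [lastTime, h1, Set.ncard_empty]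

omit hAB in
theorem timeBetween_of_mem (h0 : 0 ∈ A) : timeBetween A = lastTime A := by
  rw [timeBetween]
  congr 1
  ext t
  exact ⟨fun h => h.2, fun h => ⟨⟨0, Nat.zero_le _, h0⟩, h⟩⟩

theorem timeBetween_of_notMem (h0 : 0 ∉ A) : timeBetween A = timeBetween B := by
  have h1 : {t | (∃ s ≤ t, s ∈ A) ∧ ∃ s > t, s ∈ A} =
      Nat.succ '' {t | (∃ s ≤ t, s ∈ B) ∧ ∃ s > t, s ∈ B} := by
    ext t
    constructor
    · rintro ⟨⟨_ | s, hs, hsA⟩, _ | s', hs', hsA'⟩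
      any_goals grind
      exact ⟨t - 1, ⟨⟨s, by omega, (hAB s).1 hsA⟩, s', by omega, (hAB s').1 hsA'⟩, by omega⟩
    · rintro ⟨t, ⟨⟨s, hs, hsB⟩, s', hs', hsB'⟩, rfl⟩
      exact ⟨⟨s + 1, Nat.succ_le_succ hs, (hAB s).2 hsB⟩, s' + 1, Nat.succ_lt_succ hs',
        (hAB s').2 hsB'⟩
  rw [timeBetween, h1, Set.ncard_image_of_injective _ Nat.succ_injective, timeBetween]

theorem lastGen_of_notMem (hB : B.Finite) (h0 : 0 ∉ A) (z : ℂ) :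
    lastGen z A = z * lastGen z B := by
  have hne : A.Nonempty ↔ B.Nonempty := by
    constructor <;> rintro ⟨_ | t, ht⟩ <;> grind [Set.Nonempty]
  rw [lastGen, lastGen]
  split_ifs with h1 h2 h2
  · rw [lastTime_of_nonempty hAB hB h2, pow_succ']
  · exact absurd (hne.1 h1) h2
  · exact absurd (hne.2 h2) h1
  · rw [mul_zero]

theorem lastGen_of_mem (hB : B.Finite) (h0 : 0 ∈ A) (z : ℂ) :
    lastGen z A = z * lastGen z B + (1 - lastGen 1 B) := by
  rw [lastGen, if_pos ⟨0, h0⟩, lastGen, lastGen]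
  split_ifs with h1
  · rw [lastTime_of_nonempty hAB hB h1, pow_succ', one_pow, sub_self, add_zero]
  · rw [lastTime_of_empty hAB h1]; simp

omit hAB in
theorem norm_lastGen_le {z : ℂ} (hz : ‖z‖ ≤ 1) (A : Set ℕ) : ‖lastGen z A‖ ≤ 1 := by
  rw [lastGen]
  split_ifs
  · rw [norm_pow]; exact pow_le_one₀ (norm_nonneg _) hz
  · simp

end Sets

variable {β : ℝ} {ξ : Field}

/-- The times of the visits to `d` of the walk started at `o`. -/
def hits (β : ℝ) (ξ : Field) (d : List ℕ) (o : Option (List ℕ)) (v : ℕ → I) : Set ℕ :=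
  {t | trapFrom β ξ o v t = some d}

theorem succ_mem_hits (d w : List ℕ) (v : ℕ → I) (t : ℕ) :
    t + 1 ∈ hits β ξ d (some w) v ↔
      t ∈ hits β ξ d (trapStep β ξ w (v 0)) (shiftSeq 1 v) := by
  simp only [hits, Set.mem_ofPred_eq, trapFrom_succ]

theorem zero_mem_hits (d w : List ℕ) (v : ℕ → I) : 0 ∈ hits β ξ d (some w) v ↔ w = d := by
  simp [hits, trapFrom]

theorem hits_none (d : List ℕ) (v : ℕ → I) : hits β ξ d none v = ∅ := by
  ext t; simp [hits, trapFrom_none]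

theorem measurable_mem_hits (d : List ℕ) (o : Option (List ℕ)) (t : ℕ) :
    Measurable fun v => t ∈ hits β ξ d o v :=
  (measurable_of_countable (· = some d)).comp (measurable_trapFrom_right β ξ o t)

theorem measurable_lastGen_hits (d : List ℕ) (z : ℂ) (o : Option (List ℕ)) :
    Measurable fun v => lastGen z (hits β ξ d o v) := by
  have := measurable_mem_hits (β := β) (ξ := ξ) d o
  exact .ite (measurableSet_setOfPred.2 (by unfold Set.Nonempty; fun_prop))
    ((measurable_of_countable (z ^ ·)).comp (measurable_ncard_nat fun t => by fun_prop))
    measurable_const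

theorem measurable_timeBetween {Ω : Type*} [MeasurableSpace Ω] {A : Ω → Set ℕ}
    (h : ∀ t, Measurable fun ω => t ∈ A ω) : Measurable fun ω => timeBetween (A ω) :=
  measurable_ncard_nat fun t => by fun_prop

theorem measurable_timeBetween_hits (d : List ℕ) (o : Option (List ℕ)) :
    Measurable fun v => timeBetween (hits β ξ d o v) :=
  measurable_timeBetween (measurable_mem_hits d o)

/-- The generating function of the last visit to `d`, on the event that `d` is visited. -/
noncomputable def visitFun (β : ℝ) (ξ : Field) (d : List ℕ) (z : ℂ) (o : Option (List ℕ)) : ℂ :=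
  ∫ v, lastGen z (hits β ξ d o v) ∂uniformSeq

/-- The generating function of the time between the first and the last visit to `d`. -/
noncomputable def betweenFun (β : ℝ) (ξ : Field) (d : List ℕ) (z : ℂ) (o : Option (List ℕ)) : ℂ :=
  ∫ v, z ^ timeBetween (hits β ξ d o v) ∂uniformSeq

theorem norm_visitFun_le {z : ℂ} (hz : ‖z‖ ≤ 1) (d : List ℕ) (o : Option (List ℕ)) :
    ‖visitFun β ξ d z o‖ ≤ 1 := by
  refine (norm_integral_le_of_norm_le_const (C := 1)
    (ae_of_all _ fun v => norm_lastGen_le hz _)).trans ?_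
  simp

@[simp] theorem visitFun_none (d : List ℕ) (z : ℂ) : visitFun β ξ d z none = 0 := by
  simp [visitFun, hits_none, lastGen]

@[simp] theorem betweenFun_none (d : List ℕ) (z : ℂ) : betweenFun β ξ d z none = 1 := by
  simp [betweenFun, hits_none, timeBetween]

theorem visitFun_one_self (d : List ℕ) : visitFun β ξ d 1 (some d) = 1 := by
  have : ∀ v, lastGen 1 (hits β ξ d (some d) v) = 1 := fun v => by
    rw [lastGen, if_pos ⟨0, (zero_mem_hits d d v).2 rfl⟩, one_pow]
  simp [visitFun, this]

theorem betweenFun_self (d : List ℕ) (z : ℂ) :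
    betweenFun β ξ d z (some d) = visitFun β ξ d z (some d) := by
  have : ∀ v, lastGen z (hits β ξ d (some d) v) = z ^ timeBetween (hits β ξ d (some d) v) :=
    fun v => by
      have h0 := (zero_mem_hits (β := β) (ξ := ξ) d d v).2 rfl
      rw [lastGen, if_pos ⟨0, h0⟩, timeBetween_of_mem h0]
  simp [visitFun, betweenFun, this]

section

variable (hβ : 0 < β) (h : height ξ ≠ ⊤)

include hβ h

theorem ae_finite_hits_step (d : List ℕ) {w : List ℕ} (hw : Mem ξ w) :
    ∀ᵐ v ∂uniformSeq, (hits β ξ d (trapStep β ξ w (v 0)) (shiftSeq 1 v)).Finite := by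
  filter_upwards [ae_finite_ne_none hβ h fun x hx => by
    obtain rfl := Option.some_injective _ hx; exact hw] with v hv
  refine ((hv.preimage Nat.succ_injective.injOn).subset fun t ht => ?_)
  have := (succ_mem_hits d w v t).2 ht
  simp only [hits, Set.mem_ofPred_eq] at this
  simp [this]

omit h in
theorem integral_lastGen_step {z : ℂ} (hz : ‖z‖ ≤ 1) (d w : List ℕ) :
    (1 + β * ξ w) • ∫ v, lastGen z (hits β ξ d (trapStep β ξ w (v 0)) (shiftSeq 1 v)) ∂uniformSeq =
      β • ∑ i ∈ Finset.range (ξ w), visitFun β ξ d z (some (i :: w)) +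
        visitFun β ξ d z (parent w) :=
  integral_trapStep hβ ξ w
    (measurable_lastGen_hits d z) fun _ _ => norm_lastGen_le hz _

omit hβ h in
theorem integrable_lastGen_step {z : ℂ} (hz : ‖z‖ ≤ 1) (d w : List ℕ) : Integrable
    (fun v => lastGen z (hits β ξ d (trapStep β ξ w (v 0)) (shiftSeq 1 v))) uniformSeq := by
  have hm := (measurable_trapStep β w).comp (f := fun v : ℕ → I => (ξ, v 0)) (by fun_prop)
  have hu : Measurable fun q : Option (List ℕ) × (ℕ → I) => lastGen z (hits β ξ d q.1 q.2) :=
    measurable_from_prod_countable_right (measurable_lastGen_hits d z)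
  exact Integrable.of_bound (hu.comp
    (hm.prodMk (measurable_shiftSeq 1))).aestronglyMeasurable 1
    (ae_of_all _ fun v => norm_lastGen_le hz _)

/-- The equation satisfied by the generating function of the last visit to the leaf `d`. -/
theorem mul_lap_visitFun {z : ℂ} (hz : ‖z‖ ≤ 1) {d w : List ℕ} (hd0 : ξ d = 0) (hw : Mem ξ w) :
    z * lap β ξ (visitFun β ξ d z) w = (if w = d then 1 - visitFun β ξ d 1 (parent d) else 0) -
      (1 - z) * ((1 + β * ξ w : ℝ) * visitFun β ξ d z (some w)) := by
  have hfin := ae_finite_hits_step hβ h d hw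
  have hsub := succ_mem_hits (β := β) (ξ := ξ) d w
  have hst := integral_lastGen_step hβ (ξ := ξ) hz d w
  rw [lap]
  simp only [Complex.real_smul] at hst ⊢
  split_ifs with hwd
  · subst hwd
    have hst1 := integral_lastGen_step hβ (ξ := ξ) (z := 1) (by simp) w w
    simp only [hd0, CharP.cast_eq_zero, mul_zero, add_zero, one_smul, Complex.ofReal_one,
      one_mul] at hst hst1 ⊢
    have : visitFun β ξ w z (some w) =
        z * visitFun β ξ w z (parent w) + (1 - visitFun β ξ w 1 (parent w)) := by
      have h1 : visitFun β ξ w z (some w) = ∫ v, (z * lastGen z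
          (hits β ξ w (trapStep β ξ w (v 0)) (shiftSeq 1 v)) +
          (1 - lastGen 1 (hits β ξ w (trapStep β ξ w (v 0)) (shiftSeq 1 v)))) ∂uniformSeq := by
        refine integral_congr_ae ?_
        filter_upwards [hfin] with v hv
        exact lastGen_of_mem (hsub v) hv ((zero_mem_hits w w v).2 rfl) z
      have hi1 := integrable_lastGen_step (β := β) (ξ := ξ) (z := 1) (by simp) w w
      have hi2 : Integrable (fun v => 1 - lastGen 1
          (hits β ξ w (trapStep β ξ w (v 0)) (shiftSeq 1 v))) uniformSeq :=
        (integrable_const _).sub hi1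
      rw [h1, integral_add ((integrable_lastGen_step hz w w).const_mul z) hi2,
        integral_sub (integrable_const _) hi1,
        integral_const_mul, hst, hst1]
      simp
    rw [this]
    ring
  · have : visitFun β ξ d z (some w) =
        z * ∫ v, lastGen z (hits β ξ d (trapStep β ξ w (v 0)) (shiftSeq 1 v)) ∂uniformSeq := by
      rw [← integral_const_mul]
      refine integral_congr_ae ?_
      filter_upwards [hfin] with v hv
      exact lastGen_of_notMem (hsub v) hv (fun h0 => hwd ((zero_mem_hits d w v).1 h0)) z
    have h2 : ((1 + β * ξ w : ℝ) : ℂ) * visitFun β ξ d z (some w) =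
        z * (β * ∑ i ∈ Finset.range (ξ w), visitFun β ξ d z (some (i :: w)) +
          visitFun β ξ d z (parent w)) := by
      rw [← hst, this]; ring
    linear_combination h2

omit h in
theorem lap_one_sub_betweenFun {z : ℂ} (hz : ‖z‖ ≤ 1) {d w : List ℕ} (hwd : w ≠ d) :
    lap β ξ (fun o => 1 - betweenFun β ξ d z o) w = 0 := by
  have hst := integral_trapStep hβ ξ w (J := fun o v => z ^ timeBetween (hits β ξ d o v))
    (fun o => (measurable_of_countable fun k : ℕ => z ^ k).comp (measurable_timeBetween_hits d o))
    (C := 1) fun _ _ => by rw [norm_pow]; exact pow_le_one₀ (norm_nonneg _) hz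
  have h1 : betweenFun β ξ d z (some w) =
      ∫ v, z ^ timeBetween (hits β ξ d (trapStep β ξ w (v 0)) (shiftSeq 1 v)) ∂uniformSeq :=
    integral_congr_ae (ae_of_all _ fun v => by
      dsimp only
      rw [timeBetween_of_notMem (succ_mem_hits d w v)
        fun h0 => hwd ((zero_mem_hits d w v).1 h0)])
  rw [← h1] at hst
  simp only [lap, Complex.real_smul, Finset.sum_sub_distrib, Finset.sum_const, Finset.card_range,
    nsmul_eq_mul, mul_one] at hst ⊢
  change _ = (β : ℂ) * ∑ i ∈ Finset.range (ξ w), betweenFun β ξ d z (some (i :: w)) +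
    betweenFun β ξ d z (parent w) at hst
  push_cast at hst ⊢
  linear_combination -hst

variable {d : List ℕ} (hd : Mem ξ d) (hd0 : ξ d = 0)

include hd hd0

theorem escape_eq : (β : ℂ) ^ d.length * (green β d d *
    (1 - visitFun β ξ d 1 (parent d))) = 1 := by
  have key := sum_mul_green_mul_lap hβ h hd hd0 (visitFun_none (β := β) (ξ := ξ) d 1)
  rw [visitFun_one_self] at key
  refine Eq.trans ?_ key
  rw [Finset.sum_eq_single d]
  · have := mul_lap_visitFun hβ h (z := 1) (by simp) hd0 hd
    rw [if_pos rfl, sub_self, zero_mul, sub_zero, one_mul] at this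
    rw [this]
  · intro x hx hxd
    have := mul_lap_visitFun hβ h (z := 1) (by simp) hd0 ((mem_vertices h).1 hx)
    rw [if_neg hxd, sub_self, zero_mul, sub_zero, one_mul] at this
    rw [this, mul_zero, mul_zero]
  · exact fun hx => absurd ((mem_vertices h).2 hd) hx

/-- The generating function of the last visit, for the walk started at `d`. -/
theorem one_sub_mul_visitFun_self {z : ℂ} (hz : ‖z‖ ≤ 1) : 1 - z * visitFun β ξ d z (some d) =
    (1 - z) * ∑ x ∈ vertices ξ, ((β ^ x.length * (1 + β * ξ x) * green β d x : ℝ) : ℂ) *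
      visitFun β ξ d z (some x) := by
  have h1 : ∀ x ∈ vertices ξ, z * ((β : ℂ) ^ x.length *
      (green β d x * lap β ξ (visitFun β ξ d z) x)) =
      (if x = d then 1 else 0) - (1 - z) * (((β ^ x.length * (1 + β * ξ x) * green β d x : ℝ) : ℂ) *
        visitFun β ξ d z (some x)) := fun x hx => by
    have h2 := mul_lap_visitFun hβ h hz hd0 ((mem_vertices h).1 hx)
    split_ifs at h2 ⊢ with hxd
    · subst hxd
      push_cast at h2 ⊢
      linear_combination (β : ℂ) ^ x.length * green β x x * h2 + (escape_eq hβ h hd hd0)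
    · push_cast at h2 ⊢
      linear_combination (β : ℂ) ^ x.length * green β d x * h2
  rw [← sum_mul_green_mul_lap hβ h hd hd0 (visitFun_none d z), Finset.mul_sum,
    Finset.sum_congr rfl h1, Finset.sum_sub_distrib, ← Finset.mul_sum,
    Finset.sum_ite_eq', if_pos ((mem_vertices h).2 hd)]
  ring

theorem betweenFun_bud {z : ℂ} (hz : ‖z‖ ≤ 1) : betweenFun β ξ d z (some []) =
    1 - (1 - visitFun β ξ d z (some d)) / green β d d := by
  have h2 : (green β d d : ℂ) ≠ 0 := by exact_mod_cast (green_pos hβ d d).ne'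
  rw [← betweenFun_self, ← apply_bud_mul_green hβ h hd hd0
    (by simp) fun w _ hw => lap_one_sub_betweenFun hβ hz hw]
  field_simp
  ring

/-- The visits of the walk to the vertices that are far from `d` do not matter: `visitFun` varies
little below an ancestor of `d`. -/
theorem norm_visitFun_sub_parent_le {z : ℂ} (hz : ‖z‖ = 1) {w : List ℕ}
    (hw : Mem ξ w) : ‖visitFun β ξ d z (some w) - visitFun β ξ d z (parent w)‖ ≤
      (β⁻¹) ^ w.length + ‖1 - z‖ * totalWeight β (sub ξ w) := by
  -- From the parent of `d` the walk visits `d` with high probability.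
  have he : ‖1 - visitFun β ξ d 1 (parent d)‖ ≤ (β⁻¹) ^ d.length := by
    have h3 := congrArg norm (escape_eq hβ h hd hd0)
    have hg := green_mono hβ d d []
    rw [List.append_nil] at hg
    simp only [norm_mul, norm_pow, Complex.norm_real, Real.norm_of_nonneg hβ.le,
      Real.norm_of_nonneg (green_pos hβ d d).le, norm_one] at h3
    rw [inv_pow, ← one_div, le_div_iff₀ (by positivity), mul_comm]
    calc _ ≤ β ^ d.length * (green β d d * ‖1 - visitFun β ξ d 1 (parent d)‖) := by
          gcongr
          exact le_mul_of_one_le_left (norm_nonneg _) hg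
      _ = 1 := h3
  -- Summing `lap` over the subtree of `w` leaves the increment along the edge above `w`.
  rw [← sum_lap_eq h _ hw, ← one_mul ‖_‖, ← hz, ← norm_mul, Finset.mul_sum]
  have hterm : ∀ x ∈ vertices (sub ξ w), ‖z * ((β : ℂ) ^ x.length *
      lap β ξ (visitFun β ξ d z) (x ++ w))‖ ≤ (if x ++ w = d then (β⁻¹) ^ w.length else 0) +
        ‖1 - z‖ * (β ^ x.length * (1 + β * sub ξ w x)) := fun x hx => by
    rw [mul_left_comm, mul_lap_visitFun hβ h hz.le hd0 (mem_append.2 ⟨hw, (mem_vertices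
      (height_sub_ne_top h hw)).1 hx⟩), norm_mul, norm_pow, Complex.norm_real,
      Real.norm_of_nonneg hβ.le]
    refine (mul_le_mul_of_nonneg_left (norm_sub_le _ _) (by positivity)).trans ?_
    rw [mul_add]
    refine add_le_add ?_ ?_
    · split_ifs with hxd
      · refine (mul_le_mul_of_nonneg_left he (by positivity)).trans ?_
        rw [← hxd, List.length_append, pow_add, ← mul_assoc, ← mul_pow, mul_inv_cancel₀ hβ.ne',
          one_pow, one_mul]
      · simp
    · rw [norm_mul, norm_mul, Complex.norm_real, Real.norm_of_nonneg (by positivity)]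
      have h1 := norm_visitFun_le (β := β) (ξ := ξ) hz.le d (some (x ++ w))
      calc _ ≤ β ^ x.length * (‖1 - z‖ * ((1 + β * ξ (x ++ w)) * 1)) := by gcongr
        _ = _ := by simp only [sub]; ring
  refine (norm_sum_le_of_le _ hterm).trans ?_
  rw [Finset.sum_add_distrib, ← Finset.mul_sum]
  refine add_le_add_left ?_ _
  by_cases hx : ∃ x, x ++ w = d
  · obtain ⟨x, rfl⟩ := hx
    have : ∀ y : List ℕ, y ++ w = x ++ w ↔ y = x := fun y => List.append_left_inj w
    simp only [this, Finset.sum_ite_eq']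
    split_ifs
    · exact le_rfl
    · positivity
  · push Not at hx
    simp only [hx, if_false, Finset.sum_const_zero]
    positivity

end

end BiasedWalk

/-! ### Traps seen from the bottom point -/

namespace BiasedWalk

open PlaneTree

/-- The word that leads from the root of the tree with index `m + k` to the root of the tree with
index `m`, in a sequence of trees each of which is a subtree of the next one, with label `j m`. -/
def spinePath (j : ℕ → ℕ) (m : ℕ) : ℕ → List ℕ
  | 0 => []
  | k + 1 => spinePath j m k ++ [j (m + k)]

@[simp] theorem length_spinePath (j : ℕ → ℕ) (m k : ℕ) : (spinePath j m k).length = k := by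
  induction k with
  | zero => rfl
  | succ k ih => simp [spinePath, ih]

theorem spinePath_zero_add (j : ℕ → ℕ) (m k : ℕ) :
    spinePath j 0 (m + k) = spinePath j 0 m ++ spinePath j m k := by
  induction k with
  | zero => simp [spinePath]
  | succ k ih => rw [← add_assoc, spinePath, ih, spinePath, zero_add, List.append_assoc]

/-- A sequence of finite trees, each of which is a subtree of a child of the root of the next one,
the first of them being a single vertex. -/
structure IsSpine (t : ℕ → Field) (j : ℕ → ℕ) : Prop where
  zero : t 0 [] = 0
  lt : ∀ m, j m < t (m + 1) []
  sub_eq : ∀ m, sub (t (m + 1)) [j m] = t m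
  height_ne_top : ∀ m, height (t m) ≠ ⊤

variable {t : ℕ → Field} {j : ℕ → ℕ} {β : ℝ}

theorem IsSpine.sub_spinePath (ht : IsSpine t j) (m k : ℕ) :
    Mem (t (m + k)) (spinePath j m k) ∧ sub (t (m + k)) (spinePath j m k) = t m := by
  induction k with
  | zero => exact ⟨mem_nil _, sub_nil _⟩
  | succ k ih =>
    rw [spinePath, ← add_assoc, mem_append, ← PlaneTree.sub_sub, ht.sub_eq]
    exact ⟨⟨⟨mem_nil _, ht.lt _⟩, ih.1⟩, ih.2⟩

theorem IsSpine.mem_append_spinePath (ht : IsSpine t j) {m : ℕ} {x : List ℕ} (hx : Mem (t m) x)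
    (k : ℕ) : Mem (t (m + k)) (x ++ spinePath j m k) := by
  obtain ⟨h1, h2⟩ := ht.sub_spinePath m k
  exact mem_append.2 ⟨h1, h2 ▸ hx⟩

/-- The bottom point of the tree with index `n` is a leaf. -/
theorem IsSpine.bottom (ht : IsSpine t j) (n : ℕ) :
    Mem (t n) (spinePath j 0 n) ∧ t n (spinePath j 0 n) = 0 := by
  have h := ht.sub_spinePath 0 n
  rw [zero_add] at h
  refine ⟨h.1, ?_⟩
  have h2 := congrFun h.2 []
  rwa [ht.zero] at h2

/-- The total weight of the tree with index `m`, the edges at the bottom point having weight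
`1`. -/
noncomputable def scaledWeight (β : ℝ) (t : ℕ → Field) (m : ℕ) : ℝ :=
  (β⁻¹) ^ m * totalWeight β (t m)

theorem IsSpine.scaledWeight_le (hβ : 0 < β) (ht : IsSpine t j) (m k : ℕ) :
    scaledWeight β t m ≤ scaledWeight β t (m + k) := by
  obtain ⟨h1, h2⟩ := ht.sub_spinePath m k
  have h3 := totalWeight_sub_le hβ (ht.height_ne_top (m + k)) h1
  rw [h2, length_spinePath] at h3
  rw [scaledWeight, scaledWeight, pow_add, mul_assoc]
  refine mul_le_mul_of_nonneg_left ?_ (by positivity)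
  calc totalWeight β (t m) = (β⁻¹) ^ k * (β ^ k * totalWeight β (t m)) := by
        rw [← mul_assoc, ← mul_pow, inv_mul_cancel₀ hβ.ne', one_pow, one_mul]
    _ ≤ _ := by gcongr

theorem norm_sum_vertices_sub_le {ξ : Field} (h : height ξ ≠ ⊤) {w : List ℕ} (hw : Mem ξ w)
    {G : List ℕ → ℂ} {H : List ℕ → ℝ} (hGH : ∀ x, ‖G x‖ ≤ H x) :
    ‖∑ x ∈ vertices ξ, G x - ∑ x ∈ vertices (sub ξ w), G (x ++ w)‖ ≤
      ∑ x ∈ vertices ξ, H x - ∑ x ∈ vertices (sub ξ w), H (x ++ w) := by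
  have hinj : Set.InjOn (fun v => v ++ w) (vertices (sub ξ w) : Set (List ℕ)) :=
    fun v _ v' _ he => List.append_cancel_right he
  have hs : (vertices (sub ξ w)).image (fun v => v ++ w) ⊆ vertices ξ := fun v hv => by
    obtain ⟨x, hx, rfl⟩ := Finset.mem_image.1 hv
    exact (mem_vertices h).2 (mem_append.2 ⟨hw, (mem_vertices (height_sub_ne_top h hw)).1 hx⟩)
  rw [← Finset.sum_image (f := G) hinj, ← Finset.sum_image (f := H) hinj,
    ← Finset.sum_sdiff (f := G) hs, ← Finset.sum_sdiff (f := H) hs, add_sub_cancel_right,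
    add_sub_cancel_right]
  exact norm_sum_le_of_le _ fun x _ => hGH x

section

variable (hβ : 1 < β) (ht : IsSpine t j) {z : ℕ → ℂ} (hz : ∀ n, ‖z n‖ = 1)
  (hz1 : Tendsto z atTop (nhds 1))

include hβ ht hz hz1

/-- The values of `visitFun` at the vertices of a fixed subtree are asymptotically equal. -/
theorem tendsto_visitFun_sub {m : ℕ} {x : List ℕ} (hx : Mem (t m) x) :
    Tendsto (fun k => visitFun β (t (m + k)) (spinePath j 0 (m + k)) (z (m + k))
        (some (x ++ spinePath j m k)) -
      visitFun β (t (m + k)) (spinePath j 0 (m + k)) (z (m + k)) (some (spinePath j m k)))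
      atTop (nhds 0) := by
  have hβ0 : 0 < β := by linarith
  induction x with
  | nil => simp
  | cons i x ih =>
    have h1 : Tendsto (fun k => (β⁻¹) ^ (i :: x ++ spinePath j m k).length +
        ‖1 - z (m + k)‖ * totalWeight β (sub (t m) (i :: x))) atTop (nhds 0) := by
      have h2 : Tendsto (fun k => (β⁻¹) ^ (i :: x ++ spinePath j m k).length) atTop (nhds 0) := by
        simp only [List.length_append, length_spinePath]
        exact (tendsto_pow_atTop_nhds_zero_of_lt_one (by positivity)
          (inv_lt_one_of_one_lt₀ hβ)).comp (tendsto_add_atTop_nat _ |>.congr fun k => add_comm _ _)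
      have h3 : Tendsto (fun k => ‖1 - z (m + k)‖) atTop (nhds 0) := by
        have h4 := (tendsto_const_nhds (x := (1 : ℂ))).sub hz1
        exact h4.norm.comp (tendsto_add_atTop_nat m |>.congr fun k => add_comm _ _) |>.trans
          (by simp)
      simpa using h2.add (h3.mul_const _)
    have h5 := squeeze_zero_norm (fun k => ?_) h1 (f := fun k =>
      visitFun β (t (m + k)) (spinePath j 0 (m + k)) (z (m + k))
        (some (i :: x ++ spinePath j m k)) -
      visitFun β (t (m + k)) (spinePath j 0 (m + k)) (z (m + k)) (some (x ++ spinePath j m k)))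
    · simpa using h5.add (ih hx.1)
    · obtain ⟨hd, hd0⟩ := ht.bottom (m + k)
      have h6 := norm_visitFun_sub_parent_le hβ0 (ht.height_ne_top (m + k)) hd hd0 (hz (m + k))
        (ht.mem_append_spinePath hx k)
      rwa [← sub_sub, (ht.sub_spinePath m k).2] at h6

theorem tendsto_green_mul_visitFun_sub {m : ℕ} {x : List ℕ} (hx : Mem (t m) x) :
    Tendsto (fun k => (green β (spinePath j 0 (m + k)) (x ++ spinePath j m k) : ℂ) *
        visitFun β (t (m + k)) (spinePath j 0 (m + k)) (z (m + k))
          (some (x ++ spinePath j m k)) -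
      (((1 - β⁻¹)⁻¹ : ℝ) : ℂ) * visitFun β (t (m + k)) (spinePath j 0 (m + k)) (z (m + k))
        (some (spinePath j 0 (m + k)))) atTop (nhds 0) := by
  have hβ0 : 0 < β := by linarith
  have h3 := (tendsto_visitFun_sub hβ ht hz hz1 hx).sub (tendsto_visitFun_sub hβ ht hz hz1
    (ht.bottom m).1)
  simp only [sub_self, ← spinePath_zero_add] at h3
  have hg : Tendsto (fun k => green β (spinePath j 0 (m + k)) (x ++ spinePath j m k)) atTop
      (nhds (1 - β⁻¹)⁻¹) := by
    refine tendsto_of_tendsto_of_tendsto_of_le_of_le ((hasSum_geometric_of_lt_one (by positivity)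
      (inv_lt_one_of_one_lt₀ hβ)).tendsto_sum_nat.comp (tendsto_add_atTop_nat 1))
      tendsto_const_nhds (fun k => ?_)
      fun k => green_le_inv hβ _ _
    have h5 := green_of_suffix (β := β)
      ⟨_, (spinePath_zero_add j m k).symm⟩
    rw [length_spinePath] at h5
    exact h5.symm.trans_le (green_mono hβ0 _ _ _)
  have hg' : Tendsto (fun k => ((green β (spinePath j 0 (m + k)) (x ++ spinePath j m k) : ℝ) : ℂ) -
      (((1 - β⁻¹)⁻¹ : ℝ) : ℂ)) atTop (nhds 0) := by
    have := ((Complex.continuous_ofReal.tendsto _).comp hg).sub_const (((1 - β⁻¹)⁻¹ : ℝ) : ℂ)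
    rwa [sub_self] at this
  have h6 : Tendsto (fun k => (((green β (spinePath j 0 (m + k)) (x ++ spinePath j m k) : ℝ) : ℂ) -
      (((1 - β⁻¹)⁻¹ : ℝ) : ℂ)) * visitFun β (t (m + k)) (spinePath j 0 (m + k)) (z (m + k))
          (some (x ++ spinePath j m k))) atTop (nhds 0) := by
    refine squeeze_zero_norm (fun k => ?_) (tendsto_zero_iff_norm_tendsto_zero.1 hg')
    rw [norm_mul]
    exact mul_le_of_le_one_right (norm_nonneg _) (norm_visitFun_le (hz _).le _ _)
  have h7 := h6.add (h3.const_mul (((1 - β⁻¹)⁻¹ : ℝ) : ℂ))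
  rw [mul_zero, add_zero] at h7
  exact h7.congr fun k => by ring

variable {S : ℝ} (hS : Tendsto (scaledWeight β t) atTop (nhds S))

include hS

/-- The sum in `one_sub_mul_visitFun_self` is dominated by the vertices close to the bottom
point. -/
theorem tendsto_sum_green_mul_visitFun : Tendsto (fun n => ((β⁻¹ : ℝ) : ℂ) ^ n *
      ∑ x ∈ vertices (t n), ((β ^ x.length * (1 + β * t n x) *
        green β (spinePath j 0 n) x : ℝ) : ℂ) *
        visitFun β (t n) (spinePath j 0 n) (z n) (some x) -
      (((1 - β⁻¹)⁻¹ * scaledWeight β t n : ℝ) : ℂ) *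
        visitFun β (t n) (spinePath j 0 n) (z n) (some (spinePath j 0 n))) atTop (nhds 0) := by
  have hβ0 : 0 < β := by linarith
  set g : ℝ := (1 - β⁻¹)⁻¹ with hg
  have hg0 : 0 < g := inv_pos.2 (sub_pos.2 (inv_lt_one_of_one_lt₀ hβ))
  set a : ℕ → List ℕ → ℂ := fun n x => visitFun β (t n) (spinePath j 0 n) (z n) (some x) with ha
  have ha1 : ∀ n x, ‖a n x‖ ≤ 1 := fun n x => norm_visitFun_le (hz n).le _ _
  set wt : ℕ → List ℕ → ℝ := fun n x => β ^ x.length * (1 + β * t n x) with hwt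
  have hwt0 : ∀ n x, 0 ≤ wt n x := fun n x => by positivity
  set G : ℕ → List ℕ → ℂ := fun n x =>
    (wt n x : ℂ) * ((green β (spinePath j 0 n) x : ℂ) * a n x - g * a n (spinePath j 0 n)) with hG
  have hGH : ∀ n x, ‖G n x‖ ≤ wt n x * (2 * g) := fun n x => by
    simp only [hG]
    rw [norm_mul, Complex.norm_real, Real.norm_of_nonneg (hwt0 n x), two_mul]
    refine mul_le_mul_of_nonneg_left ((norm_sub_le _ _).trans (add_le_add ?_ ?_)) (hwt0 n x)
    · rw [norm_mul, Complex.norm_real, Real.norm_of_nonneg (green_pos hβ0 _ _).le]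
      exact (mul_le_of_le_one_right (green_pos hβ0 _ _).le (ha1 n x)).trans (green_le_inv hβ _ _)
    · rw [norm_mul, Complex.norm_real, Real.norm_of_nonneg hg0.le]
      exact mul_le_of_le_one_right hg0.le (ha1 n _)
  have heq : ∀ n, ((β⁻¹ : ℝ) : ℂ) ^ n * ∑ x ∈ vertices (t n),
      ((wt n x * green β (spinePath j 0 n) x : ℝ) : ℂ) * a n x -
      ((g * scaledWeight β t n : ℝ) : ℂ) * a n (spinePath j 0 n) =
        ((β⁻¹ : ℝ) : ℂ) ^ n * ∑ x ∈ vertices (t n), G n x := fun n => by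
    simp only [hG, mul_sub, Finset.sum_sub_distrib, scaledWeight, totalWeight]
    push_cast
    congr 1
    · congr 1
      exact Finset.sum_congr rfl fun x _ => by ring
    · rw [← Finset.sum_mul]
      simp only [hwt]
      push_cast
      ring
  refine Tendsto.congr (fun n => (heq n).symm) ?_
  rw [Metric.tendsto_atTop]
  intro ε hε
  have hSm := fun m =>
    ge_of_tendsto hS ((eventually_ge_atTop m).mono fun n hn => by
      obtain ⟨k, rfl⟩ := Nat.exists_eq_add_of_le hn
      exact ht.scaledWeight_le hβ0 m k)
  -- For large `m`, the subtree of the ancestor number `m` carries nearly all of the weight `S`.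
  obtain ⟨m, hm⟩ : ∃ m, S - scaledWeight β t m < ε / 2 / (2 * g) := by
    have h1 := (tendsto_const_nhds (x := S)).sub hS
    rw [sub_self] at h1
    exact (h1.eventually (gt_mem_nhds (by positivity))).exists
  -- On this fixed subtree the terms tend to zero one by one.
  have hfix : Tendsto (fun k => ((β⁻¹ : ℝ) : ℂ) ^ m * ∑ x ∈ vertices (t m), (wt m x : ℂ) *
      ((green β (spinePath j 0 (m + k)) (x ++ spinePath j m k) : ℂ) *
        a (m + k) (x ++ spinePath j m k) - g * a (m + k) (spinePath j 0 (m + k))))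
      atTop (nhds 0) := by
    have h1 := tendsto_finsetSum (vertices (t m)) fun x hx =>
      (tendsto_green_mul_visitFun_sub hβ ht hz hz1
        ((mem_vertices (ht.height_ne_top m)).1 hx)).const_mul (wt m x : ℂ)
    have h2 := h1.const_mul (((β⁻¹ : ℝ) : ℂ) ^ m)
    rw [← hg] at h2
    simp only [mul_zero, Finset.sum_const_zero] at h2
    exact h2
  obtain ⟨K, hK⟩ := Metric.tendsto_atTop.1 hfix (ε / 2) (by positivity)
  refine ⟨m + K, fun n hn => ?_⟩
  obtain ⟨k, rfl⟩ := Nat.exists_eq_add_of_le ((Nat.le_add_right m K).trans hn)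
  have hKk := hK k (by omega)
  rw [dist_zero_right] at hKk ⊢
  obtain ⟨hp, hsub⟩ := ht.sub_spinePath m k
  have hwtp : ∀ x, wt (m + k) (x ++ spinePath j m k) = β ^ k * wt m x := fun x => by
    have : t (m + k) (x ++ spinePath j m k) = t m x := congrFun hsub x
    simp only [hwt, this, List.length_append, length_spinePath]
    ring
  have h1 := norm_sum_vertices_sub_le (ht.height_ne_top (m + k)) hp (hGH (m + k))
  rw [hsub] at h1
  have h2 : ((β⁻¹ : ℝ) : ℂ) ^ (m + k) * ∑ x ∈ vertices (t m), G (m + k) (x ++ spinePath j m k) =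
      ((β⁻¹ : ℝ) : ℂ) ^ m * ∑ x ∈ vertices (t m), (wt m x : ℂ) *
      ((green β (spinePath j 0 (m + k)) (x ++ spinePath j m k) : ℂ) *
        a (m + k) (x ++ spinePath j m k) - g * a (m + k) (spinePath j 0 (m + k))) := by
    rw [pow_add, mul_assoc, Finset.mul_sum _ _ (((β⁻¹ : ℝ) : ℂ) ^ k)]
    congr 1
    refine Finset.sum_congr rfl fun x _ => ?_
    simp only [hG, hwtp]
    have : (β : ℂ) ≠ 0 := by exact_mod_cast hβ0.ne'
    push_cast
    rw [inv_pow]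
    field_simp
  have h3 : (β⁻¹) ^ (m + k) * (∑ x ∈ vertices (t (m + k)), wt (m + k) x * (2 * g) -
      ∑ x ∈ vertices (t m), wt (m + k) (x ++ spinePath j m k) * (2 * g)) =
        (scaledWeight β t (m + k) - scaledWeight β t m) * (2 * g) := by
    have hT : ∀ n, ∑ x ∈ vertices (t n), wt n x = totalWeight β (t n) := fun _ => rfl
    simp only [hwtp, ← Finset.sum_mul, ← Finset.mul_sum, scaledWeight, hT]
    rw [inv_pow, inv_pow, pow_add]
    field_simp
  -- The vertices outside the subtree contribute at most the weight that is missing.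
  have h4 : ((β⁻¹ : ℝ) : ℂ) ^ (m + k) * ∑ x ∈ vertices (t (m + k)), G (m + k) x =
      ((β⁻¹ : ℝ) : ℂ) ^ (m + k) * ∑ x ∈ vertices (t m), G (m + k) (x ++ spinePath j m k) +
      ((β⁻¹ : ℝ) : ℂ) ^ (m + k) * (∑ x ∈ vertices (t (m + k)), G (m + k) x -
        ∑ x ∈ vertices (t m), G (m + k) (x ++ spinePath j m k)) := by ring
  have h5 : ‖((β⁻¹ : ℝ) : ℂ) ^ (m + k) * (∑ x ∈ vertices (t (m + k)), G (m + k) x -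
        ∑ x ∈ vertices (t m), G (m + k) (x ++ spinePath j m k))‖ ≤
      (scaledWeight β t (m + k) - scaledWeight β t m) * (2 * g) := by
    rw [← h3, norm_mul, norm_pow, Complex.norm_real, Real.norm_of_nonneg (by positivity)]
    gcongr
  have h6 : (scaledWeight β t (m + k) - scaledWeight β t m) * (2 * g) < ε / 2 := by
    rw [← lt_div_iff₀ (by positivity)]
    linarith [hSm (m + k)]
  rw [h4, h2]
  refine (norm_add_le _ _).trans_lt ?_
  linarith

end

/-- The limit of the generating function of the time between the first and the last visit to the
bottom point: with probability `1 - β⁻¹` the bottom point is visited, and then the time is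
asymptotically exponential, with mean `S / (1 - β⁻¹)`. -/
theorem tendsto_betweenFun (hβ : 1 < β) (ht : IsSpine t j) {S : ℝ}
    (hS : Tendsto (scaledWeight β t) atTop (nhds S)) (l : ℝ) :
    Tendsto (fun n => betweenFun β (t n) (spinePath j 0 n)
      (Complex.exp (((l * (β⁻¹) ^ n : ℝ) : ℂ) * Complex.I)) (some [])) atTop
      (nhds (1 - (1 - (1 - ((l * (S / (1 - β⁻¹)) : ℝ) : ℂ) * Complex.I)⁻¹) *
        ((1 - β⁻¹ : ℝ) : ℂ))) := by
  have hβ0 : 0 < β := by linarith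
  set z : ℕ → ℂ := fun n => Complex.exp (((l * (β⁻¹) ^ n : ℝ) : ℂ) * Complex.I) with hzd
  have hz : ∀ n, ‖z n‖ = 1 := fun n => Complex.norm_exp_ofReal_mul_I _
  have hpow := tendsto_pow_atTop_nhds_zero_of_lt_one (by positivity) (inv_lt_one_of_one_lt₀ hβ)
  have hdz : Tendsto (fun n => (1 - z n) * (β : ℂ) ^ n) atTop (nhds (-((l : ℂ) * Complex.I))) := by
    have hd : HasDerivAt (fun h : ℝ => Complex.exp (((l * h : ℝ) : ℂ) * Complex.I))
        ((l : ℂ) * Complex.I) 0 := by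
      have h1 : HasDerivAt (fun h : ℝ => ((l * h : ℝ) : ℂ) * Complex.I)
          ((l : ℂ) * Complex.I) 0 := by
        have := (((hasDerivAt_id (0 : ℝ)).const_mul l).ofReal_comp).mul_const Complex.I
        simpa using this
      simpa using h1.cexp
    have h2 := (hasDerivAt_iff_tendsto_slope_zero.1 hd).comp
      (tendsto_nhdsWithin_iff.2 ⟨hpow, Eventually.of_forall fun n =>
        (by positivity : (β⁻¹) ^ n ≠ 0)⟩)
    refine h2.neg.congr fun n => ?_
    simp only [Function.comp_apply, zero_add, mul_zero, Complex.ofReal_zero, zero_mul,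
      Complex.exp_zero, hzd, Complex.real_smul]
    push_cast
    rw [inv_pow, inv_inv]
    ring
  have hz1 : Tendsto z atTop (nhds 1) := by
    have h1 : Tendsto (fun n => ((l * (β⁻¹) ^ n : ℝ) : ℂ) * Complex.I) atTop (nhds 0) := by
      have := ((Complex.continuous_ofReal.tendsto _).comp (hpow.const_mul l)).mul_const Complex.I
      simpa using this
    have h2 := (Complex.continuous_exp.tendsto _).comp h1
    rwa [Complex.exp_zero] at h2
  set α : ℕ → ℂ := fun n => visitFun β (t n) (spinePath j 0 n) (z n) (some (spinePath j 0 n))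
    with hα
  have hM := tendsto_sum_green_mul_visitFun hβ ht hz hz1 hS
  set den : ℕ → ℂ := fun n =>
    z n + (1 - z n) * (β : ℂ) ^ n * (((1 - β⁻¹)⁻¹ * scaledWeight β t n : ℝ) : ℂ) with hden
  have hden1 : Tendsto den atTop (nhds (1 - ((l * (S / (1 - β⁻¹)) : ℝ) : ℂ) * Complex.I)) := by
    have h1 := hz1.add (hdz.mul ((Complex.continuous_ofReal.tendsto _).comp
      (hS.const_mul (1 - β⁻¹)⁻¹)))
    have h2 : 1 - ((l * (S / (1 - β⁻¹)) : ℝ) : ℂ) * Complex.I =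
        1 + -((l : ℂ) * Complex.I) * (((1 - β⁻¹)⁻¹ * S : ℝ) : ℂ) := by
      push_cast
      ring
    rw [h2]
    exact h1
  have hlim0 : (1 - ((l * (S / (1 - β⁻¹)) : ℝ) : ℂ) * Complex.I) ≠ 0 := fun h0 => by
    have := congrArg Complex.re h0
    rw [Complex.sub_re, Complex.re_ofReal_mul, Complex.I_re] at this
    simp at this
  have hα1 : ∀ n, α n * den n = 1 - (1 - z n) * (β : ℂ) ^ n * (((β⁻¹ : ℝ) : ℂ) ^ n *
      ∑ x ∈ vertices (t n), ((β ^ x.length * (1 + β * t n x) *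
        green β (spinePath j 0 n) x : ℝ) : ℂ) *
        visitFun β (t n) (spinePath j 0 n) (z n) (some x) -
      (((1 - β⁻¹)⁻¹ * scaledWeight β t n : ℝ) : ℂ) * α n) := fun n => by
    have h1 := one_sub_mul_visitFun_self hβ0 (ht.height_ne_top n) (ht.bottom n).1 (ht.bottom n).2
      (hz n).le
    have h2 : (β : ℂ) ^ n * ((β⁻¹ : ℝ) : ℂ) ^ n = 1 := by
      rw [← mul_pow, Complex.ofReal_inv, mul_inv_cancel₀ (by exact_mod_cast hβ0.ne'), one_pow]
    simp only [hden, hα]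
    linear_combination (-1 : ℂ) * h1 + (1 - z n) * (∑ x ∈ vertices (t n),
      ((β ^ x.length * (1 + β * t n x) * green β (spinePath j 0 n) x : ℝ) : ℂ) *
        visitFun β (t n) (spinePath j 0 n) (z n) (some x)) * h2
  have hαt : Tendsto α atTop (nhds (1 - ((l * (S / (1 - β⁻¹)) : ℝ) : ℂ) * Complex.I)⁻¹) := by
    have h1 := ((hdz.mul hM).const_sub 1).mul (hden1.inv₀ hlim0)
    rw [mul_zero, sub_zero, one_mul] at h1
    refine h1.congr' ?_
    filter_upwards [hden1.eventually_ne hlim0] with n hn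
    rw [← hα1 n, mul_inv_cancel_right₀ hn]
  have hgr : Tendsto (fun n => ((green β (spinePath j 0 n) (spinePath j 0 n) : ℝ) : ℂ)⁻¹) atTop
      (nhds ((1 - β⁻¹ : ℝ) : ℂ)) := by
    have h5 := (Complex.continuous_ofReal.tendsto _).comp (((hasSum_geometric_of_lt_one (by
      positivity) (inv_lt_one_of_one_lt₀ hβ)).tendsto_sum_nat.comp (tendsto_add_atTop_nat 1)).inv₀
      (inv_ne_zero (sub_pos.2 (inv_lt_one_of_one_lt₀ hβ)).ne'))
    rw [inv_inv] at h5
    refine h5.congr fun n => ?_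
    simp only [Function.comp_apply, green_of_suffix (List.suffix_refl _), length_spinePath,
      Complex.ofReal_inv]
  refine (((hαt.const_sub 1).mul hgr).const_sub 1).congr fun n => ?_
  rw [betweenFun_bud hβ0 (ht.height_ne_top n) (ht.bottom n).1 (ht.bottom n).2 (hz n).le,
    div_eq_mul_inv]

end BiasedWalk

/-! ### The infinite trap -/

namespace PlaneTree

/-- Two fields of offspring numbers encode the same tree. -/
def SameTree (ξ η : Field) : Prop := ∀ v, Mem ξ v → ξ v = η v

theorem SameTree.mem_iff {ξ η : Field} (h : SameTree ξ η) (v : List ℕ) : Mem ξ v ↔ Mem η v := by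
  induction v with
  | nil => exact Iff.rfl
  | cons i v ih =>
    constructor
    · rintro ⟨h1, h2⟩
      exact ⟨ih.1 h1, h v h1 ▸ h2⟩
    · rintro ⟨h1, h2⟩
      have h3 := ih.2 h1
      exact ⟨h3, (h v h3).symm ▸ h2⟩

theorem SameTree.height_eq {ξ η : Field} (h : SameTree ξ η) : height ξ = height η := by
  simp only [height, h.mem_iff]

theorem SameTree.isBottom_iff {ξ η : Field} (h : SameTree ξ η) (v : List ℕ) :
    IsBottom ξ v ↔ IsBottom η v := by
  simp only [IsBottom, h.mem_iff, h.height_eq]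

theorem IsBottom.eq {ξ : Field} {v w : List ℕ} (hv : IsBottom ξ v) (hw : IsBottom ξ w) :
    v = w := by
  have h : v.length = w.length := by exact_mod_cast hv.2.1.trans hw.2.1.symm
  exact List.reverse_injective (le_antisymm (hv.2.2 w hw.1 h.symm) (hw.2.2 v hv.1 h))

/-- The tree with `k` children of the root, the tree of the descendants of the child `i` being
`c i`. -/
def node (k : ℕ) (c : ℕ → Field) : Field := fun w =>
  match w.getLast? with
  | none => k
  | some i => c i w.dropLast

@[simp] theorem node_nil (k : ℕ) (c : ℕ → Field) : node k c [] = k := rfl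

@[simp] theorem sub_node (k : ℕ) (c : ℕ → Field) (i : ℕ) : sub (node k c) [i] = c i := by
  funext v
  simp [sub, node]

@[simp] theorem node_sub (ξ : Field) : node (ξ []) (fun i => sub ξ [i]) = ξ := by
  funext w
  obtain rfl | ⟨v, i, rfl⟩ := List.eq_nil_or_concat' w
  · rfl
  · simp [sub, node]

theorem sameTree_node {k : ℕ} {c c' : ℕ → Field} (h : ∀ i < k, SameTree (c i) (c' i)) :
    SameTree (node k c) (node k c') := by
  intro w hw
  obtain rfl | ⟨v, i, rfl⟩ := List.eq_nil_or_concat' w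
  · rfl
  · obtain ⟨h1, h2⟩ := mem_append.1 hw
    simpa [node] using (h i h1.2 v (by rwa [sub_node] at h2))

theorem measurable_node_mk : Measurable fun p : ℕ × (ℕ → Field) => node p.1 p.2 := by
  refine measurable_pi_lambda _ fun w => ?_
  unfold node
  rcases w.getLast? with _ | i
  · exact measurable_fst
  · fun_prop

end PlaneTree

namespace BiasedWalk

open PlaneTree

theorem trapWalk_mem (β : ℝ) (ξ : Field) (v : ℕ → I) (t : ℕ) {w : List ℕ}
    (h : trapWalk β ξ v t = some w) : Mem ξ w := by
  induction t generalizing w with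
  | zero => obtain rfl := Option.some_injective _ h; exact mem_nil _
  | succ t ih =>
    rw [trapWalk_eq, trapFrom, ← trapWalk_eq] at h
    obtain ⟨x, hx, hs⟩ := Option.bind_eq_some_iff.1 h
    have hm := ih hx
    rw [trapStep] at hs
    split_ifs at hs with hi
    · obtain rfl := Option.some_injective _ hs
      exact ⟨hm, hi⟩
    · cases x with
      | nil => simp [parent] at hs
      | cons i y => obtain rfl := Option.some_injective _ hs; exact hm.1

theorem SameTree.bottomTime_eq {ξ η : Field} (h : SameTree ξ η) (β : ℝ) (v : ℕ → I) :
    bottomTime β ξ v = bottomTime β η v := by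
  have h1 : ∀ t, trapWalk β ξ v t = trapWalk β η v t := by
    intro t
    induction t with
    | zero => rfl
    | succ t ih =>
      rw [trapWalk, trapWalk, ← ih]
      rcases hw : trapWalk β ξ v t with _ | w
      · rfl
      · simp only [h w (trapWalk_mem β ξ v t hw)]
  simp only [bottomTime, AtBottom, h1, h.isBottom_iff]

theorem bottomTime_eq_timeBetween {ξ : Field} {d : List ℕ} (hd : IsBottom ξ d) (β : ℝ)
    (v : ℕ → I) : bottomTime β ξ v = timeBetween (hits β ξ d (some []) v) := by
  have h1 : ∀ t, AtBottom β ξ v t ↔ t ∈ hits β ξ d (some []) v := fun t => by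
    simp only [AtBottom, hits, Set.mem_ofPred_eq, trapWalk_eq]
    constructor
    · rintro ⟨w, hw, hb⟩
      rw [hw, hb.eq hd]
    · exact fun hw => ⟨d, hw, hd⟩
  simp only [bottomTime, timeBetween, h1]

end BiasedWalk

section ConditionedProducts

variable {X : Type*} [MeasurableSpace X]

/-- A function of the first `k` coordinates only sees the first `k` factors. -/
theorem lintegral_infinitePi_congr [Inhabited X] {μ ν : ℕ → Measure X}
    [∀ i, IsProbabilityMeasure (μ i)] [∀ i, IsProbabilityMeasure (ν i)] {k : ℕ}
    (h : ∀ i < k, μ i = ν i) {F : (ℕ → X) → ℝ≥0∞} (hF : Measurable F)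
    (hFk : ∀ c c', (∀ i < k, c i = c' i) → F c = F c') :
    ∫⁻ c, F c ∂Measure.infinitePi μ = ∫⁻ c, F c ∂Measure.infinitePi ν := by
  set g : ℕ → X → X := fun i x => if i < k then x else default with hg
  have hgm : ∀ i, Measurable (g i) := fun i => by
    by_cases hi : i < k
    · simp only [hg, hi, if_true]
      exact measurable_id
    · simp [hg, hi]
  have hT : Measurable fun (c : ℕ → X) i => g i (c i) := by fun_prop
  have h1 : ∀ ρ : ℕ → Measure X, ∀ _ : ∀ i, IsProbabilityMeasure (ρ i),
      ∫⁻ c, F c ∂Measure.infinitePi ρ =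
        ∫⁻ c, F c ∂(Measure.infinitePi ρ).map fun c i => g i (c i) := fun ρ _ => by
    rw [lintegral_map hF hT]
    exact lintegral_congr fun c => hFk _ _ fun i hi => by simp [hg, hi]
  rw [h1 μ inferInstance, h1 ν inferInstance, Measure.infinitePi_map_pi _ hgm,
    Measure.infinitePi_map_pi _ hgm]
  have h2 : (fun i => (μ i).map (g i)) = fun i => (ν i).map (g i) := by
    funext i
    by_cases hi : i < k
    · rw [h i hi]
    · have : g i = fun _ => default := by funext x; simp [hg, hi]
      rw [this, Measure.map_const, Measure.map_const, measure_univ, measure_univ]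
  simp only [h2]

/-- Conditioning finitely many independent coordinates. -/
theorem setLIntegral_infinitePi [Inhabited X] (μ : Measure X) [IsProbabilityMeasure μ]
    {A : ℕ → Set X} (hA : ∀ i, MeasurableSet (A i)) {k : ℕ} {F : (ℕ → X) → ℝ≥0∞}
    (hF : Measurable F) (hFk : ∀ c c', (∀ i < k, c i = c' i) → F c = F c') :
    ∫⁻ c in {c | ∀ i < k, c i ∈ A i}, F c ∂Measure.infinitePi (fun _ => μ) =
      (∏ i ∈ Finset.range k, μ (A i)) *
        ∫⁻ c, F c ∂Measure.infinitePi fun i => condLaw μ (A i) := by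
  have hset : {c : ℕ → X | ∀ i < k, c i ∈ A i} = Set.pi (Finset.range k) A := by
    ext c; simp [Set.pi]
  have hmass : Measure.infinitePi (fun _ => μ) {c : ℕ → X | ∀ i < k, c i ∈ A i} =
      ∏ i ∈ Finset.range k, μ (A i) := by
    rw [hset, Measure.infinitePi_pi _ fun i _ => hA i]
  by_cases h0 : ∏ i ∈ Finset.range k, μ (A i) = 0
  · rw [h0, zero_mul]
    exact setLIntegral_measure_zero _ _ (hmass.trans h0)
  have hAi := fun i hi =>
    Finset.prod_ne_zero_iff.1 h0 i (Finset.mem_range.2 hi)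
  have htop : ∏ i ∈ Finset.range k, μ (A i) ≠ ∞ :=
    ENNReal.prod_ne_top fun i _ => measure_ne_top _ _
  set ν : ℕ → Measure X := fun i => if i < k then condLaw μ (A i) else μ with hν
  have key : (∏ i ∈ Finset.range k, μ (A i))⁻¹ • (Measure.infinitePi fun _ => μ).restrict
      {c : ℕ → X | ∀ i < k, c i ∈ A i} = Measure.infinitePi ν := by
    refine Measure.eq_infinitePi _ fun s t ht => ?_
    set B : ℕ → Set X := fun i => (if i < k then A i else Set.univ) ∩
      if i ∈ s then t i else Set.univ with hB
    have hBm : ∀ i, MeasurableSet (B i) := fun i => by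
      refine MeasurableSet.inter ?_ ?_
      · split_ifs
        exacts [hA i, MeasurableSet.univ]
      · split_ifs
        exacts [ht i, MeasurableSet.univ]
    have hcap : Set.pi (s : Set ℕ) t ∩ {c : ℕ → X | ∀ i < k, c i ∈ A i} =
        Set.pi ((s ∪ Finset.range k : Finset ℕ) : Set ℕ) B := by
      ext c
      simp only [Set.mem_inter_iff, Set.mem_pi, Set.mem_ofPred_eq, hB, Finset.mem_coe,
        Finset.mem_union, Finset.mem_range]
      constructor
      · rintro ⟨h1, h2⟩ i _
        refine ⟨?_, ?_⟩
        · split_ifs with hi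
          exacts [h2 i hi, trivial]
        · split_ifs with hi
          exacts [h1 i hi, trivial]
      · refine fun h1 => ⟨fun i hi => ?_, fun i hi => ?_⟩
        · have := (h1 i (Or.inl hi)).2
          rwa [if_pos hi] at this
        · have := (h1 i (Or.inr hi)).1
          rwa [if_pos hi] at this
    have hμB : ∀ i, μ (B i) = (if i < k then μ (A i) else 1) *
        (if i ∈ s then ν i (t i) else 1) := fun i => by
      have h1 : (if i ∈ s then ν i (t i) else 1) = ν i (if i ∈ s then t i else Set.univ) := by
        split_ifs
        · rfl
        · exact measure_univ.symm
      rw [h1]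
      simp only [hB, hν]
      split_ifs with hi hs hs
      · rw [condLaw, if_neg (hAi i hi), cond_apply (hA i), ← mul_assoc,
          ENNReal.mul_inv_cancel (hAi i hi) (measure_ne_top _ _), one_mul]
      · rw [condLaw, if_neg (hAi i hi), cond_apply (hA i), ← mul_assoc,
          ENNReal.mul_inv_cancel (hAi i hi) (measure_ne_top _ _), one_mul]
      · rw [one_mul, Set.univ_inter]
      · rw [one_mul, Set.univ_inter]
    rw [Measure.smul_apply, smul_eq_mul,
      Measure.restrict_apply (MeasurableSet.pi s.countable_toSet fun i _ => ht i), hcap,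
      Measure.infinitePi_pi _ fun i _ => hBm i, Finset.prod_congr rfl fun i _ => hμB i,
      Finset.prod_mul_distrib, ← mul_assoc]
    have h2 : ∏ i ∈ s ∪ Finset.range k, (if i < k then μ (A i) else 1) =
        ∏ i ∈ Finset.range k, μ (A i) := by
      rw [← Finset.prod_subset Finset.subset_union_right fun i _ hi => if_neg (by simpa using hi)]
      exact Finset.prod_congr rfl fun i hi => if_pos (Finset.mem_range.1 hi)
    have h3 : ∏ i ∈ s ∪ Finset.range k, (if i ∈ s then ν i (t i) else 1) =
        ∏ i ∈ s, ν i (t i) := by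
      rw [← Finset.prod_subset Finset.subset_union_left fun i _ hi => if_neg hi]
      exact Finset.prod_congr rfl fun i hi => if_pos hi
    rw [h2, h3, ENNReal.inv_mul_cancel h0 htop, one_mul]
  rw [← lintegral_infinitePi_congr (μ := ν) (fun i hi => by simp only [hν, if_pos hi]) hF hFk,
    ← key, lintegral_smul_measure, smul_eq_mul, ← mul_assoc, ENNReal.mul_inv_cancel h0 htop,
    one_mul]

end ConditionedProducts

/-! ### The law of a trap seen from its bottom point -/

namespace BiasedGW

open PlaneTree BiasedWalk

/-- The trees of the descendants of the children of an ancestor of the bottom point: the child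
with label `j - 1` is on the spine, and `t` is the tree of its descendants. -/
def children (j : ℕ) (x : (ℕ → Field) × (ℕ → Field)) (t : Field) : ℕ → Field :=
  Function.update (fun i => if i < j then x.1 i else x.2 (i - j)) (j - 1) t

/-- The tree of the descendants of an ancestor of the bottom point. -/
def joinTree (s : SpineData) (t : Field) : Field := node s.1.2 (children s.1.1 s.2 t)

/-- The tree of the descendants of the ancestor number `n` of the bottom point. -/
def treeOf (s : ℕ → SpineData) : ℕ → Field
  | 0 => fun _ => 0
  | n + 1 => joinTree (s n) (treeOf s n)

theorem measurable_children (j : ℕ) :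
    Measurable fun p : ((ℕ → Field) × (ℕ → Field)) × Field => children j p.1 p.2 := by
  refine measurable_pi_lambda _ fun i => ?_
  by_cases hi : i = j - 1
  · subst hi
    simpa [children] using measurable_snd
  · simp only [children, Function.update_of_ne hi]
    split_ifs <;> fun_prop

theorem measurable_joinTree : Measurable fun p : SpineData × Field => joinTree p.1 p.2 :=
  .discrete_apply (f := fun (jk : ℕ × ℕ) (p : SpineData × Field) =>
    node jk.2 (children jk.1 p.1.2 p.2)) (fun jk => measurable_node_mk.comp
      (measurable_const.prodMk ((measurable_children jk.1).comp
      (f := fun p : SpineData × Field => (p.1.2, p.2)) (by fun_prop)))) (by fun_prop)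

theorem measurable_treeOf (n : ℕ) : Measurable fun s : ℕ → SpineData => treeOf s n := by
  induction n with
  | zero => exact measurable_const
  | succ n ih =>
    exact measurable_joinTree.comp
      ((measurable_pi_apply n).prodMk ih)

theorem treeOf_congr {s s' : ℕ → SpineData} {n : ℕ} (h : ∀ i < n, s i = s' i) :
    treeOf s n = treeOf s' n := by
  induction n with
  | zero => rfl
  | succ n ih => rw [treeOf, treeOf, h n n.lt_succ_self, ih fun i hi => h i (by omega)]

theorem sameTree_joinTree (s : SpineData) {t t' : Field} (h : SameTree t t') :
    SameTree (joinTree s t) (joinTree s t') := by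
  refine sameTree_node fun i _ => ?_
  simp only [children]
  by_cases hi : i = s.1.1 - 1
  · subst hi; simpa using h
  · rw [Function.update_of_ne hi, Function.update_of_ne hi]
    exact fun _ _ => rfl

/-- The constraint on the child `i` when the child `j - 1` is the first one below which the tree
reaches the height `n`, and this is the maximal height. -/
def childEvent (n j i : ℕ) : Set Field :=
  if i + 1 = j then {ξ | height ξ = (n : ℕ∞)}
  else if i < j then {ξ | height ξ < (n : ℕ∞)} else {ξ | height ξ < ((n + 1 : ℕ) : ℕ∞)}

theorem measurableSet_childEvent (n j i : ℕ) : MeasurableSet (childEvent n j i) := by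
  unfold childEvent
  split_ifs
  exacts [measurableSet_height_eq n, measurableSet_height_lt n, measurableSet_height_lt _]

theorem childEvent_subset (n j i : ℕ) : childEvent n j i ⊆ {ξ | height ξ < ((n + 1 : ℕ) : ℕ∞)} := by
  have hn : (n : ℕ∞) < ((n + 1 : ℕ) : ℕ∞) := by exact_mod_cast n.lt_succ_self
  intro ξ hξ
  unfold childEvent at hξ
  split_ifs at hξ
  · exact (show height ξ = n from hξ).trans_lt hn
  · exact (show height ξ < n from hξ).trans hn
  · exact hξ

/-- The tree reaches its maximal height `n + 1` for the first time below exactly one child. -/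
theorem indicator_height_node (n k : ℕ) (c : ℕ → Field) (a : ℝ≥0∞) :
    {c | height (node k c) = ((n + 1 : ℕ) : ℕ∞)}.indicator (fun _ => a) c =
      ∑ j ∈ Finset.Icc 1 k, {c | ∀ i < k, c i ∈ childEvent n j i}.indicator (fun _ => a) c := by
  have hiff : height (node k c) = ((n + 1 : ℕ) : ℕ∞) ↔
      (∀ i < k, height (c i) < ((n + 1 : ℕ) : ℕ∞)) ∧ ∃ i < k, height (c i) = (n : ℕ∞) := by
    rw [height_eq_succ_iff]
    simp
  have hlt : ∀ {m : ℕ∞}, m < ((n + 1 : ℕ) : ℕ∞) → m ≠ n → m < n := fun {m} h1 h2 => by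
    lift m to ℕ using ne_top_of_lt h1
    norm_cast at h1 h2 ⊢
    omega
  by_cases h : height (node k c) = ((n + 1 : ℕ) : ℕ∞)
  · obtain ⟨h1, h2⟩ := hiff.1 h
    set j := Nat.find h2 with hj
    obtain ⟨hjk, hjn⟩ := Nat.find_spec h2
    have hmin : ∀ i < j, ¬ (i < k ∧ height (c i) = (n : ℕ∞)) := fun i hi => Nat.find_min h2 hi
    have hmem : ∀ j', 1 ≤ j' → j' ≤ k → ((∀ i < k, c i ∈ childEvent n j' i) ↔ j' = j + 1) := by
      intro j' hj1 hjk'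
      constructor
      · intro hc
        have h5 := hmin (j' - 1)
        grind [childEvent]
      · rintro rfl i hi
        grind [childEvent]
    rw [Set.indicator_of_mem (s := {c | height (node k c) = ((n + 1 : ℕ) : ℕ∞)}) h,
      Finset.sum_eq_single (j + 1), Set.indicator_of_mem]
    · exact (hmem (j + 1) (by omega) (by omega)).2 rfl
    · intro j' hj' hne
      have hj'' := Finset.mem_Icc.1 hj'
      exact Set.indicator_of_notMem (s := {c : ℕ → Field | ∀ i < k, c i ∈ childEvent n j' i})
        (fun hc => hne ((hmem j' hj''.1 hj''.2).1 hc)) _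
    · exact fun hn => absurd (Finset.mem_Icc.2 ⟨by omega, by omega⟩) hn
  · refine (Set.indicator_of_notMem (s := {c | height (node k c) = ((n + 1 : ℕ) : ℕ∞)}) h _).trans
      (Finset.sum_eq_zero fun j hj => Set.indicator_of_notMem
        (s := {c : ℕ → Field | ∀ i < k, c i ∈ childEvent n j i}) (fun hc => h (hiff.2
          ⟨fun i hi => childEvent_subset n j i (hc i hi), j - 1, ?_⟩)) _).symm
    have := Finset.mem_Icc.1 hj
    have h3 := hc (j - 1) (by omega)
    rw [childEvent, if_pos (by omega)] at h3
    exact ⟨by omega, h3⟩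

variable (D : BiasedGW)

/-- The law of a trap of height `n`. -/
noncomputable def heightLaw (n : ℕ) : Measure Field :=
  condLaw D.trapMeasure {ξ | height ξ = (n : ℕ∞)}

instance (n : ℕ) : IsProbabilityMeasure (D.heightLaw n) := by unfold heightLaw; infer_instance

/-- The law of the subtraps at an ancestor of the bottom point. -/
noncomputable def subtrapLaw (n : ℕ) : Measure ((ℕ → Field) × (ℕ → Field)) :=
  (Measure.infinitePi fun _ => condLaw D.trapMeasure {ξ | height ξ < (n : ℕ∞)}).prod
    (Measure.infinitePi fun _ => condLaw D.trapMeasure {ξ | height ξ < ((n + 1 : ℕ) : ℕ∞)})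

instance (n : ℕ) : IsProbabilityMeasure (D.subtrapLaw n) := by unfold subtrapLaw; infer_instance

theorem map_children (n : ℕ) {j : ℕ} (hj : 1 ≤ j) :
    ((D.subtrapLaw n).prod (D.heightLaw n)).map (fun p => children j p.1 p.2) =
      Measure.infinitePi fun i => condLaw D.trapMeasure (childEvent n j i) := by
  set μ : ℕ → Measure Field := fun i => if i < j then
    condLaw D.trapMeasure {ξ | height ξ < (n : ℕ∞)}
    else condLaw D.trapMeasure {ξ | height ξ < ((n + 1 : ℕ) : ℕ∞)} with hμ
  have h1 := map_splice_prod_infinitePi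
    (fun _ : ℕ => condLaw D.trapMeasure {ξ | height ξ < (n : ℕ∞)})
    (fun _ : ℕ => condLaw D.trapMeasure {ξ | height ξ < ((n + 1 : ℕ) : ℕ∞)}) μ
    (fun i => if i < j then Sum.inl i else Sum.inr (i - j)) (fun i i' h => by
      simp only at h
      split_ifs at h with h2 h3 h3
      · exact Sum.inl_injective h
      · have := Sum.inr_injective h; omega) fun i => by
      simp only [hμ]; split_ifs <;> rfl
  have h2 := map_update_prod_infinitePi μ (fun i => condLaw D.trapMeasure (childEvent n j i))
    (j - 1) fun i hi => by
      simp only [hμ, childEvent]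
      rw [if_neg (by omega)]
      split_ifs <;> rfl
  rw [← h2, ← h1]
  have h3 : condLaw D.trapMeasure (childEvent n j (j - 1)) = D.heightLaw n := by
    rw [childEvent, if_pos (by omega), heightLaw]
  rw [h3]
  have hm : Measurable fun (p : (ℕ → Field) × (ℕ → Field)) (i : ℕ) =>
      Sum.elim p.1 p.2 (if i < j then Sum.inl i else Sum.inr (i - j)) := by
    refine measurable_pi_lambda _ fun i => ?_
    split_ifs
    · simp only [Sum.elim_inl]; fun_prop
    · simp only [Sum.elim_inr]; fun_prop
  have h4 : D.heightLaw n = (D.heightLaw n).map id := Measure.map_id.symm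
  conv_rhs => rw [h4, Measure.map_prod_map _ _ hm measurable_id]
  rw [Measure.map_map (measurable_update' ) (hm.prodMap measurable_id)]
  congr 1
  funext p i
  simp only [children, Function.comp_apply, Prod.map, id]
  congr 1
  funext i'
  split_ifs <;> rfl

theorem prod_measure_childEvent (n : ℕ) {j k : ℕ} (hj : 1 ≤ j) (hjk : j ≤ k) :
    ∏ i ∈ Finset.range k, D.trapMeasure (childEvent n j i) =
      D.trapMeasure {ξ | height ξ < (n : ℕ∞)} ^ (j - 1) *
        D.trapMeasure {ξ | height ξ = (n : ℕ∞)} *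
        D.trapMeasure {ξ | height ξ < ((n + 1 : ℕ) : ℕ∞)} ^ (k - j) := by
  obtain ⟨m, rfl⟩ := Nat.exists_eq_add_of_le hjk
  obtain ⟨j, rfl⟩ := Nat.exists_eq_add_of_le' hj
  rw [Finset.prod_range_add, Finset.prod_range_succ]
  congr 1
  · congr 1
    · rw [Finset.prod_congr rfl (g := fun _ => D.trapMeasure {ξ | height ξ < (n : ℕ∞)})
        fun i hi => ?_]
      · simp
      · have := Finset.mem_range.1 hi
        rw [childEvent, if_neg (by omega), if_pos (by omega)]
    · rw [childEvent, if_pos rfl]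
  · rw [Finset.prod_congr rfl (g := fun _ => D.trapMeasure {ξ | height ξ < ((n + 1 : ℕ) : ℕ∞)})
      fun i hi => ?_]
    · simp
    · rw [childEvent, if_neg (by omega), if_neg (by omega)]

/-- The decomposition of a trap of height `n + 1` at its root, before normalization. -/
theorem setLIntegral_height_succ (n : ℕ) {f : Field → ℝ≥0∞} (hf : Measurable f)
    (hfs : ∀ ξ η, SameTree ξ η → f ξ = f η) :
    ∫⁻ ξ in {ξ | height ξ = ((n + 1 : ℕ) : ℕ∞)}, f ξ ∂D.trapMeasure =
      D.trapMeasure {ξ | height ξ = (n : ℕ∞)} * ∑' x : ℕ × ℕ, D.spineWeight n x *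
        ∫⁻ p, ∫⁻ t, f (joinTree (x, p) t) ∂D.heightLaw n ∂D.subtrapLaw n := by
  set Fk : ℕ → (ℕ → Field) → ℝ≥0∞ := fun k c => f (node k c) with hFk
  have hFkm : ∀ k, Measurable (Fk k) := fun k =>
    hf.comp (measurable_node_mk.comp (measurable_const.prodMk measurable_id))
  have hFkk : ∀ k c c', (∀ i < k, c i = c' i) → Fk k c = Fk k c' := fun k c c' h =>
    hfs _ _ (sameTree_node fun i hi => by rw [h i hi]; exact fun _ _ => rfl)
  have hE n j k : MeasurableSet {c : ℕ → Field | ∀ i < k, c i ∈ childEvent n j i} := by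
    simp only [Set.ofPred_forall]
    exact .iInter fun i => .iInter fun _ => measurable_pi_apply i (measurableSet_childEvent n j i)
  rw [← lintegral_indicator (measurableSet_height_eq _)]
  have h1 := lintegral_gwMeasure_node D.trapOffspring
    (F := fun q => {ξ | height ξ = ((n + 1 : ℕ) : ℕ∞)}.indicator f (node q.1 q.2))
    ((hf.indicator (measurableSet_height_eq _)).comp measurable_node_mk)
  simp only [node_sub] at h1
  refine h1.trans ?_
  rw [ENNReal.tsum_prod', ENNReal.tsum_comm, ← ENNReal.tsum_mul_left]
  refine tsum_congr fun k => ?_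
  have h2 : ∀ c, {ξ | height ξ = ((n + 1 : ℕ) : ℕ∞)}.indicator f (node k c) =
      ∑ j ∈ Finset.Icc 1 k, {c | ∀ i < k, c i ∈ childEvent n j i}.indicator (Fk k) c := fun c => by
    exact indicator_height_node n k c (f (node k c))
  simp only [h2]
  rw [lintegral_finsetSum _ fun j _ => (hFkm k).indicator (hE n j k)]
  have hz : ∀ j ∉ Finset.Icc 1 k, D.spineWeight n (j, k) *
      ∫⁻ p, ∫⁻ t, f (joinTree ((j, k), p) t) ∂D.heightLaw n ∂D.subtrapLaw n = 0 := fun j hj => by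
    rw [spineWeight, if_neg (by simpa [Finset.mem_Icc] using hj), zero_mul]
  rw [tsum_eq_sum hz, Finset.mul_sum, Finset.mul_sum]
  refine Finset.sum_congr rfl fun j hj => ?_
  have hj' := Finset.mem_Icc.1 hj
  rw [lintegral_indicator (hE n j k)]
  have h4 : ∫⁻ c, Fk k c ∂Measure.infinitePi (fun i => condLaw D.trapMeasure (childEvent n j i)) =
      ∫⁻ p, ∫⁻ t, f (joinTree ((j, k), p) t) ∂D.heightLaw n ∂D.subtrapLaw n := by
    rw [← map_children D n hj'.1, lintegral_map (hFkm k) (measurable_children j), lintegral_prod]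
    · rfl
    · exact ((hFkm k).comp (measurable_children j)).aemeasurable
  refine (congrArg (D.trapOffspring k * ·) (setLIntegral_infinitePi D.trapMeasure
    (measurableSet_childEvent n j) (hFkm k) (hFkk k))).trans ?_
  rw [h4, prod_measure_childEvent D n hj'.1 hj'.2, spineWeight, if_pos hj']
  ring

theorem measure_height_succ (n : ℕ) : D.trapMeasure {ξ | height ξ = ((n + 1 : ℕ) : ℕ∞)} =
    D.trapMeasure {ξ | height ξ = (n : ℕ∞)} * ∑' x : ℕ × ℕ, D.spineWeight n x := by
  simpa using setLIntegral_height_succ D n (f := fun _ => 1) measurable_const fun _ _ _ => rfl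

theorem measure_height_eq_ne_zero (n : ℕ) : D.trapMeasure {ξ | height ξ = (n : ℕ∞)} ≠ 0 := by
  induction n with
  | zero =>
    refine fun h => D.trapMeasure_height_lt_ne_zero 0 (measure_mono_null (fun ξ hξ => ?_) h)
    have := hξ
    simpa using this
  | succ n ih =>
    rw [measure_height_succ]
    exact mul_ne_zero ih (D.tsum_spineWeight_ne_zero n)

theorem lintegral_heightLaw_succ (n : ℕ) {f : Field → ℝ≥0∞} (hf : Measurable f)
    (hfs : ∀ ξ η, SameTree ξ η → f ξ = f η) :
    ∫⁻ ξ, f ξ ∂D.heightLaw (n + 1) =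
      ∫⁻ s, ∫⁻ t, f (joinTree s t) ∂D.heightLaw n
        ∂((D.spineLaw n).toMeasure.prod (D.subtrapLaw n)) := by
  have hm : Measurable fun q => ∫⁻ t, f (joinTree q t) ∂D.heightLaw n :=
    (hf.comp measurable_joinTree).lintegral_prod_right'
  have hq0 := measure_height_eq_ne_zero D n
  have hqt : D.trapMeasure {ξ | height ξ = (n : ℕ∞)} ≠ ∞ := measure_ne_top _ _
  rw [lintegral_prod _ hm.aemeasurable]
  have h1 (g : ℕ × ℕ → ℝ≥0∞) : ∫⁻ x, g x ∂(D.spineLaw n).toMeasure =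
      ∑' x, D.spineLaw n x * g x := by
    simp [lintegral_countable', PMF.toMeasure_apply_singleton, mul_comm]
  rw [h1, heightLaw, condLaw, if_neg (measure_height_eq_ne_zero D (n + 1)), ProbabilityTheory.cond,
    lintegral_smul_measure, setLIntegral_height_succ D n hf hfs, measure_height_succ,
    ENNReal.mul_inv (Or.inl hq0) (Or.inl hqt), smul_eq_mul]
  simp only [spineLaw, PMF.normalize_apply]
  rw [mul_mul_mul_comm, ENNReal.inv_mul_cancel hq0 hqt, one_mul, ← ENNReal.tsum_mul_left]
  exact tsum_congr fun x => by ring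

/-- The law of a trap of height `n` is the law of the tree of the descendants of the ancestor
number `n` of the bottom point. -/
theorem lintegral_heightLaw (n : ℕ) {f : Field → ℝ≥0∞} (hf : Measurable f)
    (hfs : ∀ ξ η, SameTree ξ η → f ξ = f η) :
    ∫⁻ ξ, f ξ ∂D.heightLaw n = ∫⁻ s, f (treeOf s n) ∂D.spineMeasure := by
  induction n generalizing f with
  | zero =>
    have h1 : ∀ᵐ ξ ∂D.heightLaw 0, f ξ = f fun _ => 0 := by
      rw [heightLaw, condLaw, if_neg (measure_height_eq_ne_zero D 0)]
      filter_upwards [ae_cond_mem (measurableSet_height_eq 0)] with ξ hξ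
      refine hfs _ _ fun v hv => ?_
      have h2 : ∀ v, Mem ξ v → v = [] := fun v hv => by
        have h3 := length_le_height hv
        rw [show height ξ = ((0 : ℕ) : ℕ∞) from hξ] at h3
        exact List.length_eq_zero_iff.1 (Nat.le_zero.1 (by exact_mod_cast h3))
      obtain rfl := h2 v hv
      by_contra hne
      have h4 := h2 [0] ⟨mem_nil ξ, Nat.pos_of_ne_zero hne⟩
      simp at h4
    rw [lintegral_congr_ae h1]
    simp [treeOf]
  | succ n ih =>
    have hm2 := hf.comp measurable_joinTree
    rw [lintegral_heightLaw_succ D n hf hfs]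
    have h1 : ∀ s : SpineData, ∫⁻ t, f (joinTree s t) ∂D.heightLaw n =
        ∫⁻ s', f (joinTree s (treeOf s' n)) ∂D.spineMeasure := fun s =>
      ih (hm2.comp (measurable_const.prodMk measurable_id)) fun ξ η h =>
        hfs _ _ (sameTree_joinTree s h)
    simp only [h1]
    have h2 := map_update_prod_infinitePi (fun n => (D.spineLaw n).toMeasure.prod (D.subtrapLaw n))
      (fun n => (D.spineLaw n).toMeasure.prod (D.subtrapLaw n)) n fun _ _ => rfl
    have h3 : Measurable fun s => f (treeOf s (n + 1)) :=
      hf.comp (measurable_treeOf (n + 1))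
    have h4 : ∫⁻ s, f (treeOf s (n + 1)) ∂D.spineMeasure =
        ∫⁻ s', ∫⁻ s, f (treeOf (Function.update s' n s) (n + 1))
          ∂((D.spineLaw n).toMeasure.prod (D.subtrapLaw n)) ∂D.spineMeasure := by
      conv_lhs => rw [show D.spineMeasure = _ from h2.symm]
      rw [lintegral_map h3 measurable_update', lintegral_prod]
      · rfl
      · exact (h3.comp measurable_update').aemeasurable
    rw [h4, lintegral_lintegral_swap]
    · refine lintegral_congr fun s' => lintegral_congr fun s => ?_
      rw [treeOf, Function.update_self,
        treeOf_congr (s := Function.update s' n s) (s' := s') fun i (hi : i < n) =>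
          Function.update_of_ne hi.ne _ _]
    · exact (hm2.comp ((measurable_fst).prodMk
        ((measurable_treeOf n).comp measurable_snd))).aemeasurable

end BiasedGW

/-! ### Geometry of the infinite trap -/

namespace BiasedGW

open PlaneTree BiasedWalk

/-- The spine passes through a child, and the heights of the subtraps are such that this child is
the first one below which the height is maximal. -/
def GoodSpine (s : ℕ → SpineData) : Prop :=
  ∀ n, (1 ≤ (s n).1.1 ∧ (s n).1.1 ≤ (s n).1.2) ∧
    (2 ≤ (s n).1.1 → ∀ i, height ((s n).2.1 i) < (n : ℕ∞)) ∧
    ∀ i, height ((s n).2.2 i) < ((n + 1 : ℕ) : ℕ∞)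

theorem ae_condLaw {Ω : Type*} [MeasurableSpace Ω] (μ : Measure Ω) [IsProbabilityMeasure μ]
    {A : Set Ω} (hA : MeasurableSet A) (h : μ A ≠ 0) : ∀ᵐ x ∂condLaw μ A, x ∈ A := by
  rw [condLaw, if_neg h]
  exact ae_cond_mem hA

theorem ae_infinitePi {X : Type*} [MeasurableSpace X] {ι : Type*} [Countable ι]
    (μ : ι → Measure X) [∀ i, IsProbabilityMeasure (μ i)] {P : ι → X → Prop}
    (h : ∀ i, ∀ᵐ x ∂μ i, P i x) : ∀ᵐ c ∂Measure.infinitePi μ, ∀ i, P i (c i) :=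
  ae_all_iff.2 fun i =>
    (measurePreserving_eval_infinitePi μ i).quasiMeasurePreserving.ae (h i)

theorem ae_goodSpine (D : BiasedGW) : ∀ᵐ s ∂D.spineMeasure, GoodSpine s := by
  refine ae_infinitePi (fun n => (D.spineLaw n).toMeasure.prod (D.subtrapLaw n))
    (P := fun (n : ℕ) (x : SpineData) => (1 ≤ x.1.1 ∧ x.1.1 ≤ x.1.2) ∧
      (2 ≤ x.1.1 → ∀ i, height (x.2.1 i) < (n : ℕ∞)) ∧
        ∀ i, height (x.2.2 i) < ((n + 1 : ℕ) : ℕ∞)) fun n => ?_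
  have h1 : ∀ᵐ x ∂(D.spineLaw n).toMeasure, D.spineWeight n x ≠ 0 := by
    rw [ae_iff, ← nonpos_iff_eq_zero]
    simp only [not_not]
    refine (le_of_eq ?_)
    rw [PMF.toMeasure_apply_eq_zero_iff _ (Set.to_countable _).measurableSet]
    refine Set.disjoint_left.2 fun x hx hx' => ?_
    rw [PMF.mem_support_iff, spineLaw, PMF.normalize_apply] at hx
    exact hx (by rw [show D.spineWeight n x = 0 from hx', zero_mul])
  have h2 : ∀ᵐ p ∂D.subtrapLaw n, ∀ i, height (p.2 i) < ((n + 1 : ℕ) : ℕ∞) := by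
    refine Measure.quasiMeasurePreserving_snd.ae (ae_infinitePi (fun _ : ℕ =>
      condLaw D.trapMeasure {ξ | height ξ < ((n + 1 : ℕ) : ℕ∞)})
      (P := fun _ ξ => height ξ < ((n + 1 : ℕ) : ℕ∞)) fun i => ?_)
    exact ae_condLaw _ (measurableSet_height_lt _) (D.trapMeasure_height_lt_ne_zero n)
  have h3 : ∀ᵐ p ∂D.subtrapLaw n, D.trapMeasure {ξ | height ξ < (n : ℕ∞)} ≠ 0 →
      ∀ i, height (p.1 i) < (n : ℕ∞) := by
    by_cases h0 : D.trapMeasure {ξ | height ξ < (n : ℕ∞)} = 0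
    · exact ae_of_all _ fun p h => absurd h0 h
    · have := (Measure.quasiMeasurePreserving_fst (ν := Measure.infinitePi fun _ : ℕ =>
        condLaw D.trapMeasure {ξ | height ξ < ((n + 1 : ℕ) : ℕ∞)})).ae
        (ae_infinitePi (fun _ : ℕ => condLaw D.trapMeasure {ξ | height ξ < (n : ℕ∞)})
          fun i =>
          ae_condLaw _ (measurableSet_height_lt n) h0)
      exact this.mono fun p hp _ => hp
  filter_upwards [Measure.quasiMeasurePreserving_fst.ae h1,
    Measure.quasiMeasurePreserving_snd.ae h2, Measure.quasiMeasurePreserving_snd.ae h3]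
    with x hx1 hx2 hx3
  have h4 : 1 ≤ x.1.1 ∧ x.1.1 ≤ x.1.2 := by
    by_contra h
    exact hx1 (by rw [spineWeight, if_neg h])
  refine ⟨h4, fun h5 => hx3 fun h0 => hx1 ?_, hx2⟩
  rw [spineWeight, if_pos h4, h0, zero_pow (by omega), mul_zero, zero_mul]

variable {s : ℕ → SpineData} (hs : GoodSpine s)

theorem sub_treeOf_succ (s : ℕ → SpineData) (n i : ℕ) :
    sub (treeOf s (n + 1)) [i] = children (s n).1.1 (s n).2 (treeOf s n) i := by
  rw [treeOf, joinTree, sub_node]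

theorem treeOf_succ_nil (s : ℕ → SpineData) (n : ℕ) : treeOf s (n + 1) [] = (s n).1.2 := rfl

theorem children_spine {j : ℕ} (x : (ℕ → Field) × (ℕ → Field)) (t : Field) :
    children j x t (j - 1) = t := by simp [children]

theorem children_of_ne {i j : ℕ} (x : (ℕ → Field) × (ℕ → Field)) (t : Field) (h : i ≠ j - 1) :
    children j x t i = if i < j then x.1 i else x.2 (i - j) := by
  rw [children, Function.update_of_ne h]

include hs

theorem height_children_left {n i : ℕ} (t : Field) (hi : i < (s n).1.1 - 1) :
    height (children (s n).1.1 (s n).2 t i) < (n : ℕ∞) := by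
  rw [children_of_ne _ _ hi.ne, if_pos (by omega)]
  exact (hs n).2.1 (by omega) i

theorem height_children_right {n i : ℕ} (t : Field) (hi : (s n).1.1 ≤ i) :
    height (children (s n).1.1 (s n).2 t i) < ((n + 1 : ℕ) : ℕ∞) := by
  have := (hs n).1
  rw [children_of_ne _ _ (by omega), if_neg (by omega)]
  exact (hs n).2.2 _

theorem height_treeOf (n : ℕ) : height (treeOf s n) = (n : ℕ∞) := by
  induction n with
  | zero =>
    have h1 : height (treeOf s 0) < ((0 + 1 : ℕ) : ℕ∞) :=
      height_lt_succ_iff.2 fun i hi => absurd hi (Nat.not_lt_zero i)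
    simpa using h1
  | succ n ih =>
    have hn : (n : ℕ∞) < ((n + 1 : ℕ) : ℕ∞) := by exact_mod_cast n.lt_succ_self
    have h1 := (hs n).1
    simp only [height_eq_succ_iff, sub_treeOf_succ, treeOf_succ_nil]
    refine ⟨fun i _ => ?_, (s n).1.1 - 1, by omega, by rw [children_spine, ih]⟩
    rcases lt_trichotomy i ((s n).1.1 - 1) with h2 | h2 | h2
    · exact (height_children_left hs _ h2).trans hn
    · rw [h2, children_spine, ih]
      exact hn
    · exact height_children_right hs _ (by omega)

theorem isSpine_treeOf : IsSpine (treeOf s) fun n => (s n).1.1 - 1 where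
  zero := rfl
  lt n := by have := (hs n).1; rw [treeOf_succ_nil]; omega
  sub_eq n := by rw [sub_treeOf_succ, children_spine]
  height_ne_top n := by rw [height_treeOf hs]; exact ENat.natCast_ne_top n

theorem isBottom_treeOf (n : ℕ) :
    IsBottom (treeOf s n) (spinePath (fun n => (s n).1.1 - 1) 0 n) := by
  refine ⟨(fun n => ((isSpine_treeOf hs).bottom n).1) n, by rw [length_spinePath, height_treeOf
    hs], ?_⟩
  rw [length_spinePath]
  induction n with
  | zero => intro w _ hw; simp [List.length_eq_zero_iff.1 hw, spinePath]
  | succ n ih =>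
    intro w hw hlen
    obtain rfl | ⟨y, i, rfl⟩ := List.eq_nil_or_concat' w
    · simp at hlen
    rw [List.length_append, List.length_singleton, Nat.add_right_cancel_iff] at hlen
    obtain ⟨h1, h2⟩ := mem_append.1 hw
    rw [sub_treeOf_succ] at h2
    have h3 := length_le_height h2
    rw [hlen] at h3
    simp only [spinePath, zero_add, List.reverse_append]
    rcases lt_trichotomy i ((s n).1.1 - 1) with h4 | h4 | h4
    · exact absurd (height_children_left hs _ h4) (not_lt.2 h3)
    · rw [h4, children_spine] at h2
      rw [h4]
      exact List.cons_le_cons _ (ih y h2 hlen)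
    · exact le_of_lt (List.Lex.rel h4)

omit hs in
theorem subtrapWeight_eq (D : BiasedGW) {ξ : Field} (h : height ξ ≠ ⊤) : D.subtrapWeight ξ =
    ENNReal.ofReal (D.β * ∑ v ∈ vertices ξ, D.β ^ v.length) := by
  have hβ : 0 ≤ D.β := by linarith [D.one_lt_bias]
  have h1 : {v | Mem ξ v} = (vertices ξ : Set (List ℕ)) := by
    ext v; simp [mem_vertices h]
  rw [Finset.mul_sum, ENNReal.ofReal_sum_of_nonneg fun v _ => by positivity]
  refine ((tsum_congr_set_coe (fun v => ENNReal.ofReal D.β ^ (v.length + 1)) h1).trans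
    (Finset.tsum_subtype' (vertices ξ)
    fun v => ENNReal.ofReal D.β ^ (v.length + 1))).trans (Finset.sum_congr rfl fun v _ => ?_)
  rw [← pow_succ', ENNReal.ofReal_pow hβ]

/-- The scaled weight of the tree grown to level `n` is a partial sum of the series that defines
`S_∞`. -/
theorem ofReal_genWeight_treeOf (D : BiasedGW) (n : ℕ) :
    ENNReal.ofReal ((D.β⁻¹) ^ n * ∑ v ∈ vertices (treeOf s n), D.β ^ v.length) =
      ∑ i ∈ Finset.range (n + 1), (ENNReal.ofReal D.β)⁻¹ ^ i * (1 + D.Λ s i) := by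
  have hβ : 0 < D.β := by linarith [D.one_lt_bias]
  have hsp := isSpine_treeOf hs
  induction n with
  | zero =>
    have h1 := sum_vertices_node (hsp.height_ne_top 0) fun v => D.β ^ v.length
    rw [h1]
    simp [treeOf, Λ]
  | succ n ih =>
    have h1 := sum_vertices_node (hsp.height_ne_top (n + 1)) fun v => D.β ^ v.length
    simp only [List.length_append, List.length_singleton, List.length_nil, pow_zero,
      sub_treeOf_succ, treeOf_succ_nil] at h1
    obtain ⟨hj1, hjk⟩ := (hs n).1
    set c := children (s n).1.1 (s n).2 (treeOf s n) with hc
    have h2 : ∀ i, ∑ v ∈ vertices (c i), D.β ^ (v.length + 1) =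
        D.β * ∑ v ∈ vertices (c i), D.β ^ v.length := fun i => by
      rw [Finset.mul_sum]; exact Finset.sum_congr rfl fun v _ => pow_succ' _ _
    have hleft : ∀ i ∈ Finset.range ((s n).1.1 - 1),
        ENNReal.ofReal (D.β * ∑ v ∈ vertices (c i), D.β ^ v.length) =
          D.subtrapWeight ((s n).2.1 i) := fun i hi => by
      have hi' := Finset.mem_range.1 hi
      rw [← subtrapWeight_eq D (ne_top_of_lt (height_children_left hs (treeOf s n) hi')),
        children_of_ne _ _ hi'.ne, if_pos (by omega)]
    have hright : ∀ i ∈ Finset.range ((s n).1.2 - (s n).1.1),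
        ENNReal.ofReal (D.β * ∑ v ∈ vertices (c ((s n).1.1 + i)), D.β ^ v.length) =
          D.subtrapWeight ((s n).2.2 i) := fun i _ => by
      rw [← subtrapWeight_eq D (ne_top_of_lt (height_children_right hs (treeOf s n)
        (Nat.le_add_right (s n).1.1 i))), children_of_ne _ _ (by omega),
        if_neg (by omega), Nat.add_sub_cancel_left]
    have h4 : ENNReal.ofReal (∑ v ∈ vertices (treeOf s (n + 1)), D.β ^ v.length) =
        1 + D.ancestorWeight (s n) +
          ENNReal.ofReal (D.β * ∑ v ∈ vertices (treeOf s n), D.β ^ v.length) := by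
      have hnn : ∀ i, 0 ≤ D.β * ∑ v ∈ vertices (c i), D.β ^ v.length := fun i => by positivity
      rw [h1, ENNReal.ofReal_add zero_le_one (Finset.sum_nonneg fun i _ => (h2 i).symm ▸ hnn i),
        ENNReal.ofReal_one, add_assoc]
      simp only [h2]
      rw [ENNReal.ofReal_sum_of_nonneg fun i _ => hnn i]
      obtain ⟨m, hm⟩ := Nat.exists_eq_add_of_le hjk
      obtain ⟨l, hl⟩ := Nat.exists_eq_add_of_le' hj1
      have h5 : c l = treeOf s n := by
        rw [hc, show l = (s n).1.1 - 1 by omega, children_spine]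
      rw [ancestorWeight, ← Finset.sum_congr rfl hleft, ← Finset.sum_congr rfl hright, hm,
        Finset.sum_range_add, hl, Finset.sum_range_succ, h5, Nat.add_sub_cancel,
        Nat.add_sub_cancel_left]
      ring
    rw [Finset.sum_range_succ, ← ih, ENNReal.ofReal_mul (by positivity), h4, Λ, mul_add,
      add_comm, ← ENNReal.ofReal_mul (by positivity)]
    congr 1
    · congr 1
      rw [pow_succ]
      field_simp
    · rw [ENNReal.ofReal_pow (by positivity), ENNReal.ofReal_inv_of_pos hβ]

/-- The total weights of the traps seen from the bottom point converge to `S_∞`. -/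
theorem tendsto_scaledWeight_treeOf (D : BiasedGW) (hfin : D.Sinf s ≠ ∞) :
    Tendsto (scaledWeight D.β (treeOf s)) atTop (nhds (D.Sinf s).toReal) := by
  have hβ : 0 < D.β := by linarith [D.one_lt_bias]
  set a : ℕ → ℝ≥0∞ := fun i => (ENNReal.ofReal D.β)⁻¹ ^ i * (1 + D.Λ s i) with ha
  have hsum : ∑' i, a i ≠ ∞ := fun h => hfin (by rw [Sinf, ← ha, h]; simp)
  have h2 := (((ENNReal.tendsto_toReal hsum).comp ((ENNReal.tendsto_nat_tsum a).comp
    (tendsto_add_atTop_nat 1))).const_mul 2).sub (tendsto_pow_atTop_nhds_zero_of_lt_one (by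
    positivity)
    (inv_lt_one_of_one_lt₀ D.one_lt_bias))
  rw [sub_zero] at h2
  rw [Sinf, ENNReal.toReal_mul]
  refine h2.congr fun n => ?_
  simp only [Function.comp_apply, ha]
  rw [← ofReal_genWeight_treeOf hs D n, ENNReal.toReal_ofReal (by positivity), scaledWeight,
    eq_sub_of_add_eq (totalWeight_add_one ((isSpine_treeOf hs).height_ne_top n))]
  ring

end BiasedGW

/-! ### The mean of `S_∞` -/

namespace BiasedGW

open PlaneTree BiasedWalk

variable (D : BiasedGW)

theorem measurable_subtrapWeight : Measurable D.subtrapWeight := by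
  have h1 : D.subtrapWeight = fun ξ => ∑' v : List ℕ,
      {ξ : Field | Mem ξ v}.indicator (fun _ => ENNReal.ofReal D.β ^ (v.length + 1)) ξ := by
    funext ξ
    exact tsum_subtype {v | Mem ξ v} fun v => ENNReal.ofReal D.β ^ (v.length + 1)
  rw [h1]
  exact Measurable.tsum fun v =>
    measurable_const.indicator (measurableSet_setOfPred.2 (by fun_prop))

theorem measurable_ancestorWeight : Measurable D.ancestorWeight := by
  have := D.measurable_subtrapWeight
  exact measurable_from_prod_countable_right fun jk => by
    refine .add (Finset.measurable_fun_sum (Finset.range (jk.1 - 1)) fun j _ => ?_)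
      (Finset.measurable_fun_sum (Finset.range (jk.2 - jk.1)) fun j _ => ?_) <;> fun_prop

theorem measurable_Sinf : Measurable D.Sinf := by
  refine Measurable.const_mul (Measurable.tsum fun i => Measurable.const_mul ?_ _) _
  have := D.measurable_ancestorWeight
  cases i <;> simp only [Λ] <;> fun_prop

theorem tsum_trapOffspring_mul : ∑' k : ℕ, D.trapOffspring k * (k : ℝ≥0∞) =
    ENNReal.ofReal D.r := by
  have hq := D.q_pos
  rw [r_eq, ENNReal.ofReal_tsum_of_nonneg (fun k => mul_nonneg (D.coef_nonneg k) (by positivity))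
    D.summable_r]
  refine tsum_congr fun k => ?_
  change D.p k * ENNReal.ofReal D.q ^ k / ENNReal.ofReal D.q * k = _
  rcases k with _ | k
  · simp
  · rw [ENNReal.ofReal_mul (D.coef_nonneg _), ofReal_coef, ENNReal.ofReal_mul (by positivity),
      ENNReal.ofReal_pow hq.le, ENNReal.ofReal_natCast, Nat.add_sub_cancel, pow_succ,
      ← mul_assoc, ENNReal.mul_div_cancel_right (by simpa using hq) ENNReal.ofReal_ne_top]
    ring

theorem tsum_trapOffspring_mul_sq_ne_top :
    ∑' k : ℕ, D.trapOffspring k * (k : ℝ≥0∞) ^ 2 ≠ ∞ := by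
  have hq0 : ENNReal.ofReal D.q ≠ 0 := by simpa using D.q_pos
  refine ne_top_of_le_ne_top (ENNReal.mul_ne_top D.second_moment (ENNReal.inv_ne_top.2 hq0)) ?_
  rw [← ENNReal.tsum_mul_right]
  refine ENNReal.tsum_le_tsum fun k => ?_
  change D.p k * ENNReal.ofReal D.q ^ k / ENNReal.ofReal D.q * (k : ℝ≥0∞) ^ 2 ≤ _
  rw [div_eq_mul_inv]
  calc _ ≤ D.p k * 1 * (ENNReal.ofReal D.q)⁻¹ * (k : ℝ≥0∞) ^ 2 := by
        gcongr
        exact pow_le_one' (by simpa using D.q_lt_one.le) k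
    _ = _ := by ring

/-- The mean weight of a trap, restricted to the event that its height is less than `n`. -/
noncomputable def meanWeight (n : ℕ) : ℝ≥0∞ :=
  ∫⁻ ξ in {ξ | height ξ < (n : ℕ∞)}, D.subtrapWeight ξ ∂D.trapMeasure

theorem meanWeight_zero : D.meanWeight 0 = 0 := by
  exact setLIntegral_measure_zero _ _ (measure_height_lt_zero _)

theorem subtrapWeight_node {ξ : Field} (h : height ξ ≠ ⊤) : D.subtrapWeight ξ =
    ENNReal.ofReal D.β * (1 + ∑ i ∈ Finset.range (ξ []), D.subtrapWeight (sub ξ [i])) := by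
  have hβ : 0 ≤ D.β := by linarith [D.one_lt_bias]
  rw [subtrapWeight_eq D h, sum_vertices_node h, ENNReal.ofReal_mul hβ,
    ENNReal.ofReal_add (by positivity) (by positivity),
    ENNReal.ofReal_sum_of_nonneg fun _ _ => by positivity]
  simp only [List.length_nil, pow_zero, ENNReal.ofReal_one]
  congr 2
  refine Finset.sum_congr rfl fun i hi => ?_
  have hm : Mem ξ [i] := ⟨mem_nil ξ, Finset.mem_range.1 hi⟩
  rw [subtrapWeight_eq D (height_sub_ne_top h hm), Finset.mul_sum]
  simp only [List.length_append, List.length_singleton, pow_succ']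

theorem meanWeight_succ_le (n : ℕ) :
    D.meanWeight (n + 1) ≤ ENNReal.ofReal D.β * (1 + ENNReal.ofReal D.r * D.meanWeight n) := by
  set g : Field → ℝ≥0∞ := {ξ | height ξ < (n : ℕ∞)}.indicator D.subtrapWeight with hg
  have hgm := D.measurable_subtrapWeight.indicator (measurableSet_height_lt n)
  set F : ℕ × (ℕ → Field) → ℝ≥0∞ := fun q =>
    ENNReal.ofReal D.β * (1 + ∑ i ∈ Finset.range q.1, g (q.2 i)) with hF
  have hgi i : Measurable fun c : ℕ → Field => g (c i) := hgm.comp (measurable_pi_apply i)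
  have hsm k : Measurable fun c : ℕ → Field => ∑ i ∈ Finset.range k, g (c i) :=
    Finset.measurable_fun_sum _ fun i _ => hgi i
  have hFm : Measurable F := measurable_from_prod_countable_right fun k =>
    ((hsm k).const_add 1).const_mul _
  have h1 : D.meanWeight (n + 1) ≤ ∫⁻ ξ, F (ξ [], fun i => sub ξ [i]) ∂D.trapMeasure := by
    rw [meanWeight, ← lintegral_indicator (measurableSet_height_lt _)]
    refine lintegral_mono fun ξ => Set.indicator_apply_le' (fun hξ' => ?_) fun _ => zero_le
    rw [subtrapWeight_node D (ne_top_of_lt hξ')]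
    refine mul_le_mul_right (add_le_add_right (Finset.sum_le_sum fun i hi => ?_) _) _
    exact (Set.indicator_of_mem (s := {ξ | height ξ < (n : ℕ∞)})
      (height_lt_succ_iff.1 hξ' i (Finset.mem_range.1 hi)) _).ge
  refine h1.trans ?_
  rw [trapMeasure, lintegral_gwMeasure_node _ hFm]
  have h2 : ∀ k, ∫⁻ c, F (k, c) ∂Measure.infinitePi (fun _ : ℕ => gwMeasure D.trapOffspring) =
      ENNReal.ofReal D.β * (1 + k * D.meanWeight n) := fun k => by
    rw [lintegral_const_mul _ (Measurable.const_add (hsm k) 1),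
      lintegral_add_left measurable_const, lintegral_finsetSum _ fun i _ => hgi i]
    have h3 : ∀ i : ℕ, ∫⁻ c, g (c i) ∂Measure.infinitePi
        (fun _ : ℕ => gwMeasure D.trapOffspring) = D.meanWeight n := fun i => by
      rw [meanWeight, ← lintegral_indicator (measurableSet_height_lt _)]
      exact (measurePreserving_eval_infinitePi (fun _ : ℕ => gwMeasure D.trapOffspring)
        i).lintegral_comp hgm
    simp [h3]
  simp only [h2]
  refine le_of_eq ?_
  rw [← tsum_trapOffspring_mul, ← ENNReal.tsum_mul_right]
  conv_rhs => rw [← D.trapOffspring.tsum_coe, ← ENNReal.tsum_add, ← ENNReal.tsum_mul_left]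
  exact tsum_congr fun k => by ring

theorem tsum_meanWeight_ne_top :
    ∑' n, (ENNReal.ofReal D.β)⁻¹ ^ n * D.meanWeight n ≠ ∞ := by
  have hβ : 0 < D.β := by linarith [D.one_lt_bias]
  set b := (ENNReal.ofReal D.β)⁻¹ with hb
  set R := ENNReal.ofReal D.r with hR
  have hb1 : b < 1 := by
    rw [hb]
    simpa using D.one_lt_bias
  have hR1 : R < 1 := by simpa [hR] using D.r_lt_one
  set K := (1 - b)⁻¹ * (1 - R)⁻¹ with hK
  have hRs := (tsub_pos_of_lt hR1).ne'
  have hKK : (1 - b)⁻¹ + R * K = K := by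
    have h1 : (1 - b)⁻¹ = K * (1 - R) := by
      rw [hK, mul_assoc, ENNReal.inv_mul_cancel hRs (by simp), mul_one]
    rw [h1, mul_comm R, ← mul_add, tsub_add_cancel_of_le hR1.le, mul_one]
  refine ne_top_of_le_ne_top (ENNReal.mul_ne_top (ENNReal.inv_ne_top.2 (tsub_pos_of_lt hb1).ne')
    (ENNReal.inv_ne_top.2 hRs)) (ENNReal.tsum_le_of_sum_range_le fun N => ?_)
  induction N with
  | zero => simp
  | succ N ih =>
    rw [Finset.sum_range_succ', meanWeight_zero, mul_zero, add_zero]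
    have h1 : ∀ n, b ^ (n + 1) * D.meanWeight (n + 1) ≤
        b ^ n + R * (b ^ n * D.meanWeight n) := fun n => by
      refine (mul_le_mul_right (meanWeight_succ_le D n) _).trans (le_of_eq ?_)
      rw [pow_succ, mul_assoc, ← mul_assoc b, ENNReal.inv_mul_cancel (by simpa using hβ)
        ENNReal.ofReal_ne_top]
      ring
    refine (Finset.sum_le_sum fun n _ => h1 n).trans ?_
    rw [Finset.sum_add_distrib, ← Finset.mul_sum]
    refine (add_le_add ?_ (mul_le_mul_right ih R)).trans hKK.le
    rw [← ENNReal.tsum_geometric]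
    exact ENNReal.sum_le_tsum _

/-- The expected weight of a subtrap that is lower than `n + 1`. -/
theorem lintegral_condLaw_subtrapWeight_le (n : ℕ) :
    ∫⁻ ξ, D.subtrapWeight ξ ∂condLaw D.trapMeasure {ξ | height ξ < ((n + 1 : ℕ) : ℕ∞)} ≤
      (D.trapMeasure {ξ | height ξ < ((0 + 1 : ℕ) : ℕ∞)})⁻¹ * D.meanWeight (n + 1) := by
  rw [condLaw, if_neg (D.trapMeasure_height_lt_ne_zero n), ProbabilityTheory.cond,
    lintegral_smul_measure, smul_eq_mul, meanWeight]
  gcongr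
  exact Nat.zero_le n

theorem meanWeight_mono {m n : ℕ} (h : m ≤ n) : D.meanWeight m ≤ D.meanWeight n :=
  lintegral_mono_set fun ξ (hξ : height ξ < m) => hξ.trans_le (by exact_mod_cast h)

/-- A bound for the expected number of children of an ancestor of the bottom point. -/
theorem exists_lintegral_spineLaw_le : ∃ C : ℝ≥0∞, C ≠ ∞ ∧
    ∀ n, ∑' x, D.spineLaw n x * (x.2 : ℝ≥0∞) ≤ C := by
  set c0 := D.trapMeasure {ξ | height ξ < ((0 + 1 : ℕ) : ℕ∞)} with hc0
  obtain ⟨k, hk, hpk⟩ := D.exists_two_le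
  have hqk : D.trapOffspring k ≠ 0 := by
    change D.p k * ENNReal.ofReal D.q ^ k / ENNReal.ofReal D.q ≠ 0
    have h1 : D.p k ≠ 0 := by rw [← ofReal_coef]; simpa using hpk
    have h2 : ENNReal.ofReal D.q ≠ 0 := by simpa using D.q_pos
    simp [h1, h2]
  have hlow : ∀ n, D.trapOffspring k * c0 ^ (k - 1) ≤ ∑' x, D.spineWeight n x := fun n => by
    refine le_trans ?_ (ENNReal.le_tsum (1, k))
    rw [spineWeight, if_pos ⟨le_rfl, by omega⟩]
    simp only [Nat.sub_self, pow_zero, mul_one]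
    refine mul_le_mul_right (pow_le_pow_left' (measure_mono ?_) _) _
    exact fun ξ (hξ : height ξ < ((0 + 1 : ℕ) : ℕ∞)) =>
      hξ.trans_le (by exact_mod_cast Nat.succ_le_succ (Nat.zero_le n))
  refine ⟨(D.trapOffspring k * c0 ^ (k - 1))⁻¹ *
    ∑' k : ℕ, D.trapOffspring k * (k : ℝ≥0∞) ^ 2, ENNReal.mul_ne_top (ENNReal.inv_ne_top.2
      (mul_ne_zero hqk (pow_ne_zero _ (D.trapMeasure_height_lt_ne_zero 0))))
      D.tsum_trapOffspring_mul_sq_ne_top, fun n => ?_⟩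
  have h1 : ∑' x, D.spineLaw n x * (x.2 : ℝ≥0∞) =
      (∑' x, D.spineWeight n x)⁻¹ * ∑' x, D.spineWeight n x * (x.2 : ℝ≥0∞) := by
    rw [← ENNReal.tsum_mul_left]
    refine tsum_congr fun x => ?_
    rw [spineLaw, PMF.normalize_apply]
    ring
  rw [h1]
  refine mul_le_mul' (ENNReal.inv_le_inv.2 (hlow n)) ?_
  rw [ENNReal.tsum_prod', ENNReal.tsum_comm]
  refine ENNReal.tsum_le_tsum fun m => ?_
  have hz : ∀ j ∉ Finset.Icc 1 m, D.spineWeight n (j, m) * (m : ℝ≥0∞) = 0 := fun j hj => by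
    rw [spineWeight, if_neg (by simpa [Finset.mem_Icc] using hj), zero_mul]
  rw [tsum_eq_sum hz]
  have hb : ∀ j ∈ Finset.Icc 1 m,
      D.spineWeight n (j, m) * (m : ℝ≥0∞) ≤ D.trapOffspring m * m := fun j hj => by
    rw [spineWeight, if_pos (by simpa [Finset.mem_Icc] using hj)]
    gcongr
    exact (mul_le_of_le_one_right' (pow_le_one' prob_le_one _)).trans
      (mul_le_of_le_one_right' (pow_le_one' prob_le_one _))
  refine (Finset.sum_le_sum hb).trans (le_of_eq ?_)
  rw [Finset.sum_const, Nat.card_Icc, Nat.add_sub_cancel]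
  ring

/-- At most `C` subtraps hang off an ancestor on average, and each is a trap of bounded height. -/
theorem lintegral_ancestorWeight_le {C : ℝ≥0∞}
    (hC : ∀ n, ∑' x, D.spineLaw n x * (x.2 : ℝ≥0∞) ≤ C) (n : ℕ) :
    ∫⁻ s, D.Λ s (n + 1) ∂D.spineMeasure ≤
      C * ((D.trapMeasure {ξ | height ξ < ((0 + 1 : ℕ) : ℕ∞)})⁻¹ * D.meanWeight (n + 1)) := by
  set B := (D.trapMeasure {ξ | height ξ < ((0 + 1 : ℕ) : ℕ∞)})⁻¹ * D.meanWeight (n + 1) with hB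
  have hw := D.measurable_subtrapWeight
  have h1 : ∫⁻ s, D.Λ s (n + 1) ∂D.spineMeasure =
      ∫⁻ x, D.ancestorWeight x ∂((D.spineLaw n).toMeasure.prod (D.subtrapLaw n)) :=
    (measurePreserving_eval_infinitePi (fun n => (D.spineLaw n).toMeasure.prod (D.subtrapLaw n))
      n).lintegral_comp D.measurable_ancestorWeight
  rw [h1, lintegral_prod _ D.measurable_ancestorWeight.aemeasurable, lintegral_countable']
  refine le_trans (ENNReal.tsum_le_tsum fun x => ?_)
    ((ENNReal.tsum_mul_right
      (a := B)).le.trans (mul_le_mul_left (hC n) B))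
  rw [PMF.toMeasure_apply_singleton _ _ (measurableSet_singleton x), mul_comm, mul_assoc]
  by_cases hx : D.spineWeight n x = 0
  · rw [spineLaw, PMF.normalize_apply, hx]; simp
  refine mul_le_mul_right ?_ _
  have hx1 : 1 ≤ x.1 ∧ x.1 ≤ x.2 := by
    by_contra h
    exact hx (by rw [spineWeight, if_neg h])
  have hl : ∀ i ∈ Finset.range (x.1 - 1), ∫⁻ p, D.subtrapWeight (p.1 i) ∂D.subtrapLaw n ≤ B :=
    fun i hi => by
      have hi' := Finset.mem_range.1 hi
      rcases n with _ | n
      · refine absurd ?_ hx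
        rw [spineWeight, if_pos hx1, show D.trapMeasure {ξ | height ξ < ((0 : ℕ) : ℕ∞)} = 0 from
          measure_height_lt_zero _, zero_pow (by omega), mul_zero, zero_mul]
      · refine le_trans (le_of_eq ?_) ((lintegral_condLaw_subtrapWeight_le D n).trans
          (mul_le_mul_right (meanWeight_mono D (Nat.le_succ _)) _))
        have h2 := (measurePreserving_fst (μ := Measure.infinitePi fun _ : ℕ =>
          condLaw D.trapMeasure {ξ | height ξ < ((n + 1 : ℕ) : ℕ∞)})
          (ν := Measure.infinitePi fun _ : ℕ =>
          condLaw D.trapMeasure {ξ | height ξ < ((n + 1 + 1 : ℕ) : ℕ∞)})).lintegral_comp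
          (hw.comp (measurable_pi_apply i))
        exact h2.trans ((measurePreserving_eval_infinitePi (fun _ : ℕ =>
          condLaw D.trapMeasure {ξ | height ξ < ((n + 1 : ℕ) : ℕ∞)}) i).lintegral_comp hw)
  have hr : ∀ i ∈ Finset.range (x.2 - x.1), ∫⁻ p, D.subtrapWeight (p.2 i) ∂D.subtrapLaw n ≤ B :=
    fun i _ => by
      refine le_trans (le_of_eq ?_) (lintegral_condLaw_subtrapWeight_le D n)
      have h2 := (measurePreserving_snd (μ := Measure.infinitePi fun _ : ℕ =>
          condLaw D.trapMeasure {ξ | height ξ < (n : ℕ∞)})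
          (ν := Measure.infinitePi fun _ : ℕ =>
          condLaw D.trapMeasure {ξ | height ξ < ((n + 1 : ℕ) : ℕ∞)})).lintegral_comp
          (hw.comp (measurable_pi_apply i))
      exact h2.trans ((measurePreserving_eval_infinitePi (fun _ : ℕ =>
          condLaw D.trapMeasure {ξ | height ξ < ((n + 1 : ℕ) : ℕ∞)}) i).lintegral_comp hw)
  have hml (i : ℕ) : Measurable fun p : (ℕ → Field) × (ℕ → Field) => D.subtrapWeight (p.1 i) := by
    fun_prop
  have hmr (i : ℕ) : Measurable fun p : (ℕ → Field) × (ℕ → Field) => D.subtrapWeight (p.2 i) := by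
    fun_prop
  simp only [ancestorWeight]
  rw [lintegral_add_left (Finset.measurable_sum _ fun i _ => hml i),
    lintegral_finsetSum _ fun i _ => hml i, lintegral_finsetSum _ fun i _ => hmr i]
  refine (add_le_add (Finset.sum_le_sum hl) (Finset.sum_le_sum hr)).trans ?_
  simp only [Finset.sum_const, Finset.card_range, nsmul_eq_mul]
  rw [← add_mul, ← Nat.cast_add]
  gcongr
  omega

theorem lintegral_Sinf_ne_top : ∫⁻ s, D.Sinf s ∂D.spineMeasure ≠ ∞ := by
  obtain ⟨C, hC, hC'⟩ := D.exists_lintegral_spineLaw_le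
  set b := (ENNReal.ofReal D.β)⁻¹ with hb
  set c := (D.trapMeasure {ξ | height ξ < ((0 + 1 : ℕ) : ℕ∞)})⁻¹ with hc
  have hb1 : b < 1 := by
    rw [hb]
    simpa using D.one_lt_bias
  have hΛm : ∀ i, Measurable fun s => D.Λ s i
    | 0 => measurable_const
    | n + 1 => D.measurable_ancestorWeight.comp (measurable_pi_apply n)
  have hΛ : ∀ i, ∫⁻ s, D.Λ s i ∂D.spineMeasure ≤ C * (c * D.meanWeight i) := fun i => by
    rcases i with _ | n
    · simp [Λ]
    · exact lintegral_ancestorWeight_le D hC' n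
  have h1 : ∫⁻ s, D.Sinf s ∂D.spineMeasure =
      2 * ∑' i, b ^ i * (1 + ∫⁻ s, D.Λ s i ∂D.spineMeasure) := by
    have hm : ∀ i : ℕ, Measurable fun s => b ^ i * (1 + D.Λ s i) := fun i =>
      (measurable_const.add (hΛm i)).const_mul _
    simp only [Sinf]
    rw [lintegral_const_mul _ (Measurable.tsum hm), lintegral_tsum fun i => (hm i).aemeasurable]
    congr 1
    refine tsum_congr fun i => ?_
    rw [lintegral_const_mul _ (Measurable.const_add (hΛm i) 1)]
    simp
  rw [h1]
  refine ENNReal.mul_ne_top (by simp) (ne_top_of_le_ne_top ?_ (ENNReal.tsum_le_tsum fun i =>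
    mul_le_mul_right (add_le_add_right (hΛ i) 1) _))
  have h2 : ∀ i, b ^ i * (1 + C * (c * D.meanWeight i)) =
      b ^ i + C * c * (b ^ i * D.meanWeight i) := fun i => by ring
  simp only [h2]
  rw [ENNReal.tsum_add, ENNReal.tsum_mul_left, ENNReal.tsum_geometric]
  exact ENNReal.add_ne_top.2 ⟨ENNReal.inv_ne_top.2 (tsub_pos_of_lt hb1).ne',
    ENNReal.mul_ne_top (ENNReal.mul_ne_top hC (ENNReal.inv_ne_top.2
      (D.trapMeasure_height_lt_ne_zero 0))) D.tsum_meanWeight_ne_top⟩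

theorem ae_Sinf_lt_top : ∀ᵐ s ∂D.spineMeasure, D.Sinf s < ∞ :=
  ae_lt_top D.measurable_Sinf D.lintegral_Sinf_ne_top

end BiasedGW

/-! ### The characteristic function of the time spent at the bottom -/

namespace BiasedWalk

open PlaneTree

theorem measurable_isBottom (w : List ℕ) : Measurable fun ξ : Field => IsBottom ξ w := by
  unfold IsBottom; fun_prop

theorem measurable_bottomTime (β : ℝ) :
    Measurable fun p : Field × (ℕ → I) => bottomTime β p.1 p.2 := by
  refine measurable_timeBetween fun t => ?_
  simp only [trapWalk_eq]
  exact .exists fun w => ((measurable_of_countable (· = some w)).comp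
    (measurable_trapFrom β (some []) t)).and ((measurable_isBottom w).comp measurable_fst)

/-- The generating function of the time spent at the bottom in one excursion, given the trap. -/
noncomputable def bottomFun (β : ℝ) (z : ℂ) (ξ : Field) : ℂ :=
  ∫ v, z ^ bottomTime β ξ v ∂uniformSeq

theorem measurable_bottomFun (β : ℝ) (z : ℂ) : Measurable (bottomFun β z) :=
  (StronglyMeasurable.integral_prod_right (f := fun ξ v => z ^ bottomTime β ξ v)
    ((measurable_of_countable fun k : ℕ => z ^ k).comp
      (measurable_bottomTime β)).stronglyMeasurable).measurable

theorem norm_bottomFun_le {β : ℝ} {z : ℂ} (hz : ‖z‖ ≤ 1) (ξ : Field) : ‖bottomFun β z ξ‖ ≤ 1 := by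
  refine (norm_integral_le_of_norm_le_const (C := 1) (ae_of_all _ fun v => ?_)).trans (by simp)
  rw [norm_pow]
  exact pow_le_one₀ (norm_nonneg z) hz

theorem integral_infinitePi_prod {E : Type*} [MeasurableSpace E] (μ : Measure E)
    [IsProbabilityMeasure μ] {f : E → ℂ} (hf : Measurable f) (m : ℕ) :
    ∫ x, ∏ i ∈ Finset.range m, f (x i) ∂Measure.infinitePi (fun _ : ℕ => μ) =
      (∫ e, f e ∂μ) ^ m := by
  have h1 := integral_restrict_infinitePi (μ := fun _ : ℕ => μ) (s := Finset.range m)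
    (f := fun y => ∏ i, f (y i)) (Finset.measurable_fun_prod _ fun i _ => hf.comp
      (measurable_pi_apply i)).aestronglyMeasurable
  rw [integral_fintype_prod_eq_pow, Fintype.card_coe, Finset.card_range] at h1
  rw [← h1]
  exact integral_congr_ae (ae_of_all _ fun x => (Finset.prod_coe_sort _ fun i => f (x i)).symm)

theorem integrable_of_norm_le_one {Ω : Type*} [MeasurableSpace Ω] {μ : Measure Ω}
    [IsProbabilityMeasure μ] {f : Ω → ℂ} (hf : Measurable f) (h : ∀ ω, ‖f ω‖ ≤ 1) :
    Integrable f μ :=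
  Integrable.of_bound hf.aestronglyMeasurable 1 (ae_of_all _ h)

theorem norm_pow_le_one {x : ℂ} (h : ‖x‖ ≤ 1) (m : ℕ) : ‖x ^ m‖ ≤ 1 := by
  rw [norm_pow]; exact pow_le_one₀ (norm_nonneg _) h

end BiasedWalk

namespace BiasedGW

open PlaneTree BiasedWalk

variable (D : BiasedGW)

theorem integral_heightLaw (n : ℕ) {F : Field → ℂ} (hF : Measurable F)
    (hs : ∀ ξ η, SameTree ξ η → F ξ = F η) :
    ∫ ξ, F ξ ∂D.heightLaw n = ∫ s, F (treeOf s n) ∂D.spineMeasure := by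
  have hm : Measurable fun s => F (treeOf s n) := hF.comp (measurable_treeOf n)
  have h1 : (D.heightLaw n).map F = D.spineMeasure.map fun s => F (treeOf s n) := by
    ext B hB
    rw [Measure.map_apply hF hB, Measure.map_apply hm hB, ← lintegral_indicator_one (hF hB),
      ← lintegral_indicator_one (hm hB)]
    refine (lintegral_heightLaw D n (measurable_one.indicator (hF hB)) fun ξ η h => ?_)
    classical simp only [Set.indicator_apply, Set.mem_preimage, hs ξ η h, Pi.one_apply]
  rw [← integral_map hF.aemeasurable (f := fun z : ℂ => z)
    aestronglyMeasurable_id, h1, integral_map hm.aemeasurable (f := fun z : ℂ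
      => z) aestronglyMeasurable_id]

theorem measurable_Zbar (ε : ℝ) (n : ℕ) (k : ℤ) : Measurable (D.Zbar ε n k) := by
  refine Measurable.div_const ?_ _
  refine .discrete_apply (fun m =>
      Finset.measurable_fun_sum (Finset.range m) fun i _ =>
        (measurable_of_countable fun k : ℕ => (k : ℝ)).comp
          ((measurable_bottomTime D.β).comp (f := fun ω : (Field × (ℕ → I) × (ℕ → I)) × Field ×
            (ℕ → ℕ → I) => (ω.2.1, ω.2.2 i)) (by fun_prop)))
    ((measurable_W D ε n).comp measurable_fst)

/-- The argument of the generating function that corresponds to the argument `l` of the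
characteristic function, for a trap of height `h`. -/
noncomputable def phase (l : ℝ) (h : ℕ) : ℂ :=
  Complex.exp (((l * (D.β⁻¹) ^ h : ℝ) : ℂ) * Complex.I)

theorem norm_phase (l : ℝ) (h : ℕ) : ‖D.phase l h‖ = 1 := Complex.norm_exp_ofReal_mul_I _

theorem exp_Zbar (ε : ℝ) (n : ℕ) (k : ℤ) (l : ℝ)
    (ω : (Field × (ℕ → I) × (ℕ → I)) × Field × (ℕ → ℕ → I)) :
    Complex.exp (l * (D.Zbar ε n k ω : ℂ) * Complex.I) =
      ∏ i ∈ Finset.range (D.W ε n ω.1),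
        D.phase l (D.trapHeight ((n : ℝ) + k)) ^ bottomTime D.β ω.2.1 (ω.2.2 i) := by
  simp only [phase, ← Complex.exp_nat_mul, ← Complex.exp_sum]
  rw [Zbar]
  push_cast
  rw [Finset.sum_div, Finset.mul_sum, Finset.sum_mul]
  congr 1
  refine Finset.sum_congr rfl fun i _ => ?_
  ring

/-- Given the trap and the number of visits, the excursions are independent. -/
theorem integral_prod_bottomTime {z : ℂ} (hz : ‖z‖ ≤ 1) (n m : ℕ) :
    ∫ y, ∏ i ∈ Finset.range m, z ^ bottomTime D.β y.1 (y.2 i) ∂(D.heightLaw n).prod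
      (Measure.infinitePi fun _ => uniformSeq) =
      ∫ s, bottomFun D.β z (treeOf s n) ^ m ∂D.spineMeasure := by
  have hp : Measurable fun y : Field × (ℕ → ℕ → I) =>
      ∏ i ∈ Finset.range m, z ^ bottomTime D.β y.1 (y.2 i) :=
    Finset.measurable_fun_prod _ fun i _ => (fun i => (measurable_of_countable fun k : ℕ => z ^
      k).comp ((measurable_bottomTime D.β).comp (f := fun y : Field × (ℕ → ℕ → I) => (y.1, y.2 i))
      (by fun_prop))) i
  rw [integral_prod _ (integrable_of_norm_le_one hp fun y => ?_)]
  · have h2 : ∀ ξ, ∫ y, ∏ i ∈ Finset.range m, z ^ bottomTime D.β ξ (y i)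
        ∂Measure.infinitePi (fun _ => uniformSeq) = bottomFun D.β z ξ ^ m := fun ξ =>
      integral_infinitePi_prod uniformSeq (f := fun v => z ^ bottomTime D.β ξ v)
        ((measurable_of_countable fun k : ℕ => z ^ k).comp
          ((measurable_bottomTime D.β).comp measurable_prodMk_left)) _
    simp only [h2]
    refine D.integral_heightLaw n (F := fun ξ => bottomFun D.β z ξ ^ m)
      ((measurable_bottomFun D.β z).pow_const _) fun ξ η h => ?_
    simp only [bottomFun, SameTree.bottomTime_eq h]
  · rw [norm_prod]
    exact Finset.prod_le_one (fun _ _ => norm_nonneg _) fun i _ => norm_pow_le_one hz _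

theorem measurable_pow_W {Ω : Type*} [MeasurableSpace Ω] (ε : ℝ) (n : ℕ) {F : Ω → ℂ}
    (hF : Measurable F) :
    Measurable fun q : (Field × (ℕ → I) × (ℕ → I)) × Ω => F q.2 ^ D.W ε n q.1 :=
  .discrete_apply (fun m => (hF.comp measurable_snd).pow_const m)
    ((measurable_W D ε n).comp measurable_fst)

theorem charFun_Zbar (ε : ℝ) (n : ℕ) (k : ℤ) (l : ℝ) :
    charFun ((D.bottomMeasure n k).map (D.Zbar ε n k)) l =
      ∫ s, ∫ ω, bottomFun D.β (D.phase l (D.trapHeight ((n : ℝ) + k)))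
        (treeOf s (D.trapHeight ((n : ℝ) + k))) ^ D.W ε n ω ∂D.walkMeasure ∂D.spineMeasure := by
  have hmZ := D.measurable_Zbar ε n k
  have hm : Measurable fun ω => Complex.exp (l * (D.Zbar ε n k ω : ℂ) * Complex.I) := by fun_prop
  have hb : ∀ ω, ‖Complex.exp (l * (D.Zbar ε n k ω : ℂ) * Complex.I)‖ ≤ 1 := fun ω => by
    rw [← Complex.ofReal_mul, Complex.norm_exp_ofReal_mul_I]
  have hz := (D.norm_phase l (D.trapHeight ((n : ℝ) + k))).le
  rw [charFun_apply_real, integral_map hmZ.aemeasurable (by fun_prop)]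
  refine (integral_prod _ (integrable_of_norm_le_one hm hb)).trans ?_
  simp only [exp_Zbar]
  refine (integral_congr_ae (ae_of_all _ fun ω =>
    D.integral_prod_bottomTime hz _ (D.W ε n ω))).trans (integral_integral_swap ?_)
  exact integrable_of_norm_le_one (D.measurable_pow_W ε n ((measurable_bottomFun D.β _).comp
    (measurable_treeOf _))) fun q => norm_pow_le_one (norm_bottomFun_le hz _) _

end BiasedGW

/-! ### Convergence of the time spent at the bottom -/

namespace BiasedWalk

theorem integral_exp_expMeasure (x : ℝ) :
    ∫ y, Complex.exp ((x * y : ℝ) * Complex.I) ∂expMeasure 1 = (1 - (x : ℂ) * Complex.I)⁻¹ := by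
  have h1 : expMeasure 1 = volume.withDensity (exponentialPDF 1) := rfl
  have h2 : Measurable (exponentialPDF 1) :=
    (measurable_exponentialPDFReal 1).ennreal_ofReal
  have hre : ((x : ℂ) * Complex.I - 1).re < 0 := by simp
  rw [h1, integral_withDensity_eq_integral_toReal_smul h2 (ae_of_all _ fun y => by
    simp [exponentialPDF])]
  have h4 : (fun y : ℝ => (exponentialPDF 1 y).toReal • Complex.exp ((x * y : ℝ) * Complex.I)) =
      (Set.Ici 0).indicator fun y : ℝ => Complex.exp (((x : ℂ) * Complex.I - 1) * y) := by
    funext y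
    rw [exponentialPDF_eq]
    by_cases hy : 0 ≤ y
    · rw [if_pos hy, Set.indicator_of_mem (s := Set.Ici 0) hy,
        ENNReal.toReal_ofReal (by positivity), one_mul, Complex.real_smul,
        Complex.ofReal_exp, ← Complex.exp_add]
      push_cast
      ring
    · rw [if_neg hy, Set.indicator_of_notMem (s := Set.Ici 0) hy]
      simp
  rw [h4, integral_indicator measurableSet_Ici, integral_Ici_eq_integral_Ioi,
    integral_exp_mul_complex_Ioi hre 0]
  rw [Complex.ofReal_zero, mul_zero, Complex.exp_zero, ← neg_sub, ← one_div, neg_div_neg_eq]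

theorem norm_pow_sub_pow_le {x y : ℂ} (hx : ‖x‖ ≤ 1) (hy : ‖y‖ ≤ 1) (m : ℕ) :
    ‖x ^ m - y ^ m‖ ≤ m * ‖x - y‖ := by
  induction m with
  | zero => simp
  | succ m ih =>
    have h : x ^ (m + 1) - y ^ (m + 1) = x ^ m * (x - y) + (x ^ m - y ^ m) * y := by ring
    rw [h]
    refine (norm_add_le _ _).trans ?_
    rw [norm_mul, norm_mul]
    have h1 := mul_le_of_le_one_left (norm_nonneg (x - y)) (norm_pow_le_one hx m)
    have h2 := mul_le_of_le_one_right (norm_nonneg (x ^ m - y ^ m)) hy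
    push_cast
    linarith

/-- The generating functions of a weakly convergent sequence of laws on `ℕ` with bounded means
converge along convergent sequences of arguments. -/
theorem tendsto_integral_pow {μ : ℕ → ProbabilityMeasure ℕ} {ν : ProbabilityMeasure ℕ}
    (hμ : Tendsto μ atTop (nhds ν)) {c : ℝ≥0∞} (hc : c ≠ ∞)
    (hm : ∀ n, ∫⁻ m, (m : ℝ≥0∞) ∂(μ n : Measure ℕ) ≤ c) {x : ℕ → ℂ} {y : ℂ}
    (hx1 : ∀ n, ‖x n‖ ≤ 1) (hx : Tendsto x atTop (nhds y)) :
    Tendsto (fun n => ∫ m, x n ^ m ∂(μ n : Measure ℕ)) atTop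
      (nhds (∫ m, y ^ m ∂(ν : Measure ℕ))) := by
  have hy1 := le_of_tendsto hx.norm (Eventually.of_forall hx1)
  have hint (z : ℂ) (hz : ‖z‖ ≤ 1) (ρ : ProbabilityMeasure ℕ) :
      Integrable (fun m : ℕ => z ^ m) (ρ : Measure ℕ) :=
    integrable_of_norm_le_one (measurable_of_countable _) (norm_pow_le_one hz)
  let f : BoundedContinuousFunction ℕ ℂ := BoundedContinuousFunction.ofNormedAddCommGroupDiscrete
    (fun m : ℕ => y ^ m) 1 (norm_pow_le_one hy1)
  have h1 : Tendsto (fun n => ∫ m, y ^ m ∂(μ n : Measure ℕ)) atTop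
      (nhds (∫ m, y ^ m ∂(ν : Measure ℕ))) :=
    (ProbabilityMeasure.tendsto_iff_forall_integral_rclike_tendsto ℂ).1 hμ f
  have h2 : Tendsto (fun n => ∫ m, x n ^ m ∂(μ n : Measure ℕ) - ∫ m, y ^ m ∂(μ n : Measure ℕ))
      atTop (nhds 0) := by
    have h3 : Tendsto (fun n => c.toReal * ‖x n - y‖) atTop (nhds 0) := by
      simpa using (tendsto_iff_norm_sub_tendsto_zero.1 hx).const_mul c.toReal
    refine squeeze_zero_norm (fun n => ?_) h3
    have h4 : Integrable (fun m : ℕ => (m : ℝ)) (μ n : Measure ℕ) :=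
      ⟨(measurable_of_countable _).aestronglyMeasurable,
        lt_of_le_of_lt (by simpa [Real.enorm_natCast] using hm n) hc.lt_top⟩
    have h5 : ∫ m : ℕ, (m : ℝ) ∂(μ n : Measure ℕ) ≤ c.toReal := by
      rw [integral_eq_lintegral_of_nonneg_ae (ae_of_all _ fun m => Nat.cast_nonneg m) h4.1]
      exact ENNReal.toReal_mono hc (by simpa using hm n)
    rw [← integral_sub (hint _ (hx1 n) _) (hint _ hy1 _)]
    refine (norm_integral_le_of_norm_le (h4.mul_const ‖x n - y‖)
      (ae_of_all _ fun m => norm_pow_sub_pow_le (hx1 n) hy1 m)).trans ?_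
    rw [integral_mul_const]
    exact mul_le_mul_of_nonneg_right h5 (norm_nonneg _)
  simpa using h2.add h1

end BiasedWalk

namespace BiasedGW

open PlaneTree BiasedWalk

variable (D : BiasedGW)

/-- The generating function of the time spent at the bottom of the infinite trap in one excursion,
for the argument `l` of the characteristic function: the bottom is reached with probability `p_∞`,
and the time spent there is then exponential. -/
noncomputable def limitFun (l : ℝ) (s : ℕ → SpineData) : ℂ :=
  1 - (1 - (1 - ((l * ((D.Sinf s).toReal / (1 - D.β⁻¹)) : ℝ) : ℂ) * Complex.I)⁻¹) *
    ((1 - D.β⁻¹ : ℝ) : ℂ)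

theorem tendsto_bottomFun_treeOf (l : ℝ) {s : ℕ → SpineData} (hs : GoodSpine s)
    (hfin : D.Sinf s ≠ ∞) :
    Tendsto (fun n => bottomFun D.β (D.phase l n) (treeOf s n)) atTop (nhds (D.limitFun l s)) := by
  refine (tendsto_betweenFun D.one_lt_bias (isSpine_treeOf hs)
    (tendsto_scaledWeight_treeOf hs D hfin) l).congr fun n => ?_
  simp only [bottomFun, betweenFun, phase, bottomTime_eq_timeBetween (isBottom_treeOf hs n)]

theorem measurable_Zinf : Measurable D.Zinf := by
  have := D.measurable_Sinf
  exact .mul (by fun_prop) (.discrete_apply (f := fun (k : ℕ) (ω : ℕ × (ℕ → ℕ) × (ℕ → SpineData) ×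
    (ℕ → ℝ)) => ∑ i ∈ Finset.range k, ω.2.2.2 i) (fun k => by fun_prop) (.discrete_apply (f := fun
      (m : ℕ) (ω : ℕ × (ℕ → ℕ) × (ℕ → SpineData) × (ℕ → ℝ)) => ∑ j ∈ Finset.range m, ω.2.1 j)
      (fun m => by fun_prop) measurable_fst))

theorem integral_limitFun_pow (l : ℝ) (s : ℕ → SpineData) (m : ℕ) :
    ∫ b : ℕ → ℕ, (∫ e : ℕ → ℝ, ∏ i ∈ Finset.range (∑ j ∈ Finset.range m, b j),
      Complex.exp (((l * ((D.Sinf s).toReal / (1 - D.β⁻¹)) * e i : ℝ) : ℂ) * Complex.I)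
        ∂Measure.infinitePi fun _ => expMeasure 1)
      ∂Measure.infinitePi (fun _ => bernoulliMeasure 1 0 D.escapeProb) = D.limitFun l s ^ m := by
  set x : ℝ := l * ((D.Sinf s).toReal / (1 - D.β⁻¹)) with hx
  have h1 := fun k : ℕ => integral_infinitePi_prod (expMeasure 1)
    (f := fun y : ℝ => Complex.exp (((x * y : ℝ) : ℂ) * Complex.I)) (by fun_prop) k
  simp only [integral_exp_expMeasure] at h1
  simp only [h1, ← Finset.prod_pow_eq_pow_sum]
  rw [integral_infinitePi_prod (bernoulliMeasure (1 : ℕ) 0 D.escapeProb)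
    (measurable_of_countable _),
    integral_bernoulliMeasure, limitFun, ← hx]
  have h2 : (D.escapeProb : ℝ) = 1 - D.β⁻¹ := rfl
  simp only [h2, pow_one, Complex.real_smul]
  push_cast
  ring

/-- Given `W_∞` and the spine, `limitFun` is the characteristic function of one summand. -/
theorem charFun_Zinf (μW : Measure ℕ) [IsProbabilityMeasure μW] (l : ℝ) :
    charFun ((D.limitMeasure μW).map D.Zinf) l =
      ∫ s, ∫ m, D.limitFun l s ^ m ∂μW ∂D.spineMeasure := by
  have hmZ := D.measurable_Zinf
  set G : ℕ × (ℕ → ℕ) × (ℕ → SpineData) × (ℕ → ℝ) → ℂ := fun ω =>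
    Complex.exp (l * (D.Zinf ω : ℂ) * Complex.I) with hG
  have hm : Measurable G := by fun_prop
  have hb : ∀ ω, ‖G ω‖ ≤ 1 := fun ω => by
    simp only [hG, ← Complex.ofReal_mul, Complex.norm_exp_ofReal_mul_I, le_rfl]
  have hprod : ∀ m b s e, G (m, b, s, e) = ∏ i ∈ Finset.range (∑ j ∈ Finset.range m, b j),
      Complex.exp (((l * ((D.Sinf s).toReal / (1 - D.β⁻¹)) * e i : ℝ) : ℂ) * Complex.I) := by
    intro m b s e
    simp only [hG, ← Complex.exp_sum]
    rw [Zinf, ← Complex.ofReal_mul, ← mul_assoc, Finset.mul_sum]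
    push_cast
    rw [Finset.sum_mul]
  rw [charFun_apply_real, integral_map hmZ.aemeasurable (by fun_prop)]
  refine (integral_prod _ (integrable_of_norm_le_one hm hb)).trans ?_
  have h1 : ∀ m, ∫ y, G (m, y) ∂(Measure.infinitePi fun _ => bernoulliMeasure 1 0 D.escapeProb).prod
      (D.spineMeasure.prod (Measure.infinitePi fun _ => expMeasure 1)) =
      ∫ s, D.limitFun l s ^ m ∂D.spineMeasure := fun m => by
    have hm1 : Measurable fun y => G (m, y) := hm.comp measurable_prodMk_left
    have h2 : ∀ b, ∫ y, G (m, b, y) ∂D.spineMeasure.prod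
        (Measure.infinitePi fun _ => expMeasure 1) =
        ∫ s, ∫ e, G (m, b, s, e) ∂Measure.infinitePi (fun _ => expMeasure 1) ∂D.spineMeasure :=
      fun b => integral_prod _ (integrable_of_norm_le_one (hm1.comp measurable_prodMk_left)
        fun _ => hb _)
    refine (integral_prod _ (integrable_of_norm_le_one hm1 fun _ => hb _)).trans ?_
    simp only [h2]
    have hm2 : Measurable fun q : (ℕ → ℕ) × (ℕ → SpineData) =>
        ∫ e, G (m, q.1, q.2, e) ∂Measure.infinitePi (fun _ => expMeasure 1) :=
      (StronglyMeasurable.integral_prod_right (f := fun (q : (ℕ → ℕ) × (ℕ → SpineData)) e =>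
        G (m, q.1, q.2, e)) (hm.comp (by fun_prop)).stronglyMeasurable).measurable
    refine (integral_integral_swap (integrable_of_norm_le_one hm2 fun q => ?_)).trans ?_
    · exact (norm_integral_le_of_norm_le_const (C := 1) (ae_of_all _ fun e => hb _)).trans
        (by simp)
    · simp only [hprod, D.integral_limitFun_pow]
  refine (integral_congr_ae (ae_of_all _ h1)).trans (integral_integral_swap ?_)
  have h3 : Measurable (D.limitFun l) := by
    have := D.measurable_Sinf
    unfold limitFun
    fun_prop
  refine integrable_of_norm_le_one (measurable_from_prod_countable_right fun m => h3.pow_const m)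
    fun q => ?_
  change ‖D.limitFun l q.2 ^ q.1‖ ≤ 1
  rw [← D.integral_limitFun_pow l q.2 q.1]
  simp only [← hprod]
  refine (norm_integral_le_of_norm_le_const (C := 1) (ae_of_all _ fun b => ?_)).trans (by simp)
  exact (norm_integral_le_of_norm_le_const (C := 1) (ae_of_all _ fun e => hb _)).trans (by simp)

theorem tendsto_trapHeight (k : ℤ) :
    Tendsto (fun n : ℕ => D.trapHeight ((n : ℝ) + k)) atTop atTop := by
  exact tendsto_nat_ceil_atTop.comp (Tendsto.atTop_div_const (neg_pos.2 (Real.log_neg D.r_pos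
    D.r_lt_one)) (Real.tendsto_log_atTop.comp
    (tendsto_atTop_add_const_right _ _ tendsto_natCast_atTop_atTop)))

theorem tendstoInDistribution_Zbar {ε : ℝ} {μW : ProbabilityMeasure ℕ}
    (hW : Tendsto (β := ProbabilityMeasure ℕ) (fun n => ⟨D.walkMeasure.map (D.W ε n),
      Measure.isProbabilityMeasure_map (measurable_W D ε n).aemeasurable⟩) atTop (nhds μW))
    (k : ℤ) : TendstoInDistribution (fun n : ℕ => D.Zbar ε n k) atTop D.Zinf
      (fun n : ℕ => D.bottomMeasure n k) (D.limitMeasure (μW : Measure ℕ)) := by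
  refine ⟨fun n => (D.measurable_Zbar ε n k).aemeasurable, D.measurable_Zinf.aemeasurable,
    ProbabilityMeasure.tendsto_iff_tendsto_charFun.2 fun l => ?_⟩
  change Tendsto (fun n => charFun ((D.bottomMeasure n k).map (D.Zbar ε n k)) l) atTop
    (nhds (charFun ((D.limitMeasure (μW : Measure ℕ)).map D.Zinf) l))
  rw [charFun_Zinf]
  simp only [charFun_Zbar]
  have hb : ∀ n s, ‖bottomFun D.β (D.phase l n) (treeOf s n)‖ ≤ 1 := fun n s =>
    norm_bottomFun_le (D.norm_phase l n).le _
  refine tendsto_integral_of_dominated_convergence (fun _ => 1) (fun n => ?_)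
    (integrable_const _) (fun n => ae_of_all _ fun s => ?_) ?_
  · refine (StronglyMeasurable.integral_prod_left (f := fun ω s => bottomFun D.β _ (treeOf s _) ^
      D.W ε n ω) (Measurable.stronglyMeasurable ?_)).aestronglyMeasurable
    exact D.measurable_pow_W ε n ((measurable_bottomFun D.β _).comp (measurable_treeOf _))
  · exact (norm_integral_le_of_norm_le_const (C := 1)
      (ae_of_all _ fun ω => norm_pow_le_one (hb _ _) _)).trans (by simp)
  · filter_upwards [ae_goodSpine D, D.ae_Sinf_lt_top] with s hs hfin
    have h1 := tendsto_integral_pow hW (visitsBound_ne_top D) (fun n => ?_)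
      (fun n => hb (D.trapHeight ((n : ℝ) + k)) s)
      ((D.tendsto_bottomFun_treeOf l hs hfin.ne).comp (D.tendsto_trapHeight k))
    · refine h1.congr fun n => ?_
      exact integral_map (measurable_W D ε n).aemeasurable
        (measurable_of_countable _).aestronglyMeasurable
    · refine Eq.trans_le ?_ (lintegral_W_le D ε n)
      exact lintegral_map (measurable_of_countable _) (measurable_W D ε n)

end BiasedGW

/-! ### Domination of the time spent at the bottom -/

namespace BiasedWalk

open PlaneTree

/-- The time spent at the bottom is at most the duration of the excursion. -/
theorem lintegral_bottomTime_le {β : ℝ} (hβ : 0 < β) {ξ : Field} (h : height ξ ≠ ⊤) :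
    ∫⁻ v, (bottomTime β ξ v : ℝ≥0∞) ∂uniformSeq ≤ ENNReal.ofReal (totalWeight β ξ) := by
  refine le_trans ?_ (tsum_measure_ne_none_le hβ h fun w hw =>
    Option.some_injective _ hw ▸ mem_nil ξ)
  have hms : ∀ t, MeasurableSet {v | trapFrom β ξ (some []) v t ≠ none} := fun t =>
    measurable_trapFrom_right β ξ (some []) t (MeasurableSet.of_discrete (s := {none}ᶜ))
  simp only [← lintegral_indicator_one (hms _)]
  rw [← lintegral_tsum fun t => (measurable_one.indicator (hms t)).aemeasurable]
  refine lintegral_mono fun v => ?_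
  have h1 : (bottomTime β ξ v : ℕ∞) ≤ {t | trapFrom β ξ (some []) v t ≠ none}.encard := by
    refine (Set.ncard_le_encard _).trans (Set.encard_le_encard fun t ht => ?_)
    obtain ⟨s, hs, w, hw, -⟩ := ht.2
    exact trapFrom_ne_none hs.le (by rw [← trapWalk_eq, hw]; simp)
  refine le_trans (by simpa using ENat.toENNReal_le.2 h1) (le_of_eq ?_)
  rw [← ENNReal.tsum_set_one]
  exact tsum_subtype {t | trapFrom β ξ (some []) v t ≠ none} fun _ => (1 : ℝ≥0∞)

end BiasedWalk

namespace BiasedGW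

open PlaneTree BiasedWalk

variable (D : BiasedGW)

theorem lintegral_bottomTime_heightLaw_le (n : ℕ) :
    (∫⁻ ξ, ∫⁻ v, (bottomTime D.β ξ v : ℝ≥0∞) ∂uniformSeq ∂D.heightLaw n) *
      ENNReal.ofReal ((D.β⁻¹) ^ n) ≤ ∫⁻ s, D.Sinf s ∂D.spineMeasure := by
  have hβ : 0 < D.β := by linarith [D.one_lt_bias]
  have hm : Measurable fun ξ : Field => ∫⁻ v, (bottomTime D.β ξ v : ℝ≥0∞) ∂uniformSeq :=
    ((measurable_of_countable fun k : ℕ => (k : ℝ≥0∞)).comp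
      (measurable_bottomTime D.β)).lintegral_prod_right'
  have hms : Measurable fun s =>
      ∫⁻ v, (bottomTime D.β (treeOf s n) v : ℝ≥0∞) ∂uniformSeq := hm.comp (measurable_treeOf n)
  rw [lintegral_heightLaw D n hm fun ξ η h => by simp only [SameTree.bottomTime_eq h],
    ← lintegral_mul_const _ hms]
  refine lintegral_mono_ae ?_
  filter_upwards [ae_goodSpine D] with s hs
  have hh : height (treeOf s n) ≠ ⊤ := by rw [height_treeOf hs]; exact ENat.natCast_ne_top n
  refine (mul_le_mul_left (lintegral_bottomTime_le hβ hh) _).trans ?_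
  rw [← ENNReal.ofReal_mul (totalWeight_nonneg hβ _)]
  have h1 : totalWeight D.β (treeOf s n) * (D.β⁻¹) ^ n ≤
      2 * ((D.β⁻¹) ^ n * ∑ v ∈ vertices (treeOf s n), D.β ^ v.length) := by
    have h2 := totalWeight_add_one (β := D.β) hh
    have h3 : 0 ≤ (D.β⁻¹) ^ n := by positivity
    nlinarith
  refine (ENNReal.ofReal_le_ofReal h1).trans ?_
  rw [ENNReal.ofReal_mul zero_le_two, ofReal_genWeight_treeOf hs D n, Sinf, ENNReal.ofReal_ofNat]
  exact mul_le_mul_right (ENNReal.sum_le_tsum _) _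

/-- The mean of the rescaled time at the bottom is bounded, uniformly in `n` and `k`. -/
theorem lintegral_Zbar_le (ε : ℝ) (n : ℕ) (k : ℤ) :
    ∫⁻ ω, ENNReal.ofReal (D.Zbar ε n k ω) ∂D.bottomMeasure n k ≤
      D.visitsBound * ∫⁻ s, D.Sinf s ∂D.spineMeasure := by
  have hβ : 0 < D.β := by linarith [D.one_lt_bias]
  set H := D.trapHeight ((n : ℝ) + k) with hH
  set c := ENNReal.ofReal ((D.β⁻¹) ^ H) with hc
  have hZ : ∀ ω, ENNReal.ofReal (D.Zbar ε n k ω) =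
      (∑ i ∈ Finset.range (D.W ε n ω.1), (bottomTime D.β ω.2.1 (ω.2.2 i) : ℝ≥0∞)) * c := by
    intro ω
    rw [Zbar, ← hH, div_eq_mul_inv, ← inv_pow, ENNReal.ofReal_mul (by positivity),
      ENNReal.ofReal_sum_of_nonneg fun i _ => Nat.cast_nonneg _]
    simp only [ENNReal.ofReal_natCast, hc]
  have hmi : ∀ i, Measurable fun y : Field × (ℕ → ℕ → I) =>
      (bottomTime D.β y.1 (y.2 i) : ℝ≥0∞) := fun i =>
    (measurable_of_countable fun k : ℕ => (k : ℝ≥0∞)).comp ((measurable_bottomTime D.β).comp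
      (f := fun y : Field × (ℕ → ℕ → I) => (y.1, y.2 i)) (by fun_prop))
  have hone : ∀ i, ∫⁻ y, (bottomTime D.β y.1 (y.2 i) : ℝ≥0∞) ∂(D.heightLaw H).prod
      (Measure.infinitePi fun _ => uniformSeq) =
      ∫⁻ ξ, ∫⁻ v, (bottomTime D.β ξ v : ℝ≥0∞) ∂uniformSeq ∂D.heightLaw H := fun i => by
    rw [lintegral_prod _ (hmi i).aemeasurable]
    exact lintegral_congr fun ξ => (measurePreserving_eval_infinitePi (fun _ : ℕ => uniformSeq)
      i).lintegral_comp (f := fun v => (bottomTime D.β ξ v : ℝ≥0∞)) ((measurable_of_countable fun k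
      : ℕ => (k : ℝ≥0∞)).comp ((measurable_bottomTime D.β).comp measurable_prodMk_left))
  refine (lintegral_prod _ ((D.measurable_Zbar ε n k).ennreal_ofReal).aemeasurable).trans_le ?_
  simp only [hZ]
  have h1 : ∀ ω, ∫⁻ y, (∑ i ∈ Finset.range (D.W ε n ω), (bottomTime D.β y.1 (y.2 i) : ℝ≥0∞)) * c
      ∂(D.heightLaw H).prod (Measure.infinitePi fun _ => uniformSeq) ≤
      D.W ε n ω * ∫⁻ s, D.Sinf s ∂D.spineMeasure := fun ω => by
    rw [lintegral_mul_const _ (Finset.measurable_fun_sum _ fun i _ => hmi i), lintegral_finsetSum _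
      fun i _ => hmi i]
    simp only [hone, Finset.sum_const, Finset.card_range, nsmul_eq_mul, mul_assoc]
    exact mul_le_mul_right (D.lintegral_bottomTime_heightLaw_le H) _
  refine (lintegral_mono h1).trans ?_
  have hW : Measurable fun ω => (D.W ε n ω : ℝ≥0∞) :=
    (measurable_of_countable fun k : ℕ => (k : ℝ≥0∞)).comp (measurable_W D ε n)
  rw [lintegral_mul_const _ hW]
  exact mul_le_mul_left (lintegral_W_le D ε n) _

end BiasedGW

/-- The law of `c / U` with `U` uniform on `(0, 1]`. It dominates every non-negative variable with
mean at most `c`, by Markov's inequality. -/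
noncomputable def divUniform (c : ℝ) : Measure ℝ :=
  (volume.restrict (Set.Ioc (0 : ℝ) 1)).map fun x => c / x

instance (c : ℝ) : IsProbabilityMeasure (divUniform c) := by
  have : IsProbabilityMeasure ((volume : Measure ℝ).restrict (Set.Ioc 0 1)) := ⟨by simp⟩
  exact Measure.isProbabilityMeasure_map (MeasurableDiv.measurable_const_div c).aemeasurable

theorem ae_divUniform_nonneg {c : ℝ} (hc : 0 < c) : ∀ᵐ x ∂divUniform c, 0 ≤ x := by
  rw [divUniform, ae_map_iff (MeasurableDiv.measurable_const_div c).aemeasurable measurableSet_Ici]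
  filter_upwards [ae_restrict_mem measurableSet_Ioc] with x hx
  exact div_nonneg hc.le hx.1.le

theorem lintegral_rpow_divUniform_lt_top {c : ℝ} (hc : 0 < c) {δ : ℝ} (hδ : 0 < δ) :
    ∫⁻ x, ENNReal.ofReal x ^ (1 - δ) ∂divUniform c < ∞ := by
  rw [divUniform, lintegral_map (by fun_prop) (MeasurableDiv.measurable_const_div c)]
  have h1 : ∀ᵐ x ∂(volume : Measure ℝ).restrict (Set.Ioc 0 1), ENNReal.ofReal (c / x) ^ (1 - δ) =
      ENNReal.ofReal (c ^ (1 - δ) * x ^ (δ - 1)) := by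
    filter_upwards [ae_restrict_mem measurableSet_Ioc] with x hx
    rw [ENNReal.ofReal_rpow_of_pos (div_pos hc hx.1), Real.div_rpow hc.le hx.1.le, div_eq_mul_inv,
      ← Real.rpow_neg hx.1.le, neg_sub]
  rw [lintegral_congr_ae h1]
  exact (((intervalIntegrable_iff_integrableOn_Ioc_of_le zero_le_one).1
    (intervalIntegral.intervalIntegrable_rpow' (by linarith))).const_mul (c ^ (1 -
    δ))).lintegral_lt_top

theorem measure_lt_le_divUniform {Ω : Type*} [MeasurableSpace Ω] {P : Measure Ω}
    [IsProbabilityMeasure P] {f : Ω → ℝ} (hf : Measurable f) {c : ℝ} (hc : 0 < c)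
    (h : ∫⁻ ω, ENNReal.ofReal (f ω) ∂P ≤ ENNReal.ofReal c) (t : ℝ) :
    P {ω | t < f ω} ≤ divUniform c (Set.Ioi t) := by
  rw [divUniform, Measure.map_apply (MeasurableDiv.measurable_const_div c) measurableSet_Ioi,
    Measure.restrict_apply (MeasurableDiv.measurable_const_div c measurableSet_Ioi)]
  rcases lt_or_ge t c with htc | htc
  · have h1 : (fun x => c / x) ⁻¹' Set.Ioi t ∩ Set.Ioc (0 : ℝ) 1 = Set.Ioc 0 1 :=
      Set.inter_eq_right.2 fun x hx => htc.trans_le ((le_div_iff₀ hx.1).2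
        (mul_le_of_le_one_right hc.le hx.2))
    rw [h1, Real.volume_Ioc, sub_zero, ENNReal.ofReal_one]
    exact prob_le_one
  · have ht : 0 < t := hc.trans_le htc
    have h1 : Set.Ioo 0 (c / t) ⊆ (fun x => c / x) ⁻¹' Set.Ioi t ∩ Set.Ioc (0 : ℝ) 1 := by
      intro x hx
      refine ⟨(lt_div_iff₀ hx.1).2 ?_, hx.1, hx.2.le.trans ((div_le_one ht).2 htc)⟩
      rw [mul_comm]
      exact (lt_div_iff₀ ht).1 hx.2
    refine le_trans ?_ (measure_mono h1)
    rw [Real.volume_Ioo, sub_zero, ENNReal.ofReal_div_of_pos ht,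
      ENNReal.le_div_iff_mul_le (Or.inl (by simpa using ht)) (Or.inl ENNReal.ofReal_ne_top),
      mul_comm]
    refine le_trans (le_trans ?_ (mul_meas_ge_le_lintegral hf.ennreal_ofReal (ENNReal.ofReal t))) h
    exact mul_le_mul_right (measure_mono fun ω hω => ENNReal.ofReal_le_ofReal (le_of_lt hω)) _

theorem mainTheorem7 (D : BiasedGW) (ε : ℝ) (hε0 : 0 < ε) (hε1 : ε < 1) :
    ∃ μW : ProbabilityMeasure ℕ,
      TendstoInDistribution (fun n : ℕ => D.W ε n) atTop (id : ℕ → ℕ)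
        (fun _ => D.walkMeasure) (μW : Measure ℕ) ∧
      (∀ᵐ s ∂D.spineMeasure, D.Sinf s < ∞) ∧
      (∀ k : ℤ, TendstoInDistribution (fun n : ℕ => D.Zbar ε n k) atTop D.Zinf
        (fun n : ℕ => D.bottomMeasure n k) (D.limitMeasure (μW : Measure ℕ))) ∧
      ∃ ν : ProbabilityMeasure ℝ,
        (∀ᵐ x ∂(ν : Measure ℝ), 0 ≤ x) ∧
        (∀ δ : ℝ, 0 < δ → ∫⁻ x, ENNReal.ofReal x ^ (1 - δ) ∂(ν : Measure ℝ) < ∞) ∧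
        ∀ (n : ℕ) (k : ℤ), -(n : ℤ) < k → ∀ t : ℝ,
          D.bottomMeasure n k {ω | t < D.Zbar ε n k ω} ≤ (ν : Measure ℝ) (Set.Ioi t) := by
  obtain ⟨μW, hW⟩ := BiasedGW.exists_tendsto_law_W D hε1
  refine ⟨μW, ⟨fun n => (BiasedGW.measurable_W D ε n).aemeasurable, aemeasurable_id, ?_⟩,
    D.ae_Sinf_lt_top, fun k => D.tendstoInDistribution_Zbar hW k, ?_⟩
  · have h : (⟨(μW : Measure ℕ).map id, Measure.isProbabilityMeasure_map aemeasurable_id⟩ :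
        ProbabilityMeasure ℕ) = μW := Subtype.ext Measure.map_id
    rw [h]
    exact hW
  · set b := D.visitsBound * ∫⁻ s, D.Sinf s ∂D.spineMeasure with hb
    have hbt : b ≠ ∞ :=
      ENNReal.mul_ne_top (BiasedGW.visitsBound_ne_top D) D.lintegral_Sinf_ne_top
    have hc : 0 < b.toReal + 1 := by positivity
    refine ⟨⟨divUniform (b.toReal + 1), inferInstance⟩, ae_divUniform_nonneg hc,
      fun δ hδ => lintegral_rpow_divUniform_lt_top hc hδ, fun n k _ t => ?_⟩
    refine measure_lt_le_divUniform (D.measurable_Zbar ε n k) hc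
      ((D.lintegral_Zbar_le ε n k).trans ?_) t
    rw [← hb, ← ENNReal.ofReal_toReal hbt]
    exact ENNReal.ofReal_le_ofReal (by rw [ENNReal.toReal_ofReal ENNReal.toReal_nonneg]; linarith)
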